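/- **Conventions.** All functions live on $\mathbb R^2$; $\log_+ r=\max(\log r,0)$, $\langle\xi\rangle=\sqrt{1+|\xi|^2}$; for $k\in\mathbb R$, $\|F\|_{(1+\log_+|x|)^{-k}L^1}:=\|(1+\log_+|x|)^kF\|_{L^1}\in[0,\infty]$; $\|f\|_{H^\sigma}=\|\langle\xi\rangle^\sigma\hat f\|_{L^2}$ and $\|f\|_{\dot H^\sigma}=\||\xi|^\sigma\hat f\|_{L^2}$. For a real-valued potential $V\in L^1$ put $v=|V|^{1/2}$, $U=\operatorname{sgn}V$ (with $U=1$ where $V=0$), $G_0(x,y)=-\frac1{2\pi}\log|x-y|$, and let $Q$ be the orthogonal projection of $L^2$ onto the orthogonal complement of $v$. Zero is called a *regular point of the spectrum* of $H=-\Delta+V$ if $Q(U+vG_0v)Q$ is invertible on $QL^2$. **Lemma 3.4.** Let $k\ge 1$ be real and let $V:\mathbb R^2\to\mathbb R$ satisfy $(1+\log_+|x|)^{2k}V\in L^1$. Suppose that for some $q\in(1,\infty]$ one has $V\in L^q_{loc}$ and $\lim_{R\to\infty}R^{1-1/q}\|V\|_{L^q(R\le|x|\le 2R)}=0$, and that zero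 is a regular point of the spectrum of $H=-\Delta+V$. 1. There is a constant $C$ (depending only on $V$ and $k$) such that for every $f$ that belongs to $L^p$ for some $1\le p<\infty$ and whose distributional Laplacian is locally integrable, with $Hf=-\Delta f+Vf$, $$C^{-1}\|-\Delta f\|_{(1+\log_+|x|)^{-k}L^1}\le\|Hf\|_{(1+\log_+|x|)^{-k}L^1}\le C\|-\Delta f\|_{(1+\log_+|x|)^{-k}L^1}$$ (in particular both sides are finite or both are infinite). Assume moreover that $V\in L^{p}$ for some $p\in(1,\infty]$, and let $H=-\Delta+V$ be the self-adjoint operator on $L^2$ with form domain $H^1$, that is $D(H)=\{u\in H^1: -\Delta u+Vu\in L^2\}$; the powers $|H|^{\alpha}$ are those of the spectral calculus. 2. There is a constant $C$ (depending only on $V$) such that for all $0\le s\le 1$: every $f\in H^s$ lies in the domain of $|H|^{s/2}$ and $$\||H|^{s/2}f\|_{L^2}\le C\|f\|_{H^s};$$ and for every $f$ in the domain of $|H|^{s/2}$, $\||H|^{s/2}f\|_{H^{-s}}\le C\|f\|_{L^2}$. 3. For every $\varepsilon>0$ there is a constant $C$ (depending only on $V$ and $\varepsilon$) such that for all $0\le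 s\le1$: every $f\in L^2\cap\dot H^{-s-\varepsilon}\cap\dot H^{-s+\varepsilon}$ lies in the domain of $|H|^{-s/2}$ (there is exactly one $g\in L^2$ with $|H|^{s/2}g=f$) and $$\||H|^{-s/2}f\|_{L^2}\le C\big(\|f\|_{\dot H^{-s-\varepsilon}}+\|f\|_{\dot H^{-s+\varepsilon}}\big);$$ and every $f$ in the domain of $|H|^{s/2}$ can be written as $f=f_1+f_2$ with $f_1,f_2\in L^2$ and $\|f_1\|_{\dot H^{s+\varepsilon}}+\|f_2\|_{\dot H^{s-\varepsilon}}\le C\||H|^{s/2}f\|_{L^2}$. -/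

import Mathlib

open MeasureTheory Filter Topology
open scoped ENNReal NNReal ContDiff Laplacian InnerProductSpace FourierTransform

noncomputable section

namespace Wave2D

/-- The Euclidean plane. -/
abbrev Plane : Type := EuclideanSpace ℝ (Fin 2)

/-- The Hilbert space of complex square-integrable functions on the plane. -/
abbrev L2 : Type := Lp ℂ 2 (volume : Measure Plane)

/-- The weight `1 + log₊ |x|`. -/
def logWeight (x : Plane) : ℝ := 1 + Real.posLog ‖x‖

/-- The (extended) norm of `F` in `(1 + log₊ |x|)^{-k} L¹`. -/
def weightedL1Norm (k : ℝ) (F : Plane → ℂ) : ℝ≥0∞ :=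
  ∫⁻ x, ENNReal.ofReal (logWeight x ^ k) * ‖F x‖ₑ

/-- `-Δ f = g` in the sense of distributions, with `f` and `g` locally integrable. -/
def IsWeakNegLaplacian (f g : Plane → ℂ) : Prop :=
  LocallyIntegrable f ∧ LocallyIntegrable g ∧
    ∀ φ : Plane → ℂ, ContDiff ℝ ∞ φ → HasCompactSupport φ →
      ∫ x, f x * (-(Δ φ) x) = ∫ x, g x * φ x

/-- The (extended) inhomogeneous Sobolev norm `‖⟨ξ⟩^σ f̂‖_{L²}`. Mathlib's Fourier transform has
phase `exp(-2πi x·ξ)`, hence the frequency variable is `2πξ`. -/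
def sobolevNorm (σ : ℝ) (f : L2) : ℝ≥0∞ :=
  (∫⁻ ξ, ENNReal.ofReal ((1 + (2 * Real.pi * ‖ξ‖) ^ 2) ^ σ) * ‖(𝓕 f : L2) ξ‖ₑ ^ 2) ^ (1 / 2 : ℝ)

/-- The (extended) homogeneous Sobolev norm `‖|ξ|^σ f̂‖_{L²}`. -/
def homSobolevNorm (σ : ℝ) (f : L2) : ℝ≥0∞ :=
  (∫⁻ ξ, ENNReal.ofReal ((2 * Real.pi * ‖ξ‖) ^ (2 * σ)) * ‖(𝓕 f : L2) ξ‖ₑ ^ 2) ^ (1 / 2 : ℝ)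

/-- `v = |V|^{1/2}`. -/
def rootAbs (V : Plane → ℝ) (x : Plane) : ℝ := Real.sqrt |V x|

/-- `U = sgn V`, with `U² = 1`. -/
def sgnPot (V : Plane → ℝ) (x : Plane) : ℝ := if V x < 0 then -1 else 1

/-- Green's function of `-Δ` in the plane. -/
def green (x y : Plane) : ℝ := -(1 / (2 * Real.pi)) * Real.log ‖x - y‖

open Classical in
/-- `v = |V|^{1/2}` as an element of `L²` (which it is as soon as `V` is integrable). -/
def rootAbsL2 (V : Plane → ℝ) : L2 :=
  if h : MemLp (fun x => (rootAbs V x : ℂ)) 2 volume then h.toLp else 0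

/-- `Q L²`, the orthogonal complement of `v` in `L²`. -/
def QL2 (V : Plane → ℝ) : Submodule ℂ L2 := (Submodule.span ℂ {rootAbsL2 V})ᗮ

instance (V : Plane → ℝ) : (QL2 V).HasOrthogonalProjection := by
  unfold QL2; infer_instance

/-- `T` is the operator `U + v G₀ v`. -/
def IsThresholdOp (V : Plane → ℝ) (T : L2 →L[ℂ] L2) : Prop :=
  ∀ φ : L2, (T φ : Plane → ℂ) =ᵐ[volume] fun x =>
    (sgnPot V x : ℂ) * φ x + (rootAbs V x : ℂ) * ∫ y, ((green x y * rootAbs V y : ℝ) : ℂ) * φ y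

/-- Zero is a regular point of the spectrum of `-Δ + V`: the operator `Q (U + v G₀ v) Q` is
invertible on `Q L²`. -/
def ZeroIsRegular (V : Plane → ℝ) : Prop :=
  ∃ T : L2 →L[ℂ] L2, IsThresholdOp V T ∧
    IsUnit ((QL2 V).orthogonalProjectionOnto ∘L T ∘L (QL2 V).subtypeL : QL2 V →L[ℂ] QL2 V)

/-- The graph of the self-adjoint operator `H = -Δ + V` with form domain `H¹`:
`u ∈ D(H)` and `H u = g`, i.e. `u ∈ H¹`, `g ∈ L²` and `-Δ u = g - V u` in the sense of
distributions. -/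
def IsHamiltonian (V : Plane → ℝ) (u g : L2) : Prop :=
  sobolevNorm 1 u < ⊤ ∧ IsWeakNegLaplacian u (fun x => g x - (V x : ℂ) * u x)

/-- `R = (H + m)⁻¹`, as a bounded self-adjoint operator on `L²`. -/
def IsResolvent (V : Plane → ℝ) (m : ℝ) (R : L2 →L[ℂ] L2) : Prop :=
  IsSelfAdjoint R ∧ (∀ f : L2, IsHamiltonian V (R f) (f - (m : ℂ) • R f)) ∧
    ∀ u g : L2, IsHamiltonian V u g → R (g + (m : ℂ) • u) = u

/-- The continuous functional calculus `ψ(R)` of a bounded self-adjoint operator `R` on a complex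
Hilbert space. -/
def hilbertCfc {E : Type*} [NormedAddCommGroup E] [InnerProductSpace ℂ E] [CompleteSpace E]
    (ψ : ℝ → ℝ) (R : E →L[ℂ] E) : E →L[ℂ] E := cfc ψ R

/-- For `0 ≤ α < 1`: `f ∈ D(|H|^α)` and `|H|^α f = g`, where `H = -Δ + V`.
If `R = (H + m)⁻¹` is a resolvent at a real point, then `H = R⁻¹ - m`, so that the bounded operator
`|H|^α R` is `ψ(R)` for the continuous function `ψ(r) = r |r⁻¹ - m|^α`, `ψ(0) = 0`. Since `R` is
injective and commutes with `|H|^α`, one has `g = |H|^α f` exactly when `ψ(R) f = R g`. -/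
def IsAbsPow (V : Plane → ℝ) (α : ℝ) (f g : L2) : Prop :=
  ∃ (m : ℝ) (R : L2 →L[ℂ] L2), IsResolvent V m R ∧
    hilbertCfc (fun r : ℝ => r * |r⁻¹ - m| ^ α) R f = R g

/-- For `0 ≤ α < 1`: `f ∈ D(|H|^{-α})` and `|H|^{-α} f = g`, where `|H|^{-α}` is the inverse of
`|H|^α`: the vector `g` is the only one with `|H|^α g = f`. -/
def IsAbsPowInv (V : Plane → ℝ) (α : ℝ) (f g : L2) : Prop :=
  IsAbsPow V α g f ∧ ∀ g' : L2, IsAbsPow V α g' f → g' = g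

end Wave2D

end

/-! Local integrability and the decay on annuli put `V` in some `L^r`, `1 < r < ∞`
(`exists_lintegral_rpow_lt_top`). With the logarithmic weight this makes the kernel `v(x) log|x - y|
v(y)` Hilbert–Schmidt (`hsSq_green_lt_top`). These two facts and the regularity of zero drive
everything.

Weighted estimate. Put `g = -Δf`. If `f ∈ L^p` with `p < ∞` and `g` is in the weighted space, then
`f` is the logarithmic potential of `g` and `∫ g = 0`, because `log R ∫ g` has to converge as the
scale `R` of a representation formula grows (`integral_eq_zero_and_ae_eq_green`). Mean zero allows
`log|x - y|` to be replaced by `log|x - y| - log₊|x|`, which does not grow in `x`; this bounds `V f`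
by `g`. Conversely `φ = U v f` satisfies `(U + v G₀ v) φ = v G₀ (H f)` and `⟪v, φ⟫ = ∫ V f = ∫ H f`.
Regularity of zero bounds `φ` by these two quantities, and Cauchy–Schwarz then bounds `V f = v φ`.
The a priori finiteness of `∫ |V f|` comes from an absorption argument, using that `V` is small near
infinity (`lintegral_potential_mul_lt_top`).

Powers of `|H|`. With `B = (-Δ + μ)^{-1/2} v` and `M = U + B* B`, one has `(H + μ)⁻¹ = (-Δ + μ)⁻¹ -
(-Δ + μ)⁻¹ v M⁻¹ v (-Δ + μ)⁻¹` (`isResolvent_resolventOp`). For large `μ` the operator `B` is small,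
so the resolvents of `H` and `-Δ` are comparable as forms (`exists_isResolvent_comparable`).
Operator monotonicity of `t ↦ t^s` for `0 ≤ s ≤ 1` passes this to powers with constants uniform in
`s`, which gives the inhomogeneous estimates.

As `μ → 0` the kernel of `(-Δ + μ)⁻¹` is `c_μ + G₀ + o(1)` with `c_μ → ∞`. The divergent rank-one
term controls `M` along `v`, and regularity of zero controls it on the complement; hence `M⁻¹` stays
bounded (`exists_birmanSchwinger_bounded_below`) and `H` has no spectrum in some `(-l₀, 0)`. Then
`(|H| + l)⁻¹` is dominated, uniformly in `l`, by the multiplier with symbol `1 / barrier ε (|ξ|² +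
l)`, where `barrier ε x` is about `x^{1+ε}` for small `x`: the loss `ε` is what makes `barrier ε x /
x²`, at `x = |ξ|²`, integrable near the origin of the plane. Monotonicity and `l → 0` give `∫
barrier^s |û|² ≤ C ‖|H|^{s/2} u‖²` (`exists_lintegral_barrier_rpow_le`). The homogeneous estimates
follow by splitting frequencies and by duality. -/

noncomputable section

namespace Wave2D

/-! ### Self-adjoint operators: ranges, inverses, the Heinz inequality. -/

section Hilbert

variable {E : Type*} [NormedAddCommGroup E] [InnerProductSpace ℂ E] [CompleteSpace E]

/-- A vector which is dominated by `A` as a functional lies in the range of `A`. -/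
theorem exists_apply_eq_of_inner_le {A : E →L[ℂ] E} (hA : IsSelfAdjoint A)
    (hinj : Function.Injective A) {x : E} {C : ℝ} (hC : 0 ≤ C)
    (h : ∀ y, ‖⟪x, y⟫_ℂ‖ ≤ C * ‖A y‖) : ∃ g, A g = x ∧ ‖g‖ ≤ C := by
  let e := LinearEquiv.ofInjective (A : E →ₗ[ℂ] E) hinj
  -- The functional `A z ↦ ⟪x, z⟫` is well defined by injectivity and bounded by `C` on the range. A
  -- norm-preserving Hahn–Banach extension has a Riesz representative `g`, and `⟪g, A z⟫ = ⟪x, z⟫`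
  -- says `A g = x`.
  let l₀ : LinearMap.range (A : E →ₗ[ℂ] E) →ₗ[ℂ] ℂ :=
    (innerSL ℂ x : E →ₗ[ℂ] ℂ) ∘ₗ (e.symm : _ →ₗ[ℂ] E)
  have hl₀ : ∀ y, ‖l₀ y‖ ≤ C * ‖y‖ := by
    intro y
    obtain ⟨z, rfl⟩ := e.surjective y
    have : ‖e z‖ = ‖A z‖ := rfl
    rw [this]
    simpa [l₀] using h z
  obtain ⟨l, hl, hln⟩ := exists_extension_norm_eq _ (l₀.mkContinuous C hl₀)
  refine ⟨(InnerProductSpace.toDual ℂ E).symm l, ?_, ?_⟩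
  · refine ext_inner_right ℂ fun y => ?_
    rw [← ContinuousLinearMap.adjoint_inner_right, ← ContinuousLinearMap.star_eq_adjoint,
      hA.star_eq, InnerProductSpace.toDual_symm_apply]
    have := hl (e y)
    rw [show ((e y : _) : E) = A y from rfl] at this
    rw [this]
    simp [l₀]
  · rw [LinearIsometryEquiv.norm_map, hln]
    exact LinearMap.mkContinuous_norm_le _ hC _

/-- A self-adjoint operator which is bounded below is invertible. -/
theorem exists_inverse_of_bounded_below {M : E →L[ℂ] E} (hM : IsSelfAdjoint M) {c : ℝ}
    (hc : 0 < c) (h : ∀ x, c * ‖x‖ ≤ ‖M x‖) :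
    ∃ N : E →L[ℂ] E, M * N = 1 ∧ N * M = 1 ∧ ‖N‖ ≤ c⁻¹ ∧ IsSelfAdjoint N := by
  have hinj : Function.Injective M := by
    refine (injective_iff_map_eq_zero M).2 fun x hx => ?_
    have := h x
    rw [hx, norm_zero] at this
    exact norm_eq_zero.1 (le_antisymm (by nlinarith [norm_nonneg x]) (norm_nonneg x))
  -- The lower bound dominates `⟪x, ·⟫` by `‖x‖ c⁻¹ ‖M ·‖`, so the previous lemma applies to every
  -- `x`.
  have hsurj : Function.Surjective M := fun x => by
    obtain ⟨g, hg, -⟩ := exists_apply_eq_of_inner_le hM hinj (x := x) (C := ‖x‖ * c⁻¹)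
      (by positivity) fun y => (norm_inner_le_norm x y).trans (by
        rw [mul_assoc]
        gcongr
        rw [inv_mul_eq_div, le_div_iff₀ hc, mul_comm]
        exact h y)
    exact ⟨g, hg⟩
  let e := LinearEquiv.ofBijective (M : E →ₗ[ℂ] E) ⟨hinj, hsurj⟩
  have he : ∀ x, M (e.symm x) = x := fun x => e.apply_symm_apply x
  have hb : ∀ x, ‖e.symm x‖ ≤ c⁻¹ * ‖x‖ := fun x => by
    rw [inv_mul_eq_div, le_div_iff₀ hc, mul_comm]
    simpa [he] using h (e.symm x)
  have h1 : M * (e.symm : E →ₗ[ℂ] E).mkContinuous c⁻¹ hb = 1 := by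
    ext x; exact he x
  have h2 : (e.symm : E →ₗ[ℂ] E).mkContinuous c⁻¹ hb * M = 1 := by
    ext x; exact e.symm_apply_apply x
  refine ⟨_, h1, h2, LinearMap.mkContinuous_norm_le _ (by positivity) _, ?_⟩
  have h3 : star ((e.symm : E →ₗ[ℂ] E).mkContinuous c⁻¹ hb) * M = 1 := by
    rw [← hM.star_eq, ← star_mul, h1, star_one]
  exact left_inv_eq_right_inv h3 h1

/-- Heinz inequality for the powers of nonnegative bounded operators. -/
theorem norm_rpow_half_le {X Y : E →L[ℂ] E} (hX : 0 ≤ X) (hY : 0 ≤ Y) {C : ℝ} (hC : 1 ≤ C)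
    (hXY : X ≤ C • Y) {s : ℝ} (hs : s ∈ Set.Icc (0 : ℝ) 1) (h : E) :
    ‖(X ^ (s / 2)) h‖ ≤ C * ‖(Y ^ (s / 2)) h‖ := by
  have key : ∀ Z : E →L[ℂ] E, 0 ≤ Z →
      ‖(Z ^ (s / 2)) h‖ ^ 2 = RCLike.re ⟪(Z ^ s) h, h⟫_ℂ := by
    intro Z hZ
    have h1 : Z ^ s = Z ^ (s / 2) * Z ^ (s / 2) := by
      rw [← pow_two, ← CFC.rpow_natCast _ 2 CFC.rpow_nonneg,
        CFC.rpow_rpow_of_exponent_nonneg _ _ _ (by linarith [hs.1]) (by norm_num) hZ]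
      congr 1
      push_cast; ring
    have h2 : IsSelfAdjoint (Z ^ (s / 2)) := (CFC.rpow_nonneg (a := Z) (y := s / 2)).isSelfAdjoint
    rw [h1, mul_apply_eq_comp, ← ContinuousLinearMap.adjoint_inner_right,
      ← ContinuousLinearMap.star_eq_adjoint, h2.star_eq, inner_self_eq_norm_sq]
  -- Operator monotonicity of `t ↦ t ^ s`, which is where `s ≤ 1` enters.
  have hmono : X ^ s ≤ C ^ s • Y ^ s := by
    have h1 : X ^ s ≤ (C • Y) ^ s := CFC.rpow_le_rpow hs hXY
    have h2 : (C • Y) ^ s = C ^ s • Y ^ s := by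
      rw [CFC.rpow_eq_cfc_real (smul_nonneg (by linarith) hY), CFC.rpow_eq_cfc_real hY]
      have hid : C • Y = cfc (fun r : ℝ => C * r) Y := by
        rw [cfc_const_mul_id C Y hY.isSelfAdjoint]
      have hcont : ∀ S : Set ℝ, ContinuousOn (fun x : ℝ => x ^ s) S := fun S =>
        (Real.continuous_rpow_const hs.1).continuousOn
      rw [hid, ← cfc_comp' (fun x : ℝ => x ^ s) (fun r : ℝ => C * r) Y (hcont _),
        ← cfc_smul (C ^ s) (fun x : ℝ => x ^ s) Y (hcont _)]
      refine cfc_congr fun r hr => ?_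
      have hr0 : 0 ≤ r := spectrum_nonneg_of_nonneg hY hr
      simp [Real.mul_rpow (by linarith : 0 ≤ C) hr0]
    rwa [h2] at h1
  have hq : ‖(X ^ (s / 2)) h‖ ^ 2 ≤ C ^ s * ‖(Y ^ (s / 2)) h‖ ^ 2 := by
    rw [key X hX, key Y hY]
    have := (ContinuousLinearMap.le_def _ _).1 hmono
    have := this.re_inner_nonneg_left h
    simp only [sub_apply, inner_sub_left, map_sub,
      smul_apply] at this
    rw [inner_smul_left_eq_smul] at this
    simp at this
    simpa using this
  -- Enlarging `C ^ s` to `C ^ 2` makes the final constant independent of `s`.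
  have hCs : C ^ s ≤ C ^ 2 := by
    calc C ^ s ≤ C ^ (2 : ℝ) := Real.rpow_le_rpow_of_exponent_le hC (by linarith [hs.2])
      _ = C ^ 2 := by norm_cast
  refine le_of_sq_le_sq ?_ (by positivity)
  rw [mul_pow]
  exact hq.trans (by gcongr)

end Hilbert

/-! ### Operators whose compression to the complement of `v` is invertible. -/

section Hilbert

variable {E : Type*} [NormedAddCommGroup E] [InnerProductSpace ℂ E] [CompleteSpace E]

/-- If the compression of `T` to `vᗮ` is invertible, then `φ` is controlled by the component of
`T φ` in `vᗮ` and by `⟪v, φ⟫`. -/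
theorem exists_norm_le_of_isUnit_compression {v : E} {T : E →L[ℂ] E} {K : Submodule ℂ E}
    [K.HasOrthogonalProjection] (hK : K = (Submodule.span ℂ {v})ᗮ)
    (hT : IsUnit (K.orthogonalProjectionOnto ∘L T ∘L K.subtypeL : K →L[ℂ] K)) :
    ∃ D : ℝ, 0 < D ∧ ∀ φ : E,
      ‖φ‖ ≤ D * (‖K.orthogonalProjectionOnto (T φ)‖ + ‖⟪v, φ⟫_ℂ‖) := by
  obtain ⟨A, hA⟩ := hT
  set a := ‖((A⁻¹ : (K →L[ℂ] K)ˣ) : K →L[ℂ] K)‖ with ha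
  have ha0 : 0 ≤ a := by rw [ha]; positivity
  obtain ⟨b, hb0, hb⟩ : ∃ b : ℝ, 0 ≤ b ∧ ∀ φ : E,
      ‖φ - K.orthogonalProjectionOnto φ‖ ≤ b * ‖⟪v, φ⟫_ℂ‖ := by
    -- For `v = 0` this constant is `0`, which is correct: `K` is then the whole space and the left
    -- side vanishes.
    refine ⟨‖v‖⁻¹, by positivity, fun φ => ?_⟩
    have h1 : φ - K.orthogonalProjectionOnto φ = (Submodule.span ℂ {v}).starProjection φ := by
      subst hK
      have := Submodule.starProjection_add_starProjection_orthogonal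
        (K := Submodule.span ℂ {v}) φ
      rw [sub_eq_iff_eq_add]
      exact this.symm
    rw [h1, Submodule.starProjection_singleton, norm_smul, norm_div]
    rcases eq_or_ne v 0 with rfl | hv
    · simp
    · have : ‖v‖ ≠ 0 := norm_ne_zero_iff.2 hv
      simp only [Complex.coe_algebraMap, Complex.norm_real, norm_pow, norm_norm]
      apply le_of_eq
      field_simp
  refine ⟨a + (a * ‖T‖ + 1) * b + 1, by positivity, fun φ => ?_⟩
  set P := K.orthogonalProjectionOnto with hP
  set ψ := φ - P φ with hψ
  -- Projecting `T φ = T (P φ) + T ψ` expresses the compression at `P φ` through `P (T φ)` and the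
  -- part `ψ` of `φ` along `v`.
  have h1 : (A : K →L[ℂ] K) (P φ) = P (T φ) - P (T ψ) := by
    rw [hA]
    simp [hψ]
  have h2 : P φ = ((A⁻¹ : (K →L[ℂ] K)ˣ) : K →L[ℂ] K) (P (T φ) - P (T ψ)) := by
    rw [← h1, ← mul_apply_eq_comp, Units.inv_mul]; rfl
  have hPn : ∀ x : E, ‖P x‖ ≤ ‖x‖ := fun x => K.norm_orthogonalProjectionOnto_apply_le x
  have h3 : ‖P φ‖ ≤ a * (‖P (T φ)‖ + ‖T‖ * ‖ψ‖) := by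
    rw [h2]
    refine (ContinuousLinearMap.le_opNorm _ _).trans ?_
    gcongr
    refine (norm_sub_le _ _).trans ?_
    gcongr
    exact (hPn _).trans (T.le_opNorm _)
  have h4 : ‖φ‖ ≤ ‖P φ‖ + ‖ψ‖ := by
    have : φ = (P φ : E) + ψ := by simp [hψ]
    calc ‖φ‖ = ‖(P φ : E) + ψ‖ := by rw [← this]
      _ ≤ ‖(P φ : E)‖ + ‖ψ‖ := norm_add_le _ _
      _ = _ := rfl
  have h5 := hb φ
  have h6 : 0 ≤ ‖P (T φ)‖ := norm_nonneg _
  have h7 : 0 ≤ ‖⟪v, φ⟫_ℂ‖ := norm_nonneg _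
  have h8 : 0 ≤ ‖T‖ := norm_nonneg _
  calc ‖φ‖ ≤ a * (‖P (T φ)‖ + ‖T‖ * ‖ψ‖) + ‖ψ‖ := by linarith
    _ ≤ a * (‖P (T φ)‖ + ‖T‖ * (b * ‖⟪v, φ⟫_ℂ‖)) + b * ‖⟪v, φ⟫_ℂ‖ := by gcongr
    _ ≤ _ := by
      have : 0 ≤ (a * ‖T‖ + 1) * b * ‖P (T φ)‖ := by positivity
      have : 0 ≤ a * ‖⟪v, φ⟫_ℂ‖ := by positivity
      nlinarith

/-- Perturbations of `T + c ⟪v, ·⟫ v` are uniformly bounded below for large `c`, if the compression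
of `T` to `vᗮ` is invertible. -/
theorem exists_uniform_bounded_below {v : E} {T : E →L[ℂ] E} {K : Submodule ℂ E}
    [K.HasOrthogonalProjection] (hK : K = (Submodule.span ℂ {v})ᗮ)
    (hT : IsUnit (K.orthogonalProjectionOnto ∘L T ∘L K.subtypeL : K →L[ℂ] K)) :
    ∃ D δ c₀ : ℝ, 0 < D ∧ 0 < δ ∧ 0 < c₀ ∧ ∀ (M S : E →L[ℂ] E) (c : ℝ), c₀ ≤ c → ‖S‖ ≤ δ →
      (∀ φ, M φ = T φ + ((c : ℂ) * ⟪v, φ⟫_ℂ) • v + S φ) → ∀ φ, ‖φ‖ ≤ D * ‖M φ‖ := by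
  obtain ⟨D, hD, h⟩ := exists_norm_le_of_isUnit_compression hK hT
  have hδ : 0 < min (1 / (4 * D)) 1 := by positivity
  -- The choice of `δ` makes `D ‖S φ‖ ≤ ‖φ‖ / 4`, and that of `c₀` makes `D |⟪v, φ⟫| ≤ (‖M φ‖ + ‖φ‖)
  -- / 4`; half of `‖φ‖` is then absorbed on the left, whence the factor `2`.
  refine ⟨2 * (D + 1 / 4), min (1 / (4 * D)) 1, 4 * D * (‖T‖ + 1) / ‖v‖ + 1, by positivity, hδ,
    by positivity, fun M S c hc hS hM φ => ?_⟩
  have hSφ : ‖S φ‖ ≤ min (1 / (4 * D)) 1 * ‖φ‖ :=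
    (S.le_opNorm φ).trans (by gcongr)
  have hS1 : ‖S φ‖ ≤ ‖φ‖ :=
    hSφ.trans (by nlinarith [norm_nonneg φ, min_le_right (1 / (4 * D)) 1])
  have hS2 : D * ‖S φ‖ ≤ ‖φ‖ / 4 := by
    calc D * ‖S φ‖ ≤ D * (1 / (4 * D) * ‖φ‖) := by
          gcongr
          exact hSφ.trans (by gcongr; exact min_le_left _ _)
      _ = ‖φ‖ / 4 := by field_simp
  have hTφ := T.le_opNorm φ
  have h1 : ‖K.orthogonalProjectionOnto (T φ)‖ ≤ ‖M φ‖ + ‖S φ‖ := by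
    have hPv : K.orthogonalProjectionOnto v = 0 := by
      rw [Submodule.orthogonalProjectionOnto_eq_zero_iff, hK]
      exact Submodule.le_orthogonal_orthogonal _ (Submodule.mem_span_singleton_self v)
    -- The rank-one term is killed by the projection, so this bound does not see the size of `c`.
    have : K.orthogonalProjectionOnto (T φ) = K.orthogonalProjectionOnto (M φ - S φ) := by
      rw [hM φ]
      simp [hPv]
    rw [this]
    exact (K.norm_orthogonalProjectionOnto_apply_le _).trans (norm_sub_le _ _)
  have h2 : D * ‖⟪v, φ⟫_ℂ‖ ≤ ‖M φ‖ / 4 + ‖φ‖ / 4 := by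
    rcases eq_or_ne v 0 with rfl | hv
    · simp; positivity
    have hv' : 0 < ‖v‖ := norm_pos_iff.2 hv
    have hc' : 0 < c := lt_of_lt_of_le (by positivity) hc
    have e1 : c * ‖⟪v, φ⟫_ℂ‖ * ‖v‖ ≤ ‖M φ‖ + (‖T‖ + 1) * ‖φ‖ := by
      calc c * ‖⟪v, φ⟫_ℂ‖ * ‖v‖ = ‖((c : ℂ) * ⟪v, φ⟫_ℂ) • v‖ := by
            rw [norm_smul, norm_mul, Complex.norm_real, Real.norm_of_nonneg hc'.le]
        _ = ‖M φ - T φ - S φ‖ := by rw [hM φ]; congr 1; abel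
        _ ≤ ‖M φ‖ + ‖T φ‖ + ‖S φ‖ := by
            refine (norm_sub_le _ _).trans ?_
            gcongr
            exact norm_sub_le _ _
        _ ≤ _ := by linarith
    have e2 : 4 * D * (‖T‖ + 1) ≤ c * ‖v‖ := by
      rw [← div_le_iff₀ hv']
      linarith
    have e3 : 4 * D * (‖T‖ + 1) * ‖⟪v, φ⟫_ℂ‖ ≤ ‖M φ‖ + (‖T‖ + 1) * ‖φ‖ := by
      refine le_trans ?_ e1
      calc _ ≤ (c * ‖v‖) * ‖⟪v, φ⟫_ℂ‖ := by gcongr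
        _ = _ := by ring
    have e4 : 1 ≤ ‖T‖ + 1 := by linarith [norm_nonneg T]
    have e5 : (‖T‖ + 1) * (4 * D * ‖⟪v, φ⟫_ℂ‖) ≤ (‖T‖ + 1) * (‖M φ‖ + ‖φ‖) := by
      nlinarith [norm_nonneg (M φ)]
    have := le_of_mul_le_mul_left e5 (by linarith)
    linarith
  have h3 := h φ
  have : D * (‖K.orthogonalProjectionOnto (T φ)‖ + ‖⟪v, φ⟫_ℂ‖)
      ≤ D * (‖M φ‖ + ‖S φ‖) + D * ‖⟪v, φ⟫_ℂ‖ := by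
    rw [mul_add]; gcongr
  nlinarith [norm_nonneg φ, norm_nonneg (M φ)]

/-! ### The resolvent identity and functions of a resolvent. -/

section Resolvents

variable {R R' : E →L[ℂ] E} {a : ℝ}

/-- The inverse is `1 + a R'`. The product in the other order uses the adjoint of the identity,
which exchanges `R` and `R'`. For resolvents at `-m` and `-m'` one has `a = m - m'`. -/
theorem isUnit_of_resolvent_identity (hR : IsSelfAdjoint R) (hR' : IsSelfAdjoint R')
    (h : R' - R = a • (R * R')) : IsUnit (1 - a • R) := by
  have h' : R' - R = a • (R' * R) := by
    have := congrArg star h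
    simpa [hR.star_eq, hR'.star_eq] using this
  refine ⟨⟨1 - a • R, 1 + a • R', ?_, ?_⟩, rfl⟩
  · have : (1 - a • R) * (1 + a • R') = 1 + a • ((R' - R) - a • (R * R')) := by
      simp only [sub_mul, mul_add, mul_one, one_mul, smul_mul_smul_comm, smul_sub, smul_smul]
      abel
    rw [this, h, sub_self, smul_zero, add_zero]
  · have : (1 + a • R') * (1 - a • R) = 1 + a • ((R' - R) - a • (R' * R)) := by
      simp only [add_mul, mul_sub, mul_one, one_mul, smul_mul_smul_comm, smul_sub, smul_smul]
      abel
    rw [this, h', sub_self, smul_zero, add_zero]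

theorem one_sub_mul_ne_zero_of_resolvent_identity (hR : IsSelfAdjoint R) (hR' : IsSelfAdjoint R')
    (h : R' - R = a • (R * R')) {r : ℝ} (hr : r ∈ spectrum ℝ R) : 1 - a * r ≠ 0 := by
  intro h0
  have hu := isUnit_of_resolvent_identity hR hR' h
  have ha : a ≠ 0 := by rintro rfl; simp at h0
  apply spectrum.mem_iff.1 hr
  have : algebraMap ℝ (E →L[ℂ] E) r - R = a⁻¹ • (1 - a • R) := by
    rw [smul_sub, smul_smul, inv_mul_cancel₀ ha, one_smul, Algebra.algebraMap_eq_smul_one]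
    congr 2
    field_simp
    linarith
  rw [this]
  exact hu.smul (Units.mk0 a⁻¹ (inv_ne_zero ha))

theorem cfc_one_sub_mul (hR : IsSelfAdjoint R) (a : ℝ) :
    cfc (fun r : ℝ => 1 - a * r) R = 1 - a • R := by
  rw [cfc_sub (fun _ : ℝ => (1 : ℝ)) (fun r => a * r) R, cfc_const_one ℝ R,
    cfc_const_mul_id a R]

/-- If `r = 1 / (λ + m)` and `a = m - m'`, then `r / (1 - a r) = 1 / (λ + m')`. The operator version
is `(1 - a R) R' = R`, where the left factor is invertible. -/
theorem eq_cfc_of_resolvent_identity (hR : IsSelfAdjoint R) (hR' : IsSelfAdjoint R')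
    (h : R' - R = a • (R * R')) : R' = cfc (fun r : ℝ => r / (1 - a * r)) R := by
  have hu := isUnit_of_resolvent_identity hR hR' h
  have hne : ∀ r ∈ spectrum ℝ R, 1 - a * r ≠ 0 := fun r hr =>
    one_sub_mul_ne_zero_of_resolvent_identity hR hR' h hr
  have hc : ContinuousOn (fun r : ℝ => r / (1 - a * r)) (spectrum ℝ R) :=
    continuousOn_id.div (by fun_prop) hne
  apply hu.mul_left_cancel
  have h1 : (1 - a • R) * R' = R := by
    rw [sub_mul, one_mul, smul_mul_assoc, ← h]; abel
  rw [h1, ← cfc_one_sub_mul hR, ← cfc_mul _ _ R (by fun_prop) hc]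
  conv_lhs => rw [← cfc_id' ℝ R]
  refine cfc_congr fun r hr => ?_
  exact (mul_div_cancel₀ r (hne r hr)).symm

end Resolvents

end Hilbert

/-- The point `r = 0` stands for infinite energy. There the function is at most `|r|^{1-α} |1 - m
r|^α`, which tends to `0` because `α < 1`; so the symbol in `IsAbsPow` is admissible in the
continuous functional calculus. -/
theorem continuous_mul_abs_inv_sub_rpow (m : ℝ) {α : ℝ} (h0 : 0 ≤ α) (h1 : α < 1) :
    Continuous fun r : ℝ => r * |r⁻¹ - m| ^ α := by
  rw [continuous_iff_continuousAt]
  intro r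
  rcases eq_or_ne r 0 with rfl | hr
  · have hb : ∀ r : ℝ, ‖r * |r⁻¹ - m| ^ α‖ ≤ |r| ^ (1 - α) * |1 - m * r| ^ α := by
      intro r
      rcases eq_or_ne r 0 with rfl | hr
      · simp only [inv_zero, zero_mul, norm_zero]
        positivity
      have hr' : 0 < |r| := abs_pos.2 hr
      have : |r⁻¹ - m| = |1 - m * r| / |r| := by
        rw [← abs_div]; congr 1; field_simp
      rw [norm_mul, Real.norm_eq_abs, Real.norm_of_nonneg (by positivity), this,
        Real.div_rpow (abs_nonneg _) (abs_nonneg _), Real.rpow_sub hr', Real.rpow_one]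
      apply le_of_eq
      field_simp
    have hlim : Tendsto (fun r : ℝ => |r| ^ (1 - α) * |1 - m * r| ^ α) (𝓝 0) (𝓝 0) := by
      have : Continuous fun r : ℝ => |r| ^ (1 - α) * |1 - m * r| ^ α := by
        refine Continuous.mul ?_ ?_
        · exact continuous_abs.rpow_const fun _ => Or.inr (by linarith)
        · exact Continuous.rpow_const (by fun_prop) fun _ => Or.inr h0
      have := this.tendsto 0
      simpa [Real.zero_rpow (by linarith : 1 - α ≠ 0)] using this
    rw [ContinuousAt, zero_mul]
    exact squeeze_zero_norm hb hlim
  · refine continuousAt_id.mul (ContinuousAt.rpow_const ?_ (Or.inr h0))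
    exact ((continuousAt_inv₀ hr).sub continuousAt_const).abs

/-! ### Powers of `|H|` seen through a bounded resolvent. -/

section Spectral

variable {E : Type*} [NormedAddCommGroup E] [InnerProductSpace ℂ E] [CompleteSpace E]

theorem inner_apply_left_of_isSelfAdjoint {A : E →L[ℂ] E} (hA : IsSelfAdjoint A) (x y : E) :
    ⟪A x, y⟫_ℂ = ⟪x, A y⟫_ℂ := by
  rw [← ContinuousLinearMap.adjoint_inner_right, ← ContinuousLinearMap.star_eq_adjoint, hA.star_eq]

theorem continuousOn_cfc_apply_comp {R : E →L[ℂ] E} {φ ψ : ℝ → ℝ}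
    (hφ : ContinuousOn φ (spectrum ℝ R)) (hψ : ContinuousOn ψ (spectrum ℝ R)) (x : E) :
    cfc φ R (cfc ψ R x) = cfc (fun r => φ r * ψ r) R x := by
  rw [cfc_mul φ ψ R hφ hψ, mul_apply_eq_comp]

/-- The vectors `f`, `g` with `|H|^α f = g` can be recognized with any resolvent of `H`. -/
theorem cfc_abs_pow_eq_of_resolvent_identity {R R' : E →L[ℂ] E} {m m' α : ℝ}
    (h0 : 0 ≤ α) (h1 : α < 1) (hR : IsSelfAdjoint R) (hR' : IsSelfAdjoint R')
    (h : R' - R = (m - m') • (R * R')) {f g : E}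
    (hfg : cfc (fun r : ℝ => r * |r⁻¹ - m'| ^ α) R' f = R' g) :
    cfc (fun r : ℝ => r * |r⁻¹ - m| ^ α) R f = R g := by
  have hne : ∀ r ∈ spectrum ℝ R, 1 - (m - m') * r ≠ 0 := fun r hr =>
    one_sub_mul_ne_zero_of_resolvent_identity hR hR' h hr
  have hc : ContinuousOn (fun r : ℝ => r / (1 - (m - m') * r)) (spectrum ℝ R) :=
    continuousOn_id.div (by fun_prop) hne
  have hψ := continuous_mul_abs_inv_sub_rpow m' h0 h1
  have e1 : (1 - (m - m') • R) * R' = R := by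
    rw [sub_mul, one_mul, smul_mul_assoc, ← h]; abel
  -- The spectral value `λ = r⁻¹ - m` of `H` does not change when one resolvent is replaced by
  -- another, so the two symbols differ only by the factor `1 - (m - m') r`.
  have e2 : (1 - (m - m') • R) * cfc (fun r : ℝ => r * |r⁻¹ - m'| ^ α) R'
      = cfc (fun r : ℝ => r * |r⁻¹ - m| ^ α) R := by
    rw [eq_cfc_of_resolvent_identity hR hR' h, ← cfc_comp' _ _ R hψ.continuousOn hc,
      ← cfc_one_sub_mul hR, ← cfc_mul (fun r : ℝ => 1 - (m - m') * r)
        (fun x => x / (1 - (m - m') * x) * |(x / (1 - (m - m') * x))⁻¹ - m'| ^ α) R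
        (by fun_prop) (hψ.comp_continuousOn hc)]
    refine cfc_congr fun r hr => ?_
    have hn := hne r hr
    rcases eq_or_ne r 0 with rfl | hr0
    · simp
    have : (r / (1 - (m - m') * r))⁻¹ - m' = r⁻¹ - m := by
      field_simp
      ring
    simp only [this]
    rw [← mul_assoc, mul_div_cancel₀ r hn]
  rw [← e2, mul_apply_eq_comp, hfg, ← mul_apply_eq_comp, e1]

variable {R : E →L[ℂ] E}

theorem nonneg_of_mem_spectrum (hR : 0 ≤ R) {r : ℝ} (hr : r ∈ spectrum ℝ R) : 0 ≤ r :=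
  spectrum_nonneg_of_nonneg hR hr

theorem abs_one_sub_mul_rpow_le {m K s : ℝ} (hK : ∀ r ∈ spectrum ℝ R, |1 - m * r| ≤ K)
    (hK1 : 1 ≤ K) (hs : s ∈ Set.Icc (0 : ℝ) 1) (x : E) :
    ‖cfc (fun r : ℝ => |1 - m * r| ^ (s / 2)) R x‖ ≤ K * ‖x‖ := by
  have : ‖cfc (fun r : ℝ => |1 - m * r| ^ (s / 2)) R‖ ≤ K := by
    refine norm_cfc_le (by linarith) fun r hr => ?_
    rw [Real.norm_of_nonneg (by positivity)]
    calc |1 - m * r| ^ (s / 2) ≤ K ^ (s / 2) :=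
          Real.rpow_le_rpow (abs_nonneg _) (hK r hr) (by linarith [hs.1])
      _ ≤ K ^ (1 : ℝ) := Real.rpow_le_rpow_of_exponent_le hK1 (by linarith [hs.2])
      _ = K := Real.rpow_one K
  exact (ContinuousLinearMap.le_opNorm _ _).trans (by gcongr)

/-- Since `|1 - m r| = r |λ|` with `λ = r⁻¹ - m`, the constant `K` bounds `|H| (H + m)⁻¹`; taking `K
≥ 1` makes it serve all powers of exponent at most one. -/
theorem exists_abs_one_sub_mul_le (R : E →L[ℂ] E) (m : ℝ) :
    ∃ K : ℝ, 1 ≤ K ∧ ∀ r ∈ spectrum ℝ R, |1 - m * r| ≤ K := by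
  obtain ⟨K, hK⟩ := (spectrum.isCompact (𝕜 := ℝ) R).exists_bound_of_continuousOn
    (f := fun r : ℝ => 1 - m * r) (by fun_prop)
  exact ⟨max K 1, le_max_right _ _, fun r hr => (hK r hr).trans (le_max_left _ _)⟩

/-- Formally `R^{s/2} |H|^{s/2} = |1 - m R|^{s/2}`, whose right side is bounded. The extra factor
`R` keeps every symbol continuous at `r = 0`. -/
theorem rpow_half_mul_cfc_abs_pow (hR : 0 ≤ R) (m : ℝ) {s : ℝ} (hs : s ∈ Set.Icc (0 : ℝ) 1) :
    R ^ (s / 2) * cfc (fun r : ℝ => r * |r⁻¹ - m| ^ (s / 2)) R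
      = R * cfc (fun r : ℝ => |1 - m * r| ^ (s / 2)) R := by
  have h0 : 0 ≤ s / 2 := by linarith [hs.1]
  have c1 : Continuous fun r : ℝ => r ^ (s / 2) := Real.continuous_rpow_const h0
  have c2 : Continuous fun r : ℝ => |1 - m * r| ^ (s / 2) :=
    Continuous.rpow_const (by fun_prop) fun _ => Or.inr h0
  have c3 := continuous_mul_abs_inv_sub_rpow m h0 (by linarith [hs.2])
  have hRs : IsSelfAdjoint R := hR.isSelfAdjoint
  rw [CFC.rpow_eq_cfc_real hR, ← cfc_mul _ _ R c1.continuousOn c3.continuousOn]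
  have : R * cfc (fun r : ℝ => |1 - m * r| ^ (s / 2)) R
      = cfc (fun r : ℝ => r * |1 - m * r| ^ (s / 2)) R := by
    rw [cfc_mul (fun r : ℝ => r) _ R (by fun_prop) c2.continuousOn, cfc_id' ℝ R]
  rw [this]
  refine cfc_congr fun r hr => ?_
  have hr0 := nonneg_of_mem_spectrum hR hr
  rcases hr0.eq_or_lt with rfl | hr'
  · simp
  have : |1 - m * r| = r * |r⁻¹ - m| := by
    rw [← abs_of_pos hr', ← abs_mul, abs_of_pos hr']
    congr 1
    field_simp
  simp only [this]
  rw [Real.mul_rpow hr0 (abs_nonneg _)]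
  ring

variable {J : E →L[ℂ] E} {C K m s : ℝ}

/-- This is the boundedness of `J^{s/2} |H|^{s/2}` on the range of `R`: Heinz replaces `J` by `R`,
and then the product is the bounded operator `|1 - m R|^{s/2}`. -/
theorem norm_rpow_half_cfc_abs_pow_le (hR : 0 ≤ R) (hJ : 0 ≤ J) (hC : 1 ≤ C) (hJR : J ≤ C • R)
    (hK : ∀ r ∈ spectrum ℝ R, |1 - m * r| ≤ K) (hK1 : 1 ≤ K) (hs : s ∈ Set.Icc (0 : ℝ) 1) (h : E) :
    ‖(J ^ (s / 2)) (cfc (fun r : ℝ => r * |r⁻¹ - m| ^ (s / 2)) R h)‖ ≤ C * K * ‖R h‖ := by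
  have hRs : IsSelfAdjoint R := hR.isSelfAdjoint
  refine (norm_rpow_half_le hJ hR hC hJR hs _).trans ?_
  rw [← mul_apply_eq_comp, rpow_half_mul_cfc_abs_pow hR m hs,
    show R * cfc (fun r : ℝ => |1 - m * r| ^ (s / 2)) R
      = cfc (fun r : ℝ => |1 - m * r| ^ (s / 2)) R * R from
      ((Commute.refl R).cfc_real _).eq.symm, mul_apply_eq_comp, mul_assoc]
  gcongr
  exact abs_one_sub_mul_rpow_le hK hK1 hs _

/-- `|H|^{s/2}` is bounded from the form domain of `J⁻ˢ`. -/
theorem exists_abs_pow_of_rpow_half (hR : 0 ≤ R) (hinj : Function.Injective R) (hJ : 0 ≤ J)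
    (hC : 1 ≤ C) (hJR : J ≤ C • R) (hK : ∀ r ∈ spectrum ℝ R, |1 - m * r| ≤ K) (hK1 : 1 ≤ K)
    (hs : s ∈ Set.Icc (0 : ℝ) 1) (h : E) :
    ∃ g, cfc (fun r : ℝ => r * |r⁻¹ - m| ^ (s / 2)) R ((J ^ (s / 2)) h) = R g ∧
      ‖g‖ ≤ C * K * ‖h‖ := by
  have hRs : IsSelfAdjoint R := hR.isSelfAdjoint
  -- By duality: moving both self-adjoint factors to `y` bounds the pairing by `C K ‖h‖ ‖R y‖`, so
  -- the vector lies in the range of `R`.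
  obtain ⟨g, hg, hgn⟩ := exists_apply_eq_of_inner_le hRs hinj
    (x := cfc (fun r : ℝ => r * |r⁻¹ - m| ^ (s / 2)) R ((J ^ (s / 2)) h)) (C := C * K * ‖h‖)
    (by positivity) fun y => by
      rw [inner_apply_left_of_isSelfAdjoint (cfc_predicate _ R),
        inner_apply_left_of_isSelfAdjoint (CFC.rpow_nonneg (a := J)).isSelfAdjoint]
      refine (norm_inner_le_norm _ _).trans ?_
      have := norm_rpow_half_cfc_abs_pow_le hR hJ hC hJR hK hK1 hs y
      calc _ ≤ ‖h‖ * (C * K * ‖R y‖) := by gcongr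
        _ = _ := by ring
  exact ⟨g, hg.symm, hgn⟩

theorem norm_rpow_half_le_of_abs_pow (hR : 0 ≤ R) (hinj : Function.Injective R) (hJ : 0 ≤ J)
    (hC : 1 ≤ C) (hJR : J ≤ C • R) (hK : ∀ r ∈ spectrum ℝ R, |1 - m * r| ≤ K) (hK1 : 1 ≤ K)
    (hs : s ∈ Set.Icc (0 : ℝ) 1) {f g : E}
    (hfg : cfc (fun r : ℝ => r * |r⁻¹ - m| ^ (s / 2)) R f = R g) :
    ‖(J ^ (s / 2)) g‖ ≤ C * K * ‖f‖ := by
  have hRs : IsSelfAdjoint R := hR.isSelfAdjoint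
  refine (norm_rpow_half_le hJ hR hC hJR hs _).trans ?_
  -- For `g = |H|^{s/2} f` this is `R^{s/2} |H|^{s/2} = |1 - m R|^{s/2}` again, verified after
  -- applying the injective `R`.
  have e : (R ^ (s / 2)) g = cfc (fun r : ℝ => |1 - m * r| ^ (s / 2)) R f := by
    apply hinj
    have e1 : R ((R ^ (s / 2)) g) = (R ^ (s / 2)) (R g) := by
      rw [← mul_apply_eq_comp, ← mul_apply_eq_comp, CFC.rpow_eq_cfc_real hR,
        ((Commute.refl R).cfc_real _).eq]
    rw [e1, ← hfg, ← mul_apply_eq_comp, ← mul_apply_eq_comp, rpow_half_mul_cfc_abs_pow hR m hs]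
  rw [e, mul_assoc]
  gcongr
  exact abs_one_sub_mul_rpow_le hK hK1 hs _

/-! ### The regularized inverse `(|H| + l)⁻¹`. -/

section Regularized

variable {l : ℝ}

theorem continuousOn_regularized (m : ℝ) (hl : 0 < l) :
    ContinuousOn (fun r : ℝ => r / (|1 - m * r| + l * r)) (Set.Ici 0) := by
  refine continuousOn_id.div (by fun_prop) fun r (hr : 0 ≤ r) => ?_
  rcases hr.eq_or_lt with rfl | hr
  · simp
  · positivity

/-- The right side is the symbol of `(|H| + l)⁻¹` at `λ = r⁻¹ - m`; the left side is the form that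
is continuous down to `r = 0`. -/
theorem regularized_eq {r : ℝ} (hr : 0 < r) (m l : ℝ) :
    r / (|1 - m * r| + l * r) = (|r⁻¹ - m| + l)⁻¹ := by
  have : |1 - m * r| = r * |r⁻¹ - m| := by
    rw [← abs_of_pos hr, ← abs_mul, abs_of_pos hr]
    congr 1
    field_simp
  rw [this, mul_comm l r, ← mul_add, ← div_div, div_self hr.ne', one_div]

theorem rpow_add_sub_rpow_le {x p : ℝ} (hx : 0 ≤ x) (hl : 0 < l) (hp : p ∈ Set.Icc (0 : ℝ) 1) :
    (x + l) ^ p - x ^ p ≤ l ^ p := by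
  linarith [Real.rpow_add_le_add_rpow hx hl.le hp.1 hp.2]

/-- As `|λ| → ∞` the difference `(|λ| + l)^p - |λ|^p` is at most `l |λ|^{-1/2}`, by Bernoulli's
inequality and `p ≤ 1/2`. So `(|H| + l)^p - |H|^p` is a bounded function of `R`, and the two powers
have the same domain. -/
theorem continuous_rpow_increment (m : ℝ) (hl : 0 < l) {p : ℝ} (hp : p ∈ Set.Icc (0 : ℝ) (1 / 2)) :
    Continuous fun r : ℝ =>
      if r = 0 then 0 else (|r⁻¹ - m| + l) ^ p - |r⁻¹ - m| ^ p := by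
  rw [continuous_iff_continuousAt]
  intro r
  rcases eq_or_ne r 0 with rfl | hr
  · rw [continuousAt_iff_punctured_nhds]
    simp only [if_true]
    have ha : Tendsto (fun r : ℝ => |r⁻¹ - m|) (𝓝[≠] 0) atTop := by
      have h1 : Tendsto (fun r : ℝ => |r⁻¹| - |m|) (𝓝[≠] 0) atTop :=
        tendsto_atTop_add_const_right _ _ (tendsto_norm_inv_nhdsNE_zero_atTop (α := ℝ))
      exact tendsto_atTop_mono (fun r => abs_sub_abs_le_abs_sub _ _) h1
    have hb : Tendsto (fun a : ℝ => l * a ^ (-(1 / 2) : ℝ)) atTop (𝓝 0) := by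
      simpa using (tendsto_rpow_neg_atTop (by norm_num : (0 : ℝ) < 1 / 2)).const_mul l
    refine squeeze_zero_norm' ?_ (hb.comp ha)
    filter_upwards [ha.eventually_ge_atTop 1, self_mem_nhdsWithin] with r hr1 hr0
    have hr0 : r ≠ 0 := hr0
    simp only [hr0, if_false, Function.comp]
    set a := |r⁻¹ - m| with ha_def
    have ha0 : 0 < a := by linarith
    have hpos : a ^ p ≤ (a + l) ^ p := Real.rpow_le_rpow ha0.le (by linarith) hp.1
    rw [Real.norm_of_nonneg (by linarith)]
    have e1 : (a + l) ^ p = a ^ p * (1 + l / a) ^ p := by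
      rw [← Real.mul_rpow ha0.le (by positivity)]
      congr 1
      field_simp
    have e2 : (1 + l / a) ^ p ≤ 1 + p * (l / a) :=
      rpow_one_add_le_one_add_mul_self (by linarith [div_pos hl ha0]) hp.1
        (by linarith [hp.2])
    have e3 : a ^ p ≤ a ^ (1 / 2 : ℝ) := Real.rpow_le_rpow_of_exponent_le hr1 hp.2
    have e4 : a ^ (-(1 / 2) : ℝ) = a ^ (1 / 2 : ℝ) / a := by
      rw [← Real.rpow_sub_one ha0.ne']; norm_num
    have e5 : 0 ≤ a ^ p := by positivity
    calc (a + l) ^ p - a ^ p ≤ a ^ p * (1 + p * (l / a)) - a ^ p := by rw [e1]; gcongr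
      _ = p * a ^ p * (l / a) := by ring
      _ ≤ 1 * a ^ (1 / 2 : ℝ) * (l / a) := by
          have := hp.1
          have := hp.2
          gcongr
          linarith
      _ = _ := by rw [e4]; ring
  · have h1 : ContinuousAt (fun r : ℝ => |r⁻¹ - m|) r :=
      ((continuousAt_inv₀ hr).sub continuousAt_const).abs
    have h2 : ContinuousAt (fun r : ℝ => (|r⁻¹ - m| + l) ^ p - |r⁻¹ - m| ^ p) r :=
      ((h1.add continuousAt_const).rpow_const (Or.inr hp.1)).sub (h1.rpow_const (Or.inr hp.1))
    refine h2.congr ?_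
    filter_upwards [isOpen_ne.mem_nhds hr] with t ht
    exact (if_neg ht).symm

/-- A vector of the domain of `|H|^{s/2}` lies in the form domain of any `N⁻ˢ` such that
`(|H| + l)⁻¹ ≤ C N`. -/
theorem exists_rpow_half_eq_of_abs_pow (hR : 0 ≤ R) (hinj : Function.Injective R) (hl : 0 < l)
    {N : E →L[ℂ] E} (hN : 0 ≤ N) (hNinj : Function.Injective (N ^ (s / 2)))
    (hC : 1 ≤ C) (hSN : cfc (fun r : ℝ => r / (|1 - m * r| + l * r)) R ≤ C • N)
    (hs : s ∈ Set.Icc (0 : ℝ) 1) {u g : E}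
    (hug : cfc (fun r : ℝ => r * |r⁻¹ - m| ^ (s / 2)) R u = R g) :
    ∃ x, (N ^ (s / 2)) x = u ∧ ‖x‖ ≤ C * (‖g‖ + l ^ (s / 2) * ‖u‖) := by
  have hRs : IsSelfAdjoint R := hR.isSelfAdjoint
  have hp : s / 2 ∈ Set.Icc (0 : ℝ) (1 / 2) := ⟨by linarith [hs.1], by linarith [hs.2]⟩
  have hspec : spectrum ℝ R ⊆ Set.Ici 0 := fun r hr => nonneg_of_mem_spectrum hR hr
  set S := cfc (fun r : ℝ => r / (|1 - m * r| + l * r)) R with hS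
  have cS : ContinuousOn (fun r : ℝ => r / (|1 - m * r| + l * r)) (spectrum ℝ R) :=
    (continuousOn_regularized m hl).mono hspec
  have hS0 : 0 ≤ S := cfc_nonneg fun r hr => by
    have := nonneg_of_mem_spectrum hR hr
    positivity
  set θ : ℝ → ℝ := fun r => if r = 0 then 0 else (|r⁻¹ - m| + l) ^ (s / 2) - |r⁻¹ - m| ^ (s / 2)
    with hθ
  have cθ : Continuous θ := continuous_rpow_increment m hl hp
  have cψ := continuous_mul_abs_inv_sub_rpow m hp.1 (by linarith [hp.2])
  have cpow : Continuous fun r : ℝ => r ^ (s / 2) := Real.continuous_rpow_const hp.1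
  have hθn : ‖cfc θ R‖ ≤ l ^ (s / 2) := by
    refine norm_cfc_le (by positivity) fun r _ => ?_
    simp only [hθ]
    split_ifs with h0
    · rw [norm_zero]; positivity
    · have h1 := rpow_add_sub_rpow_le (abs_nonneg (r⁻¹ - m)) hl ⟨hp.1, by linarith [hp.2]⟩
      have h2 : |r⁻¹ - m| ^ (s / 2) ≤ (|r⁻¹ - m| + l) ^ (s / 2) :=
        Real.rpow_le_rpow (abs_nonneg _) (by linarith) hp.1
      rwa [Real.norm_of_nonneg (by linarith)]
  -- This is `(|H| + l)^{s/2} u`, written as `|H|^{s/2} u` plus the bounded increment applied to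
  -- `u`.
  set z := g + cfc θ R u with hz
  have hzn : ‖z‖ ≤ ‖g‖ + l ^ (s / 2) * ‖u‖ := by
    refine (norm_add_le _ _).trans ?_
    gcongr
    exact (ContinuousLinearMap.le_opNorm _ _).trans (by gcongr)
  have hSpow : S ^ (s / 2) = cfc (fun r : ℝ => (r / (|1 - m * r| + l * r)) ^ (s / 2)) R := by
    rw [CFC.rpow_eq_cfc_real hS0, hS, ← cfc_comp' (fun r : ℝ => r ^ (s / 2)) _ R
      cpow.continuousOn cS]
  have cSp : ContinuousOn (fun r : ℝ => (r / (|1 - m * r| + l * r)) ^ (s / 2)) (spectrum ℝ R) :=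
    cpow.comp_continuousOn cS
  have hSz : (S ^ (s / 2)) z = u := by
    apply hinj
    have e1 : R ((S ^ (s / 2)) z) = (S ^ (s / 2)) (R z) := by
      rw [← mul_apply_eq_comp, ← mul_apply_eq_comp, hSpow, ((Commute.refl R).cfc_real _).eq]
    have e2 : R z = cfc (fun r : ℝ => r * |r⁻¹ - m| ^ (s / 2) + r * θ r) R u := by
      have cr : ContinuousOn (fun r : ℝ => r * θ r) (spectrum ℝ R) := by fun_prop
      rw [hz, map_add, ← hug, cfc_add R _ _ cψ.continuousOn cr, add_apply,
        cfc_mul (fun r : ℝ => r) θ R (by fun_prop) cθ.continuousOn, cfc_id' ℝ R,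
        mul_apply_eq_comp]
    rw [e1, e2, hSpow, continuousOn_cfc_apply_comp cSp (by fun_prop)]
    conv_rhs => rw [← cfc_id' ℝ R]
    congr 1
    refine cfc_congr fun r hr => ?_
    have hr0 := nonneg_of_mem_spectrum hR hr
    rcases hr0.eq_or_lt with rfl | hr'
    · simp
    have ha : 0 < |r⁻¹ - m| + l := by positivity
    simp only [hθ, if_neg hr'.ne', regularized_eq hr']
    rw [Real.inv_rpow ha.le, ← mul_add, add_sub_cancel, mul_comm r, ← mul_assoc,
      inv_mul_cancel₀ (by positivity), one_mul]
  -- As `u = S^{s/2} z`, pairing with `y` and applying Heinz to `S ≤ C N` dominates `⟪u, y⟫` by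
  -- `‖N^{s/2} y‖`.
  obtain ⟨x, hx, hxn⟩ := exists_apply_eq_of_inner_le
    (CFC.rpow_nonneg (a := N) (y := s / 2)).isSelfAdjoint hNinj
    (x := u) (C := C * ‖z‖) (by positivity) fun y => by
      rw [← hSz, inner_apply_left_of_isSelfAdjoint (CFC.rpow_nonneg (a := S)).isSelfAdjoint]
      refine (norm_inner_le_norm _ _).trans ?_
      have := norm_rpow_half_le hS0 hN hC hSN hs y
      calc _ ≤ ‖z‖ * (C * ‖(N ^ (s / 2)) y‖) := by gcongr
        _ = _ := by ring
  exact ⟨x, hx, hxn.trans (by gcongr)⟩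

/-- If `H` has no spectrum in `(-l₀, 0)`, then `(|H| + l)⁻¹ ≤ (H + l)⁻¹ + C (H + m)⁻¹`. -/
theorem cfc_regularized_le (hR : 0 ≤ R) (hm : 0 < m) {l₀ : ℝ} (hl : 0 < l) (hl₀ : l ≤ l₀ / 2)
    (hgap : ∀ t, 0 < t → t < l₀ → ∀ r ∈ spectrum ℝ R, 1 - (m - t) * r ≠ 0) :
    cfc (fun r : ℝ => r / (|1 - m * r| + l * r)) R
      ≤ cfc (fun r : ℝ => r / (1 - (m - l) * r)) R + (3 * m / l₀) • R := by
  have hRs : IsSelfAdjoint R := hR.isSelfAdjoint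
  have hl₀' : 0 < l₀ := by linarith
  have hspec : spectrum ℝ R ⊆ Set.Ici 0 := fun r hr => nonneg_of_mem_spectrum hR hr
  have cS : ContinuousOn (fun r : ℝ => r / (|1 - m * r| + l * r)) (spectrum ℝ R) :=
    (continuousOn_regularized m hl).mono hspec
  have c1 : ContinuousOn (fun r : ℝ => r / (1 - (m - l) * r)) (spectrum ℝ R) :=
    continuousOn_id.div (by fun_prop) (hgap l hl (by linarith))
  have e : cfc (fun r : ℝ => r / (1 - (m - l) * r)) R + (3 * m / l₀) • R
      = cfc (fun r : ℝ => r / (1 - (m - l) * r) + 3 * m / l₀ * r) R := by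
    rw [cfc_add R _ _ c1 (by fun_prop), cfc_const_mul_id _ R]
  rw [e]
  refine cfc_mono (fun r hr => ?_) cS (c1.add (by fun_prop))
  rcases (nonneg_of_mem_spectrum hR hr).eq_or_lt with rfl | hr'
  · simp
  rw [regularized_eq hr']
  set e := r⁻¹ - m with he
  have h1 : r / (1 - (m - l) * r) = (e + l)⁻¹ := by
    have : 1 - (m - l) * r = r * (e + l) := by rw [he]; field_simp; ring
    rw [this, ← div_div, div_self hr'.ne', one_div]
  rw [h1]
  -- Here `e` is the spectral value of `H`. On `e ≥ 0` the two inverses agree. A negative `e`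
  -- satisfies `e ≤ -l₀` by the gap, so they differ by at most `3 / l₀`, and `r ≥ 1 / m` lets `(3 m
  -- / l₀) r` absorb this.
  rcases le_or_gt 0 e with he0 | he0
  · rw [abs_of_nonneg he0]
    have : 0 ≤ 3 * m / l₀ * r := by positivity
    linarith
  · have he1 : e ≤ -l₀ := by
      by_contra hlt
      refine hgap (-e) (by linarith) (by linarith) r hr ?_
      rw [he]; field_simp; ring
    have hrm : m⁻¹ ≤ r := by
      rw [inv_le_comm₀ hm hr']
      linarith
    have h2 : -(2 / l₀) ≤ (e + l)⁻¹ := by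
      have h : (-(e + l))⁻¹ ≤ 2 / l₀ := by
        rw [show 2 / l₀ = (l₀ / 2)⁻¹ by field_simp]
        exact inv_anti₀ (by linarith) (by linarith)
      rw [inv_neg] at h
      linarith
    have h3 : (|e| + l)⁻¹ ≤ 1 / l₀ := by
      rw [one_div]
      refine inv_anti₀ hl₀' ?_
      rw [abs_of_neg he0]; linarith
    have h4 : 3 / l₀ ≤ 3 * m / l₀ * r := by
      calc 3 / l₀ = 3 * m / l₀ * m⁻¹ := by field_simp
        _ ≤ _ := by gcongr
    have h5 : 3 / l₀ = 1 / l₀ + 2 / l₀ := by ring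
    linarith

end Regularized

end Spectral

/-! ### Integrability of the potential and the logarithmic singularity. -/

section Potential

theorem exists_two_pow_mul_le {R x : ℝ} (hR : 0 < R) (hx : R ≤ x) :
    ∃ j : ℕ, 2 ^ j * R ≤ x ∧ x ≤ 2 * (2 ^ j * R) := by
  obtain ⟨j, h1, h2⟩ := exists_nat_pow_near ((one_le_div₀ hR).2 hx) one_lt_two
  refine ⟨j, (le_div_iff₀ hR).1 h1, ?_⟩
  have := ((div_lt_iff₀ hR).1 h2).le
  rw [pow_succ] at this
  linarith

/-- A potential which is locally in `L^q`, with the decay condition on dyadic annuli, lies in some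
`L^r` with `1 < r < ∞`. -/
theorem exists_lintegral_rpow_lt_top {V : Plane → ℝ} (hV : Integrable V) {q : ℝ≥0∞} (hq : 1 < q)
    (hloc : ∀ K : Set Plane, IsCompact K → MemLp V q (volume.restrict K))
    (htail : Tendsto (fun R : ℝ => ENNReal.ofReal (R ^ (1 - (q⁻¹).toReal)) *
      eLpNorm V q (volume.restrict {x | R ≤ ‖x‖ ∧ ‖x‖ ≤ 2 * R})) atTop (𝓝 0)) :
    ∃ r : ℝ, 1 < r ∧ ∫⁻ x, ‖V x‖ₑ ^ r < ⊤ := by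
  obtain ⟨R, hR1, hR⟩ : ∃ R : ℝ, 1 ≤ R ∧ ∀ R' ≥ R, ENNReal.ofReal (R' ^ (1 - (q⁻¹).toReal)) *
      eLpNorm V q (volume.restrict {x | R' ≤ ‖x‖ ∧ ‖x‖ ≤ 2 * R'}) ≤ 1 := by
    obtain ⟨R, hR⟩ := eventually_atTop.1 (htail.eventually_le_const zero_lt_one)
    exact ⟨max R 1, le_max_right _ _, fun R' hR' => hR R' ((le_max_left _ _).trans hR')⟩
  have hR0 : 0 < R := by linarith
  set A : ℕ → Set Plane := fun j => {x | 2 ^ j * R ≤ ‖x‖ ∧ ‖x‖ ≤ 2 * (2 ^ j * R)} with hA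
  have hcover : (Set.univ : Set Plane) ⊆ Metric.closedBall 0 R ∪ ⋃ j, A j := by
    intro x _
    rcases le_total ‖x‖ R with h | h
    · left; simpa using h
    · right
      obtain ⟨j, hj⟩ := exists_two_pow_mul_le hR0 h
      exact Set.mem_iUnion.2 ⟨j, hj⟩
  have hpow : ∀ j : ℕ, (1 : ℝ) ≤ 2 ^ j := fun j => one_le_pow₀ one_le_two
  have hRj : ∀ j : ℕ, R ≤ 2 ^ j * R := fun j => by nlinarith [hpow j]
  have hball := hloc _ (isCompact_closedBall (0 : Plane) R)
  have hmA : ∀ j, MeasurableSet (A j) := fun j =>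
    (measurableSet_le measurable_const measurable_norm).inter
      (measurableSet_le measurable_norm measurable_const)
  rcases eq_or_ne q ⊤ with rfl | hqt
  -- For `q = ∞` the condition reads `R ‖V‖_∞ ≤ 1` on far annuli with `R ≥ 1`, so `V` is bounded;
  -- together with `V ∈ L¹` this gives `V ∈ L²`.
  · refine ⟨2, by norm_num, ?_⟩
    set M := eLpNorm V ⊤ (volume.restrict (Metric.closedBall (0 : Plane) R)) with hM
    have hae : ∀ᵐ x, ‖V x‖ₑ ≤ M + 1 := by
      have h1 : ∀ᵐ x ∂volume.restrict (Metric.closedBall (0 : Plane) R), ‖V x‖ₑ ≤ M := by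
        rw [hM, eLpNorm_exponent_top]; exact ae_le_eLpNormEssSup
      have h2 : ∀ j, ∀ᵐ x ∂volume.restrict (A j), ‖V x‖ₑ ≤ 1 := by
        intro j
        have hj := hR _ (hRj j)
        have h3 : eLpNorm V ⊤ (volume.restrict (A j)) ≤ 1 := by
          refine le_trans ?_ hj
          refine le_mul_of_one_le_left zero_le ?_
          simp only [ENNReal.inv_top, ENNReal.toReal_zero, sub_zero, Real.rpow_one]
          rw [ENNReal.one_le_ofReal]
          exact hR1.trans (hRj j)
        have h4 : ∀ᵐ x ∂volume.restrict (A j), ‖V x‖ₑ ≤ eLpNorm V ⊤ (volume.restrict (A j)) := by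
          rw [eLpNorm_exponent_top]; exact ae_le_eLpNormEssSup
        filter_upwards [h4] with x hx using hx.trans h3
      rw [ae_restrict_iff' Metric.isClosed_closedBall.measurableSet] at h1
      have h2' : ∀ᵐ x, ∀ j, x ∈ A j → ‖V x‖ₑ ≤ 1 :=
        ae_all_iff.2 fun j => (ae_restrict_iff' (hmA j)).1 (h2 j)
      filter_upwards [h1, h2'] with x hx1 hx2
      rcases hcover (Set.mem_univ x) with h | h
      · exact (hx1 h).trans le_self_add
      · obtain ⟨j, hj⟩ := Set.mem_iUnion.1 h
        exact (hx2 j hj).trans le_add_self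
    have hMt : M + 1 ≠ ⊤ := ENNReal.add_ne_top.2 ⟨hball.2.ne, ENNReal.one_ne_top⟩
    calc ∫⁻ x, ‖V x‖ₑ ^ (2 : ℝ) ≤ ∫⁻ x, (M + 1) * ‖V x‖ₑ := by
          refine lintegral_mono_ae ?_
          filter_upwards [hae] with x hx
          rw [ENNReal.rpow_two, pow_two]
          gcongr
      _ = (M + 1) * ∫⁻ x, ‖V x‖ₑ := by rw [lintegral_const_mul' _ _ hMt]
      _ < ⊤ := ENNReal.mul_lt_top hMt.lt_top hV.2
  · set r := q.toReal with hr
    have hr1 : 1 < r := by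
      rw [hr, ← ENNReal.toReal_one]
      exact (ENNReal.toReal_lt_toReal ENNReal.one_ne_top hqt).2 hq
    have hr0 : 0 < r := by linarith
    have hq0 : q ≠ 0 := (zero_lt_one.trans hq).ne'
    have hnorm : ∀ μ : Measure Plane, ∫⁻ x, ‖V x‖ₑ ^ r ∂μ = eLpNorm V q μ ^ r := by
      intro μ
      rw [eLpNorm_eq_lintegral_rpow_enorm_toReal hq0 hqt, ← ENNReal.rpow_mul, ← hr,
        one_div_mul_cancel hr0.ne', ENNReal.rpow_one]
    refine ⟨r, hr1, ?_⟩
    -- Take `r = q`. The decay condition bounds the integral over the `j`-th annulus by `(2^j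
    -- R)^{-(r-1)}`, a geometric sequence since `r > 1`.
    have hAj : ∀ j, ∫⁻ x in A j, ‖V x‖ₑ ^ r
        ≤ ENNReal.ofReal (2 ^ (-(r - 1))) ^ j := by
      intro j
      have hx0 : 0 < 2 ^ j * R := by positivity
      have hj := hR _ (hRj j)
      rw [hnorm]
      have hexp : 1 - (q⁻¹).toReal = (r - 1) / r := by
        rw [ENNReal.toReal_inv, ← hr]; field_simp
      rw [hexp, ENNReal.mul_le_iff_le_inv
        (by simpa using Real.rpow_pos_of_pos hx0 _) (by simp), mul_one] at hj
      calc eLpNorm V q (volume.restrict (A j)) ^ r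
          ≤ ((ENNReal.ofReal ((2 ^ j * R) ^ ((r - 1) / r)))⁻¹) ^ r := by gcongr
        _ = ENNReal.ofReal ((2 ^ j * R) ^ (-(r - 1))) := by
          rw [ENNReal.inv_rpow, ENNReal.ofReal_rpow_of_nonneg (by positivity) hr0.le,
            ← Real.rpow_mul hx0.le, div_mul_cancel₀ _ hr0.ne', Real.rpow_neg hx0.le,
            ENNReal.ofReal_inv_of_pos (by positivity)]
        _ ≤ ENNReal.ofReal ((2 ^ j) ^ (-(r - 1))) := by
          refine ENNReal.ofReal_le_ofReal ?_
          exact Real.rpow_le_rpow_of_nonpos (by positivity) (by nlinarith [hpow j]) (by linarith)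
        _ = _ := by
          rw [← ENNReal.ofReal_pow (by positivity), ← Real.rpow_natCast, ← Real.rpow_natCast,
            ← Real.rpow_mul (by norm_num), ← Real.rpow_mul (by norm_num), mul_comm]
    have hgeo : ∑' j, ENNReal.ofReal (2 ^ (-(r - 1))) ^ j < ⊤ := by
      rw [ENNReal.tsum_geometric, ENNReal.inv_lt_top, tsub_pos_iff_lt, ENNReal.ofReal_lt_one]
      exact Real.rpow_lt_one_of_one_lt_of_neg one_lt_two (by linarith)
    calc ∫⁻ x, ‖V x‖ₑ ^ r
        ≤ ∫⁻ x in Metric.closedBall 0 R ∪ ⋃ j, A j, ‖V x‖ₑ ^ r := by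
          rw [← setLIntegral_univ]
          exact lintegral_mono_set hcover
      _ ≤ (∫⁻ x in Metric.closedBall 0 R, ‖V x‖ₑ ^ r) + ∫⁻ x in ⋃ j, A j, ‖V x‖ₑ ^ r :=
          lintegral_union_le _ _ _
      _ ≤ (∫⁻ x in Metric.closedBall 0 R, ‖V x‖ₑ ^ r) + ∑' j, ∫⁻ x in A j, ‖V x‖ₑ ^ r := by
          gcongr
          exact lintegral_iUnion_le _ _
      _ ≤ (∫⁻ x in Metric.closedBall 0 R, ‖V x‖ₑ ^ r)
          + ∑' j, ENNReal.ofReal (2 ^ (-(r - 1))) ^ j := by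
          gcongr with j
          exact hAj j
      _ < ⊤ := by
          refine ENNReal.add_lt_top.2 ⟨?_, hgeo⟩
          rw [hnorm]
          exact ENNReal.rpow_lt_top_of_nonneg hr0.le hball.2.ne

/-- The negative part of the logarithm of the norm. -/
def negLog (z : Plane) : ℝ≥0∞ := ENNReal.ofReal (Real.posLog ‖z‖⁻¹)

@[fun_prop]
theorem measurable_negLog : Measurable negLog := by
  unfold negLog
  fun_prop

theorem negLog_neg (z : Plane) : negLog (-z) = negLog z := by simp [negLog]

theorem negLog_sub_comm (x y : Plane) : negLog (x - y) = negLog (y - x) := by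
  rw [← negLog_neg, neg_sub]

theorem integrableOn_ball_norm_rpow {a : ℝ} (ha : -2 < a) :
    IntegrableOn (fun x : Plane => ‖x‖ ^ a) (Metric.ball 0 1) := by
  rw [integrableOn_fun_norm_addHaar volume (f := fun y => y ^ a)]
  have h2 : Module.finrank ℝ Plane = 2 := by simp
  rw [h2, integrableOn_congr_fun (g := fun y : ℝ => y ^ (a + 1)) _ measurableSet_Ioo,
    intervalIntegral.integrableOn_Ioo_rpow_iff one_pos]
  · linarith
  · intro y hy
    have : 0 < y := hy.1
    simp [Real.rpow_add_one this.ne', mul_comm]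

theorem posLog_inv_le {x t : ℝ} (hx : 0 < x) (hx1 : x < 1) (ht : 0 < t) :
    Real.posLog x⁻¹ ≤ t⁻¹ * x ^ (-t) := by
  have h1 := Real.abs_log_mul_self_rpow_lt x t hx hx1.le ht
  have hlog : Real.log x < 0 := Real.log_neg hx hx1
  rw [Real.posLog_apply, Real.log_inv, max_eq_right (by linarith)]
  have hxt : 0 < x ^ t := Real.rpow_pos_of_pos hx t
  rw [abs_mul, abs_of_neg hlog, abs_of_pos hxt, one_div] at h1
  rw [Real.rpow_neg hx.le, ← div_eq_mul_inv, le_div_iff₀ hxt]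
  exact h1.le

/-- Bounding the logarithm by the power `-1/a` of `|z|` turns its `a`-th power into a multiple of
`|z|⁻¹`, which is integrable on the unit disc. -/
theorem lintegral_negLog_rpow_lt_top {a : ℝ} (ha : 0 < a) : ∫⁻ z, negLog z ^ a < ⊤ := by
  have hb : ∀ z, negLog z ^ a ≤ (Metric.ball (0 : Plane) 1).indicator
      (fun z => ENNReal.ofReal (((a⁻¹)⁻¹) ^ a * ‖z‖ ^ (-1 : ℝ))) z := by
    intro z
    rcases eq_or_ne z 0 with rfl | hz
    · simp [negLog, ha]
    have hz' : 0 < ‖z‖ := norm_pos_iff.2 hz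
    rcases lt_or_ge ‖z‖ 1 with h | h
    · rw [Set.indicator_of_mem (by simpa using h), negLog,
        ENNReal.ofReal_rpow_of_nonneg Real.posLog_nonneg ha.le]
      refine ENNReal.ofReal_le_ofReal ?_
      calc Real.posLog ‖z‖⁻¹ ^ a ≤ ((a⁻¹)⁻¹ * ‖z‖ ^ (-a⁻¹)) ^ a :=
            Real.rpow_le_rpow Real.posLog_nonneg (posLog_inv_le hz' h (by positivity)) ha.le
        _ = _ := by
            rw [Real.mul_rpow (by positivity) (by positivity), ← Real.rpow_mul hz'.le]
            congr 2
            field_simp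
    · have : Real.posLog ‖z‖⁻¹ = 0 := by
        rw [Real.posLog_eq_zero_iff, abs_of_nonneg (by positivity)]
        exact inv_le_one_of_one_le₀ h
      simp [negLog, this, ha]
  refine (lintegral_mono hb).trans_lt ?_
  rw [lintegral_indicator Metric.isOpen_ball.measurableSet]
  have := (integrableOn_ball_norm_rpow (a := -1) (by norm_num)).const_mul (((a⁻¹)⁻¹) ^ a)
  refine lt_of_le_of_lt (lintegral_mono fun z => ?_) this.2
  exact Real.ofReal_le_enorm _

/-- Convolution of a function in `L^r` with a power of the logarithmic singularity. -/
theorem exists_lintegral_mul_negLog_le {r a : ℝ} (hr : 1 < r) (ha : 0 < a) :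
    ∃ A : ℝ≥0∞, A ≠ ⊤ ∧ ∀ F : Plane → ℝ≥0∞, AEMeasurable F → ∀ y,
      ∫⁻ x, F x * negLog (x - y) ^ a ≤ (∫⁻ x, F x ^ r) ^ (1 / r) * A := by
  have hrr := Real.HolderConjugate.conjExponent hr
  set r' := r.conjExponent
  have hr' : 0 < r' := hrr.symm.pos
  refine ⟨(∫⁻ z, negLog z ^ (a * r')) ^ (1 / r'), ?_, fun F hF y => ?_⟩
  · exact (ENNReal.rpow_lt_top_of_nonneg (by positivity)
      (lintegral_negLog_rpow_lt_top (by positivity)).ne).ne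
  · have hm : Measurable fun x => negLog (x - y) ^ a := by fun_prop
    refine (ENNReal.lintegral_mul_le_Lp_mul_Lq volume hrr hF hm.aemeasurable).trans ?_
    gcongr 2
    simp_rw [← ENNReal.rpow_mul]
    exact (lintegral_sub_right_eq_self (fun z => negLog z ^ (a * r')) y).le

theorem exists_lintegral_tail_rpow_le {F : Plane → ℝ≥0∞} (hF : AEMeasurable F)
    {r : ℝ} (hfin : ∫⁻ x, F x ^ r < ⊤) {ε : ℝ≥0∞} (hε : 0 < ε) :
    ∃ R : ℝ, ∫⁻ x in {x | R ≤ ‖x‖}, F x ^ r ≤ ε := by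
  have hlim : Tendsto (fun n : ℕ => ∫⁻ x, {x : Plane | (n : ℝ) ≤ ‖x‖}.indicator (fun x => F x ^ r) x)
      atTop (𝓝 (∫⁻ _ : Plane, 0)) := by
    refine tendsto_lintegral_of_dominated_convergence' (fun x => F x ^ r) (fun n => ?_) (fun n => ?_)
      hfin.ne ?_
    · exact (hF.pow_const r).indicator (measurableSet_le measurable_const measurable_norm)
    · exact Eventually.of_forall fun x => Set.indicator_le_self _ _ x
    · refine Eventually.of_forall fun x => tendsto_const_nhds.congr' ?_
      obtain ⟨N, hN⟩ := exists_nat_gt ‖x‖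
      filter_upwards [eventually_ge_atTop N] with n hn
      rw [Set.indicator_of_notMem]
      simp only [Set.mem_ofPred_eq, not_le]
      exact hN.trans_le (by exact_mod_cast hn)
  rw [lintegral_zero] at hlim
  obtain ⟨n, hn⟩ := (hlim.eventually_le_const hε).exists
  refine ⟨n, ?_⟩
  rwa [lintegral_indicator (measurableSet_le measurable_const measurable_norm)] at hn

end Potential

/-! ### A smooth radial mollifier and the matching parametrix of `-Δ`. -/

section RadialKernel

/-- A smooth function on the line which agrees with the logarithm on `[1, ∞)`. -/
def cutLog (s : ℝ) : ℝ := Real.smoothTransition (2 * s - 1) * Real.log s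

theorem cutLog_of_one_le {s : ℝ} (hs : 1 ≤ s) : cutLog s = Real.log s := by
  rw [cutLog, Real.smoothTransition.one_of_one_le (by linarith), one_mul]

theorem contDiff_cutLog : ContDiff ℝ ∞ cutLog := by
  rw [contDiff_iff_contDiffAt]
  intro s
  rcases lt_or_ge s (1 / 2) with hs | hs
  · refine (contDiffAt_const (c := (0 : ℝ))).congr_of_eventuallyEq ?_
    filter_upwards [isOpen_Iio.mem_nhds hs] with t ht
    rw [cutLog, Real.smoothTransition.zero_of_nonpos (by linarith [Set.mem_Iio.1 ht]), zero_mul]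
  · have h1 : ContDiff ℝ ∞ fun s : ℝ => Real.smoothTransition (2 * s - 1) :=
      Real.smoothTransition.contDiff.comp (by fun_prop)
    exact h1.contDiffAt.mul (Real.contDiffAt_log.2 (by linarith))

theorem hasDerivAt_cutLog (s : ℝ) : HasDerivAt cutLog (deriv cutLog s) s :=
  (contDiff_cutLog.differentiable (by simp)).differentiableAt.hasDerivAt

theorem contDiff_deriv_cutLog : ContDiff ℝ ∞ (deriv cutLog) :=
  contDiff_infty_iff_deriv.1 contDiff_cutLog |>.2

theorem hasDerivAt_deriv_cutLog (s : ℝ) :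
    HasDerivAt (deriv cutLog) (deriv (deriv cutLog) s) s :=
  (contDiff_deriv_cutLog.differentiable (by simp)).differentiableAt.hasDerivAt

/-- The radial profile `(s L')'` of the Laplacian of `L (|x|²)`, up to a factor. -/
def bumpProfile (s : ℝ) : ℝ := deriv cutLog s + s * deriv (deriv cutLog) s

theorem continuous_bumpProfile : Continuous bumpProfile := by
  have h2 : Continuous (deriv (deriv cutLog)) :=
    (contDiff_infty_iff_deriv.1 contDiff_deriv_cutLog).2.continuous
  exact contDiff_deriv_cutLog.continuous.add (continuous_id.mul h2)

theorem deriv_cutLog_of_one_lt {s : ℝ} (hs : 1 < s) : deriv cutLog s = s⁻¹ := by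
  have : cutLog =ᶠ[𝓝 s] Real.log := by
    filter_upwards [isOpen_Ioi.mem_nhds hs] with t ht using cutLog_of_one_le (le_of_lt ht)
  rw [this.deriv_eq, Real.deriv_log]

theorem bumpProfile_of_one_lt {s : ℝ} (hs : 1 < s) : bumpProfile s = 0 := by
  have : deriv cutLog =ᶠ[𝓝 s] fun t => t⁻¹ := by
    filter_upwards [isOpen_Ioi.mem_nhds hs] with t ht using deriv_cutLog_of_one_lt ht
  rw [bumpProfile, this.deriv_eq, deriv_cutLog_of_one_lt hs, deriv_inv]
  field_simp
  simp

theorem exists_abs_bumpProfile_le : ∃ C : ℝ, 0 < C ∧ ∀ s, 0 ≤ s → |bumpProfile s| ≤ C := by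
  obtain ⟨C, hC⟩ := (isCompact_Icc (a := (0 : ℝ)) (b := 1)).exists_bound_of_continuousOn
    continuous_bumpProfile.continuousOn
  refine ⟨max C 1, by positivity, fun s hs => ?_⟩
  rcases le_or_gt s 1 with h | h
  · exact (hC s ⟨hs, h⟩).trans (le_max_left _ _)
  · rw [bumpProfile_of_one_lt h, abs_zero]; positivity

/-- The radial mollifier of radius `R`. -/
def mollifier (R : ℝ) (z : Plane) : ℝ := (Real.pi * R ^ 2)⁻¹ * bumpProfile (‖z‖ ^ 2 / R ^ 2)

@[fun_prop]
theorem continuous_mollifier (R : ℝ) : Continuous (mollifier R) := by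
  have := continuous_bumpProfile
  unfold mollifier
  fun_prop

theorem mollifier_eq_zero {R : ℝ} (hR : 0 < R) {z : Plane} (hz : R < ‖z‖) :
    mollifier R z = 0 := by
  rw [mollifier, bumpProfile_of_one_lt, mul_zero]
  rw [one_lt_div (by positivity)]
  gcongr

theorem exists_abs_mollifier_le :
    ∃ C : ℝ, 0 < C ∧ ∀ R, 0 < R → ∀ z, |mollifier R z| ≤ C / (Real.pi * R ^ 2) := by
  obtain ⟨C, hC, h⟩ := exists_abs_bumpProfile_le
  refine ⟨C, hC, fun R hR z => ?_⟩
  have hpos : 0 < (Real.pi * R ^ 2)⁻¹ := by positivity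
  rw [mollifier, abs_mul, abs_of_pos hpos, div_eq_inv_mul C]
  exact mul_le_mul_of_nonneg_left (h _ (by positivity)) hpos.le

theorem integral_mollifier {R : ℝ} (hR : 0 < R) : ∫ z, mollifier R z = 1 := by
  have h2 : Module.finrank ℝ Plane = 2 := by simp
  have hvol : (volume : Measure Plane).real (Metric.ball 0 1) = Real.pi := by
    simp [Measure.real, EuclideanSpace.volume_ball_fin_two, Real.pi_pos.le]
  have e := integral_fun_norm_addHaar (volume : Measure Plane)
    (fun r : ℝ => (Real.pi * R ^ 2)⁻¹ * bumpProfile (r ^ 2 / R ^ 2))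
  have e' : ∫ z, mollifier R z =
      ∫ z : Plane, (Real.pi * R ^ 2)⁻¹ * bumpProfile (‖z‖ ^ 2 / R ^ 2) := rfl
  rw [e', e, h2, hvol]
  -- The primitive of `r` times the profile is the flux `s L'(s) / (2π)` with `s = r²/R²` and `L =
  -- cutLog`. It vanishes at `0` and is constant for `s > 1`, where `L = log`.
  set G : ℝ → ℝ := fun r => 1 / (2 * Real.pi) * (r ^ 2 / R ^ 2 * deriv cutLog (r ^ 2 / R ^ 2)) with hG
  have hder : ∀ r ∈ Set.Ici (0 : ℝ), HasDerivAt G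
      (r ^ (2 - 1) • ((Real.pi * R ^ 2)⁻¹ * bumpProfile (r ^ 2 / R ^ 2))) r := by
    intro r _
    have hs : HasDerivAt (fun r : ℝ => r ^ 2 / R ^ 2) (2 * r / R ^ 2) r := by
      simpa using (hasDerivAt_pow 2 r).div_const (R ^ 2)
    have hd := (hasDerivAt_deriv_cutLog (r ^ 2 / R ^ 2)).comp r hs
    refine ((hs.mul hd).const_mul (1 / (2 * Real.pi))).congr_deriv ?_
    simp only [bumpProfile, smul_eq_mul, Function.comp]
    field_simp
    ring
  have hlim : Tendsto G atTop (𝓝 (1 / (2 * Real.pi))) := by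
    refine tendsto_const_nhds.congr' ?_
    filter_upwards [eventually_gt_atTop R] with r hr
    have hr0 : 0 < r := hR.trans hr
    have : 1 < r ^ 2 / R ^ 2 := by
      rw [one_lt_div (by positivity)]; gcongr
    simp only [hG]
    rw [deriv_cutLog_of_one_lt this, mul_inv_cancel₀ (by positivity), mul_one]
  have hint : IntegrableOn
      (fun r : ℝ => r ^ (2 - 1) • ((Real.pi * R ^ 2)⁻¹ * bumpProfile (r ^ 2 / R ^ 2)))
      (Set.Ioi 0) := by
    apply Integrable.integrableOn
    refine Continuous.integrable_of_hasCompactSupport ?_ ?_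
    · have := continuous_bumpProfile
      fun_prop
    · refine HasCompactSupport.intro (isCompact_Icc (a := -R) (b := R)) fun r hr => ?_
      have : R < |r| := by
        by_contra h
        exact hr (abs_le.1 (not_lt.1 h))
      rw [bumpProfile_of_one_lt]
      · simp
      · rw [one_lt_div (by positivity), ← sq_abs r]
        gcongr
  have h0 : G 0 = 0 := by simp [hG]
  have := integral_Ioi_of_hasDerivAt_of_tendsto' hder hint hlim
  rw [this, h0]
  have hpi := Real.pi_pos
  simp only [smul_eq_mul, nsmul_eq_mul]
  field_simp
  norm_num

/-- A compactly supported parametrix for the Laplacian. -/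
def parametrix (R : ℝ) (z : Plane) : ℝ :=
  1 / (4 * Real.pi) * (cutLog (‖z‖ ^ 2 / R ^ 2) - Real.log (‖z‖ ^ 2 / R ^ 2))

@[fun_prop]
theorem measurable_parametrix (R : ℝ) : Measurable (parametrix R) := by
  have := contDiff_cutLog.continuous
  have : Measurable cutLog := this.measurable
  unfold parametrix
  fun_prop

theorem parametrix_eq_zero {R : ℝ} (hR : 0 < R) {z : Plane} (hz : R ≤ ‖z‖) :
    parametrix R z = 0 := by
  rw [parametrix, cutLog_of_one_le, sub_self, mul_zero]
  rw [one_le_div (by positivity)]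
  gcongr

/-- Inside the disc the parametrix is `(1 - c) log(R/|z|) / (2π)` with the cutoff value `0 ≤ c ≤ 1`;
outside it vanishes. At `z = 0` both sides are `0` by the convention `log 0 = 0`. -/
theorem abs_parametrix_le {R : ℝ} (hR : 0 < R) (z : Plane) :
    |parametrix R z| ≤ 1 / (2 * Real.pi) * Real.posLog ‖R⁻¹ • z‖⁻¹ := by
  rcases le_or_gt R ‖z‖ with h | h
  · rw [parametrix_eq_zero hR h, abs_zero]
    have := Real.pi_pos
    have := Real.posLog_nonneg (x := ‖R⁻¹ • z‖⁻¹)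
    positivity
  rcases eq_or_ne z 0 with rfl | hz
  · simp [parametrix, cutLog]
  have hz' : 0 < ‖z‖ := norm_pos_iff.2 hz
  have hn : ‖R⁻¹ • z‖ = ‖z‖ / R := by
    rw [norm_smul, norm_inv, Real.norm_of_nonneg hR.le, inv_mul_eq_div]
  have h1 : ‖z‖ / R < 1 := (div_lt_one hR).2 h
  have hlog : Real.log (‖z‖ / R) < 0 := Real.log_neg (by positivity) h1
  rw [hn, Real.posLog_apply, Real.log_inv, max_eq_right (by linarith), parametrix, cutLog,
    ← div_pow, Real.log_pow]
  set c := Real.smoothTransition (2 * (‖z‖ / R) ^ 2 - 1)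
  have hc0 : 0 ≤ c := Real.smoothTransition.nonneg _
  have hc1 : c ≤ 1 := Real.smoothTransition.le_one _
  have hpi := Real.pi_pos
  rw [show 1 / (4 * Real.pi) * (c * ((2 : ℕ) * Real.log (‖z‖ / R)) - (2 : ℕ) * Real.log (‖z‖ / R))
    = 1 / (2 * Real.pi) * ((1 - c) * -Real.log (‖z‖ / R)) by push_cast; field_simp; ring,
    abs_mul, abs_of_pos (by positivity : 0 < 1 / (2 * Real.pi))]
  gcongr
  rw [abs_mul, abs_of_nonneg (by linarith), abs_of_pos (by linarith)]
  nlinarith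

theorem enorm_parametrix_le {R : ℝ} (hR : 0 < R) (z : Plane) :
    ‖(parametrix R z : ℂ)‖ₑ ≤ negLog (R⁻¹ • z) := by
  rw [← ofReal_norm, Complex.norm_real, negLog]
  refine ENNReal.ofReal_le_ofReal ((abs_parametrix_le hR z).trans ?_)
  have h1 : 1 / (2 * Real.pi) ≤ 1 := by
    rw [div_le_one (by positivity)]; linarith [Real.pi_gt_three]
  nlinarith [Real.posLog_nonneg (x := ‖R⁻¹ • z‖⁻¹)]

/-- Used to dominate the parametrices at all scales up to `R'` by a single function. -/
theorem negLog_smul_le_of_le {R R' : ℝ} (hR : 0 < R) (h : R ≤ R') (z : Plane) :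
    negLog (R⁻¹ • z) ≤ negLog (R'⁻¹ • z) := by
  unfold negLog
  refine ENNReal.ofReal_le_ofReal (Real.posLog_le_posLog (by positivity) ?_)
  have hR' : 0 < R' := hR.trans_le h
  rw [norm_smul, norm_smul, mul_inv, mul_inv, norm_inv, norm_inv, inv_inv, inv_inv,
    Real.norm_of_nonneg hR.le, Real.norm_of_nonneg hR'.le]
  gcongr

theorem negLog_smul_eq_zero {R : ℝ} (hR : 0 < R) {z : Plane} (hz : R ≤ ‖z‖) :
    negLog (R⁻¹ • z) = 0 := by
  have : Real.posLog ‖R⁻¹ • z‖⁻¹ = 0 := by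
    rw [Real.posLog_eq_zero_iff, abs_of_nonneg (by positivity)]
    refine inv_le_one_of_one_le₀ ?_
    rw [norm_smul, norm_inv, Real.norm_of_nonneg hR.le, inv_mul_eq_div, one_le_div hR]
    exact hz
  simp [negLog, this]

theorem negLog_smul_le {R : ℝ} (hR : 0 < R) (z : Plane) :
    negLog (R⁻¹ • z) ≤ ENNReal.ofReal (Real.posLog R) + negLog z := by
  unfold negLog
  rw [← ENNReal.ofReal_add Real.posLog_nonneg Real.posLog_nonneg]
  refine ENNReal.ofReal_le_ofReal ?_
  rw [norm_smul, mul_inv, norm_inv, inv_inv, Real.norm_of_nonneg hR.le]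
  exact Real.posLog_mul

theorem lintegral_negLog_smul_lt_top {R : ℝ} (hR : 0 < R) : ∫⁻ z, negLog (R⁻¹ • z) < ⊤ := by
  calc ∫⁻ z, negLog (R⁻¹ • z)
      ≤ ∫⁻ z, (Metric.closedBall (0 : Plane) R).indicator
          (fun z => ENNReal.ofReal (Real.posLog R) + negLog z) z := by
        refine lintegral_mono fun z => ?_
        rcases le_or_gt ‖z‖ R with h | h
        · rw [Set.indicator_of_mem (by simpa using h)]
          exact negLog_smul_le hR z
        · rw [negLog_smul_eq_zero hR h.le]; exact zero_le
    _ = ∫⁻ z in Metric.closedBall (0 : Plane) R, (ENNReal.ofReal (Real.posLog R) + negLog z) :=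
        lintegral_indicator Metric.isClosed_closedBall.measurableSet _
    _ = ENNReal.ofReal (Real.posLog R) * volume (Metric.closedBall (0 : Plane) R)
          + ∫⁻ z in Metric.closedBall (0 : Plane) R, negLog z := by
        rw [lintegral_add_left measurable_const, setLIntegral_const]
    _ < ⊤ := by
        refine ENNReal.add_lt_top.2 ⟨ENNReal.mul_lt_top ENNReal.ofReal_lt_top
          measure_closedBall_lt_top, (setLIntegral_le_lintegral _ _).trans_lt ?_⟩
        simpa using lintegral_negLog_rpow_lt_top one_pos

/-- The Laplacian of a radial function in the plane. -/
theorem laplacian_radial {h : ℝ → ℝ} (hh : ContDiff ℝ ∞ h) (x y : Plane) :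
    Δ (fun y : Plane => ((h (‖y - x‖ ^ 2) : ℝ) : ℂ)) y
      = ((4 * (deriv h (‖y - x‖ ^ 2) + ‖y - x‖ ^ 2 * deriv (deriv h) (‖y - x‖ ^ 2)) : ℝ) : ℂ) := by
  have hn : ContDiff ℝ ∞ fun y : Plane => ‖y - x‖ ^ 2 :=
    (contDiff_id.sub contDiff_const).norm_sq ℝ
  have hc : ContDiff ℝ ∞ fun y : Plane => h (‖y - x‖ ^ 2) := hh.comp hn
  have e1 : Δ (fun y : Plane => ((h (‖y - x‖ ^ 2) : ℝ) : ℂ)) y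
      = ((Δ (fun y : Plane => h (‖y - x‖ ^ 2)) y : ℝ) : ℂ) := by
    have := (hc.contDiffAt (x := y)).of_le (m := 2) (by exact_mod_cast ENat.LEInfty.out)
    exact this.laplacian_CLM_comp_left (l := Complex.ofRealCLM)
  rw [e1]
  congr 1
  have hder : ∀ z : Plane, fderiv ℝ (fun y : Plane => h (‖y - x‖ ^ 2)) z
      = (2 * deriv h (‖z - x‖ ^ 2)) • innerSL ℝ (z - x) := by
    intro z
    have h1 : HasFDerivAt (fun y : Plane => ‖y - x‖ ^ 2) (2 • innerSL ℝ (z - x)) z := by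
      have := (hasStrictFDerivAt_norm_sq (z - x)).hasFDerivAt.comp z
        ((hasFDerivAt_id z).sub_const x)
      simpa [Function.comp_def] using this
    have h2 : HasDerivAt h (deriv h (‖z - x‖ ^ 2)) (‖z - x‖ ^ 2) :=
      (hh.differentiable (by simp)).differentiableAt.hasDerivAt
    have h3 : HasFDerivAt (fun y : Plane => h (‖y - x‖ ^ 2)) _ z := h2.comp_hasFDerivAt z h1
    rw [h3.fderiv]
    ext w
    simp
    ring
  have hh' : ContDiff ℝ ∞ (deriv h) := (contDiff_infty_iff_deriv.1 hh).2
  have hder2 : ∀ e : Plane, fderiv ℝ (fderiv ℝ (fun y : Plane => h (‖y - x‖ ^ 2))) y e e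
      = 4 * deriv (deriv h) (‖y - x‖ ^ 2) * ⟪y - x, e⟫_ℝ ^ 2
        + 2 * deriv h (‖y - x‖ ^ 2) * ‖e‖ ^ 2 := by
    intro e
    rw [show fderiv ℝ (fun y : Plane => h (‖y - x‖ ^ 2)) =
      fun z => (2 * deriv h (‖z - x‖ ^ 2)) • innerSL ℝ (z - x) from funext hder]
    have h1 : HasFDerivAt (fun y : Plane => ‖y - x‖ ^ 2) (2 • innerSL ℝ (y - x)) y := by
      have := (hasStrictFDerivAt_norm_sq (y - x)).hasFDerivAt.comp y
        ((hasFDerivAt_id y).sub_const x)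
      simpa [Function.comp_def] using this
    have h2 : HasDerivAt (deriv h) (deriv (deriv h) (‖y - x‖ ^ 2)) (‖y - x‖ ^ 2) :=
      (hh'.differentiable (by simp)).differentiableAt.hasDerivAt
    have h3 := (h2.comp_hasFDerivAt y h1).const_mul 2
    have h4 : HasFDerivAt (fun z : Plane => innerSL ℝ (z - x)) (innerSL ℝ) y := by
      have := (innerSL ℝ (E := Plane)).hasFDerivAt (x := y - x) |>.comp y
        ((hasFDerivAt_id y).sub_const x)
      simpa [Function.comp_def] using this
    have h5 : HasFDerivAt (fun z => (2 * deriv h (‖z - x‖ ^ 2)) • innerSL ℝ (z - x)) _ y :=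
      h3.smul h4
    rw [h5.fderiv]
    simp only [Function.comp_apply, add_apply, smul_apply, ContinuousLinearMap.smulRight_apply,
      innerSL_apply_apply, smul_eq_mul, nsmul_eq_mul, Nat.cast_ofNat]
    change 2 * deriv h (‖y - x‖ ^ 2) * ⟪e, e⟫_ℝ + _ = _
    rw [real_inner_self_eq_norm_sq]
    ring
  rw [InnerProductSpace.laplacian_eq_iteratedFDeriv_orthonormalBasis _
    (EuclideanSpace.basisFun (Fin 2) ℝ)]
  simp only [iteratedFDeriv_two_apply, Matrix.cons_val_zero, Matrix.cons_val_one]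
  simp only [hder2, Finset.sum_add_distrib, ← Finset.mul_sum]
  have hb := (EuclideanSpace.basisFun (Fin 2) ℝ).sum_sq_inner_left (y - x)
  rw [hb]
  simp
  ring

end RadialKernel

/-! ### A function recovered from its averages and its distributional Laplacian. -/

section Representation

variable {f g : Plane → ℂ}

theorem integrable_mul_of_continuous_compactSupport (hf : LocallyIntegrable f) {φ : Plane → ℂ}
    (hφ : Continuous φ) (hc : HasCompactSupport φ) : Integrable fun y => f y * φ y := by
  have := hf.integrable_smul_left_of_hasCompactSupport hφ hc
  simpa [mul_comm] using this

theorem hasCompactSupport_of_norm_sub {φ : Plane → ℂ} {x : Plane} {R : ℝ}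
    (h : ∀ y, R < ‖y - x‖ → φ y = 0) : HasCompactSupport φ := by
  refine HasCompactSupport.intro (isCompact_closedBall x R) fun y hy => h y ?_
  simpa [dist_eq_norm] using hy

theorem integrable_mul_mollifier (hf : LocallyIntegrable f) {R : ℝ} (hR : 0 < R) (x : Plane) :
    Integrable fun y => f y * (mollifier R (y - x) : ℂ) := by
  refine integrable_mul_of_continuous_compactSupport hf (by fun_prop)
    (hasCompactSupport_of_norm_sub (x := x) (R := R) fun y hy => ?_)
  rw [mollifier_eq_zero hR hy, Complex.ofReal_zero]

/-- Since `-Δ parametrix R = δ₀ - mollifier R`, the singularities cancel in the difference of two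
parametrices. What remains is smooth and compactly supported, hence an admissible test function. -/
theorem integral_mul_mollifier_sub (h : IsWeakNegLaplacian f g) {δ R : ℝ} (hδ : 0 < δ)
    (hδR : δ < R) (x : Plane) :
    (∫ y, f y * (mollifier δ (y - x) : ℂ)) - ∫ y, f y * (mollifier R (y - x) : ℂ)
      = ∫ y, g y * ((parametrix R (y - x) - parametrix δ (y - x) : ℝ) : ℂ) := by
  have hR : 0 < R := hδ.trans hδR
  -- The constant `log (R²/δ²)` is the difference of the two removed logarithms; with it `H` is
  -- smooth at `0` and vanishes for `s ≥ R²`.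
  set H : ℝ → ℝ := fun s => 1 / (4 * Real.pi) *
    (cutLog (s / R ^ 2) - cutLog (s / δ ^ 2) + Real.log (R ^ 2 / δ ^ 2)) with hH
  have hcd : ContDiff ℝ ∞ H := by
    have h1 : ∀ c : ℝ, ContDiff ℝ ∞ fun s : ℝ => cutLog (s / c) := fun c =>
      contDiff_cutLog.comp (contDiff_id.div_const c)
    exact contDiff_const.mul (((h1 _).sub (h1 _)).add contDiff_const)
  have hd1 : ∀ (c s : ℝ), HasDerivAt (fun s : ℝ => cutLog (s / c)) (c⁻¹ * deriv cutLog (s / c)) s := by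
    intro c s
    have := (hasDerivAt_cutLog (s / c)).comp s ((hasDerivAt_id s).div_const c)
    refine this.congr_deriv ?_
    rw [one_div, mul_comm]
  have hd2 : ∀ (c s : ℝ), HasDerivAt (fun s : ℝ => c⁻¹ * deriv cutLog (s / c))
      (c⁻¹ * (c⁻¹ * deriv (deriv cutLog) (s / c))) s := by
    intro c s
    have := ((hasDerivAt_deriv_cutLog (s / c)).comp s ((hasDerivAt_id s).div_const c)).const_mul c⁻¹
    refine this.congr_deriv ?_
    rw [one_div]; ring
  have hH1 : deriv H = fun s => 1 / (4 * Real.pi) *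
      ((R ^ 2)⁻¹ * deriv cutLog (s / R ^ 2) - (δ ^ 2)⁻¹ * deriv cutLog (s / δ ^ 2)) := by
    ext s
    exact ((((hd1 (R ^ 2) s).sub (hd1 (δ ^ 2) s)).add_const _).const_mul _).deriv
  have hH2 : ∀ s, deriv (deriv H) s = 1 / (4 * Real.pi) *
      ((R ^ 2)⁻¹ * ((R ^ 2)⁻¹ * deriv (deriv cutLog) (s / R ^ 2))
        - (δ ^ 2)⁻¹ * ((δ ^ 2)⁻¹ * deriv (deriv cutLog) (s / δ ^ 2))) := by
    intro s
    rw [hH1]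
    exact (((hd2 (R ^ 2) s).sub (hd2 (δ ^ 2) s)).const_mul _).deriv
  set φ : Plane → ℂ := fun y => ((H (‖y - x‖ ^ 2) : ℝ) : ℂ) with hφ
  have hφc : ContDiff ℝ ∞ φ := by
    have hn : ContDiff ℝ ∞ fun y : Plane => ‖y - x‖ ^ 2 :=
      (contDiff_id.sub contDiff_const).norm_sq ℝ
    exact Complex.ofRealCLM.contDiff.comp (hcd.comp hn)
  have hφs : HasCompactSupport φ := by
    refine hasCompactSupport_of_norm_sub (x := x) (R := R) fun y hy => ?_
    have hy0 : 0 < ‖y - x‖ := hR.trans hy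
    have h1 : 1 ≤ ‖y - x‖ ^ 2 / R ^ 2 := by rw [one_le_div (by positivity)]; gcongr
    have h2 : 1 ≤ ‖y - x‖ ^ 2 / δ ^ 2 := by
      rw [one_le_div (by positivity)]; gcongr; exact (hδR.trans hy).le
    simp only [hφ, hH]
    rw [cutLog_of_one_le h1, cutLog_of_one_le h2, Real.log_div (by positivity) (by positivity),
      Real.log_div (by positivity) (by positivity), Real.log_div (by positivity) (by positivity)]
    simp
  have hlap : ∀ y, -(Δ φ) y = ((mollifier δ (y - x) - mollifier R (y - x) : ℝ) : ℂ) := by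
    intro y
    rw [hφ, laplacian_radial hcd, ← Complex.ofReal_neg, hH2, hH1]
    congr 1
    simp only [mollifier, bumpProfile]
    have := Real.pi_pos
    field_simp
    ring
  have key := h.2.2 φ hφc hφs
  rw [← integral_sub (integrable_mul_mollifier h.1 hδ x) (integrable_mul_mollifier h.1 hR x)]
  have e1 : ∀ y, f y * (mollifier δ (y - x) : ℂ) - f y * (mollifier R (y - x) : ℂ)
      = f y * (-(Δ φ) y) := by
    intro y; rw [hlap y]; push_cast; ring
  simp_rw [e1]
  rw [key]
  refine integral_congr_ae ?_
  filter_upwards [(measure_eq_zero_iff_ae_notMem.1 (measure_singleton x))] with y hy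
  have hy' : y ≠ x := by simpa using hy
  have hyx : 0 < ‖y - x‖ := norm_pos_iff.2 (sub_ne_zero.2 hy')
  simp only [hφ, hH, parametrix]
  congr 2
  rw [Real.log_div (by positivity) (by positivity),
      Real.log_div (by positivity) (by positivity), Real.log_div (by positivity) (by positivity)]
  ring

/-- Convergence at Lebesgue points: the mollifier has integral one, lives in the disc of radius `δ`
and is `O(δ⁻²)`. Its sign does not matter. -/
theorem ae_tendsto_integral_mul_mollifier (hf : LocallyIntegrable f) {δ : ℕ → ℝ}
    (hδ : ∀ n, 0 < δ n) (hlim : Tendsto δ atTop (𝓝 0)) :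
    ∀ᵐ x, Tendsto (fun n => ∫ y, f y * (mollifier (δ n) (y - x) : ℂ)) atTop (𝓝 (f x)) := by
  obtain ⟨C, hC, hCb⟩ := exists_abs_mollifier_le
  filter_upwards [IsUnifLocDoublingMeasure.ae_tendsto_average_norm_sub volume hf 1] with x hx
  have h1 := hx (fun _ : ℕ => x) δ (l := atTop)
    (tendsto_nhdsWithin_iff.2 ⟨hlim, Eventually.of_forall fun n => hδ n⟩)
    (Eventually.of_forall fun n => by simpa using (hδ n).le)
  rw [tendsto_iff_norm_sub_tendsto_zero]
  refine squeeze_zero (fun _ => norm_nonneg _) (fun n => ?_) (by simpa using h1.const_mul C)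
  have hone : ∫ y, (mollifier (δ n) (y - x) : ℂ) = 1 := by
    rw [integral_complex_ofReal, integral_sub_right_eq_self (fun z => mollifier (δ n) z),
      integral_mollifier (hδ n), Complex.ofReal_one]
  have hint := integrable_mul_mollifier hf (hδ n) x
  have hint1 : Integrable fun y => f x * (mollifier (δ n) (y - x) : ℂ) :=
    integrable_mul_mollifier (f := fun _ => f x) (locallyIntegrable_const _) (hδ n) x
  have e1 : (∫ y, f y * (mollifier (δ n) (y - x) : ℂ)) - f x
      = ∫ y, (f y - f x) * (mollifier (δ n) (y - x) : ℂ) := by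
    simp_rw [sub_mul]
    rw [integral_sub hint hint1, integral_const_mul, hone, mul_one]
  rw [e1]
  have hsub : LocallyIntegrable fun y => f y - f x := hf.sub (locallyIntegrable_const _)
  calc ‖∫ y, (f y - f x) * (mollifier (δ n) (y - x) : ℂ)‖
      ≤ ∫ y, ‖(f y - f x) * (mollifier (δ n) (y - x) : ℂ)‖ := norm_integral_le_integral_norm _
    _ ≤ ∫ y, (Metric.closedBall x (δ n)).indicator
          (fun y => C / (Real.pi * δ n ^ 2) * ‖f y - f x‖) y := by
        refine integral_mono_of_nonneg (Eventually.of_forall fun _ => norm_nonneg _) ?_ ?_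
        · refine (integrable_indicator_iff Metric.isClosed_closedBall.measurableSet).2 ?_
          exact ((hsub.integrableOn_isCompact (isCompact_closedBall x (δ n))).norm).const_mul _
        · refine Eventually.of_forall fun y => ?_
          by_cases hy : y ∈ Metric.closedBall x (δ n)
          · simp only [Set.indicator_of_mem hy]
            rw [norm_mul, mul_comm, Complex.norm_real]
            gcongr
            exact hCb _ (hδ n) _
          · have : δ n < ‖y - x‖ := by simpa [dist_eq_norm] using hy
            simp [Set.indicator_of_notMem hy, mollifier_eq_zero (hδ n) this]
    _ = C / (Real.pi * δ n ^ 2) * ∫ y in Metric.closedBall x (δ n), ‖f y - f x‖ := by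
        rw [integral_indicator Metric.isClosed_closedBall.measurableSet, integral_const_mul]
    _ = C * ⨍ y in Metric.closedBall x (δ n), ‖f y - f x‖ := by
        rw [setAverage_eq]
        have hvol : (volume : Measure Plane).real (Metric.closedBall x (δ n))
            = Real.pi * δ n ^ 2 := by
          rw [Measure.real, EuclideanSpace.volume_closedBall_fin_two, ENNReal.toReal_mul,
            ENNReal.toReal_pow, ENNReal.toReal_ofReal (hδ n).le]
          simp [mul_comm, Real.pi_pos.le]
        rw [hvol, smul_eq_mul]
        ring

/-- Tonelli on each ball: the kernel has range `R` and finite mass, so only the integral of `g` over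
a slightly larger ball matters. -/
theorem ae_lintegral_mul_negLog_lt_top (hg : LocallyIntegrable g) {R : ℝ} (hR : 0 < R) :
    ∀ᵐ x, ∫⁻ y, ‖g y‖ₑ * negLog (R⁻¹ • (y - x)) < ⊤ := by
  have hgm : AEMeasurable (fun y => ‖g y‖ₑ) := hg.aestronglyMeasurable.enorm
  have hm2 : AEMeasurable (fun p : Plane × Plane => ‖g p.2‖ₑ * negLog (R⁻¹ • (p.2 - p.1)))
      (volume.prod volume) :=
    (hgm.comp_quasiMeasurePreserving Measure.quasiMeasurePreserving_snd).mul
      (measurable_negLog.comp (by fun_prop)).aemeasurable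
  have key : ∀ n : ℕ, ∀ᵐ x ∂volume.restrict (Metric.closedBall (0 : Plane) n),
      ∫⁻ y, ‖g y‖ₑ * negLog (R⁻¹ • (y - x)) < ⊤ := by
    intro n
    have hm3 : AEMeasurable (fun p : Plane × Plane => ‖g p.2‖ₑ * negLog (R⁻¹ • (p.2 - p.1)))
        ((volume.restrict (Metric.closedBall (0 : Plane) n)).prod volume) :=
      hm2.mono_ac ((Measure.absolutelyContinuous_of_le Measure.restrict_le_self).prod
        Measure.AbsolutelyContinuous.rfl)
    refine ae_lt_top' hm3.lintegral_prod_right' ?_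
    rw [lintegral_lintegral_swap hm3]
    refine ne_of_lt ?_
    calc ∫⁻ y, ∫⁻ x in Metric.closedBall (0 : Plane) n, ‖g y‖ₑ * negLog (R⁻¹ • (y - x))
        ≤ ∫⁻ y, (Metric.closedBall (0 : Plane) (n + R)).indicator
            (fun y => ‖g y‖ₑ * ∫⁻ z, negLog (R⁻¹ • z)) y := by
          refine lintegral_mono fun y => ?_
          rw [lintegral_const_mul _ (by fun_prop)]
          by_cases hy : y ∈ Metric.closedBall (0 : Plane) (n + R)
          · rw [Set.indicator_of_mem hy]
            refine mul_le_mul' le_rfl ((setLIntegral_le_lintegral _ _).trans ?_)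
            exact (lintegral_sub_left_eq_self (fun z => negLog (R⁻¹ • z)) y).le
          · rw [Set.indicator_of_notMem hy]
            have : ∫⁻ x in Metric.closedBall (0 : Plane) n, negLog (R⁻¹ • (y - x)) = 0 := by
              rw [setLIntegral_congr_fun (g := fun _ => 0) Metric.isClosed_closedBall.measurableSet,
                lintegral_zero]
              intro x hx
              refine negLog_smul_eq_zero hR ?_
              have h1 : n + R < ‖y‖ := by simpa using hy
              have h2 : ‖x‖ ≤ n := by simpa using hx
              linarith [norm_sub_norm_le y x]
            rw [this, mul_zero]
      _ = (∫⁻ y in Metric.closedBall (0 : Plane) (n + R), ‖g y‖ₑ) * ∫⁻ z, negLog (R⁻¹ • z) := by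
          rw [lintegral_indicator Metric.isClosed_closedBall.measurableSet,
            lintegral_mul_const' _ _ (lintegral_negLog_smul_lt_top hR).ne]
      _ < ⊤ := ENNReal.mul_lt_top
          (hg.integrableOn_isCompact (isCompact_closedBall _ _)).2 (lintegral_negLog_smul_lt_top hR)
  have := ae_all_iff.2 fun n : ℕ =>
    (ae_restrict_iff' Metric.isClosed_closedBall.measurableSet).1 (key n)
  filter_upwards [this] with x hx
  obtain ⟨n, hn⟩ := exists_nat_ge ‖x‖
  exact hx n (by simpa using hn)

/-- Representation of a function through its distributional Laplacian, at scale `R`. -/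
theorem ae_eq_mollifier_add_parametrix (h : IsWeakNegLaplacian f g) {R : ℝ} (hR : 0 < R) :
    ∀ᵐ x, f x = (∫ y, f y * (mollifier R (y - x) : ℂ)) + ∫ y, g y * (parametrix R (y - x) : ℂ) := by
  set δ : ℕ → ℝ := fun n => R / (n + 2) with hδ_def
  have hδ : ∀ n, 0 < δ n := fun n => by positivity
  have hδR : ∀ n, δ n < R := fun n => by
    rw [hδ_def, div_lt_iff₀ (by positivity)]
    nlinarith [(Nat.cast_nonneg n : (0 : ℝ) ≤ n)]
  have hlim : Tendsto δ atTop (𝓝 0) := by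
    refine tendsto_const_nhds.div_atTop ?_
    exact tendsto_atTop_add_const_right _ _ tendsto_natCast_atTop_atTop
  filter_upwards [ae_tendsto_integral_mul_mollifier h.1 hδ hlim,
    ae_lintegral_mul_negLog_lt_top h.2.1 hR] with x hx hfin
  have hgm := h.2.1.aestronglyMeasurable
  have e : ∀ n, ∫ y, f y * (mollifier (δ n) (y - x) : ℂ)
      = (∫ y, f y * (mollifier R (y - x) : ℂ))
        + ∫ y, g y * ((parametrix R (y - x) - parametrix (δ n) (y - x) : ℝ) : ℂ) := fun n => by
    rw [← integral_mul_mollifier_sub h (hδ n) (hδR n) x]; ring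
  simp_rw [e] at hx
  refine tendsto_nhds_unique hx (tendsto_const_nhds.add ?_)
  set bound : Plane → ℝ := fun y => 2 * (‖g y‖ * Real.posLog ‖R⁻¹ • (y - x)‖⁻¹) with hbound
  have hbint : Integrable bound := by
    refine Integrable.const_mul ⟨hgm.norm.mul (Measurable.aestronglyMeasurable (by fun_prop)), ?_⟩ 2
    refine lt_of_le_of_lt (lintegral_mono fun y => ?_) hfin
    rw [Pi.mul_apply, enorm_mul, enorm_norm, Real.enorm_of_nonneg Real.posLog_nonneg, negLog]
  refine tendsto_integral_of_dominated_convergence bound (fun n => ?_) hbint (fun n => ?_) ?_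
  · exact hgm.mul (Measurable.aestronglyMeasurable (by fun_prop))
  · refine Eventually.of_forall fun y => ?_
    rw [norm_mul, Complex.norm_real, hbound]
    have hpi : 1 / (2 * Real.pi) ≤ 1 := by
      rw [div_le_one (by positivity)]; linarith [Real.pi_gt_three]
    have h1 : ∀ R' : ℝ, 0 < R' → R' ≤ R →
        |parametrix R' (y - x)| ≤ Real.posLog ‖R⁻¹ • (y - x)‖⁻¹ := by
      intro R' hR' hle
      have h2 : Real.posLog ‖R'⁻¹ • (y - x)‖⁻¹ ≤ Real.posLog ‖R⁻¹ • (y - x)‖⁻¹ := by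
        have := negLog_smul_le_of_le hR' hle (y - x)
        unfold negLog at this
        rwa [ENNReal.ofReal_le_ofReal_iff Real.posLog_nonneg] at this
      have h3 := abs_parametrix_le hR' (y - x)
      nlinarith [Real.posLog_nonneg (x := ‖R'⁻¹ • (y - x)‖⁻¹)]
    have h4 := h1 R hR le_rfl
    have h5 := h1 (δ n) (hδ n) (hδR n).le
    calc ‖g y‖ * ‖parametrix R (y - x) - parametrix (δ n) (y - x)‖
        ≤ ‖g y‖ * (Real.posLog ‖R⁻¹ • (y - x)‖⁻¹ + Real.posLog ‖R⁻¹ • (y - x)‖⁻¹) := by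
          gcongr
          exact (norm_sub_le _ _).trans (add_le_add h4 h5)
      _ = _ := by ring
  -- For `y ≠ x` the parametrix of radius `δ n` vanishes at `y - x` as soon as `δ n < |y - x|`.
  · filter_upwards [measure_eq_zero_iff_ae_notMem.1 (measure_singleton (μ := volume) x)] with y hy
    have hyx : 0 < ‖y - x‖ := norm_pos_iff.2 (sub_ne_zero.2 (by simpa using hy))
    refine tendsto_const_nhds.congr' ?_
    filter_upwards [hlim.eventually (gt_mem_nhds hyx)] with n hn
    rw [parametrix_eq_zero (hδ n) (le_of_lt hn), sub_zero]

end Representation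

/-! ### The logarithmic weight. -/

section Weight

/-- The weight `1 + log₊ |x|` as an extended nonnegative real. -/
def wt (x : Plane) : ℝ≥0∞ := ENNReal.ofReal (logWeight x)

theorem one_le_logWeight (x : Plane) : 1 ≤ logWeight x := by
  have := Real.posLog_nonneg (x := ‖x‖)
  unfold logWeight
  linarith

theorem continuous_logWeight : Continuous logWeight := by
  unfold logWeight
  fun_prop

@[fun_prop]
theorem measurable_wt : Measurable wt := by
  have := continuous_logWeight.measurable
  unfold wt
  fun_prop

theorem one_le_wt (x : Plane) : 1 ≤ wt x := by
  rw [wt, ENNReal.one_le_ofReal]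
  exact one_le_logWeight x

theorem wt_ne_top (x : Plane) : wt x ≠ ⊤ := ENNReal.ofReal_ne_top

theorem ofReal_logWeight_rpow (k : ℝ) (x : Plane) : ENNReal.ofReal (logWeight x ^ k) = wt x ^ k := by
  rw [wt, ENNReal.ofReal_rpow_of_pos (by linarith [one_le_logWeight x])]

theorem weightedL1Norm_eq (k : ℝ) (F : Plane → ℂ) :
    weightedL1Norm k F = ∫⁻ x, wt x ^ k * ‖F x‖ₑ := by
  simp only [weightedL1Norm, ofReal_logWeight_rpow]

theorem wt_rpow_le_rpow {a b : ℝ} (h : a ≤ b) (x : Plane) : wt x ^ a ≤ wt x ^ b :=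
  ENNReal.rpow_le_rpow_of_exponent_le (one_le_wt x) h

theorem wt_le_rpow {k : ℝ} (hk : 1 ≤ k) (x : Plane) : wt x ≤ wt x ^ k := by
  simpa using wt_rpow_le_rpow hk x

theorem log_two_lt_one : Real.log 2 < 1 := by linarith [Real.log_two_lt_d9]

theorem posLog_norm_sub_le (x y : Plane) :
    Real.posLog ‖x - y‖ ≤ Real.log 2 + Real.posLog ‖x‖ + Real.posLog ‖y‖ := by
  have := Real.posLog_norm_add_le x (-y)
  simp only [norm_neg] at this
  rw [sub_eq_add_neg]
  linarith

theorem posLog_norm_le_add (x y : Plane) :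
    Real.posLog ‖x‖ ≤ Real.log 2 + Real.posLog ‖x - y‖ + Real.posLog ‖y‖ := by
  have := Real.posLog_norm_add_le (x - y) y
  rw [sub_add_cancel] at this
  linarith

/-- Subtracting `log₊|x|` removes the growth in `x`; the remainder costs one weight in `y` and the
local singularity. -/
theorem abs_log_norm_sub_sub_posLog_le (x y : Plane) :
    |Real.log ‖y - x‖ - Real.posLog ‖x‖| ≤ logWeight y + Real.posLog ‖y - x‖⁻¹ := by
  have h1 := posLog_norm_sub_le y x
  have h2 := posLog_norm_le_add x y
  rw [norm_sub_rev x y] at h2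
  have h3 := log_two_lt_one
  have h4 := Real.posLog_sub_posLog_inv (x := ‖y - x‖)
  have h5 := Real.posLog_nonneg (x := ‖y - x‖⁻¹)
  rw [abs_le]
  unfold logWeight
  constructor <;> linarith

/-- The singular kernel only acts where `|x - y| ≤ 1`, and there weights may be moved from `x` to
`y`. -/
theorem wt_le_two_mul_of_negLog_ne_zero {x y : Plane} (h : negLog (x - y) ≠ 0) :
    wt x ≤ 2 * wt y := by
  have hlt : ‖x - y‖ ≤ 1 := by
    by_contra hn
    apply h
    have := negLog_smul_eq_zero one_pos (z := x - y) (not_le.1 hn).le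
    simpa using this
  have h0 : Real.posLog ‖x - y‖ = 0 := by
    rw [Real.posLog_eq_zero_iff, abs_of_nonneg (norm_nonneg _)]; exact hlt
  have h1 := posLog_norm_le_add x y
  rw [wt, wt, ← ENNReal.ofReal_ofNat, ← ENNReal.ofReal_mul (by norm_num)]
  refine ENNReal.ofReal_le_ofReal ?_
  have h3 := log_two_lt_one
  have := Real.posLog_nonneg (x := ‖y‖)
  unfold logWeight
  linarith

variable {V : Plane → ℝ} {k : ℝ}

theorem aestronglyMeasurable_of_weighted (hV : Integrable fun x => logWeight x ^ (2 * k) * V x) :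
    AEStronglyMeasurable V := by
  have h1 : AEStronglyMeasurable fun x => (logWeight x ^ (2 * k))⁻¹ :=
    (continuous_logWeight.measurable.pow_const _).inv.aestronglyMeasurable
  refine (h1.mul hV.1).congr (Eventually.of_forall fun x => ?_)
  have : 0 < logWeight x ^ (2 * k) := Real.rpow_pos_of_pos (by linarith [one_le_logWeight x]) _
  simp only [Pi.mul_apply]
  field_simp

theorem lintegral_wt_rpow_mul_lt_top (hV : Integrable fun x => logWeight x ^ (2 * k) * V x) :
    ∫⁻ x, wt x ^ (2 * k) * ‖V x‖ₑ < ⊤ := by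
  refine lt_of_le_of_lt (lintegral_mono fun x => ?_) hV.2
  have : 0 ≤ logWeight x ^ (2 * k) := Real.rpow_nonneg (by linarith [one_le_logWeight x]) _
  rw [enorm_mul, Real.enorm_of_nonneg this, ofReal_logWeight_rpow]

theorem lintegral_wt_rpow_mul_lt_top_of_le (hV : ∫⁻ x, wt x ^ (2 * k) * ‖V x‖ₑ < ⊤) {a : ℝ}
    (ha : a ≤ 2 * k) : ∫⁻ x, wt x ^ a * ‖V x‖ₑ < ⊤ := by
  refine lt_of_le_of_lt (lintegral_mono fun x => ?_) hV
  exact mul_le_mul' (wt_rpow_le_rpow ha x) le_rfl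

theorem integrable_of_weighted (hk : 0 ≤ k) (hV : Integrable fun x => logWeight x ^ (2 * k) * V x) :
    Integrable V := by
  refine ⟨aestronglyMeasurable_of_weighted hV, ?_⟩
  have := lintegral_wt_rpow_mul_lt_top_of_le (lintegral_wt_rpow_mul_lt_top hV) (a := 0)
    (by linarith)
  simpa [HasFiniteIntegral] using this

end Weight

/-! ### Logarithmic potentials and vanishing of the mean. -/

section Green

variable {f g : Plane → ℂ}

/-- Hölder on the disc of radius `R`, whose area is `π R²`. -/
theorem exists_norm_integral_mul_mollifier_le {p : ℝ≥0∞} (hp : 1 ≤ p) (hpt : p ≠ ⊤)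
    (hf : MemLp f p) : ∃ C : ℝ, 0 ≤ C ∧ ∀ R, 0 < R → ∀ x,
      ‖∫ y, f y * (mollifier R (y - x) : ℂ)‖ ≤ C * (Real.pi * R ^ 2) ^ (-(p.toReal)⁻¹) := by
  obtain ⟨C, hC, hCb⟩ := exists_abs_mollifier_le
  have hpr : 1 ≤ p.toReal := by
    rw [← ENNReal.toReal_one]; exact (ENNReal.toReal_le_toReal ENNReal.one_ne_top hpt).2 hp
  refine ⟨C * (eLpNorm f p volume).toReal, by positivity, fun R hR x => ?_⟩
  have hfl : LocallyIntegrable f := hf.locallyIntegrable hp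
  have hpos : 0 < Real.pi * R ^ 2 := by positivity
  have hvol : volume (Metric.closedBall x R) = ENNReal.ofReal (Real.pi * R ^ 2) := by
    rw [EuclideanSpace.volume_closedBall_fin_two, mul_comm, ENNReal.ofReal_mul Real.pi_pos.le,
      ENNReal.ofReal_pow hR.le]
  have hL1 : ∫ y in Metric.closedBall x R, ‖f y‖
      ≤ (eLpNorm f p volume).toReal * (Real.pi * R ^ 2) ^ (1 - (p.toReal)⁻¹) := by
    have h1 := eLpNorm_le_eLpNorm_mul_rpow_measure_univ (μ := volume.restrict (Metric.closedBall x R))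
      hp (f := f) hf.1.restrict
    rw [Measure.restrict_apply_univ, hvol, eLpNorm_one_eq_lintegral_enorm] at h1
    have h2 : eLpNorm f p (volume.restrict (Metric.closedBall x R)) ≤ eLpNorm f p volume :=
      eLpNorm_mono_measure _ Measure.restrict_le_self
    rw [integral_norm_eq_lintegral_enorm hf.1.restrict]
    have h3 := h1.trans (mul_le_mul' h2 le_rfl)
    rw [ENNReal.ofReal_rpow_of_pos hpos] at h3
    have h4 := ENNReal.toReal_mono (ENNReal.mul_ne_top hf.2.ne ENNReal.ofReal_ne_top) h3
    rw [ENNReal.toReal_mul, ENNReal.toReal_ofReal (by positivity)] at h4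
    simpa using h4
  calc ‖∫ y, f y * (mollifier R (y - x) : ℂ)‖
      ≤ ∫ y, ‖f y * (mollifier R (y - x) : ℂ)‖ := norm_integral_le_integral_norm _
    _ ≤ ∫ y, (Metric.closedBall x R).indicator
          (fun y => C / (Real.pi * R ^ 2) * ‖f y‖) y := by
        refine integral_mono_of_nonneg (Eventually.of_forall fun _ => norm_nonneg _) ?_ ?_
        · refine (integrable_indicator_iff Metric.isClosed_closedBall.measurableSet).2 ?_
          exact ((hfl.integrableOn_isCompact (isCompact_closedBall x R)).norm).const_mul _
        · refine Eventually.of_forall fun y => ?_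
          by_cases hy : y ∈ Metric.closedBall x R
          · simp only [Set.indicator_of_mem hy]
            rw [norm_mul, mul_comm, Complex.norm_real]
            gcongr
            exact hCb _ hR _
          · have : R < ‖y - x‖ := by simpa [dist_eq_norm] using hy
            simp [Set.indicator_of_notMem hy, mollifier_eq_zero hR this]
    _ = C / (Real.pi * R ^ 2) * ∫ y in Metric.closedBall x R, ‖f y‖ := by
        rw [integral_indicator Metric.isClosed_closedBall.measurableSet, integral_const_mul]
    _ ≤ C / (Real.pi * R ^ 2) * ((eLpNorm f p volume).toReal *
          (Real.pi * R ^ 2) ^ (1 - (p.toReal)⁻¹)) := by gcongr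
    _ = _ := by
        rw [sub_eq_add_neg, Real.rpow_add hpos, Real.rpow_one]
        field_simp

/-- Here `p < ∞` is essential: it makes the area to the power `-1/p` tend to zero, and so excludes
constants. -/
theorem tendsto_integral_mul_mollifier_atTop {p : ℝ≥0∞} (hp : 1 ≤ p) (hpt : p ≠ ⊤)
    (hf : MemLp f p) (x : Plane) :
    Tendsto (fun n : ℕ => ∫ y, f y * (mollifier n (y - x) : ℂ)) atTop (𝓝 0) := by
  obtain ⟨C, hC, h⟩ := exists_norm_integral_mul_mollifier_le hp hpt hf
  have hpr : 0 < p.toReal := ENNReal.toReal_pos (zero_lt_one.trans_le hp).ne' hpt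
  have h1 : Tendsto (fun n : ℕ => Real.pi * (n : ℝ) ^ 2) atTop atTop :=
    ((tendsto_pow_atTop two_ne_zero).comp tendsto_natCast_atTop_atTop).const_mul_atTop Real.pi_pos
  have h2 := ((tendsto_rpow_neg_atTop (inv_pos.2 hpr)).comp h1).const_mul C
  rw [mul_zero] at h2
  refine squeeze_zero_norm' ?_ h2
  filter_upwards [eventually_gt_atTop 0] with n hn
  exact h n (by exact_mod_cast hn) x

/-- Isolates `log R`, which multiplies `∫ g` when the parametrix is integrated against `g`. -/
theorem two_pi_mul_parametrix {R : ℝ} (hR : 0 < R) {z : Plane} (hz : z ≠ 0) :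
    2 * Real.pi * parametrix R z
      = Real.log R - Real.smoothTransition (2 * (‖z‖ ^ 2 / R ^ 2) - 1) * Real.log R
        - (1 - Real.smoothTransition (2 * (‖z‖ ^ 2 / R ^ 2) - 1)) * Real.log ‖z‖ := by
  have hz' : 0 < ‖z‖ := norm_pos_iff.2 hz
  rw [parametrix, cutLog, ← div_pow, Real.log_pow, Real.log_div hz'.ne' hR.ne']
  have := Real.pi_pos
  push_cast
  field_simp
  ring

theorem aemeasurable_enorm_of_weighted {k : ℝ} (hg : AEStronglyMeasurable g) :
    AEMeasurable fun y => wt y ^ k * ‖g y‖ₑ := by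
  have := hg.enorm
  fun_prop

theorem integrable_of_wt_mul (hg : AEStronglyMeasurable g) (hw : ∫⁻ y, wt y * ‖g y‖ₑ < ⊤) :
    Integrable g := by
  refine ⟨hg, lt_of_le_of_lt (lintegral_mono fun y => ?_) hw⟩
  exact le_mul_of_one_le_left zero_le (one_le_wt y)

theorem integrable_logWeight_mul (hg : AEStronglyMeasurable g) (hw : ∫⁻ y, wt y * ‖g y‖ₑ < ⊤) :
    Integrable fun y => logWeight y * ‖g y‖ := by
  refine ⟨continuous_logWeight.aestronglyMeasurable.mul hg.norm, ?_⟩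
  refine lt_of_le_of_lt (lintegral_mono fun y => ?_) hw
  rw [enorm_mul, enorm_norm, Real.enorm_of_nonneg (by linarith [one_le_logWeight y]), wt]

/-- A function in `L^p` with Laplacian in `(1 + log₊ |x|)⁻¹ L¹` is the logarithmic potential of its
Laplacian, which has mean zero. -/
theorem integral_eq_zero_and_ae_eq_green {p : ℝ≥0∞} (hp : 1 ≤ p) (hpt : p ≠ ⊤) (hf : MemLp f p)
    (h : IsWeakNegLaplacian f g) (hw : ∫⁻ y, wt y * ‖g y‖ₑ < ⊤) :
    ∫ y, g y = 0 ∧ ∀ᵐ x, Integrable (fun y => g y * ((green x y : ℝ) : ℂ)) ∧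
      f x = ∫ y, g y * ((green x y : ℝ) : ℂ) := by
  have hgm := h.2.1.aestronglyMeasurable
  have hgi := integrable_of_wt_mul hgm hw
  have hgw := integrable_logWeight_mul hgm hw
  have hrep : ∀ᵐ x, ∀ n : ℕ, 0 < n → f x = (∫ y, f y * (mollifier n (y - x) : ℂ))
      + ∫ y, g y * (parametrix n (y - x) : ℂ) := by
    refine ae_all_iff.2 fun n => ?_
    by_cases hn : 0 < n
    · filter_upwards [ae_eq_mollifier_add_parametrix h (R := n) (by exact_mod_cast hn)] with x hx _
      exact hx
    · exact Eventually.of_forall fun x h => absurd h hn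
  -- Represent `f` at scale `n`. The average tends to `0`, the logarithmic part converges by
  -- dominated convergence, and the cutoff part tends to `0`; so `log n ∫ g` converges.
  have key : ∀ᵐ x, Integrable (fun y => g y * ((Real.log ‖y - x‖ : ℝ) : ℂ)) ∧
      Tendsto (fun n : ℕ => (Real.log n : ℂ) * ∫ y, g y) atTop
        (𝓝 (2 * Real.pi * f x + ∫ y, g y * ((Real.log ‖y - x‖ : ℝ) : ℂ))) := by
    filter_upwards [hrep, ae_lintegral_mul_negLog_lt_top h.2.1 one_pos] with x hx hfin
    have hneg : Integrable fun y => ‖g y‖ * Real.posLog ‖y - x‖⁻¹ := by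
      refine ⟨hgm.norm.mul (Measurable.aestronglyMeasurable (by fun_prop)), ?_⟩
      refine lt_of_le_of_lt (lintegral_mono fun y => ?_) hfin
      rw [enorm_mul, enorm_norm, Real.enorm_of_nonneg Real.posLog_nonneg, negLog,
        inv_one, one_smul]
    set bound : Plane → ℝ := fun y => (2 + Real.posLog ‖x‖) * (logWeight y * ‖g y‖)
      + ‖g y‖ * Real.posLog ‖y - x‖⁻¹ with hbound
    have hbint : Integrable bound := (hgw.const_mul _).add hneg
    have hlogb : ∀ y, Real.log 2 + Real.posLog ‖y - x‖ ≤ (2 + Real.posLog ‖x‖) * logWeight y := by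
      intro y
      have h1 := posLog_norm_sub_le y x
      have h2 := log_two_lt_one
      have h3 := Real.posLog_nonneg (x := ‖x‖)
      have h4 := Real.posLog_nonneg (x := ‖y‖)
      unfold logWeight
      nlinarith
    have hb1 : ∀ y, ‖g y‖ * |Real.log ‖y - x‖| ≤ bound y := by
      intro y
      have h1 : |Real.log ‖y - x‖| ≤ Real.posLog ‖y - x‖ + Real.posLog ‖y - x‖⁻¹ := by
        rw [← Real.posLog_sub_posLog_inv]
        have a := Real.posLog_nonneg (x := ‖y - x‖)
        have b := Real.posLog_nonneg (x := ‖y - x‖⁻¹)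
        rw [abs_le]; constructor <;> linarith
      have h2 := hlogb y
      have h3 : 0 ≤ Real.log 2 := Real.log_nonneg (by norm_num)
      calc ‖g y‖ * |Real.log ‖y - x‖|
          ≤ ‖g y‖ * ((2 + Real.posLog ‖x‖) * logWeight y + Real.posLog ‖y - x‖⁻¹) := by
            gcongr; linarith
        _ = bound y := by simp only [hbound]; ring
    have hlogm : Measurable fun y => ((Real.log ‖y - x‖ : ℝ) : ℂ) := by fun_prop
    have hlogint : Integrable (fun y => g y * ((Real.log ‖y - x‖ : ℝ) : ℂ)) := by
      refine hbint.mono' (hgm.mul hlogm.aestronglyMeasurable) (Eventually.of_forall fun y => ?_)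
      rw [norm_mul, Complex.norm_real]
      exact hb1 y
    refine ⟨hlogint, ?_⟩
    set χ : ℕ → Plane → ℝ := fun n y =>
      Real.smoothTransition (2 * (‖y - x‖ ^ 2 / (n : ℝ) ^ 2) - 1) with hχ
    have hχm : ∀ n, Measurable (χ n) := fun n => by
      have := Real.smoothTransition.continuous.measurable
      simp only [hχ]
      fun_prop
    have hχ0 : ∀ n y, 0 ≤ χ n y := fun n y => Real.smoothTransition.nonneg _
    have hχ1 : ∀ n y, χ n y ≤ 1 := fun n y => Real.smoothTransition.le_one _
    have hχlim : ∀ y, ∀ᶠ n in atTop, χ n y = 0 := by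
      intro y
      obtain ⟨N, hN⟩ := exists_nat_gt (2 * ‖y - x‖)
      filter_upwards [eventually_ge_atTop N, eventually_gt_atTop 0] with n hn hn0
      have hn0' : (0 : ℝ) < n := by exact_mod_cast hn0
      have h1 : 2 * ‖y - x‖ ≤ n := hN.le.trans (by exact_mod_cast hn)
      refine Real.smoothTransition.zero_of_nonpos ?_
      have : ‖y - x‖ ^ 2 / (n : ℝ) ^ 2 ≤ 1 / 2 := by
        rw [div_le_iff₀ (by positivity)]
        nlinarith [norm_nonneg (y - x)]
      linarith
    -- The cutoff is nonzero only when `n ≤ 2 |y - x|`, so `log n` is paid for by the weights of `x`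
    -- and `y`.
    have hBb : ∀ n : ℕ, 0 < n → ∀ y, χ n y * Real.log n ≤ Real.log 2 + Real.posLog ‖y - x‖ := by
      intro n hn y
      have hn1 : (1 : ℝ) ≤ n := by exact_mod_cast hn
      have hlogn : 0 ≤ Real.log n := Real.log_nonneg hn1
      have hp := Real.posLog_nonneg (x := ‖y - x‖)
      have hl2 : 0 ≤ Real.log 2 := Real.log_nonneg (by norm_num)
      rcases eq_or_ne (χ n y) 0 with h0 | h0
      · rw [h0]; linarith
      have hlt : (n : ℝ) ≤ 2 * ‖y - x‖ := by
        by_contra hcon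
        apply h0
        refine Real.smoothTransition.zero_of_nonpos ?_
        have : ‖y - x‖ ^ 2 / (n : ℝ) ^ 2 ≤ 1 / 2 := by
          rw [div_le_iff₀ (by positivity)]
          nlinarith [norm_nonneg (y - x)]
        linarith
      have hz : 0 < ‖y - x‖ := by linarith
      calc χ n y * Real.log n ≤ 1 * Real.log n := by gcongr; exact hχ1 n y
        _ ≤ Real.log (2 * ‖y - x‖) := by rw [one_mul]; exact Real.log_le_log (by linarith) hlt
        _ = Real.log 2 + Real.log ‖y - x‖ := Real.log_mul (by norm_num) hz.ne'
        _ ≤ _ := by gcongr; rw [Real.posLog_apply]; exact le_max_right _ _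
    have hBnorm : ∀ n : ℕ, 0 < n → ∀ y, ‖g y * ((χ n y * Real.log n : ℝ) : ℂ)‖ ≤ bound y := by
      intro n hn y
      have hn1 : (1 : ℝ) ≤ n := by exact_mod_cast hn
      have hlogn : 0 ≤ Real.log n := Real.log_nonneg hn1
      rw [norm_mul, Complex.norm_real, Real.norm_of_nonneg (mul_nonneg (hχ0 n y) hlogn)]
      have h1 := (hBb n hn y).trans (hlogb y)
      have h2 : 0 ≤ ‖g y‖ * Real.posLog ‖y - x‖⁻¹ :=
        mul_nonneg (norm_nonneg _) Real.posLog_nonneg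
      calc ‖g y‖ * (χ n y * Real.log n) ≤ ‖g y‖ * ((2 + Real.posLog ‖x‖) * logWeight y) := by gcongr
        _ ≤ bound y := by simp only [hbound]; linarith
    have hBm : ∀ n, AEStronglyMeasurable fun y => g y * ((χ n y * Real.log n : ℝ) : ℂ) := fun n =>
      hgm.mul (Complex.measurable_ofReal.comp ((hχm n).mul_const _)).aestronglyMeasurable
    have hB : Tendsto (fun n : ℕ => ∫ y, g y * ((χ n y * Real.log n : ℝ) : ℂ)) atTop (𝓝 0) := by
      have := tendsto_integral_filter_of_dominated_convergence (l := atTop)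
        (F := fun (n : ℕ) y => g y * ((χ n y * Real.log n : ℝ) : ℂ)) (f := fun _ => 0) bound
        (Eventually.of_forall hBm) ((eventually_gt_atTop 0).mono fun n hn =>
          Eventually.of_forall (hBnorm n hn)) hbint (Eventually.of_forall fun y => ?_)
      · simpa using this
      · refine tendsto_const_nhds.congr' ?_
        filter_upwards [hχlim y] with n hn
        simp [hn]
    have hCm : ∀ n, AEStronglyMeasurable fun y =>
        g y * (((1 - χ n y) * Real.log ‖y - x‖ : ℝ) : ℂ) := fun n => by
      have := hχm n
      exact hgm.mul (Measurable.aestronglyMeasurable (by fun_prop))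
    have hCb : ∀ n y, ‖g y * (((1 - χ n y) * Real.log ‖y - x‖ : ℝ) : ℂ)‖ ≤ bound y := by
      intro n y
      rw [norm_mul, Complex.norm_real, norm_mul, Real.norm_eq_abs, Real.norm_eq_abs]
      refine le_trans ?_ (hb1 y)
      have h1 : |1 - χ n y| ≤ 1 := by
        rw [abs_le]; constructor <;> linarith [hχ0 n y, hχ1 n y]
      have h2 : |1 - χ n y| * |Real.log ‖y - x‖| ≤ 1 * |Real.log ‖y - x‖| := by gcongr
      rw [one_mul] at h2
      gcongr
    have hC : Tendsto (fun n : ℕ => ∫ y, g y * (((1 - χ n y) * Real.log ‖y - x‖ : ℝ) : ℂ)) atTop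
        (𝓝 (∫ y, g y * ((Real.log ‖y - x‖ : ℝ) : ℂ))) := by
      refine tendsto_integral_of_dominated_convergence bound hCm hbint
        (fun n => Eventually.of_forall (hCb n)) (Eventually.of_forall fun y => ?_)
      refine tendsto_const_nhds.congr' ?_
      filter_upwards [hχlim y] with n hn
      simp [hn]
    have hA := tendsto_integral_mul_mollifier_atTop hp hpt hf x
    have hlim := ((((tendsto_const_nhds (x := f x)).sub hA).const_mul (2 * (Real.pi : ℂ))).add
      hB).add hC
    rw [sub_zero, add_zero] at hlim
    refine hlim.congr' ?_
    filter_upwards [eventually_gt_atTop 0] with n hn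
    have hn' : (0 : ℝ) < n := by exact_mod_cast hn
    have hBi : Integrable fun y => g y * ((χ n y * Real.log n : ℝ) : ℂ) :=
      hbint.mono' (hBm n) (Eventually.of_forall (hBnorm n hn))
    have hCi : Integrable fun y => g y * (((1 - χ n y) * Real.log ‖y - x‖ : ℝ) : ℂ) :=
      hbint.mono' (hCm n) (Eventually.of_forall (hCb n))
    have e1 : f x - ∫ y, f y * (mollifier n (y - x) : ℂ) = ∫ y, g y * (parametrix n (y - x) : ℂ) := by
      rw [sub_eq_iff_eq_add']; exact hx n hn
    rw [e1, ← integral_const_mul, add_assoc, ← integral_add hBi hCi]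
    have e2 : (∫ y, 2 * (Real.pi : ℂ) * (g y * (parametrix n (y - x) : ℂ)))
        = ∫ y, (g y * (Real.log n : ℂ) - (g y * ((χ n y * Real.log n : ℝ) : ℂ)
          + g y * (((1 - χ n y) * Real.log ‖y - x‖ : ℝ) : ℂ))) := by
      refine integral_congr_ae ?_
      filter_upwards [measure_eq_zero_iff_ae_notMem.1 (measure_singleton (μ := volume) x)] with y hy
      have hyx : y - x ≠ 0 := sub_ne_zero.2 (by simpa using hy)
      have h3 := two_pi_mul_parametrix hn' hyx
      have h4 : 2 * (Real.pi : ℂ) * (parametrix n (y - x) : ℂ)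
          = ((2 * Real.pi * parametrix n (y - x) : ℝ) : ℂ) := by push_cast; ring
      calc 2 * (Real.pi : ℂ) * (g y * (parametrix n (y - x) : ℂ))
          = g y * (2 * (Real.pi : ℂ) * (parametrix n (y - x) : ℂ)) := by ring
        _ = _ := by
          rw [h4, h3]
          simp only [hχ]
          push_cast
          ring
    have hBCi : Integrable fun y => g y * ((χ n y * Real.log n : ℝ) : ℂ)
        + g y * (((1 - χ n y) * Real.log ‖y - x‖ : ℝ) : ℂ) := hBi.add hCi
    rw [e2, integral_sub (hgi.mul_const _) hBCi, integral_mul_const, sub_add_cancel,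
      mul_comm]
  -- `log n → ∞`, so a convergent `log n ∫ g` forces `∫ g = 0`; the limit then identifies `f`.
  have hzero : ∫ y, g y = 0 := by
    obtain ⟨x, -, hx⟩ := key.exists
    by_contra hne
    have h1 : Tendsto (fun n : ℕ => ‖(Real.log n : ℂ) * ∫ y, g y‖) atTop atTop := by
      simp_rw [norm_mul, Complex.norm_real]
      refine Tendsto.atTop_mul_const (norm_pos_iff.2 hne) ?_
      exact tendsto_norm_atTop_atTop.comp (Real.tendsto_log_atTop.comp tendsto_natCast_atTop_atTop)
    exact not_tendsto_nhds_of_tendsto_atTop h1 _ hx.norm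
  refine ⟨hzero, ?_⟩
  filter_upwards [key] with x hx
  obtain ⟨hi, hlim⟩ := hx
  have e : ∀ y, g y * ((green x y : ℝ) : ℂ)
      = -(1 / (2 * Real.pi) : ℂ) * (g y * ((Real.log ‖y - x‖ : ℝ) : ℂ)) := by
    intro y
    rw [green, norm_sub_rev]
    push_cast
    ring
  simp_rw [e]
  refine ⟨hi.const_mul _, ?_⟩
  rw [hzero] at hlim
  simp only [mul_zero] at hlim
  have h0 := tendsto_nhds_unique hlim tendsto_const_nhds
  rw [integral_const_mul]
  have hpi : (Real.pi : ℂ) ≠ 0 := by exact_mod_cast Real.pi_ne_zero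
  field_simp
  linear_combination h0

end Green

/-! ### Schur-type bounds for positive kernels. -/

section Schur

/-- Schur-type bound: if `∫ a(x) K(x,y)² dx ≤ E` for all `y`, then
`∫ a(x) (∫ h(y) K(x,y) dy)² dx ≤ E (∫ h)²`. -/
theorem lintegral_mul_sq_kernel_le {a h : Plane → ℝ≥0∞} {K : Plane → Plane → ℝ≥0∞}
    (ha : AEMeasurable a) (hh : AEMeasurable h) (hK : Measurable (Function.uncurry K)) {E : ℝ≥0∞}
    (hE : ∀ y, ∫⁻ x, a x * K x y ^ 2 ≤ E) :
    ∫⁻ x, a x * (∫⁻ y, h y * K x y) ^ 2 ≤ E * (∫⁻ y, h y) ^ 2 := by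
  have hKx : ∀ x, Measurable (K x) := fun x => hK.comp measurable_prodMk_left
  -- Cauchy–Schwarz with respect to the measure `h(y) dy`; Tonelli then reduces the claim to the
  -- column bound `hE`.
  have h1 : ∀ x, (∫⁻ y, h y * K x y) ^ 2 ≤ (∫⁻ y, h y) * ∫⁻ y, h y * K x y ^ 2 := by
    intro x
    have hm : AEMeasurable fun y => h y ^ (1 / 2 : ℝ) := hh.pow_const _
    have hc := ENNReal.lintegral_mul_le_Lp_mul_Lq volume Real.HolderConjugate.two_two hm
      (hm.mul (hKx x).aemeasurable)
    have e1 : ∀ y, (h y ^ (1 / 2 : ℝ)) ^ (2 : ℝ) = h y := fun y => by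
      rw [← ENNReal.rpow_mul]; norm_num
    have e0 : ∀ y, h y ^ (1 / 2 : ℝ) * (h y ^ (1 / 2 : ℝ) * K x y) = h y * K x y := fun y => by
      rw [← mul_assoc, ← ENNReal.rpow_add_of_nonneg _ _ (by norm_num) (by norm_num)]; norm_num
    have e2 : ∀ y, (h y ^ (1 / 2 : ℝ) * K x y) ^ (2 : ℝ) = h y * K x y ^ 2 := fun y => by
      rw [ENNReal.mul_rpow_of_nonneg _ _ (by norm_num), e1, ENNReal.rpow_two]
    simp only [Pi.mul_apply, e0, e1, e2] at hc
    have hsq := pow_le_pow_left' hc 2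
    rw [mul_pow, ← ENNReal.rpow_natCast, ← ENNReal.rpow_natCast, ← ENNReal.rpow_natCast,
      ← ENNReal.rpow_mul, ← ENNReal.rpow_mul] at hsq
    norm_num at hsq
    exact hsq
  have hm2 : AEMeasurable (Function.uncurry fun x y => a x * (h y * K x y ^ 2))
      (volume.prod volume) :=
    (ha.comp_quasiMeasurePreserving Measure.quasiMeasurePreserving_fst).mul
      ((hh.comp_quasiMeasurePreserving Measure.quasiMeasurePreserving_snd).mul
        (hK.pow_const 2).aemeasurable)
  calc ∫⁻ x, a x * (∫⁻ y, h y * K x y) ^ 2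
      ≤ ∫⁻ x, (∫⁻ y, h y) * ∫⁻ y, a x * (h y * K x y ^ 2) := by
        refine lintegral_mono fun x => ?_
        refine (mul_le_mul' le_rfl (h1 x)).trans_eq ?_
        have hm : AEMeasurable fun y => h y * K x y ^ 2 :=
          hh.mul ((hKx x).pow_const 2).aemeasurable
        rw [mul_left_comm, lintegral_const_mul'' _ hm]
    _ = (∫⁻ y, h y) * ∫⁻ y, ∫⁻ x, a x * (h y * K x y ^ 2) := by
        have hm : AEMeasurable fun x => ∫⁻ y, a x * (h y * K x y ^ 2) := hm2.lintegral_prod_right'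
        rw [lintegral_const_mul'' _ hm, lintegral_lintegral_swap hm2]
    _ ≤ (∫⁻ y, h y) * ∫⁻ y, E * h y := by
        refine mul_le_mul' le_rfl (lintegral_mono fun y => ?_)
        have : ∀ x, a x * (h y * K x y ^ 2) = h y * (a x * K x y ^ 2) := fun x => by ring
        simp_rw [this]
        have hm : AEMeasurable fun x => a x * K x y ^ 2 :=
          ha.mul ((hK.comp measurable_prodMk_right).pow_const 2).aemeasurable
        rw [lintegral_const_mul'' _ hm, mul_comm]
        exact mul_le_mul' (hE y) le_rfl
    _ = _ := by rw [lintegral_const_mul'' _ hh]; ring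

theorem lintegral_mul_kernel_le {a h : Plane → ℝ≥0∞} {K : Plane → Plane → ℝ≥0∞}
    (ha : AEMeasurable a) (hh : AEMeasurable h) (hK : Measurable (Function.uncurry K))
    {E : Plane → ℝ≥0∞} (hE : ∀ y, ∫⁻ x, a x * K x y ≤ E y) :
    ∫⁻ x, a x * (∫⁻ y, h y * K x y) ≤ ∫⁻ y, h y * E y := by
  have hKx : ∀ x, Measurable (K x) := fun x => hK.comp measurable_prodMk_left
  have hm2 : AEMeasurable (Function.uncurry fun x y => a x * (h y * K x y)) (volume.prod volume) :=
    (ha.comp_quasiMeasurePreserving Measure.quasiMeasurePreserving_fst).mul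
      ((hh.comp_quasiMeasurePreserving Measure.quasiMeasurePreserving_snd).mul hK.aemeasurable)
  calc ∫⁻ x, a x * (∫⁻ y, h y * K x y) = ∫⁻ x, ∫⁻ y, a x * (h y * K x y) := by
        refine lintegral_congr fun x => ?_
        have hm : AEMeasurable fun y => h y * K x y := hh.mul (hKx x).aemeasurable
        rw [lintegral_const_mul'' _ hm]
    _ = ∫⁻ y, ∫⁻ x, a x * (h y * K x y) := lintegral_lintegral_swap hm2
    _ ≤ ∫⁻ y, h y * E y := by
        refine lintegral_mono fun y => ?_
        have : ∀ x, a x * (h y * K x y) = h y * (a x * K x y) := fun x => by ring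
        simp_rw [this]
        have hm : AEMeasurable fun x => a x * K x y :=
          ha.mul (hK.comp measurable_prodMk_right).aemeasurable
        rw [lintegral_const_mul'' _ hm]
        exact mul_le_mul' le_rfl (hE y)

end Schur

/-! ### Pointwise kernel bounds and the bound of `V f` by the Laplacian. -/

section Bounds

variable {V : Plane → ℝ} {f g : Plane → ℂ} {k : ℝ}

theorem enorm_log_sub_le (x y : Plane) :
    ‖green x y + 1 / (2 * Real.pi) * Real.posLog ‖x‖‖ₑ ≤ wt y + negLog (y - x) := by
  have h := abs_log_norm_sub_sub_posLog_le x y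
  have e : green x y + 1 / (2 * Real.pi) * Real.posLog ‖x‖
      = -(1 / (2 * Real.pi)) * (Real.log ‖y - x‖ - Real.posLog ‖x‖) := by
    rw [green, norm_sub_rev]; ring
  have hpi : 1 / (2 * Real.pi) ≤ 1 := by
    rw [div_le_one (by positivity)]; linarith [Real.pi_gt_three]
  rw [e, wt, negLog, ← ENNReal.ofReal_add (by linarith [one_le_logWeight y]) Real.posLog_nonneg,
    Real.enorm_eq_ofReal_abs]
  refine ENNReal.ofReal_le_ofReal ?_
  rw [abs_mul, abs_neg, abs_of_nonneg (by positivity)]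
  exact (mul_le_of_le_one_left (abs_nonneg _) hpi).trans h

theorem enorm_green_le (x y : Plane) : ‖green x y‖ₑ ≤ wt x * wt y + negLog (y - x) := by
  have hpi : 1 / (2 * Real.pi) ≤ 1 := by
    rw [div_le_one (by positivity)]; linarith [Real.pi_gt_three]
  have h1 := posLog_norm_sub_le y x
  have h2 := log_two_lt_one
  have h3 := Real.posLog_nonneg (x := ‖x‖)
  have h4 := Real.posLog_nonneg (x := ‖y‖)
  have a := Real.posLog_nonneg (x := ‖y - x‖)
  have b := Real.posLog_nonneg (x := ‖y - x‖⁻¹)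
  rw [green, norm_sub_rev, wt, wt, negLog, ← ENNReal.ofReal_mul (by linarith [one_le_logWeight x]),
    ← ENNReal.ofReal_add (mul_nonneg (by linarith [one_le_logWeight x])
      (by linarith [one_le_logWeight y])) Real.posLog_nonneg, Real.enorm_eq_ofReal_abs]
  refine ENNReal.ofReal_le_ofReal ?_
  rw [abs_mul, abs_neg, abs_of_nonneg (by positivity)]
  refine (mul_le_of_le_one_left (abs_nonneg _) hpi).trans ?_
  rw [← Real.posLog_sub_posLog_inv, abs_le]
  unfold logWeight
  constructor <;> nlinarith

theorem measurable_negLog_sub : Measurable (Function.uncurry fun x y : Plane => negLog (y - x)) :=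
  measurable_negLog.comp (measurable_snd.sub measurable_fst)

/-- Because `∫ g = 0`, a multiple of `log₊|x|` may be added to the kernel for free, and the
resulting kernel does not grow in `x`. -/
theorem enorm_le_of_eq_green {x : Plane} (hg : Integrable g) (h0 : ∫ y, g y = 0)
    (hi : Integrable (fun y => g y * ((green x y : ℝ) : ℂ)))
    (hx : f x = ∫ y, g y * ((green x y : ℝ) : ℂ)) :
    ‖f x‖ₑ ≤ ∫⁻ y, ‖g y‖ₑ * (wt y + negLog (y - x)) := by
  have e : f x = ∫ y, g y * ((green x y + 1 / (2 * Real.pi) * Real.posLog ‖x‖ : ℝ) : ℂ) := by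
    have : ∀ y, g y * ((green x y + 1 / (2 * Real.pi) * Real.posLog ‖x‖ : ℝ) : ℂ)
        = g y * ((green x y : ℝ) : ℂ) + g y * ((1 / (2 * Real.pi) * Real.posLog ‖x‖ : ℝ) : ℂ) := by
      intro y; push_cast; ring
    simp_rw [this]
    rw [integral_add hi (hg.mul_const _), integral_mul_const, h0, zero_mul, add_zero, hx]
  rw [e]
  refine (enorm_integral_le_lintegral_enorm _).trans (lintegral_mono fun y => ?_)
  rw [enorm_mul, ← enorm_norm (Complex.ofReal _), Complex.norm_real, enorm_norm]
  exact mul_le_mul' le_rfl (enorm_log_sub_le x y)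

/-- The non-singular part of the kernel meets `∫ wt^k |V|` and leaves one weight on `g`, which `k ≥
1` permits. The singular part acts at distance at most one, where the weight can be moved onto `g`.
-/
theorem exists_lintegral_weighted_le (hVm : AEMeasurable V) (hk : 1 ≤ k)
    (hVk : ∫⁻ x, wt x ^ k * ‖V x‖ₑ < ⊤) {A : ℝ≥0∞} (hA : A ≠ ⊤)
    (hVA : ∀ y, ∫⁻ x, ‖V x‖ₑ * negLog (x - y) ≤ A) :
    ∃ C : ℝ≥0∞, C ≠ ⊤ ∧ ∀ f g : Plane → ℂ, AEStronglyMeasurable g →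
      (∀ᵐ x, ‖f x‖ₑ ≤ ∫⁻ y, ‖g y‖ₑ * (wt y + negLog (y - x))) →
      ∫⁻ x, wt x ^ k * ‖(V x : ℂ) * f x‖ₑ ≤ C * ∫⁻ x, wt x ^ k * ‖g x‖ₑ := by
  set B := ∫⁻ x, wt x ^ k * ‖V x‖ₑ with hB
  have hVe : AEMeasurable fun x => ‖V x‖ₑ := hVm.enorm
  refine ⟨B + 2 ^ k * A, by finiteness, fun f g hg hfg => ?_⟩
  have ha : AEMeasurable fun x => wt x ^ k * ‖V x‖ₑ := by fun_prop
  have hK : Measurable (Function.uncurry fun x y : Plane => wt y + negLog (y - x)) :=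
    (measurable_wt.comp measurable_snd).add measurable_negLog_sub
  calc ∫⁻ x, wt x ^ k * ‖(V x : ℂ) * f x‖ₑ
      ≤ ∫⁻ x, (wt x ^ k * ‖V x‖ₑ) * ∫⁻ y, ‖g y‖ₑ * (wt y + negLog (y - x)) := by
        refine lintegral_mono_ae (hfg.mono fun x hx => ?_)
        rw [enorm_mul, ← mul_assoc, ← enorm_norm (Complex.ofReal _), Complex.norm_real, enorm_norm]
        exact mul_le_mul' le_rfl hx
    _ ≤ ∫⁻ y, ‖g y‖ₑ * ((B + 2 ^ k * A) * wt y ^ k) := by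
        refine lintegral_mul_kernel_le ha hg.enorm hK fun y => ?_
        have h1 : ∀ x, wt x ^ k * ‖V x‖ₑ * (wt y + negLog (y - x))
            ≤ (wt x ^ k * ‖V x‖ₑ) * wt y + (2 * wt y) ^ k * (‖V x‖ₑ * negLog (x - y)) := by
          intro x
          rw [mul_add, negLog_sub_comm y x, mul_assoc _ _ (negLog (x - y))]
          refine add_le_add le_rfl ?_
          rcases eq_or_ne (negLog (x - y)) 0 with h0 | h0
          · simp [h0]
          · exact mul_le_mul' (ENNReal.rpow_le_rpow (wt_le_two_mul_of_negLog_ne_zero h0)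
              (by linarith)) le_rfl
        refine (lintegral_mono h1).trans ?_
        have hm : AEMeasurable fun x => ‖V x‖ₑ * negLog (x - y) :=
          hVe.mul (measurable_negLog.comp (measurable_id.sub_const y)).aemeasurable
        rw [lintegral_add_left' (ha.mul_const _), lintegral_mul_const'' _ ha, ← hB,
          lintegral_const_mul'' _ hm]
        · rw [ENNReal.mul_rpow_of_nonneg _ _ (by linarith), add_mul]
          refine add_le_add (mul_le_mul' le_rfl (wt_le_rpow hk y)) ?_
          rw [mul_assoc, mul_assoc, mul_comm A]
          exact mul_le_mul' le_rfl (mul_le_mul' le_rfl (hVA y))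
    _ = (B + 2 ^ k * A) * ∫⁻ x, wt x ^ k * ‖g x‖ₑ := by
        rw [← lintegral_const_mul'' _ (aemeasurable_enorm_of_weighted hg)]
        refine lintegral_congr fun y => ?_
        ring

/-- Iterate with radii growing by `2^{-j}`: the radius never exceeds `ρ + 2`, the costs `4^j 8^{-j}
= 2^{-j}` sum to `2`, and the remainder `8^{-n} b(ρ + 2)` disappears. -/
theorem le_two_mul_of_le_add {b : ℝ → ℝ} {K : ℝ} (hK : 0 ≤ K) (hb : Monotone b)
    (h : ∀ ρ (j : ℕ), b ρ ≤ K * 4 ^ j + b (ρ + (1 / 2) ^ j) / 8) (ρ : ℝ) : b ρ ≤ 2 * K := by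
  have hind : ∀ n : ℕ, b ρ ≤ K * (2 - 2 * (1 / 2) ^ n) + (1 / 8) ^ n * b (ρ + (2 - 2 * (1 / 2) ^ n)) := by
    intro n
    induction n with
    | zero => simp
    | succ n ih =>
      have h1 := h (ρ + (2 - 2 * (1 / 2) ^ n)) n
      have e : ρ + (2 - 2 * (1 / 2) ^ n) + (1 / 2) ^ n = ρ + (2 - 2 * (1 / 2) ^ (n + 1)) := by
        rw [pow_succ]; ring
      rw [e] at h1
      have e2 : (1 / 8 : ℝ) ^ n * (K * 4 ^ n) = K * (1 / 2) ^ n := by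
        rw [mul_left_comm, ← mul_pow]; norm_num
      have h8 : (0 : ℝ) ≤ (1 / 8) ^ n := by positivity
      have h2 := mul_le_mul_of_nonneg_left h1 h8
      rw [mul_add, e2] at h2
      rw [pow_succ (1 / 2 : ℝ), pow_succ (1 / 8 : ℝ)] at *
      linarith
  have hlim : Tendsto (fun n : ℕ => 2 * K + (1 / 8) ^ n * b (ρ + 2)) atTop (𝓝 (2 * K + 0 * b (ρ + 2))) :=
    tendsto_const_nhds.add ((tendsto_pow_atTop_nhds_zero_of_lt_one (by norm_num) (by norm_num)).mul_const _)
  rw [zero_mul, add_zero] at hlim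
  refine ge_of_tendsto' hlim fun n => (hind n).trans ?_
  have hp : (0 : ℝ) ≤ (1 / 2) ^ n := by positivity
  refine add_le_add (by nlinarith) (mul_le_mul_of_nonneg_left (hb ?_) (by positivity))
  linarith

end Bounds

/-! ### A priori integrability of `V f` when `H f` is integrable. -/

section Integrability

variable {V : Plane → ℝ} {f g : Plane → ℂ} {k : ℝ}

theorem enorm_ofReal_mul (a : ℝ) (z : ℂ) : ‖(a : ℂ) * z‖ₑ = ‖a‖ₑ * ‖z‖ₑ := by
  rw [enorm_mul, ← enorm_norm (a : ℂ), Complex.norm_real, enorm_norm]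

/-- The representation formula at scale `2^{-j}`. Averaging over a disc of that radius costs at most
a constant times `4^j`, whatever `p ≥ 1` is. -/
theorem exists_enorm_le_add_lintegral_negLog {p : ℝ≥0∞} (hp : 1 ≤ p) (hpt : p ≠ ⊤) (hf : MemLp f p)
    (h : IsWeakNegLaplacian f g) : ∃ M : ℝ≥0, ∀ j : ℕ, ∀ᵐ x,
      ‖f x‖ₑ ≤ M * 4 ^ j + ∫⁻ y, ‖g y‖ₑ * negLog ((2 : ℝ) ^ j • (y - x)) := by
  obtain ⟨C, hC, hb⟩ := exists_norm_integral_mul_mollifier_le hp hpt hf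
  have hpr : 1 ≤ p.toReal := by
    rw [← ENNReal.toReal_one]; exact (ENNReal.toReal_le_toReal ENNReal.one_ne_top hpt).2 hp
  refine ⟨C.toNNReal, fun j => ?_⟩
  have hR : (0 : ℝ) < ((2 : ℝ) ^ j)⁻¹ := by positivity
  filter_upwards [ae_eq_mollifier_add_parametrix h hR] with x hx
  rw [hx]
  refine (enorm_add_le _ _).trans (add_le_add ?_ ?_)
  · have h1 : (Real.pi * ((2 : ℝ) ^ j)⁻¹ ^ 2) ^ (-(p.toReal)⁻¹) ≤ 4 ^ j := by
      have e : (Real.pi * ((2 : ℝ) ^ j)⁻¹ ^ 2)⁻¹ = Real.pi⁻¹ * 4 ^ j := by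
        rw [mul_inv, inv_pow, inv_inv, ← pow_mul, mul_comm j, pow_mul]; norm_num
      rw [Real.rpow_neg (by positivity), ← Real.inv_rpow (by positivity), e]
      have hp1 : (p.toReal)⁻¹ ≤ 1 := inv_le_one_of_one_le₀ hpr
      have hpi : Real.pi⁻¹ ≤ 1 := inv_le_one_of_one_le₀ (by linarith [Real.pi_gt_three])
      have h4 : (1 : ℝ) ≤ 4 ^ j := one_le_pow₀ (by norm_num)
      calc (Real.pi⁻¹ * 4 ^ j) ^ (p.toReal)⁻¹ ≤ ((4 : ℝ) ^ j) ^ (p.toReal)⁻¹ := by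
            refine Real.rpow_le_rpow (by positivity) ?_ (by positivity)
            exact mul_le_of_le_one_left (by positivity) hpi
        _ ≤ ((4 : ℝ) ^ j) ^ (1 : ℝ) := Real.rpow_le_rpow_of_exponent_le h4 hp1
        _ = 4 ^ j := Real.rpow_one _
    have h2 := (hb _ hR x).trans (mul_le_mul_of_nonneg_left h1 hC)
    rw [← ofReal_norm]
    refine (ENNReal.ofReal_le_ofReal h2).trans_eq ?_
    rw [ENNReal.ofReal_mul hC, ENNReal.ofReal_pow (by norm_num), ENNReal.ofReal_ofNat]
    rfl
  · refine (enorm_integral_le_lintegral_enorm _).trans (lintegral_mono fun y => ?_)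
    rw [enorm_mul]
    refine mul_le_mul' le_rfl ((enorm_parametrix_le hR _).trans_eq ?_)
    rw [inv_inv]

theorem negLog_two_pow_smul_le (j : ℕ) (z : Plane) : negLog ((2 : ℝ) ^ j • z) ≤ negLog z := by
  have := negLog_smul_le_of_le (R := ((2 : ℝ) ^ j)⁻¹) (R' := 1) (by positivity)
    (inv_le_one_of_one_le₀ (one_le_pow₀ (by norm_num))) z
  simpa using this

/-- Local integrability is clear since `V f = H f - g`. Near infinity `V` is small in `L^r`, so
there `V` composed with the local singular integral has norm at most `1/8` on `L¹` and can be
absorbed. As finiteness is only known on bounded discs, the absorption is run on growing discs, as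
in `le_two_mul_of_le_add`. -/
theorem lintegral_potential_mul_lt_top (hV : Integrable V) {r : ℝ} (hr : 1 < r)
    (hVr : ∫⁻ x, ‖V x‖ₑ ^ r < ⊤) {p : ℝ≥0∞} (hp : 1 ≤ p) (hpt : p ≠ ⊤) (hf : MemLp f p)
    (h : IsWeakNegLaplacian f g) (hF : ∫⁻ x, ‖g x + (V x : ℂ) * f x‖ₑ < ⊤) :
    ∫⁻ x, ‖(V x : ℂ) * f x‖ₑ < ⊤ := by
  have hVe : AEMeasurable fun x => ‖V x‖ₑ := hV.1.enorm
  have hfe : AEMeasurable fun x => ‖f x‖ₑ := hf.1.enorm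
  have hVf : ∀ x, ‖(V x : ℂ) * f x‖ₑ ≤ ‖g x + (V x : ℂ) * f x‖ₑ + ‖g x‖ₑ := fun x => by
    have := enorm_sub_le (a := g x + (V x : ℂ) * f x) (b := g x)
    rwa [add_sub_cancel_left] at this
  have hgV : ∀ x, ‖g x‖ₑ ≤ ‖g x + (V x : ℂ) * f x‖ₑ + ‖(V x : ℂ) * f x‖ₑ := fun x => by
    have := enorm_sub_le (a := g x + (V x : ℂ) * f x) (b := (V x : ℂ) * f x)
    rwa [add_sub_cancel_right] at this
  have hFm : AEMeasurable fun x => ‖g x + (V x : ℂ) * f x‖ₑ :=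
    (h.2.1.aestronglyMeasurable.add
      ((Complex.continuous_ofReal.comp_aestronglyMeasurable hV.1).mul hf.1)).enorm
  have hfin : ∀ ρ : ℝ, ∫⁻ x in Metric.ball (0 : Plane) ρ, ‖(V x : ℂ) * f x‖ₑ < ⊤ := by
    intro ρ
    have hg : ∫⁻ x in Metric.closedBall (0 : Plane) ρ, ‖g x‖ₑ < ⊤ :=
      (h.2.1.integrableOn_isCompact (isCompact_closedBall 0 ρ)).2
    calc ∫⁻ x in Metric.ball (0 : Plane) ρ, ‖(V x : ℂ) * f x‖ₑ
        ≤ ∫⁻ x in Metric.ball (0 : Plane) ρ, (‖g x + (V x : ℂ) * f x‖ₑ + ‖g x‖ₑ) :=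
          lintegral_mono hVf
      _ = (∫⁻ x in Metric.ball (0 : Plane) ρ, ‖g x + (V x : ℂ) * f x‖ₑ)
          + ∫⁻ x in Metric.ball (0 : Plane) ρ, ‖g x‖ₑ := lintegral_add_left' hFm.restrict _
      _ ≤ (∫⁻ x, ‖g x + (V x : ℂ) * f x‖ₑ) + ∫⁻ x in Metric.closedBall (0 : Plane) ρ, ‖g x‖ₑ :=
          add_le_add (setLIntegral_le_lintegral _ _)
            (lintegral_mono_set Metric.ball_subset_closedBall)
      _ < ⊤ := ENNReal.add_lt_top.2 ⟨hF, hg⟩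
  obtain ⟨A, hA, hAb⟩ := exists_lintegral_mul_negLog_le hr (a := 1) one_pos
  -- The value `1/8` beats the growth `4^j` of the averaging cost.
  obtain ⟨ε, hε, hεA⟩ : ∃ ε : ℝ≥0∞, 0 < ε ∧ ε ^ (1 / r) * A ≤ 8⁻¹ := by
    have hlim : Tendsto (fun ε : ℝ≥0∞ => ε ^ (1 / r) * A) (𝓝 0) (𝓝 (0 ^ (1 / r) * A)) :=
      ENNReal.Tendsto.mul_const ((ENNReal.continuous_rpow_const).tendsto 0) (Or.inr hA)
    rw [ENNReal.zero_rpow_of_pos (by positivity), zero_mul] at hlim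
    have h2 := (hlim.eventually_le_const (u := 8⁻¹) (by norm_num))
    obtain ⟨ε, h3, h4⟩ := ((h2.filter_mono nhdsWithin_le_nhds).and
      (self_mem_nhdsWithin (s := Set.Ioi (0 : ℝ≥0∞)) (a := 0))).exists
    exact ⟨ε, h4, h3⟩
  obtain ⟨R₀, hR₀⟩ := exists_lintegral_tail_rpow_le hVe hVr hε
  set S : Set Plane := {x | R₀ ≤ ‖x‖} with hS
  have hSm : MeasurableSet S := measurableSet_le measurable_const measurable_norm
  set a : Plane → ℝ≥0∞ := S.indicator fun x => ‖V x‖ₑ with ha_def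
  have ha : AEMeasurable a := hVe.indicator hSm
  have ha1 : ∫⁻ x, a x < ⊤ :=
    lt_of_le_of_lt (lintegral_mono (Set.indicator_le_self _ _)) hV.2
  have hak : ∀ y, ∫⁻ x, a x * negLog (y - x) ≤ 8⁻¹ := by
    intro y
    have h1 := hAb a ha y
    simp only [ENNReal.rpow_one] at h1
    simp_rw [negLog_sub_comm y]
    refine h1.trans (le_trans ?_ hεA)
    refine mul_le_mul' (ENNReal.rpow_le_rpow ?_ (by positivity)) le_rfl
    refine le_trans (le_of_eq ?_) hR₀
    rw [← lintegral_indicator hSm]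
    refine lintegral_congr fun x => ?_
    by_cases hx : x ∈ S
    · simp [ha_def, hx]
    · simp [ha_def, hx, (zero_lt_one.trans hr)]
  -- The part of `|g|` already known to be integrable: `H f`, and `V f` on the disc of radius `R₀`.
  set c : Plane → ℝ≥0∞ := fun x => ‖g x + (V x : ℂ) * f x‖ₑ +
    (Metric.ball (0 : Plane) R₀).indicator (fun x => ‖(V x : ℂ) * f x‖ₑ) x with hc_def
  have hVfm : AEMeasurable fun x => ‖(V x : ℂ) * f x‖ₑ := by
    simp_rw [enorm_ofReal_mul]; exact hVe.mul hfe
  have hcm : AEMeasurable c := hFm.add (hVfm.indicator Metric.isOpen_ball.measurableSet)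
  have hc1 : ∫⁻ x, c x < ⊤ := by
    rw [lintegral_add_left' hFm, lintegral_indicator Metric.isOpen_ball.measurableSet]
    exact ENNReal.add_lt_top.2 ⟨hF, hfin R₀⟩
  have hgc' : ∀ y, ‖g y + (V y : ℂ) * f y‖ₑ + ‖(V y : ℂ) * f y‖ₑ ≤ c y + a y * ‖f y‖ₑ := by
    intro y
    rw [hc_def, add_assoc]
    refine add_le_add le_rfl ?_
    by_cases hy : y ∈ S
    · rw [enorm_ofReal_mul, ha_def, Set.indicator_of_mem hy]
      exact le_add_self
    · have hy' : y ∈ Metric.ball (0 : Plane) R₀ := by simpa [hS] using hy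
      rw [Set.indicator_of_mem hy']
      exact le_self_add
  have hgc : ∀ y, ‖g y‖ₑ ≤ c y + a y * ‖f y‖ₑ := fun y => (hgV y).trans (hgc' y)
  set b : ℝ → ℝ≥0∞ := fun ρ => ∫⁻ x in Metric.ball (0 : Plane) ρ, a x * ‖f x‖ₑ with hb_def
  have hbmono : Monotone b := fun ρ ρ' hρ => lintegral_mono_set (Metric.ball_subset_ball hρ)
  have hbfin : ∀ ρ, b ρ < ⊤ := fun ρ => by
    refine lt_of_le_of_lt (lintegral_mono fun x => ?_) (hfin ρ)
    rw [enorm_ofReal_mul]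
    exact mul_le_mul' (Set.indicator_le_self _ _ x) le_rfl
  obtain ⟨M, hM⟩ := exists_enorm_le_add_lintegral_negLog hp hpt hf h
  set K : ℝ≥0∞ := M * (∫⁻ x, a x) + 8⁻¹ * ∫⁻ x, c x with hK_def
  have hKfin : K < ⊤ := by finiteness
  -- At scale `2^{-j}` the value of `f` inside radius `ρ` only involves `g` inside radius `ρ +
  -- 2^{-j}`.
  have hstep : ∀ ρ (j : ℕ), b ρ ≤ K * 4 ^ j + 8⁻¹ * b (ρ + (1 / 2) ^ j) := by
    intro ρ j
    set B' := Metric.ball (0 : Plane) (ρ + (1 / 2) ^ j) with hB'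
    set h' : Plane → ℝ≥0∞ := fun y => c y + B'.indicator (fun y => a y * ‖f y‖ₑ) y with hh'
    have hafm : AEMeasurable fun y => a y * ‖f y‖ₑ := ha.mul hfe
    have hh'm : AEMeasurable h' := hcm.add (hafm.indicator Metric.isOpen_ball.measurableSet)
    have hpt' : ∀ x ∈ Metric.ball (0 : Plane) ρ, ∀ y,
        ‖g y‖ₑ * negLog ((2 : ℝ) ^ j • (y - x)) ≤ h' y * negLog (y - x) := by
      intro x hx y
      by_cases hy : y ∈ B'
      · refine mul_le_mul' ?_ (negLog_two_pow_smul_le j _)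
        simp only [hh', Set.indicator_of_mem hy]
        exact hgc y
      · have hyx : ((2 : ℝ) ^ j)⁻¹ ≤ ‖y - x‖ := by
          have h1 : ‖x‖ < ρ := by simpa using hx
          have h2 : ρ + (1 / 2) ^ j ≤ ‖y‖ := by simpa [hB'] using hy
          have h3 := norm_sub_norm_le y x
          rw [one_div, inv_pow] at h2
          linarith
        have := negLog_smul_eq_zero (R := ((2 : ℝ) ^ j)⁻¹) (by positivity) hyx
        rw [inv_inv] at this
        simp [this]
    calc b ρ ≤ ∫⁻ x in Metric.ball (0 : Plane) ρ, a x * (M * 4 ^ j + ∫⁻ y, h' y * negLog (y - x)) := by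
          refine lintegral_mono_ae ?_
          filter_upwards [ae_restrict_of_ae (hM j), ae_restrict_mem Metric.isOpen_ball.measurableSet]
            with x hx hxρ
          exact mul_le_mul' le_rfl (hx.trans (add_le_add le_rfl (lintegral_mono (hpt' x hxρ))))
      _ ≤ ∫⁻ x, a x * (M * 4 ^ j + ∫⁻ y, h' y * negLog (y - x)) := setLIntegral_le_lintegral _ _
      _ = (∫⁻ x, a x) * (M * 4 ^ j) + ∫⁻ x, a x * ∫⁻ y, h' y * negLog (y - x) := by
          simp_rw [mul_add]
          rw [lintegral_add_left' (ha.mul_const _), lintegral_mul_const'' _ ha]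
      _ ≤ (∫⁻ x, a x) * (M * 4 ^ j) + ∫⁻ y, h' y * 8⁻¹ :=
          add_le_add le_rfl (lintegral_mul_kernel_le ha hh'm measurable_negLog_sub hak)
      _ = (∫⁻ x, a x) * (M * 4 ^ j) + 8⁻¹ * ((∫⁻ y, c y) + b (ρ + (1 / 2) ^ j)) := by
          rw [lintegral_mul_const'' _ hh'm, mul_comm _ (8⁻¹ : ℝ≥0∞), lintegral_add_left' hcm,
            lintegral_indicator Metric.isOpen_ball.measurableSet]
      _ ≤ K * 4 ^ j + 8⁻¹ * b (ρ + (1 / 2) ^ j) := by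
          rw [mul_add, ← add_assoc, hK_def, add_mul]
          refine add_le_add (add_le_add (le_of_eq (by ring)) ?_) le_rfl
          exact le_mul_of_one_le_right zero_le (one_le_pow₀ (by norm_num))
  have hbound : ∀ ρ, b ρ ≤ 2 * K := by
    intro ρ
    have h1 := le_two_mul_of_le_add (b := fun ρ => (b ρ).toReal) (K := K.toReal) ENNReal.toReal_nonneg
      (fun ρ ρ' hρ => ENNReal.toReal_mono (hbfin _).ne (hbmono hρ)) (fun ρ j => ?_) ρ
    · rw [← ENNReal.toReal_le_toReal (hbfin ρ).ne (by finiteness), ENNReal.toReal_mul]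
      simpa using h1
    · have h2 := ENNReal.toReal_mono (by have := hbfin (ρ + (1 / 2) ^ j); finiteness) (hstep ρ j)
      rw [ENNReal.toReal_add (by finiteness) (by have := hbfin (ρ + (1 / 2) ^ j); finiteness),
        ENNReal.toReal_mul, ENNReal.toReal_mul] at h2
      simp only [ENNReal.toReal_pow, ENNReal.toReal_inv, ENNReal.toReal_ofNat] at h2
      linarith
  have htot : ∫⁻ x, a x * ‖f x‖ₑ ≤ 2 * K := by
    have h1 := setLIntegral_iUnion_of_directed (μ := volume) (fun x => a x * ‖f x‖ₑ)
      (s := fun n : ℕ => Metric.ball (0 : Plane) n)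
      (Monotone.directed_le fun m n hmn => Metric.ball_subset_ball (by exact_mod_cast hmn))
    rw [Metric.iUnion_ball_nat, setLIntegral_univ] at h1
    rw [h1]
    exact iSup_le fun n => hbound n
  have haf1 : ∫⁻ x, a x * ‖f x‖ₑ < ⊤ := lt_of_le_of_lt htot (by finiteness)
  refine lt_of_le_of_lt (lintegral_mono fun x => le_add_self.trans (hgc' x)) ?_
  rw [lintegral_add_left' hcm]
  exact ENNReal.add_lt_top.2 ⟨hc1, haf1⟩

end Integrability

/-! ### The factorization of the potential through `v` and `U`. -/

section RootAbs

variable {V : Plane → ℝ}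

theorem rootAbs_nonneg (V : Plane → ℝ) (x : Plane) : 0 ≤ rootAbs V x := Real.sqrt_nonneg _

theorem rootAbs_mul_self (V : Plane → ℝ) (x : Plane) : rootAbs V x * rootAbs V x = |V x| :=
  Real.mul_self_sqrt (abs_nonneg _)

theorem enorm_rootAbs_sq (V : Plane → ℝ) (x : Plane) : ‖rootAbs V x‖ₑ ^ 2 = ‖V x‖ₑ := by
  rw [sq, ← enorm_mul, rootAbs_mul_self, Real.enorm_abs]

theorem sgnPot_mul_self (V : Plane → ℝ) (x : Plane) : sgnPot V x * sgnPot V x = 1 := by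
  unfold sgnPot; split_ifs <;> norm_num

theorem sgnPot_mul_abs (V : Plane → ℝ) (x : Plane) : sgnPot V x * |V x| = V x := by
  unfold sgnPot
  split_ifs with h
  · rw [abs_of_neg h]; ring
  · rw [abs_of_nonneg (not_lt.1 h), one_mul]

theorem enorm_sgnPot (V : Plane → ℝ) (x : Plane) : ‖sgnPot V x‖ₑ = 1 := by
  unfold sgnPot; split_ifs <;> simp

theorem aemeasurable_rootAbs (hV : AEMeasurable V) : AEMeasurable (rootAbs V) := by
  have : rootAbs V = fun x => Real.sqrt ‖V x‖ := rfl
  rw [this]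
  exact hV.norm.sqrt

theorem aemeasurable_sgnPot (hV : AEMeasurable V) : AEMeasurable (sgnPot V) := by
  have h : Measurable fun t : ℝ => if t < 0 then (-1 : ℝ) else 1 :=
    Measurable.ite measurableSet_Iio measurable_const measurable_const
  exact h.comp_aemeasurable hV

theorem memLp_rootAbs (hV : Integrable V) : MemLp (fun x => (rootAbs V x : ℂ)) 2 volume := by
  refine ⟨(Complex.measurable_ofReal.comp_aemeasurable
    (aemeasurable_rootAbs hV.1.aemeasurable)).aestronglyMeasurable, ?_⟩
  rw [eLpNorm_lt_top_iff_lintegral_rpow_enorm_lt_top two_ne_zero ENNReal.ofNat_ne_top]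
  refine lt_of_le_of_lt (lintegral_mono fun x => ?_) hV.2
  rw [← enorm_norm (Complex.ofReal _), Complex.norm_real, enorm_norm]
  simp [enorm_rootAbs_sq]

theorem coeFn_rootAbsL2 (hV : Integrable V) :
    (rootAbsL2 V : Plane → ℂ) =ᵐ[volume] fun x => (rootAbs V x : ℂ) := by
  rw [rootAbsL2, dif_pos (memLp_rootAbs hV)]
  exact MemLp.coeFn_toLp _

theorem L2.enorm_sq_eq (φ : L2) : ‖φ‖ₑ ^ 2 = ∫⁻ x, ‖φ x‖ₑ ^ 2 := by
  rw [Lp.enorm_def, eLpNorm_eq_lintegral_rpow_enorm_toReal two_ne_zero ENNReal.ofNat_ne_top]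
  simp only [ENNReal.toReal_ofNat, ENNReal.rpow_two]
  rw [← ENNReal.rpow_natCast, ← ENNReal.rpow_mul]
  norm_num

theorem memLp_two_of_lintegral {h : Plane → ℂ} (hm : AEStronglyMeasurable h)
    (hfin : ∫⁻ x, ‖h x‖ₑ ^ 2 < ⊤) : MemLp h 2 volume := by
  refine ⟨hm, ?_⟩
  rw [eLpNorm_lt_top_iff_lintegral_rpow_enorm_lt_top two_ne_zero ENNReal.ofNat_ne_top]
  simpa using hfin

end RootAbs

/-! ### `L²` bounds for `v f` and for `v G₀ F`. -/

section Weighted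

variable {V : Plane → ℝ} {f g : Plane → ℂ} {k : ℝ}

/-- Cauchy–Schwarz for `V f = (v)(v f)` up to sign. All the weight goes on one factor `v`, which
explains the exponent `2k` in the hypothesis on `V`. -/
theorem lintegral_weighted_mul_le (hVm : AEMeasurable V) (hf : AEStronglyMeasurable f) (k : ℝ) :
    ∫⁻ x, wt x ^ k * ‖(V x : ℂ) * f x‖ₑ
      ≤ (∫⁻ x, wt x ^ (2 * k) * ‖V x‖ₑ) ^ (1 / 2 : ℝ) * (∫⁻ x, ‖V x‖ₑ * ‖f x‖ₑ ^ 2) ^ (1 / 2 : ℝ) := by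
  have hr : AEMeasurable fun x => ‖rootAbs V x‖ₑ := (aemeasurable_rootAbs hVm).enorm
  have hfe : AEMeasurable fun x => ‖f x‖ₑ := hf.enorm
  have hc := ENNReal.lintegral_mul_le_Lp_mul_Lq volume Real.HolderConjugate.two_two
    (f := fun x => wt x ^ k * ‖rootAbs V x‖ₑ) (g := fun x => ‖rootAbs V x‖ₑ * ‖f x‖ₑ)
    (by fun_prop) (by fun_prop)
  refine le_trans (le_of_eq (lintegral_congr fun x => ?_)) (hc.trans (le_of_eq ?_))
  · rw [Pi.mul_apply, enorm_ofReal_mul, ← enorm_rootAbs_sq V x]; ring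
  · congr 3 <;> ext x
    · rw [ENNReal.mul_rpow_of_nonneg _ _ (by norm_num), ENNReal.rpow_two ‖rootAbs V x‖ₑ,
        enorm_rootAbs_sq, ← ENNReal.rpow_mul, mul_comm k]
    · rw [ENNReal.rpow_two, mul_pow, enorm_rootAbs_sq]

/-- At scale one, `|f|` is at most a constant plus a local singular integral of `|g|`; a Schur bound
with `V ∈ L^r` handles the latter. Only finiteness is obtained here, and it places `U v f` in `L²`.
-/
theorem lintegral_potential_mul_sq_lt_top (hV : Integrable V) {r : ℝ} (hr : 1 < r)
    (hVr : ∫⁻ x, ‖V x‖ₑ ^ r < ⊤) {p : ℝ≥0∞} (hp : 1 ≤ p) (hpt : p ≠ ⊤) (hf : MemLp f p)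
    (h : IsWeakNegLaplacian f g) (hg : ∫⁻ x, ‖g x‖ₑ < ⊤) :
    ∫⁻ x, ‖V x‖ₑ * ‖f x‖ₑ ^ 2 < ⊤ := by
  obtain ⟨M, hM⟩ := exists_enorm_le_add_lintegral_negLog hp hpt hf h
  obtain ⟨A, hA, hAb⟩ := exists_lintegral_mul_negLog_le hr (a := 2) two_pos
  have hVe : AEMeasurable fun x => ‖V x‖ₑ := hV.1.enorm
  have hgm : AEMeasurable fun x => ‖g x‖ₑ := h.2.1.aestronglyMeasurable.enorm
  have hVr' : (∫⁻ x, ‖V x‖ₑ ^ r) ^ (1 / r) ≠ ⊤ :=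
    ENNReal.rpow_ne_top_of_nonneg (by positivity) hVr.ne
  have hS := lintegral_mul_sq_kernel_le hVe hgm measurable_negLog_sub
    (E := (∫⁻ x, ‖V x‖ₑ ^ r) ^ (1 / r) * A) fun y => by
      have := hAb _ hVe y
      simp_rw [ENNReal.rpow_two] at this
      simp_rw [negLog_sub_comm y]
      exact this
  have h1 : ∀ᵐ x, ‖V x‖ₑ * ‖f x‖ₑ ^ 2
      ≤ 2 * M ^ 2 * ‖V x‖ₑ + 2 * (‖V x‖ₑ * (∫⁻ y, ‖g y‖ₑ * negLog (y - x)) ^ 2) := by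
    filter_upwards [hM 0] with x hx
    simp only [pow_zero, mul_one, one_smul] at hx
    have h2 : (∀ a b : ℝ≥0∞, (a + b) ^ 2 ≤ 2 * a ^ 2 + 2 * b ^ 2) := fun a b => by
      have := ENNReal.rpow_add_le_mul_rpow_add_rpow a b (p := 2) one_le_two
      norm_num at this
      rw [← mul_add]
      exact this
    refine (mul_le_mul' le_rfl ((pow_le_pow_left' hx 2).trans (h2 _ _))).trans (le_of_eq ?_)
    ring
  refine lt_of_le_of_lt (lintegral_mono_ae h1) ?_
  rw [lintegral_add_left' (hVe.const_mul _), lintegral_const_mul'' _ hVe,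
    lintegral_const_mul' _ _ (by finiteness)]
  refine ENNReal.add_lt_top.2 ⟨ENNReal.mul_lt_top (by finiteness) hV.2, ?_⟩
  exact ENNReal.mul_lt_top (by finiteness) (lt_of_le_of_lt hS (by finiteness))

/-- `‖v G₀ F‖_{L²} ≤ C ‖(1 + log₊ |x|) F‖_{L¹}` in squared form. -/
theorem exists_lintegral_mul_green_sq_le (hV : AEMeasurable V)
    (hV2 : ∫⁻ x, wt x ^ (2 : ℝ) * ‖V x‖ₑ < ⊤) {r : ℝ} (hr : 1 < r) (hVr : ∫⁻ x, ‖V x‖ₑ ^ r < ⊤) :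
    ∃ E : ℝ≥0∞, E ≠ ⊤ ∧ ∀ F : Plane → ℂ, AEStronglyMeasurable F →
      ∫⁻ x, ‖V x‖ₑ * (∫⁻ y, ‖F y‖ₑ * ‖green x y‖ₑ) ^ 2 ≤ E * (∫⁻ y, wt y * ‖F y‖ₑ) ^ 2 := by
  obtain ⟨A, hA, hAb⟩ := exists_lintegral_mul_negLog_le hr (a := 2) two_pos
  have hVe : AEMeasurable fun x => ‖V x‖ₑ := hV.enorm
  have hVr' : (∫⁻ x, ‖V x‖ₑ ^ r) ^ (1 / r) ≠ ⊤ :=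
    ENNReal.rpow_ne_top_of_nonneg (by positivity) hVr.ne
  set W := ∫⁻ x, wt x ^ (2 : ℝ) * ‖V x‖ₑ with hW
  refine ⟨2 * W + 2 * ((∫⁻ x, ‖V x‖ₑ ^ r) ^ (1 / r) * A), by finiteness, fun F hF => ?_⟩
  have hK : Measurable (Function.uncurry fun x y : Plane => wt x + negLog (y - x)) :=
    (measurable_wt.comp measurable_fst).add measurable_negLog_sub
  have hFe : AEMeasurable fun y => wt y * ‖F y‖ₑ := by
    have := hF.enorm
    fun_prop
  refine le_trans (lintegral_mono fun x => mul_le_mul' le_rfl (pow_le_pow_left'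
    (lintegral_mono fun y => ?_) 2)) (lintegral_mul_sq_kernel_le hVe hFe hK fun y => ?_)
  · rw [mul_comm (wt y), mul_assoc]
    refine mul_le_mul' le_rfl ((enorm_green_le x y).trans ?_)
    rw [mul_add, mul_comm (wt x)]
    exact add_le_add le_rfl (le_mul_of_one_le_left zero_le (one_le_wt y))
  · have hm1 : AEMeasurable fun x => wt x ^ (2 : ℝ) * ‖V x‖ₑ := by fun_prop
    have h1 : ∀ x, ‖V x‖ₑ * (wt x + negLog (y - x)) ^ 2
        ≤ 2 * (wt x ^ (2 : ℝ) * ‖V x‖ₑ) + 2 * (‖V x‖ₑ * negLog (x - y) ^ (2 : ℝ)) := fun x => by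
      have := ENNReal.rpow_add_le_mul_rpow_add_rpow (wt x) (negLog (y - x)) (p := 2) one_le_two
      norm_num at this
      refine (mul_le_mul' le_rfl this).trans (le_of_eq ?_)
      rw [negLog_sub_comm y, ENNReal.rpow_two, ENNReal.rpow_two]
      ring
    refine (lintegral_mono h1).trans ?_
    rw [lintegral_add_left' (hm1.const_mul _), lintegral_const_mul'' _ hm1,
      lintegral_const_mul' _ _ (by finiteness)]
    exact add_le_add le_rfl (mul_le_mul' le_rfl (hAb _ hVe y))

theorem ae_integrable_mul_green (hg : AEStronglyMeasurable g) (hw : ∫⁻ y, wt y * ‖g y‖ₑ < ⊤) :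
    ∀ᵐ x, Integrable fun y => g y * ((green x y : ℝ) : ℂ) := by
  have hgi := integrable_of_wt_mul hg hw
  filter_upwards [ae_lintegral_mul_negLog_lt_top hgi.locallyIntegrable one_pos] with x hx
  have hm : Measurable fun y => ((green x y : ℝ) : ℂ) := by unfold green; fun_prop
  refine ⟨hg.mul hm.aestronglyMeasurable, ?_⟩
  have h1 : ∀ y, ‖g y * ((green x y : ℝ) : ℂ)‖ₑ
      ≤ wt x * (wt y * ‖g y‖ₑ) + ‖g y‖ₑ * negLog ((1 : ℝ)⁻¹ • (y - x)) := fun y => by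
    rw [mul_comm, enorm_ofReal_mul, inv_one, one_smul]
    refine (mul_le_mul' (enorm_green_le x y) le_rfl).trans (le_of_eq ?_)
    ring
  refine lt_of_le_of_lt (lintegral_mono h1) ?_
  have hm1 : AEMeasurable fun y => wt y * ‖g y‖ₑ := by
    have := hg.enorm
    fun_prop
  rw [lintegral_add_left' (hm1.const_mul _), lintegral_const_mul'' _ hm1]
  exact ENNReal.add_lt_top.2 ⟨ENNReal.mul_lt_top (wt_ne_top x).lt_top hw, hx⟩

end Weighted

/-! ### The weighted `L¹` equivalence. -/

section PartOne

variable {V : Plane → ℝ} {f g : Plane → ℂ} {k : ℝ}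

/-- With `φ = U v f` and `v U v = V`, this computes the component of `φ` along `v`. -/
theorem norm_inner_rootAbsL2 (hV : Integrable V) {φ : L2}
    (hφ : φ =ᵐ[volume] fun x => (sgnPot V x : ℂ) * (rootAbs V x : ℂ) * f x) :
    ⟪rootAbsL2 V, φ⟫_ℂ = ∫ x, (V x : ℂ) * f x := by
  rw [L2.inner_def]
  refine integral_congr_ae ?_
  filter_upwards [coeFn_rootAbsL2 hV, hφ] with x hx hx'
  rw [hx, hx', RCLike.inner_apply, Complex.conj_ofReal]
  have : (V x : ℂ) = sgnPot V x * (rootAbs V x * rootAbs V x) := by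
    rw [← Complex.ofReal_mul, ← Complex.ofReal_mul, rootAbs_mul_self, sgnPot_mul_abs]
  rw [this]
  ring

/-- If `f = G₀ g` then `φ = U v f` satisfies `(U + v G₀ v) φ = v G₀ (g + V f)`. -/
theorem ae_eq_thresholdOp {T : L2 →L[ℂ] L2} (hT : IsThresholdOp V T) {φ : L2}
    (hφ : φ =ᵐ[volume] fun x => (sgnPot V x : ℂ) * (rootAbs V x : ℂ) * f x)
    (hf : ∀ᵐ x, Integrable (fun y => g y * ((green x y : ℝ) : ℂ)) ∧
      f x = ∫ y, g y * ((green x y : ℝ) : ℂ))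
    (hF : ∀ᵐ x, Integrable (fun y => (g y + (V y : ℂ) * f y) * ((green x y : ℝ) : ℂ))) :
    T φ =ᵐ[volume] fun x => (rootAbs V x : ℂ) *
      ∫ y, (g y + (V y : ℂ) * f y) * ((green x y : ℝ) : ℂ) := by
  filter_upwards [hT φ, hφ, hf, hF] with x hTx hφx hfx hFx
  have e1 : ∫ y, ((green x y * rootAbs V y : ℝ) : ℂ) * φ y
      = ∫ y, ((V y : ℂ) * f y) * ((green x y : ℝ) : ℂ) := by
    refine integral_congr_ae ?_
    filter_upwards [hφ] with y hy
    have : (V y : ℂ) = sgnPot V y * (rootAbs V y * rootAbs V y) := by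
      rw [← Complex.ofReal_mul, ← Complex.ofReal_mul, rootAbs_mul_self, sgnPot_mul_abs]
    rw [hy, this]
    push_cast
    ring
  have e2 : ∫ y, ((V y : ℂ) * f y) * ((green x y : ℝ) : ℂ)
      = (∫ y, (g y + (V y : ℂ) * f y) * ((green x y : ℝ) : ℂ)) - f x := by
    rw [hfx.2, ← integral_sub hFx hfx.1]
    refine integral_congr_ae (Eventually.of_forall fun y => ?_)
    ring
  have hs : (sgnPot V x : ℂ) * sgnPot V x = 1 := by
    rw [← Complex.ofReal_mul, sgnPot_mul_self, Complex.ofReal_one]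
  rw [hTx, hφx, e1, e2]
  linear_combination (rootAbs V x : ℂ) * f x * hs

/-- The weighted `L¹` estimates between `-Δ f` and `H f`. -/
theorem exists_weightedL1Norm_equiv (hk : 1 ≤ k)
    (hV : Integrable (fun x => logWeight x ^ (2 * k) * V x)) {r : ℝ} (hr : 1 < r)
    (hVr : ∫⁻ x, ‖V x‖ₑ ^ r < ⊤) (hreg : ZeroIsRegular V) :
    ∃ C : ℝ≥0, ∀ (p : ℝ≥0∞) (f g : Plane → ℂ), 1 ≤ p → p ≠ ⊤ → MemLp f p volume →
      IsWeakNegLaplacian f g →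
        weightedL1Norm k (fun x => g x + (V x : ℂ) * f x) ≤ C * weightedL1Norm k g ∧
        weightedL1Norm k g ≤ C * weightedL1Norm k (fun x => g x + (V x : ℂ) * f x) := by
  have hVi : Integrable V := integrable_of_weighted (by linarith) hV
  have hVm := hVi.1.aemeasurable
  have hV2k := lintegral_wt_rpow_mul_lt_top hV
  have hVk : ∫⁻ x, wt x ^ k * ‖V x‖ₑ < ⊤ := lintegral_wt_rpow_mul_lt_top_of_le hV2k (by linarith)
  have hV2 : ∫⁻ x, wt x ^ (2 : ℝ) * ‖V x‖ₑ < ⊤ :=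
    lintegral_wt_rpow_mul_lt_top_of_le hV2k (by linarith)
  obtain ⟨A, hA, hAb⟩ := exists_lintegral_mul_negLog_le hr (a := 1) one_pos
  have hVr' : (∫⁻ x, ‖V x‖ₑ ^ r) ^ (1 / r) ≠ ⊤ :=
    ENNReal.rpow_ne_top_of_nonneg (by positivity) hVr.ne
  obtain ⟨C₁, hC₁, h₁⟩ := exists_lintegral_weighted_le hVm hk hVk
    (A := (∫⁻ x, ‖V x‖ₑ ^ r) ^ (1 / r) * A) (by finiteness) fun y => by
      have := hAb _ hVm.enorm y
      simpa only [ENNReal.rpow_one] using this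
  obtain ⟨E, hE, hEb⟩ := exists_lintegral_mul_green_sq_le hVm hV2 hr hVr
  obtain ⟨T, hT, hTu⟩ := hreg
  obtain ⟨D, hD, hDb⟩ := exists_norm_le_of_isUnit_compression (v := rootAbsL2 V) (K := QL2 V) rfl hTu
  set B := (∫⁻ x, wt x ^ (2 * k) * ‖V x‖ₑ) ^ (1 / 2 : ℝ) with hB
  have hBf : B ≠ ⊤ := ENNReal.rpow_ne_top_of_nonneg (by norm_num) hV2k.ne
  set C₂ : ℝ≥0∞ := B * (ENNReal.ofReal D * (E ^ (1 / 2 : ℝ) + 1)) with hC₂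
  have hC₂f : C₂ ≠ ⊤ := by finiteness
  refine ⟨(1 + C₁ + C₂).toNNReal, fun p f g hp hpt hf h => ?_⟩
  rw [ENNReal.coe_toNNReal (by finiteness)]
  simp only [weightedL1Norm_eq]
  have hgm := h.2.1.aestronglyMeasurable
  have hVfm : AEStronglyMeasurable fun x => (V x : ℂ) * f x :=
    (Complex.continuous_ofReal.comp_aestronglyMeasurable hVi.1).mul hf.1
  have hFm : AEStronglyMeasurable fun x => g x + (V x : ℂ) * f x := hgm.add hVfm
  have hle : ∀ h₁ : Plane → ℂ, ∫⁻ y, wt y * ‖h₁ y‖ₑ ≤ ∫⁻ y, wt y ^ k * ‖h₁ y‖ₑ := fun h₁ =>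
    lintegral_mono fun y => mul_le_mul' (wt_le_rpow hk y) le_rfl
  have hsplit : ∀ {h₁ h₂ h₃ : Plane → ℂ}, AEStronglyMeasurable h₂ →
      (∀ x, ‖h₁ x‖ₑ ≤ ‖h₂ x‖ₑ + ‖h₃ x‖ₑ) →
      ∫⁻ x, wt x ^ k * ‖h₁ x‖ₑ ≤ (∫⁻ x, wt x ^ k * ‖h₂ x‖ₑ) + ∫⁻ x, wt x ^ k * ‖h₃ x‖ₑ := by
    intro h₁ h₂ h₃ hm hb
    rw [← lintegral_add_left' (aemeasurable_enorm_of_weighted hm)]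
    refine lintegral_mono fun x => ?_
    rw [← mul_add]
    exact mul_le_mul' le_rfl (hb x)
  have hgV : ∀ x, ‖g x‖ₑ ≤ ‖g x + (V x : ℂ) * f x‖ₑ + ‖(V x : ℂ) * f x‖ₑ := fun x => by
    have := enorm_sub_le (a := g x + (V x : ℂ) * f x) (b := (V x : ℂ) * f x)
    rwa [add_sub_cancel_right] at this
  constructor
  · by_cases hfin : ∫⁻ x, wt x ^ k * ‖g x‖ₑ = ⊤
    · rw [hfin, ENNReal.mul_top (by simp)]
      exact le_top
    have hw : ∫⁻ y, wt y * ‖g y‖ₑ < ⊤ := (hle g).trans_lt (Ne.lt_top hfin)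
    obtain ⟨h0, hgr⟩ := integral_eq_zero_and_ae_eq_green hp hpt hf h hw
    have hb := h₁ f g hgm (hgr.mono fun x hx =>
      enorm_le_of_eq_green (integrable_of_wt_mul hgm hw) h0 hx.1 hx.2)
    refine (hsplit hgm fun x => enorm_add_le _ _).trans ((add_le_add le_rfl hb).trans ?_)
    rw [← one_add_mul]
    exact mul_le_mul' le_self_add le_rfl
  · set I := ∫⁻ x, wt x ^ k * ‖g x + (V x : ℂ) * f x‖ₑ with hI
    by_cases hfin : I = ⊤
    · rw [hfin, ENNReal.mul_top (by simp)]
      exact le_top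
    have hIlt : I < ⊤ := Ne.lt_top hfin
    have hwF : ∫⁻ y, wt y * ‖g y + (V y : ℂ) * f y‖ₑ ≤ I := hle _
    have hF1 : ∫⁻ y, ‖g y + (V y : ℂ) * f y‖ₑ ≤ I :=
      (lintegral_mono fun y => le_mul_of_one_le_left zero_le (one_le_wt y)).trans hwF
    -- Qualitative chain: `H f ∈ L¹` gives `V f ∈ L¹`, so `g ∈ L¹`, so `v f ∈ L²`. Then `V f` and
    -- `g` lie in the weighted space, and the Green representation is available.
    have hVf1 := lintegral_potential_mul_lt_top hVi hr hVr hp hpt hf h (hF1.trans_lt hIlt)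
    have hg1 : ∫⁻ x, ‖g x‖ₑ < ⊤ := by
      refine lt_of_le_of_lt (lintegral_mono hgV) ?_
      rw [lintegral_add_left' hFm.enorm]
      exact ENNReal.add_lt_top.2 ⟨hF1.trans_lt hIlt, hVf1⟩
    have hVf2 := lintegral_potential_mul_sq_lt_top hVi hr hVr hp hpt hf h hg1
    have hCS := lintegral_weighted_mul_le hVm hf.1 k
    rw [← hB] at hCS
    have hVfk : ∫⁻ x, wt x ^ k * ‖(V x : ℂ) * f x‖ₑ < ⊤ :=
      hCS.trans_lt (ENNReal.mul_lt_top hBf.lt_top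
        (ENNReal.rpow_lt_top_of_nonneg (by norm_num) hVf2.ne))
    have hwg : ∫⁻ y, wt y * ‖g y‖ₑ < ⊤ :=
      (hle g).trans_lt ((hsplit hFm hgV).trans_lt (ENNReal.add_lt_top.2 ⟨hIlt, hVfk⟩))
    obtain ⟨h0, hgr⟩ := integral_eq_zero_and_ae_eq_green hp hpt hf h hwg
    have hφm : AEStronglyMeasurable fun x => (sgnPot V x : ℂ) * (rootAbs V x : ℂ) * f x :=
      ((Complex.measurable_ofReal.comp_aemeasurable (aemeasurable_sgnPot hVm)).mul
        (Complex.measurable_ofReal.comp_aemeasurable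
          (aemeasurable_rootAbs hVm))).aestronglyMeasurable.mul hf.1
    have hφe : ∀ x, ‖(sgnPot V x : ℂ) * (rootAbs V x : ℂ) * f x‖ₑ ^ 2 = ‖V x‖ₑ * ‖f x‖ₑ ^ 2 := by
      intro x
      rw [mul_assoc, enorm_ofReal_mul, enorm_ofReal_mul, enorm_sgnPot, one_mul, mul_pow,
        enorm_rootAbs_sq]
    have hφL : MemLp (fun x => (sgnPot V x : ℂ) * (rootAbs V x : ℂ) * f x) 2 volume :=
      memLp_two_of_lintegral hφm (by simpa only [hφe] using hVf2)
    set φ : L2 := hφL.toLp with hφ_def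
    have hφ : φ =ᵐ[volume] fun x => (sgnPot V x : ℂ) * (rootAbs V x : ℂ) * f x := hφL.coeFn_toLp
    have hφn : ‖φ‖ₑ ^ 2 = ∫⁻ x, ‖V x‖ₑ * ‖f x‖ₑ ^ 2 := by
      rw [L2.enorm_sq_eq]
      refine lintegral_congr_ae ?_
      filter_upwards [hφ] with x hx
      rw [hx, hφe]
    have hTφ := ae_eq_thresholdOp hT hφ hgr (ae_integrable_mul_green hFm (hwF.trans_lt hIlt))
    have hTn : ‖T φ‖ₑ ≤ E ^ (1 / 2 : ℝ) * I := by
      have h2 : ‖T φ‖ₑ ^ 2 ≤ E * I ^ 2 := by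
        rw [L2.enorm_sq_eq]
        calc ∫⁻ x, ‖T φ x‖ₑ ^ 2
            ≤ ∫⁻ x, ‖V x‖ₑ * (∫⁻ y, ‖g y + (V y : ℂ) * f y‖ₑ * ‖green x y‖ₑ) ^ 2 := by
              refine lintegral_mono_ae ?_
              filter_upwards [hTφ] with x hx
              rw [hx, enorm_ofReal_mul, mul_pow, enorm_rootAbs_sq]
              refine mul_le_mul' le_rfl (pow_le_pow_left' ?_ 2)
              refine (enorm_integral_le_lintegral_enorm _).trans (lintegral_mono fun y => ?_)
              rw [mul_comm, enorm_ofReal_mul, mul_comm]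
          _ ≤ E * I ^ 2 := (hEb _ hFm).trans (mul_le_mul' le_rfl (pow_le_pow_left' hwF 2))
      have h3 := ENNReal.rpow_le_rpow h2 (z := 1 / 2) (by norm_num)
      rw [ENNReal.mul_rpow_of_nonneg _ _ (by norm_num), ← ENNReal.rpow_natCast,
        ← ENNReal.rpow_natCast, ← ENNReal.rpow_mul, ← ENNReal.rpow_mul] at h3
      norm_num at h3
      simpa using h3
    -- `⟪v, φ⟫ = ∫ V f`, which equals `∫ H f` because `g` has mean zero.
    have hvφ : ‖⟪rootAbsL2 V, φ⟫_ℂ‖ₑ ≤ I := by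
      have hgi := integrable_of_wt_mul hgm hwg
      have hFi : Integrable fun x => g x + (V x : ℂ) * f x := ⟨hFm, hF1.trans_lt hIlt⟩
      have e : ∫ x, (V x : ℂ) * f x = ∫ x, (g x + (V x : ℂ) * f x) := by
        rw [integral_add hgi ⟨hVfm, hVf1⟩, h0, zero_add]
      rw [norm_inner_rootAbsL2 hVi hφ, e]
      exact (enorm_integral_le_lintegral_enorm _).trans hF1
    -- Regularity of zero bounds `φ` by `T φ = v G₀ (H f)` and `⟪v, φ⟫`, hence by `H f` alone.
    have hφb : ‖φ‖ₑ ≤ ENNReal.ofReal D * (E ^ (1 / 2 : ℝ) + 1) * I := by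
      have h1 := hDb φ
      have h2 := ((QL2 V).norm_orthogonalProjectionOnto_apply_le (T φ))
      have h3 : ‖φ‖ ≤ D * (‖T φ‖ + ‖⟪rootAbsL2 V, φ⟫_ℂ‖) :=
        h1.trans (by gcongr)
      have h4 := ENNReal.ofReal_le_ofReal h3
      rw [ENNReal.ofReal_mul hD.le, ENNReal.ofReal_add (norm_nonneg _) (norm_nonneg _), ofReal_norm,
        ofReal_norm, ofReal_norm] at h4
      refine h4.trans ?_
      rw [mul_assoc, add_mul, one_mul]
      exact mul_le_mul' le_rfl (add_le_add hTn hvφ)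
    have hsq : (∫⁻ x, ‖V x‖ₑ * ‖f x‖ₑ ^ 2) ^ (1 / 2 : ℝ) = ‖φ‖ₑ := by
      rw [← hφn, ← ENNReal.rpow_natCast, ← ENNReal.rpow_mul]
      norm_num
    rw [hsq] at hCS
    refine (hsplit hFm hgV).trans ((add_le_add le_rfl (hCS.trans (mul_le_mul' le_rfl hφb))).trans ?_)
    calc I + B * (ENNReal.ofReal D * (E ^ (1 / 2 : ℝ) + 1) * I) = (1 + C₂) * I := by
          rw [hC₂]; ring
      _ ≤ _ := by
          refine mul_le_mul' ?_ le_rfl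
          rw [add_right_comm]
          exact le_self_add

end PartOne

/-! ### The Laplace transform of the heat kernel and Frullani integrals. -/

section HeatIntegral

open Set

/-- `∫₀^∞ e^{-bt} (4πt)⁻¹ e^{-a/(4t)} dt`. -/
def heatIntegrand (a b t : ℝ) : ℝ := Real.exp (-(b * t)) * ((4 * Real.pi * t)⁻¹ * Real.exp (-(a / (4 * t))))

/-- The Laplace transform in time of the heat kernel of the plane, `a = |z|²`. -/
def heatIntegral (a b : ℝ) : ℝ := ∫ t in Ioi 0, heatIntegrand a b t

variable {a b t : ℝ}

theorem heatIntegrand_nonneg (ht : 0 < t) : 0 ≤ heatIntegrand a b t := by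
  unfold heatIntegrand; positivity

theorem heatIntegrand_le (ha : 0 < a) (ht : 0 < t) :
    heatIntegrand a b t ≤ (Real.pi * a)⁻¹ * Real.exp (-(b * t)) := by
  rw [heatIntegrand, mul_comm]
  refine mul_le_mul_of_nonneg_right ?_ (Real.exp_pos _).le
  have h1 : a / (4 * t) * Real.exp (-(a / (4 * t))) ≤ 1 := by
    rw [Real.exp_neg, mul_inv_le_iff₀ (Real.exp_pos _), one_mul]
    linarith [Real.add_one_le_exp (a / (4 * t))]
  have e : (4 * Real.pi * t)⁻¹ * Real.exp (-(a / (4 * t)))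
      = (Real.pi * a)⁻¹ * (a / (4 * t) * Real.exp (-(a / (4 * t)))) := by
    have := Real.pi_pos
    field_simp
  rw [e]
  exact mul_le_of_le_one_right (by positivity) h1

theorem measurable_heatIntegrand : Measurable fun p : ℝ × ℝ × ℝ => heatIntegrand p.1 p.2.1 p.2.2 := by
  unfold heatIntegrand
  fun_prop

theorem integrableOn_exp_neg_mul (hb : 0 < b) : IntegrableOn (fun t => Real.exp (-(b * t))) (Ioi 0) := by
  simpa [neg_mul] using integrableOn_exp_mul_Ioi (neg_neg_of_pos hb) 0

theorem integral_exp_neg_mul (hb : 0 < b) : ∫ t in Ioi 0, Real.exp (-(b * t)) = b⁻¹ := by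
  have := integral_exp_mul_Ioi (neg_neg_of_pos hb) 0
  simp only [neg_mul, mul_zero, Real.exp_zero] at this
  rw [this]
  field_simp

theorem integrableOn_heatIntegrand (ha : 0 < a) (hb : 0 < b) :
    IntegrableOn (heatIntegrand a b) (Ioi 0) := by
  refine Integrable.mono' ((integrableOn_exp_neg_mul hb).const_mul (Real.pi * a)⁻¹)
    ?_ ?_
  · exact (measurable_heatIntegrand.comp (by fun_prop : Measurable fun t : ℝ => (a, b, t))).aestronglyMeasurable
  · filter_upwards [ae_restrict_mem measurableSet_Ioi] with t ht
    rw [Real.norm_of_nonneg (heatIntegrand_nonneg ht)]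
    exact heatIntegrand_le ha ht

theorem heatIntegral_nonneg : 0 ≤ heatIntegral a b :=
  setIntegral_nonneg measurableSet_Ioi fun _ ht => heatIntegrand_nonneg ht

theorem heatIntegral_le (ha : 0 < a) (hb : 0 < b) : heatIntegral a b ≤ (Real.pi * a * b)⁻¹ := by
  have h1 := setIntegral_mono_on (integrableOn_heatIntegrand ha hb)
    ((integrableOn_exp_neg_mul hb).const_mul (Real.pi * a)⁻¹) measurableSet_Ioi
    fun t ht => heatIntegrand_le ha ht
  rw [integral_const_mul, integral_exp_neg_mul hb, ← mul_inv] at h1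
  exact h1

theorem heatIntegral_anti {b' : ℝ} (ha : 0 < a) (hb : 0 < b) (h : b ≤ b') :
    heatIntegral a b' ≤ heatIntegral a b := by
  refine setIntegral_mono_on (integrableOn_heatIntegrand ha (hb.trans_le h))
    (integrableOn_heatIntegrand ha hb) measurableSet_Ioi fun t ht => ?_
  have ht' : 0 < t := ht
  unfold heatIntegrand
  gcongr

/-- The substitution `t ↦ (a/b) t` preserves `dt/t` and exchanges the two exponentials. Afterwards
`a = |z|²` sits in `e^{-at}`, so differences in `a` become Frullani integrals. -/
theorem heatIntegral_comm (ha : 0 < a) (hb : 0 < b) : heatIntegral a b = heatIntegral b a := by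
  have hc : 0 < a / b := by positivity
  have h1 := integral_comp_mul_left_Ioi (heatIntegrand a b) 0 hc
  rw [mul_zero, smul_eq_mul, eq_inv_mul_iff_mul_eq₀ hc.ne', ← integral_const_mul] at h1
  rw [heatIntegral, ← h1, heatIntegral]
  refine setIntegral_congr_fun measurableSet_Ioi fun t ht => ?_
  have ht' : 0 < t := ht
  have hp := Real.pi_pos
  simp only [heatIntegrand]
  have e1 : b * (a / b * t) = a * t := by field_simp
  have e2 : a / (4 * (a / b * t)) = b / (4 * t) := by field_simp
  rw [e1, e2]
  field_simp

theorem abs_exp_neg_sub_exp_neg_le (p q : ℝ) :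
    |Real.exp (-p) - Real.exp (-q)| ≤ |p - q| * Real.exp (-(min p q)) := by
  have key : ∀ p q : ℝ, p ≤ q → |Real.exp (-p) - Real.exp (-q)| ≤ |p - q| * Real.exp (-(min p q)) := by
    intro p q h
    rw [min_eq_left h, abs_of_nonneg (sub_nonneg.2 (Real.exp_le_exp.2 (by linarith))),
      abs_of_nonpos (by linarith)]
    have h1 : Real.exp (-q) = Real.exp (-p) * Real.exp (-(q - p)) := by rw [← Real.exp_add]; ring_nf
    have h2 := Real.add_one_le_exp (-(q - p))
    have h3 := Real.exp_pos (-p)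
    rw [h1]
    nlinarith
  rcases le_total p q with h | h
  · exact key p q h
  · rw [abs_sub_comm, abs_sub_comm p q, min_comm]
    exact key q p h

theorem integrableOn_frullani (ha : 0 < a) :
    IntegrableOn (fun t => t⁻¹ * (Real.exp (-(a * t)) - Real.exp (-(1 * t)))) (Ioi 0) := by
  refine Integrable.mono' ((integrableOn_exp_neg_mul (lt_min ha one_pos)).const_mul |a - 1|) ?_ ?_
  · exact Measurable.aestronglyMeasurable (by fun_prop)
  · filter_upwards [ae_restrict_mem measurableSet_Ioi] with t ht
    have ht' : 0 < t := ht
    have h1 := abs_exp_neg_sub_exp_neg_le (a * t) (1 * t)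
    rw [← min_mul_of_nonneg _ _ ht'.le, ← sub_mul, abs_mul, abs_of_pos ht'] at h1
    rw [norm_mul, norm_inv, Real.norm_of_nonneg ht'.le, Real.norm_eq_abs, inv_mul_le_iff₀ ht']
    linarith

theorem integral_frullani (ha : 0 < a) :
    ∫ t in Ioi 0, t⁻¹ * (Real.exp (-(a * t)) - Real.exp (-(1 * t))) = -Real.log a := by
  have h := Frullani.integral_Ioi_eq (f := fun t : ℝ => Real.exp (-t)) (a := a) (b := 1) (L := 1) (R := 0)
    ((by fun_prop : Continuous fun t : ℝ => Real.exp (-t)).locallyIntegrable.locallyIntegrableOn _)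
    ha one_pos ?_ ?_ (integrableOn_frullani ha)
  · simp only [smul_eq_mul] at h
    rw [h, one_div, Real.log_inv]
    ring
  · have : Tendsto (fun t : ℝ => Real.exp (-t)) (𝓝 0) (𝓝 (Real.exp (-0))) :=
      (by fun_prop : Continuous fun t : ℝ => Real.exp (-t)).tendsto 0
    rw [neg_zero, Real.exp_zero] at this
    exact this.mono_left nhdsWithin_le_nhds
  · exact Real.tendsto_exp_neg_atTop_nhds_zero

theorem heatIntegral_sub_eq (ha : 0 < a) (hb : 0 < b) :
    heatIntegral a b - heatIntegral 1 b = ∫ t in Ioi 0, (4 * Real.pi)⁻¹ *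
      (t⁻¹ * (Real.exp (-(a * t)) - Real.exp (-(1 * t)))) * Real.exp (-(b / (4 * t))) := by
  rw [heatIntegral_comm ha hb, heatIntegral_comm one_pos hb, heatIntegral, heatIntegral,
    ← integral_sub (integrableOn_heatIntegrand hb ha) (integrableOn_heatIntegrand hb one_pos)]
  refine integral_congr_ae (Eventually.of_forall fun t => ?_)
  simp only [heatIntegrand, mul_inv]
  ring

theorem integral_frullani_const (ha : 0 < a) : ∫ t in Ioi 0, (4 * Real.pi)⁻¹ *
      (t⁻¹ * (Real.exp (-(a * t)) - Real.exp (-(1 * t)))) = -((4 * Real.pi)⁻¹ * Real.log a) := by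
  rw [integral_const_mul, integral_frullani ha]
  ring

theorem integrableOn_frullani_mul (ha : 0 < a) (hb : 0 < b) :
    IntegrableOn (fun t => (4 * Real.pi)⁻¹ *
      (t⁻¹ * (Real.exp (-(a * t)) - Real.exp (-(1 * t)))) * Real.exp (-(b / (4 * t)))) (Ioi 0) := by
  refine Integrable.mono ((integrableOn_frullani ha).const_mul (4 * Real.pi)⁻¹) ?_ ?_
  · exact Measurable.aestronglyMeasurable (by fun_prop)
  · filter_upwards [ae_restrict_mem measurableSet_Ioi] with t ht
    have ht' : 0 < t := ht
    rw [norm_mul, Real.norm_of_nonneg (Real.exp_pos _).le]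
    refine mul_le_of_le_one_right (norm_nonneg _) (Real.exp_le_one_iff.2 ?_)
    have : 0 ≤ b / (4 * t) := by positivity
    linarith

/-- The Frullani integrand has constant sign, so the extra factor `e^{-b/(4t)} ≤ 1` can only
decrease its modulus. -/
theorem abs_heatIntegral_sub_le (ha : 0 < a) (hb : 0 < b) :
    |heatIntegral a b - heatIntegral 1 b| ≤ (4 * Real.pi)⁻¹ * |Real.log a| := by
  have hF := integral_frullani_const ha
  have hi := (integrableOn_frullani ha).const_mul (4 * Real.pi)⁻¹
  have hi' := integrableOn_frullani_mul ha hb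
  have he : ∀ t ∈ Ioi (0 : ℝ), Real.exp (-(b / (4 * t))) ≤ 1 := fun t ht => by
    have ht' : 0 < t := ht
    refine Real.exp_le_one_iff.2 ?_
    have : 0 ≤ b / (4 * t) := by positivity
    linarith
  have hp : 0 < (4 * Real.pi)⁻¹ := by positivity
  rw [heatIntegral_sub_eq ha hb]
  rcases le_total a 1 with h1 | h1
  · have hs : ∀ t ∈ Ioi (0 : ℝ), 0 ≤ (4 * Real.pi)⁻¹ *
        (t⁻¹ * (Real.exp (-(a * t)) - Real.exp (-(1 * t)))) := fun t ht => by
      have ht' : 0 < t := ht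
      have : Real.exp (-(1 * t)) ≤ Real.exp (-(a * t)) := Real.exp_le_exp.2 (by nlinarith)
      exact mul_nonneg hp.le (mul_nonneg (inv_nonneg.2 ht'.le) (by linarith))
    rw [abs_of_nonneg (setIntegral_nonneg measurableSet_Ioi fun t ht =>
      mul_nonneg (hs t ht) (Real.exp_pos _).le), abs_of_nonpos (Real.log_nonpos ha.le h1), mul_neg, ← hF]
    exact setIntegral_mono_on hi' hi measurableSet_Ioi fun t ht =>
      mul_le_of_le_one_right (hs t ht) (he t ht)
  · have hs : ∀ t ∈ Ioi (0 : ℝ), (4 * Real.pi)⁻¹ *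
        (t⁻¹ * (Real.exp (-(a * t)) - Real.exp (-(1 * t)))) ≤ 0 := fun t ht => by
      have ht' : 0 < t := ht
      have : Real.exp (-(a * t)) ≤ Real.exp (-(1 * t)) := Real.exp_le_exp.2 (by nlinarith)
      exact mul_nonpos_of_nonneg_of_nonpos hp.le
        (mul_nonpos_of_nonneg_of_nonpos (inv_nonneg.2 ht'.le) (by linarith))
    rw [abs_of_nonpos (setIntegral_nonpos measurableSet_Ioi fun t ht =>
      mul_nonpos_of_nonpos_of_nonneg (hs t ht) (Real.exp_pos _).le),
      abs_of_nonneg (Real.log_nonneg h1), neg_le, ← hF]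
    refine setIntegral_mono_on hi hi' measurableSet_Ioi fun t ht => ?_
    nlinarith [hs t ht, he t ht]

theorem tendsto_heatIntegral_sub (ha : 0 < a) :
    Tendsto (fun b => heatIntegral a b - heatIntegral 1 b) (𝓝[>] 0)
      (𝓝 (-((4 * Real.pi)⁻¹ * Real.log a))) := by
  rw [← integral_frullani_const ha]
  have h : Tendsto (fun b => ∫ t in Ioi 0, (4 * Real.pi)⁻¹ *
      (t⁻¹ * (Real.exp (-(a * t)) - Real.exp (-(1 * t)))) * Real.exp (-(b / (4 * t)))) (𝓝[>] 0)
      (𝓝 (∫ t in Ioi 0, (4 * Real.pi)⁻¹ *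
      (t⁻¹ * (Real.exp (-(a * t)) - Real.exp (-(1 * t)))))) := by
    refine tendsto_integral_filter_of_dominated_convergence
      (fun t => ‖(4 * Real.pi)⁻¹ * (t⁻¹ * (Real.exp (-(a * t)) - Real.exp (-(1 * t))))‖)
      (Eventually.of_forall fun b => Measurable.aestronglyMeasurable (by fun_prop)) ?_
      ((integrableOn_frullani ha).const_mul (4 * Real.pi)⁻¹).norm ?_
    · filter_upwards [self_mem_nhdsWithin] with b hb
      filter_upwards [ae_restrict_mem measurableSet_Ioi] with t ht
      have ht' : 0 < t := ht
      have hb' : 0 < b := hb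
      rw [norm_mul, Real.norm_of_nonneg (Real.exp_pos _).le]
      refine mul_le_of_le_one_right (norm_nonneg _) (Real.exp_le_one_iff.2 ?_)
      have : 0 ≤ b / (4 * t) := by positivity
      linarith
    · refine Eventually.of_forall fun t => ?_
      have hc : Tendsto (fun b : ℝ => Real.exp (-(b / (4 * t)))) (𝓝[>] 0) (𝓝 (Real.exp (-(0 / (4 * t))))) :=
        ((by fun_prop : Continuous fun b : ℝ => Real.exp (-(b / (4 * t)))).tendsto 0).mono_left
          nhdsWithin_le_nhds
      rw [zero_div, neg_zero, Real.exp_zero] at hc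
      simpa using hc.const_mul ((4 * Real.pi)⁻¹ * (t⁻¹ * (Real.exp (-(a * t)) - Real.exp (-(1 * t)))))
  refine h.congr' ?_
  filter_upwards [self_mem_nhdsWithin] with b hb
  exact (heatIntegral_sub_eq ha hb).symm

/-- After exchanging the parameters the integrand is at least a constant times `1/t` on `[b, 1]`, so
the integral diverges like `-log b`. -/
theorem tendsto_heatIntegral_one_atTop : Tendsto (heatIntegral 1) (𝓝[>] 0) atTop := by
  have hc : 0 < (4 * Real.pi)⁻¹ * (Real.exp (-1) * Real.exp (-(1 / 4))) := by positivity
  have hlim : Tendsto (fun b : ℝ => (4 * Real.pi)⁻¹ * (Real.exp (-1) * Real.exp (-(1 / 4))) *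
      (-Real.log b)) (𝓝[>] 0) atTop :=
    (tendsto_neg_atBot_atTop.comp (Real.tendsto_log_nhdsGT_zero)).const_mul_atTop hc
  refine tendsto_atTop_mono' _ ?_ hlim
  filter_upwards [Ioo_mem_nhdsGT (one_pos : (0 : ℝ) < 1)] with b hb
  have h1 : ∫ t in b..1, (4 * Real.pi)⁻¹ * (Real.exp (-1) * Real.exp (-(1 / 4))) * t⁻¹
      = (4 * Real.pi)⁻¹ * (Real.exp (-1) * Real.exp (-(1 / 4))) * (-Real.log b) := by
    rw [intervalIntegral.integral_const_mul, integral_inv_of_pos hb.1 one_pos,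
      one_div b, Real.log_inv]
  rw [heatIntegral_comm one_pos hb.1, heatIntegral, ← h1, intervalIntegral.integral_of_le hb.2.le]
  have hsub : Ioc b 1 ⊆ Ioi 0 := fun t ht => hb.1.trans ht.1
  refine le_trans (setIntegral_mono_on ?_
    ((integrableOn_heatIntegrand hb.1 one_pos).mono_set hsub) measurableSet_Ioc fun t ht => ?_)
    (setIntegral_mono_set (integrableOn_heatIntegrand hb.1 one_pos) ?_ hsub.eventuallyLE)
  · rw [← intervalIntegrable_iff_integrableOn_Ioc_of_le hb.2.le]
    refine IntervalIntegrable.const_mul ?_ _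
    rw [intervalIntegrable_inv_iff]
    right
    rw [Set.uIcc_of_le hb.2.le]
    exact fun h => absurd h.1 (not_le.2 hb.1)
  · have ht0 : 0 < t := hb.1.trans ht.1
    have e1 : Real.exp (-1) ≤ Real.exp (-(1 * t)) := Real.exp_le_exp.2 (by linarith [ht.2])
    have e2 : Real.exp (-(1 / 4)) ≤ Real.exp (-(b / (4 * t))) := by
      refine Real.exp_le_exp.2 (neg_le_neg ?_)
      rw [div_le_div_iff₀ (by positivity) (by norm_num)]
      linarith [ht.1]
    calc (4 * Real.pi)⁻¹ * (Real.exp (-1) * Real.exp (-(1 / 4))) * t⁻¹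
        ≤ (4 * Real.pi)⁻¹ * (Real.exp (-(1 * t)) * Real.exp (-(b / (4 * t)))) * t⁻¹ := by gcongr
      _ = heatIntegrand b 1 t := by rw [heatIntegrand, mul_inv _ t]; ring
  · filter_upwards [ae_restrict_mem measurableSet_Ioi] with t ht
    exact heatIntegrand_nonneg ht

end HeatIntegral

/-! ### The kernel of `(-Δ + μ)⁻¹` compared with Green's function. -/

section ResKernel

/-- The integral kernel of `(-Δ + μ)⁻¹`. -/
def resKernel (μ : ℝ) (z : Plane) : ℝ := heatIntegral (‖z‖ ^ 2) μ

theorem resKernel_nonneg (μ : ℝ) (z : Plane) : 0 ≤ resKernel μ z := heatIntegral_nonneg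

theorem measurable_resKernel (μ : ℝ) : Measurable (resKernel μ) := by
  have h : StronglyMeasurable fun p : Plane × ℝ => heatIntegrand (‖p.1‖ ^ 2) μ p.2 :=
    (measurable_heatIntegrand.comp (by fun_prop :
      Measurable fun p : Plane × ℝ => (‖p.1‖ ^ 2, μ, p.2))).stronglyMeasurable
  exact (h.integral_prod_right (ν := volume.restrict (Set.Ioi 0))).measurable

theorem green_eq (x y : Plane) : green x y = -((4 * Real.pi)⁻¹ * Real.log (‖x - y‖ ^ 2)) := by
  rw [green, Real.log_pow]
  have := Real.pi_pos
  field_simp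
  ring

/-- A bound uniform in `μ`: once the divergent constant is subtracted, Green's function dominates.
It is the majorant for the limit `μ → 0`. -/
theorem abs_resKernel_sub_le {μ : ℝ} (hμ : 0 < μ) {x y : Plane} (hxy : x ≠ y) :
    |resKernel μ (x - y) - heatIntegral 1 μ| ≤ |green x y| := by
  have h : 0 < ‖x - y‖ ^ 2 := by have := norm_pos_iff.2 (sub_ne_zero.2 hxy); positivity
  refine (abs_heatIntegral_sub_le h hμ).trans_eq ?_
  rw [green_eq, abs_neg, abs_mul, abs_of_pos (by positivity : 0 < (4 * Real.pi)⁻¹)]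

theorem tendsto_resKernel_sub {x y : Plane} (hxy : x ≠ y) :
    Tendsto (fun μ => resKernel μ (x - y) - heatIntegral 1 μ) (𝓝[>] 0) (𝓝 (green x y)) := by
  have h : 0 < ‖x - y‖ ^ 2 := by have := norm_pos_iff.2 (sub_ne_zero.2 hxy); positivity
  rw [green_eq]
  exact tendsto_heatIntegral_sub h

theorem tendsto_resKernel_atTop {z : Plane} (hz : z ≠ 0) :
    Tendsto (fun μ => resKernel μ z) atTop (𝓝 0) := by
  have h : 0 < ‖z‖ ^ 2 := by have := norm_pos_iff.2 hz; positivity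
  have hlim : Tendsto (fun μ : ℝ => (Real.pi * ‖z‖ ^ 2 * μ)⁻¹) atTop (𝓝 0) :=
    (tendsto_id.const_mul_atTop (by positivity)).inv_tendsto_atTop
  refine squeeze_zero' (Eventually.of_forall fun μ => resKernel_nonneg μ z) ?_ hlim
  filter_upwards [eventually_gt_atTop 0] with μ hμ
  exact heatIntegral_le h hμ

end ResKernel

/-! ### Fourier transform of integrable functions and Gaussian damping. -/

section FourierL1

variable {F G : Plane → ℂ}

open scoped ComplexConjugate

theorem continuous_inner_prod : Continuous fun p : Plane × Plane => (innerₗ Plane) p.1 p.2 :=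
  continuous_inner

theorem continuous_fourier_of_integrable (hF : Integrable F) : Continuous (𝓕 F) :=
  VectorFourier.fourierIntegral_continuous Real.continuous_fourierChar continuous_inner_prod hF

theorem norm_fourier_le_integral (F : Plane → ℂ) (ξ : Plane) : ‖𝓕 F ξ‖ ≤ ∫ x, ‖F x‖ :=
  VectorFourier.norm_fourierIntegral_le_integral_norm _ _ _ _ _

theorem enorm_fourier_le_lintegral (F : Plane → ℂ) (ξ : Plane) : ‖𝓕 F ξ‖ₑ ≤ ∫⁻ x, ‖F x‖ₑ := by
  rw [Real.fourier_eq]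
  refine (enorm_integral_le_lintegral_enorm _).trans (lintegral_mono fun x => ?_)
  rw [Circle.smul_def, enorm_smul, ← ofReal_norm (_ : ℂ), Circle.norm_coe, ENNReal.ofReal_one, one_mul]

theorem integral_fourier_mul_eq (hF : Integrable F) (hG : Integrable G) :
    ∫ ξ, 𝓕 F ξ * G ξ = ∫ x, F x * 𝓕 G x := by
  have h := VectorFourier.integral_fourierIntegral_smul_eq_flip (L := innerₗ Plane)
    Real.continuous_fourierChar continuous_inner_prod hF hG
  rw [flip_innerₗ] at h
  exact h

/-- The heat kernel of the plane. -/
def heat (t : ℝ) (z : Plane) : ℝ := (4 * Real.pi * t)⁻¹ * Real.exp (-(‖z‖ ^ 2 / (4 * t)))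

/-- The square of the frequency. -/
def freqSq (ξ : Plane) : ℝ := (2 * Real.pi * ‖ξ‖) ^ 2

theorem freqSq_nonneg (ξ : Plane) : 0 ≤ freqSq ξ := sq_nonneg _

@[fun_prop]
theorem continuous_freqSq : Continuous freqSq := by unfold freqSq; fun_prop

theorem heat_nonneg {t : ℝ} (ht : 0 < t) (z : Plane) : 0 ≤ heat t z := by unfold heat; positivity

theorem heat_le {t : ℝ} (ht : 0 < t) (z : Plane) : heat t z ≤ (4 * Real.pi * t)⁻¹ := by
  unfold heat
  refine mul_le_of_le_one_right (by positivity) (Real.exp_le_one_iff.2 ?_)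
  have : 0 ≤ ‖z‖ ^ 2 / (4 * t) := by positivity
  linarith

theorem fourier_modulated_gaussian {t : ℝ} (ht : 0 < t) (x y : Plane) :
    𝓕 (fun ξ : Plane => Complex.exp (2 * Real.pi * Complex.I * ⟪y, ξ⟫_ℝ) *
      (Real.exp (-(freqSq ξ * t)) : ℂ)) x = (heat t (x - y) : ℂ) := by
  have hb : 0 < ((4 * Real.pi ^ 2 * t : ℝ) : ℂ).re := by
    rw [Complex.ofReal_re]; positivity
  have h := fourier_gaussian_innerProductSpace' (V := Plane) hb y x
  have e : (fun ξ : Plane => Complex.exp (2 * Real.pi * Complex.I * ⟪y, ξ⟫_ℝ) *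
      (Real.exp (-(freqSq ξ * t)) : ℂ)) = fun v : Plane =>
      Complex.exp (-((4 * Real.pi ^ 2 * t : ℝ) : ℂ) * (‖v‖ : ℂ) ^ 2
        + 2 * Real.pi * Complex.I * ⟪y, v⟫_ℝ) := by
    ext v
    rw [Complex.ofReal_exp, ← Complex.exp_add]
    congr 1
    unfold freqSq
    push_cast
    ring
  rw [e, h]
  have h2 : (Module.finrank ℝ Plane : ℂ) / 2 = 1 := by simp
  rw [h2, Complex.cpow_one, heat, norm_sub_rev]
  have hpi : (Real.pi : ℂ) ≠ 0 := by exact_mod_cast Real.pi_ne_zero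
  have ht' : (t : ℂ) ≠ 0 := by exact_mod_cast ht.ne'
  push_cast
  congr 1
  · field_simp
  · congr 1
    field_simp

theorem integrable_exp_neg_freqSq {t : ℝ} (ht : 0 < t) :
    Integrable fun ξ : Plane => (Real.exp (-(freqSq ξ * t)) : ℂ) := by
  have hb : 0 < ((4 * Real.pi ^ 2 * t : ℝ) : ℂ).re := by
    rw [Complex.ofReal_re]; positivity
  have h := GaussianFourier.integrable_cexp_neg_mul_sq_norm_add (V := Plane) hb 0 0
  refine h.congr (Eventually.of_forall fun ξ => ?_)
  simp only [zero_mul, add_zero]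
  rw [Complex.ofReal_exp]
  congr 1
  unfold freqSq
  push_cast
  ring

theorem integrable_fourier_mul {γ : Plane → ℂ} (hF : Integrable F) (hγ : Integrable γ) :
    Integrable fun ξ => 𝓕 F ξ * γ ξ :=
  hγ.bdd_mul (continuous_fourier_of_integrable hF).aestronglyMeasurable
    (Eventually.of_forall (norm_fourier_le_integral F))

theorem integrable_conj {γ : Plane → ℂ} (hγ : Integrable γ) : Integrable fun ξ => conj (γ ξ) :=
  (Complex.conjLIE.toContinuousLinearEquiv.toContinuousLinearMap.integrable_comp hγ)

theorem integrable_mul_heat (hF : Integrable F) (hG : Integrable G) {t : ℝ} (ht : 0 < t) :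
    Integrable (fun p : Plane × Plane => conj (F p.1) * G p.2 * (heat t (p.1 - p.2) : ℂ))
      (volume.prod volume) := by
  have h1 : Integrable (fun p : Plane × Plane => conj (F p.1) * G p.2) (volume.prod volume) :=
    (integrable_conj hF).mul_prod hG
  refine h1.mul_bdd (c := (4 * Real.pi * t)⁻¹) ?_ (Eventually.of_forall fun p => ?_)
  · refine Continuous.aestronglyMeasurable ?_
    unfold heat
    fun_prop
  · rw [Complex.norm_real, Real.norm_of_nonneg (heat_nonneg ht _)]
    exact heat_le ht _

/-- Parseval for functions that are merely integrable, as `v φ` is: the Gaussian makes the frequency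
integral converge, and its transform is the heat kernel. -/
theorem integral_conj_fourier_mul_gaussian (hF : Integrable F) (hG : Integrable G) {t : ℝ}
    (ht : 0 < t) :
    ∫ ξ, conj (𝓕 F ξ) * 𝓕 G ξ * (Real.exp (-(freqSq ξ * t)) : ℂ)
      = ∫ p : Plane × Plane, conj (F p.1) * G p.2 * (heat t (p.1 - p.2) : ℂ) ∂(volume.prod volume) := by
  have hγ := integrable_exp_neg_freqSq ht
  have hcγ : Integrable fun ξ => conj (𝓕 F ξ) * (Real.exp (-(freqSq ξ * t)) : ℂ) := by
    refine (integrable_conj (integrable_fourier_mul hF hγ)).congr (Eventually.of_forall fun ξ => ?_)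
    simp only [map_mul, Complex.conj_ofReal]
  have h1 : ∫ ξ, conj (𝓕 F ξ) * 𝓕 G ξ * (Real.exp (-(freqSq ξ * t)) : ℂ)
      = ∫ y, G y * 𝓕 (fun ξ => conj (𝓕 F ξ) * (Real.exp (-(freqSq ξ * t)) : ℂ)) y := by
    rw [← integral_fourier_mul_eq hG hcγ]
    refine integral_congr_ae (Eventually.of_forall fun ξ => ?_)
    ring
  -- Exchange of the Fourier transform between `F` and a modulated Gaussian, whose transform is a
  -- translated heat kernel.
  have h2 : ∀ y, conj (𝓕 (fun ξ => conj (𝓕 F ξ) * (Real.exp (-(freqSq ξ * t)) : ℂ)) y)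
      = ∫ x, F x * (heat t (x - y) : ℂ) := by
    intro y
    have hm : Integrable fun ξ : Plane => Complex.exp (2 * Real.pi * Complex.I * ⟪y, ξ⟫_ℝ) *
      (Real.exp (-(freqSq ξ * t)) : ℂ) := by
      refine hγ.bdd_mul (c := 1) ?_ (Eventually.of_forall fun ξ => ?_)
      · exact Continuous.aestronglyMeasurable (by fun_prop)
      · have : (2 * Real.pi * Complex.I * ⟪y, ξ⟫_ℝ : ℂ)
            = ((2 * Real.pi * ⟪y, ξ⟫_ℝ : ℝ) : ℂ) * Complex.I := by push_cast; ring
        rw [this, Complex.norm_exp_ofReal_mul_I]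
    have h3 := integral_fourier_mul_eq hF hm
    simp_rw [fourier_modulated_gaussian ht] at h3
    rw [← h3, Real.fourier_eq', ← integral_conj]
    refine integral_congr_ae (Eventually.of_forall fun ξ => ?_)
    simp only [smul_eq_mul, map_mul, Complex.conj_ofReal, Complex.conj_conj]
    rw [← Complex.exp_conj, mul_left_comm]
    congr 3
    simp only [map_mul, Complex.conj_ofReal, Complex.conj_I]
    rw [real_inner_comm]
    push_cast
    ring
  rw [h1, integral_prod_symm _ (integrable_mul_heat hF hG ht)]
  refine integral_congr_ae (Eventually.of_forall fun y => ?_)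
  have h4 := congrArg conj (h2 y)
  rw [Complex.conj_conj, ← integral_conj] at h4
  simp only
  rw [h4, ← integral_const_mul]
  refine integral_congr_ae (Eventually.of_forall fun x => ?_)
  simp only [map_mul, Complex.conj_ofReal]
  ring

end FourierL1

/-! ### The quadratic form of `(-Δ + μ)⁻¹` on integrable functions. -/

section ResolventForm

variable {F G : Plane → ℂ} {μ : ℝ}

open scoped ComplexConjugate
open Set

theorem freqSq_add_pos (hμ : 0 < μ) (ξ : Plane) : 0 < freqSq ξ + μ := by
  have := freqSq_nonneg ξ
  linarith

theorem integrableOn_exp_mul_exp_freqSq (hμ : 0 < μ) (ξ : Plane) :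
    IntegrableOn (fun t => Real.exp (-(μ * t)) * Real.exp (-(freqSq ξ * t))) (Ioi 0) := by
  refine (integrableOn_exp_neg_mul (freqSq_add_pos hμ ξ)).congr_fun (fun t _ => ?_) measurableSet_Ioi
  simp only
  rw [← Real.exp_add]
  ring_nf

theorem integral_exp_mul_exp_freqSq (hμ : 0 < μ) (ξ : Plane) :
    ∫ t in Ioi 0, Real.exp (-(μ * t)) * Real.exp (-(freqSq ξ * t)) = (freqSq ξ + μ)⁻¹ := by
  rw [← integral_exp_neg_mul (freqSq_add_pos hμ ξ)]
  refine integral_congr_ae (Eventually.of_forall fun t => ?_)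
  simp only
  rw [← Real.exp_add]
  ring_nf

theorem lintegral_exp_mul_exp_freqSq (hμ : 0 < μ) (ξ : Plane) :
    ∫⁻ t in Ioi 0, ENNReal.ofReal (Real.exp (-(μ * t)) * Real.exp (-(freqSq ξ * t)))
      = ENNReal.ofReal (freqSq ξ + μ)⁻¹ := by
  rw [← integral_exp_mul_exp_freqSq hμ ξ, ofReal_integral_eq_lintegral_ofReal
    (integrableOn_exp_mul_exp_freqSq hμ ξ) (Eventually.of_forall fun t => by positivity)]

theorem ae_ne_prod : ∀ᵐ p : Plane × Plane ∂(volume.prod volume), p.1 ≠ p.2 := by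
  rw [ae_iff]
  simp only [ne_eq, not_not]
  rw [Measure.measure_prod_null (measurableSet_eq_fun measurable_fst measurable_snd)]
  refine Eventually.of_forall fun x => ?_
  have : (Prod.mk x ⁻¹' {p : Plane × Plane | p.1 = p.2}) = {x} := by
    ext y; simp [eq_comm]
  simp only [this]
  simp

theorem lintegral_exp_mul_heat (hμ : 0 < μ) {z : Plane} (hz : z ≠ 0) :
    ∫⁻ t in Ioi 0, ENNReal.ofReal (Real.exp (-(μ * t)) * heat t z)
      = ENNReal.ofReal (resKernel μ z) := by
  have h : 0 < ‖z‖ ^ 2 := by have := norm_pos_iff.2 hz; positivity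
  rw [resKernel, heatIntegral, ofReal_integral_eq_lintegral_ofReal (integrableOn_heatIntegrand h hμ)]
  · rfl
  · filter_upwards [ae_restrict_mem measurableSet_Ioi] with t ht
    exact heatIntegrand_nonneg ht

theorem integral_exp_mul_heat (μ : ℝ) (z : Plane) :
    ∫ t in Ioi 0, Real.exp (-(μ * t)) * heat t z = resKernel μ z := rfl

theorem measurable_exp_mul_heat : Measurable fun q : (Plane × Plane) × ℝ =>
    Real.exp (-(μ * q.2)) * heat q.2 (q.1.1 - q.1.2) := by
  unfold heat
  fun_prop

theorem aestronglyMeasurable_conj_mul (hF : AEStronglyMeasurable F) (hG : AEStronglyMeasurable G) :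
    AEStronglyMeasurable (fun p : Plane × Plane => conj (F p.1) * G p.2) (volume.prod volume) :=
  (Complex.continuous_conj.comp_aestronglyMeasurable
    (hF.comp_quasiMeasurePreserving Measure.quasiMeasurePreserving_fst)).mul
    (hG.comp_quasiMeasurePreserving Measure.quasiMeasurePreserving_snd)

theorem enorm_conj_mul (a b : ℂ) : ‖conj a * b‖ₑ = ‖a‖ₑ * ‖b‖ₑ := by
  rw [enorm_mul, ← ofReal_norm (conj a), RCLike.norm_conj, ofReal_norm]

theorem lintegral_lintegral_heat (F G : Plane → ℂ) (hμ : 0 < μ) :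
    ∫⁻ p : Plane × Plane, (∫⁻ t in Ioi 0, ‖conj (F p.1) * G p.2‖ₑ *
        ENNReal.ofReal (Real.exp (-(μ * t)) * heat t (p.1 - p.2))) ∂(volume.prod volume)
      = ∫⁻ p : Plane × Plane, ‖F p.1‖ₑ * ‖G p.2‖ₑ * ENNReal.ofReal (resKernel μ (p.1 - p.2))
        ∂(volume.prod volume) := by
  refine lintegral_congr_ae ?_
  filter_upwards [ae_ne_prod] with p hp
  have hm : Measurable fun t : ℝ => ENNReal.ofReal (Real.exp (-(μ * t)) * heat t (p.1 - p.2)) := by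
    unfold heat; fun_prop
  rw [lintegral_const_mul _ hm, lintegral_exp_mul_heat hμ (sub_ne_zero.2 hp), enorm_conj_mul]

/-- `∫ |F̂|² / (ω² + μ) ≤ ∬ |F(x)| |F(y)| k_μ(x - y)` for integrable `F`. -/
theorem lintegral_fourier_sq_le (hF : Integrable F) (hμ : 0 < μ) :
    ∫⁻ ξ, ‖𝓕 F ξ‖ₑ ^ 2 * ENNReal.ofReal (freqSq ξ + μ)⁻¹
      ≤ ∫⁻ p : Plane × Plane, ‖F p.1‖ₑ * ‖F p.2‖ₑ * ENNReal.ofReal (resKernel μ (p.1 - p.2))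
        ∂(volume.prod volume) := by
  have hFc := continuous_fourier_of_integrable hF
  have hFm : Measurable fun ξ => ‖𝓕 F ξ‖ₑ := hFc.measurable.enorm
  have hcF := aestronglyMeasurable_conj_mul hF.1 hF.1
  have hm1 : AEMeasurable (Function.uncurry fun (ξ : Plane) (t : ℝ) => ‖𝓕 F ξ‖ₑ ^ 2 *
      ENNReal.ofReal (Real.exp (-(μ * t)) * Real.exp (-(freqSq ξ * t))))
      (volume.prod (volume.restrict (Ioi 0))) := by
    refine Measurable.aemeasurable ?_
    refine ((hFm.comp measurable_fst).pow_const 2).mul ?_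
    fun_prop
  have hm2 : AEMeasurable (Function.uncurry fun (p : Plane × Plane) (t : ℝ) =>
      ‖conj (F p.1) * F p.2‖ₑ * ENNReal.ofReal (Real.exp (-(μ * t)) * heat t (p.1 - p.2)))
      ((volume.prod volume).prod (volume.restrict (Ioi 0))) :=
    (hcF.enorm.comp_quasiMeasurePreserving Measure.quasiMeasurePreserving_fst).mul
      (measurable_exp_mul_heat.ennreal_ofReal).aemeasurable
  calc ∫⁻ ξ, ‖𝓕 F ξ‖ₑ ^ 2 * ENNReal.ofReal (freqSq ξ + μ)⁻¹
      = ∫⁻ ξ, ∫⁻ t in Ioi 0, ‖𝓕 F ξ‖ₑ ^ 2 *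
          ENNReal.ofReal (Real.exp (-(μ * t)) * Real.exp (-(freqSq ξ * t))) := by
        refine lintegral_congr fun ξ => ?_
        rw [lintegral_const_mul _ (by fun_prop), lintegral_exp_mul_exp_freqSq hμ]
    _ = ∫⁻ t in Ioi 0, ∫⁻ ξ, ‖𝓕 F ξ‖ₑ ^ 2 *
          ENNReal.ofReal (Real.exp (-(μ * t)) * Real.exp (-(freqSq ξ * t))) :=
        lintegral_lintegral_swap hm1
    _ ≤ ∫⁻ t in Ioi 0, ∫⁻ p : Plane × Plane, ‖conj (F p.1) * F p.2‖ₑ *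
          ENNReal.ofReal (Real.exp (-(μ * t)) * heat t (p.1 - p.2)) ∂(volume.prod volume) := by
        -- For fixed time this is the Gaussian Parseval identity followed by the triangle
        -- inequality; integrating against `e^{-μt}` produces both resolvent expressions.
        refine setLIntegral_mono' measurableSet_Ioi fun t ht => ?_
        have ht' : 0 < t := ht
        have hid := integral_conj_fourier_mul_gaussian hF hF ht'
        have hγ : Integrable fun ξ => conj (𝓕 F ξ) * 𝓕 F ξ * (Real.exp (-(freqSq ξ * t)) : ℂ) := by
          have h1 := integrable_fourier_mul hF (integrable_exp_neg_freqSq ht')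
          have h2 := h1.bdd_mul (c := ∫ x, ‖F x‖) (f := fun ξ => conj (𝓕 F ξ))
            (Complex.continuous_conj.comp hFc).aestronglyMeasurable
            (Eventually.of_forall fun ξ => by
              rw [RCLike.norm_conj]; exact norm_fourier_le_integral F ξ)
          exact h2.congr (Eventually.of_forall fun ξ => by simp only [mul_assoc])
        have hpos : ∀ ξ, conj (𝓕 F ξ) * 𝓕 F ξ * (Real.exp (-(freqSq ξ * t)) : ℂ)
            = ((‖𝓕 F ξ‖ ^ 2 * Real.exp (-(freqSq ξ * t)) : ℝ) : ℂ) := fun ξ => by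
          rw [Complex.conj_mul']; push_cast; ring
        have e1 : ∫⁻ ξ, ‖𝓕 F ξ‖ₑ ^ 2 * ENNReal.ofReal (Real.exp (-(freqSq ξ * t)))
            = ‖∫ ξ, conj (𝓕 F ξ) * 𝓕 F ξ * (Real.exp (-(freqSq ξ * t)) : ℂ)‖ₑ := by
          have hre : Integrable fun ξ => ‖𝓕 F ξ‖ ^ 2 * Real.exp (-(freqSq ξ * t)) := by
            have := hγ.re
            refine this.congr (Eventually.of_forall fun ξ => ?_)
            simp only [hpos]
            exact Complex.ofReal_re _
          simp_rw [hpos]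
          rw [integral_complex_ofReal, ← ofReal_norm, Complex.norm_real, Real.norm_of_nonneg
            (integral_nonneg fun ξ => by positivity), ofReal_integral_eq_lintegral_ofReal hre
            (Eventually.of_forall fun ξ => by positivity)]
          refine lintegral_congr fun ξ => ?_
          rw [ENNReal.ofReal_mul (by positivity), ENNReal.ofReal_pow (norm_nonneg _), ofReal_norm]
        have e2 : ‖∫ ξ, conj (𝓕 F ξ) * 𝓕 F ξ * (Real.exp (-(freqSq ξ * t)) : ℂ)‖ₑ
            ≤ ∫⁻ p : Plane × Plane, ‖conj (F p.1) * F p.2‖ₑ * ENNReal.ofReal (heat t (p.1 - p.2))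
              ∂(volume.prod volume) := by
          rw [hid]
          refine (enorm_integral_le_lintegral_enorm _).trans (lintegral_mono fun p => ?_)
          rw [enorm_mul, ← ofReal_norm (_ : ℂ) , ← ofReal_norm ((heat t (p.1 - p.2) : ℝ) : ℂ),
            Complex.norm_real, Real.norm_of_nonneg (heat_nonneg ht' _)]
        have hsplit : ∀ a : ℝ≥0∞, ∀ c : ℝ, a * ENNReal.ofReal (Real.exp (-(μ * t)) * c)
            = ENNReal.ofReal (Real.exp (-(μ * t))) * (a * ENNReal.ofReal c) := fun a c => by
          rw [ENNReal.ofReal_mul (Real.exp_pos _).le, mul_left_comm]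
        simp_rw [hsplit]
        rw [lintegral_const_mul' _ _ ENNReal.ofReal_ne_top, lintegral_const_mul' _ _ ENNReal.ofReal_ne_top]
        exact mul_le_mul' le_rfl (e1.trans_le e2)
    _ = ∫⁻ p : Plane × Plane, (∫⁻ t in Ioi 0, ‖conj (F p.1) * F p.2‖ₑ *
          ENNReal.ofReal (Real.exp (-(μ * t)) * heat t (p.1 - p.2))) ∂(volume.prod volume) :=
        (lintegral_lintegral_swap hm2).symm
    _ = _ := lintegral_lintegral_heat F F hμ

/-- `∫ conj F̂ Ĝ / (ω² + μ) = ∬ conj F(x) G(y) k_μ(x - y)`. -/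
theorem integral_conj_fourier_mul_resolvent (hF : Integrable F) (hG : Integrable G) (hμ : 0 < μ)
    (hFG : ∫⁻ p : Plane × Plane, ‖F p.1‖ₑ * ‖G p.2‖ₑ * ENNReal.ofReal (resKernel μ (p.1 - p.2))
        ∂(volume.prod volume) < ⊤)
    (hint : ∫⁻ ξ, ‖𝓕 F ξ‖ₑ * ‖𝓕 G ξ‖ₑ * ENNReal.ofReal (freqSq ξ + μ)⁻¹ < ⊤) :
    ∫ ξ, conj (𝓕 F ξ) * 𝓕 G ξ * ((freqSq ξ + μ)⁻¹ : ℝ)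
      = ∫ p : Plane × Plane, conj (F p.1) * G p.2 * (resKernel μ (p.1 - p.2) : ℂ)
        ∂(volume.prod volume) := by
  have hFc := continuous_fourier_of_integrable hF
  have hGc := continuous_fourier_of_integrable hG
  have hcF := aestronglyMeasurable_conj_mul hF.1 hG.1
  have hi1 : Integrable (Function.uncurry fun (ξ : Plane) (t : ℝ) => conj (𝓕 F ξ) * 𝓕 G ξ *
      ((Real.exp (-(μ * t)) * Real.exp (-(freqSq ξ * t)) : ℝ) : ℂ))
      (volume.prod (volume.restrict (Ioi 0))) := by
    have hc : Continuous (Function.uncurry fun (ξ : Plane) (t : ℝ) => conj (𝓕 F ξ) * 𝓕 G ξ *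
      ((Real.exp (-(μ * t)) * Real.exp (-(freqSq ξ * t)) : ℝ) : ℂ)) := by
      have a := hFc.comp (continuous_fst (X := Plane) (Y := ℝ))
      have b := hGc.comp (continuous_fst (X := Plane) (Y := ℝ))
      refine ((Complex.continuous_conj.comp a).mul b).mul (Complex.continuous_ofReal.comp ?_)
      fun_prop
    refine ⟨hc.aestronglyMeasurable, ?_⟩
    rw [HasFiniteIntegral, lintegral_prod _ hc.enorm.measurable.aemeasurable]
    refine lt_of_le_of_lt (lintegral_mono fun ξ => ?_) hint
    simp only [Function.uncurry_apply_pair]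
    rw [← lintegral_exp_mul_exp_freqSq hμ, ← lintegral_const_mul _ (by fun_prop)]
    refine lintegral_mono fun t => ?_
    rw [enorm_mul, enorm_conj_mul, ← ofReal_norm ((_ : ℝ) : ℂ), Complex.norm_real,
      Real.norm_of_nonneg (by positivity)]
  have hi2 : Integrable (Function.uncurry fun (p : Plane × Plane) (t : ℝ) => conj (F p.1) * G p.2 *
      ((Real.exp (-(μ * t)) * heat t (p.1 - p.2) : ℝ) : ℂ))
      ((volume.prod volume).prod (volume.restrict (Ioi 0))) := by
    have hm : AEStronglyMeasurable (Function.uncurry fun (p : Plane × Plane) (t : ℝ) =>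
        conj (F p.1) * G p.2 * ((Real.exp (-(μ * t)) * heat t (p.1 - p.2) : ℝ) : ℂ))
        ((volume.prod volume).prod (volume.restrict (Ioi 0))) :=
      (hcF.comp_quasiMeasurePreserving Measure.quasiMeasurePreserving_fst).mul
        (Complex.measurable_ofReal.comp measurable_exp_mul_heat).aestronglyMeasurable
    refine ⟨hm, ?_⟩
    rw [HasFiniteIntegral, lintegral_prod _ hm.enorm]
    refine lt_of_le_of_lt (le_of_eq ?_) hFG
    rw [← lintegral_lintegral_heat F G hμ]
    refine lintegral_congr fun p => setLIntegral_congr_fun measurableSet_Ioi fun t ht => ?_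
    simp only [Function.uncurry_apply_pair]
    rw [enorm_mul, ← ofReal_norm ((_ : ℝ) : ℂ), Complex.norm_real,
      Real.norm_of_nonneg (mul_nonneg (Real.exp_pos _).le (heat_nonneg ht _))]
  calc ∫ ξ, conj (𝓕 F ξ) * 𝓕 G ξ * ((freqSq ξ + μ)⁻¹ : ℝ)
      = ∫ ξ, ∫ t in Ioi 0, conj (𝓕 F ξ) * 𝓕 G ξ *
          ((Real.exp (-(μ * t)) * Real.exp (-(freqSq ξ * t)) : ℝ) : ℂ) := by
        refine integral_congr_ae (Eventually.of_forall fun ξ => ?_)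
        simp only
        rw [integral_const_mul, integral_complex_ofReal, integral_exp_mul_exp_freqSq hμ]
    _ = ∫ t in Ioi 0, ∫ ξ, conj (𝓕 F ξ) * 𝓕 G ξ *
          ((Real.exp (-(μ * t)) * Real.exp (-(freqSq ξ * t)) : ℝ) : ℂ) := integral_integral_swap hi1
    _ = ∫ t in Ioi 0, ∫ p : Plane × Plane, conj (F p.1) * G p.2 *
          ((Real.exp (-(μ * t)) * heat t (p.1 - p.2) : ℝ) : ℂ) ∂(volume.prod volume) := by
        refine setIntegral_congr_fun measurableSet_Ioi fun t ht => ?_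
        have h := congrArg (fun z => (Real.exp (-(μ * t)) : ℂ) * z)
          (integral_conj_fourier_mul_gaussian hF hG ht)
        rw [← integral_const_mul, ← integral_const_mul] at h
        refine Eq.trans (integral_congr_ae (Eventually.of_forall fun ξ => ?_)) (h.trans
          (integral_congr_ae (Eventually.of_forall fun p => ?_))) <;>
        · push_cast
          ring
    _ = ∫ p : Plane × Plane, (∫ t in Ioi 0, conj (F p.1) * G p.2 *
          ((Real.exp (-(μ * t)) * heat t (p.1 - p.2) : ℝ) : ℂ)) ∂(volume.prod volume) :=
        (integral_integral_swap hi2).symm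
    _ = _ := by
        refine integral_congr_ae (Eventually.of_forall fun p => ?_)
        simp only
        rw [integral_const_mul, integral_complex_ofReal, integral_exp_mul_heat]

end ResolventForm

/-! ### Multiplication operators, Fourier multipliers and their powers. -/

section Multipliers

open scoped ComplexConjugate BoundedContinuousFunction

/-- Multiplication by an essentially bounded function, on `L²`. -/
def mulBdd (m : Plane → ℂ) (hm : MemLp m ⊤ volume) : L2 →L[ℂ] L2 :=
  (ContinuousLinearMap.mul ℂ ℂ).holderL volume ⊤ 2 2 (hm.toLp m)

theorem coeFn_mulBdd {m : Plane → ℂ} (hm : MemLp m ⊤ volume) (φ : L2) :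
    mulBdd m hm φ =ᵐ[volume] fun x => m x * φ x := by
  have h := ContinuousLinearMap.coeFn_holder (r := 2) (ContinuousLinearMap.mul ℂ ℂ) (hm.toLp m) φ
  filter_upwards [h, hm.coeFn_toLp] with x hx hx'
  rw [← hx']
  exact hx

theorem memLp_top_bcf (m : Plane →ᵇ ℂ) : MemLp m ⊤ (volume : Measure Plane) :=
  memLp_top_of_bound m.continuous.aestronglyMeasurable ‖m‖ (Eventually.of_forall m.norm_coe_le_norm)

theorem L2.ext_fourier {f g : L2} (h : (𝓕 f : L2) =ᵐ[volume] (𝓕 g : L2)) : f = g :=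
  (Lp.fourierTransformₗᵢ Plane ℂ).injective (Lp.ext h)

theorem L2.inner_eq_integral_fourier (f g : L2) :
    ⟪f, g⟫_ℂ = ∫ ξ, conj ((𝓕 f : L2) ξ) * (𝓕 g : L2) ξ := by
  rw [← Lp.inner_fourier_eq f g, L2.inner_def]
  refine integral_congr_ae (Eventually.of_forall fun ξ => ?_)
  simp only [RCLike.inner_apply]
  rw [mul_comm]

/-- The Fourier multiplier with a given symbol. -/
def fourierMulFun (m : Plane →ᵇ ℂ) : L2 →L[ℂ] L2 :=
  ((Lp.fourierTransformₗᵢ Plane ℂ).symm : L2 →L[ℂ] L2) ∘L mulBdd m (memLp_top_bcf m) ∘L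
    ((Lp.fourierTransformₗᵢ Plane ℂ) : L2 →L[ℂ] L2)

theorem fourier_fourierMulFun (m : Plane →ᵇ ℂ) (f : L2) :
    (𝓕 (fourierMulFun m f) : L2) =ᵐ[volume] fun ξ => m ξ * (𝓕 f : L2) ξ := by
  have h : (𝓕 (fourierMulFun m f) : L2) = mulBdd m (memLp_top_bcf m) (𝓕 f) :=
    (Lp.fourierTransformₗᵢ Plane ℂ).apply_symm_apply _
  rw [h]
  exact coeFn_mulBdd _ _

/-- Fourier multipliers as a star homomorphism on bounded continuous symbols. -/
def fourierMul : (Plane →ᵇ ℂ) →⋆ₐ[ℂ] (L2 →L[ℂ] L2) where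
  toFun := fourierMulFun
  map_one' := by
    ext1 f
    refine L2.ext_fourier ?_
    filter_upwards [fourier_fourierMulFun 1 f] with ξ hξ
    rw [hξ]
    simp
  map_mul' m n := by
    ext1 f
    refine L2.ext_fourier ?_
    filter_upwards [fourier_fourierMulFun (m * n) f, fourier_fourierMulFun m (fourierMulFun n f),
      fourier_fourierMulFun n f] with ξ h1 h2 h3
    rw [h1]
    change _ = (𝓕 (fourierMulFun m (fourierMulFun n f)) : L2) ξ
    rw [h2, h3, BoundedContinuousFunction.mul_apply, mul_assoc]
  map_zero' := by
    ext1 f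
    refine L2.ext_fourier ?_
    filter_upwards [fourier_fourierMulFun 0 f, Lp.coeFn_zero ℂ 2 (volume : Measure Plane)]
      with ξ hξ h0
    have : (𝓕 ((0 : L2 →L[ℂ] L2) f) : L2) = 0 := (Lp.fourierTransformₗᵢ Plane ℂ).map_zero
    rw [hξ, this, h0]
    simp
  map_add' m n := by
    ext1 f
    refine L2.ext_fourier ?_
    have hadd : (𝓕 ((fourierMulFun m + fourierMulFun n) f) : L2)
        = 𝓕 (fourierMulFun m f) + 𝓕 (fourierMulFun n f) :=
      (Lp.fourierTransformₗᵢ Plane ℂ).map_add _ _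
    rw [hadd]
    filter_upwards [fourier_fourierMulFun (m + n) f, fourier_fourierMulFun m f,
      fourier_fourierMulFun n f, Lp.coeFn_add (𝓕 (fourierMulFun m f) : L2)
        (𝓕 (fourierMulFun n f) : L2)] with ξ h1 h2 h3 h4
    rw [h1, h4, Pi.add_apply, h2, h3, BoundedContinuousFunction.add_apply, add_mul]
  commutes' c := by
    ext1 f
    refine L2.ext_fourier ?_
    have hs : (𝓕 ((algebraMap ℂ (L2 →L[ℂ] L2) c) f) : L2) = c • (𝓕 f : L2) := by
      rw [Algebra.algebraMap_eq_smul_one]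
      exact (Lp.fourierTransformₗᵢ Plane ℂ).map_smul _ _
    rw [hs]
    filter_upwards [fourier_fourierMulFun (algebraMap ℂ _ c) f, Lp.coeFn_smul c (𝓕 f : L2)]
      with ξ h1 h2
    rw [h1, h2]
    simp [Algebra.algebraMap_eq_smul_one]
  map_star' m := by
    rw [ContinuousLinearMap.star_eq_adjoint, ContinuousLinearMap.eq_adjoint_iff]
    intro f g
    rw [L2.inner_eq_integral_fourier, L2.inner_eq_integral_fourier]
    refine integral_congr_ae ?_
    filter_upwards [fourier_fourierMulFun (star m) f, fourier_fourierMulFun m g] with ξ h1 h2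
    rw [h1, h2, BoundedContinuousFunction.star_apply, map_mul]
    simp only [RCLike.star_def, Complex.conj_conj]
    ring

theorem fourier_fourierMul (m : Plane →ᵇ ℂ) (f : L2) :
    (𝓕 (fourierMul m f) : L2) =ᵐ[volume] fun ξ => m ξ * (𝓕 f : L2) ξ :=
  fourier_fourierMulFun m f

/-- A bounded continuous real function as a complex symbol. -/
def realSymbol (ν : Plane → ℝ) (hc : Continuous ν) (C : ℝ) (hb : ∀ ξ, |ν ξ| ≤ C) : Plane →ᵇ ℂ :=
  BoundedContinuousFunction.ofNormedAddCommGroup (fun ξ => (ν ξ : ℂ))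
    (Complex.continuous_ofReal.comp hc) C fun ξ => by simpa [Complex.norm_real] using hb ξ

theorem realSymbol_apply {ν : Plane → ℝ} (hc : Continuous ν) {C : ℝ} (hb : ∀ ξ, |ν ξ| ≤ C)
    (ξ : Plane) : realSymbol ν hc C hb ξ = (ν ξ : ℂ) := rfl

theorem isSelfAdjoint_realSymbol {ν : Plane → ℝ} (hc : Continuous ν) {C : ℝ} (hb : ∀ ξ, |ν ξ| ≤ C) :
    IsSelfAdjoint (realSymbol ν hc C hb) := by
  ext ξ
  simp [realSymbol_apply]

theorem inner_fourierMul_realSymbol {ν : Plane → ℝ} (hc : Continuous ν) {C : ℝ}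
    (hb : ∀ ξ, |ν ξ| ≤ C) (f : L2) :
    ⟪fourierMul (realSymbol ν hc C hb) f, f⟫_ℂ = ((∫ ξ, ν ξ * ‖(𝓕 f : L2) ξ‖ ^ 2 : ℝ) : ℂ) := by
  rw [L2.inner_eq_integral_fourier, ← integral_complex_ofReal]
  refine integral_congr_ae ?_
  filter_upwards [fourier_fourierMul (realSymbol ν hc C hb) f] with ξ h1
  rw [h1, map_mul, realSymbol_apply, Complex.conj_ofReal, mul_assoc, Complex.conj_mul']
  push_cast
  ring

theorem fourierMul_nonneg {ν : Plane → ℝ} (hc : Continuous ν) {C : ℝ} (hb : ∀ ξ, |ν ξ| ≤ C)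
    (h0 : ∀ ξ, 0 ≤ ν ξ) : 0 ≤ fourierMul (realSymbol ν hc C hb) := by
  rw [ContinuousLinearMap.nonneg_iff_isPositive, ContinuousLinearMap.isPositive_iff_complex]
  intro f
  rw [inner_fourierMul_realSymbol]
  refine ⟨by simp, ?_⟩
  have : 0 ≤ ∫ ξ, ν ξ * ‖(𝓕 f : L2) ξ‖ ^ 2 := integral_nonneg fun ξ => mul_nonneg (h0 ξ) (by positivity)
  simpa using this

/-- Real powers of a nonnegative bounded operator on a complex Hilbert space. -/
def hilbertRpow {E : Type*} [NormedAddCommGroup E] [InnerProductSpace ℂ E] [CompleteSpace E]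
    (A : E →L[ℂ] E) (s : ℝ) : E →L[ℂ] E := A ^ s

open scoped CStarAlgebra in
theorem continuous_starAlgHom {A B : Type*} [CStarAlgebra A] [CStarAlgebra B] (Φ : A →⋆ₐ[ℂ] B) :
    Continuous Φ := map_continuous Φ

/-- The functional calculus commutes with star homomorphisms. Applied to `Φ` it moves the power
inside; applied to the separating evaluations `ev` it computes that power as `b`. -/
theorem cfc_rpow_map {A E : Type*} [CStarAlgebra A] [NormedAddCommGroup E] [InnerProductSpace ℂ E]
    [CompleteSpace E] (Φ : A →⋆ₐ[ℂ] (E →L[ℂ] E)) {a b : A} (ha : IsSelfAdjoint a)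
    (h0 : 0 ≤ Φ a) {s : ℝ} (hs : 0 ≤ s) {ι : Type*} (ev : ι → A →⋆ₐ[ℂ] ℂ)
    (hev : ∀ x y : A, (∀ i, ev i x = ev i y) → x = y) (α : ι → ℝ)
    (hα : ∀ i, ev i a = (α i : ℂ)) (hβ : ∀ i, ev i b = ((α i ^ s : ℝ) : ℂ)) :
    hilbertRpow (Φ a) s = Φ b := by
  have hcont : Continuous fun t : ℝ => t ^ s := Real.continuous_rpow_const hs
  have hΦ : Continuous Φ := continuous_starAlgHom Φ
  rw [hilbertRpow, CFC.rpow_eq_cfc_real h0,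
    ← StarAlgHomClass.map_cfc (R := ℝ) (S := ℂ) (p := IsSelfAdjoint) (q := IsSelfAdjoint) Φ
    (fun t : ℝ => t ^ s) a hcont.continuousOn hΦ ha (ha.map Φ)]
  congr 1
  refine hev _ _ fun i => ?_
  have h := StarAlgHomClass.map_cfc (R := ℝ) (S := ℂ) (p := IsSelfAdjoint) (q := IsSelfAdjoint) (ev i)
    (fun t : ℝ => t ^ s) a hcont.continuousOn (map_continuous (ev i)) ha (ha.map (ev i))
  have h2 : ev i a = algebraMap ℝ ℂ (α i) := hα i
  rw [h, h2, cfc_algebraMap, hβ]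
  rfl

/-- Evaluation at a point, as a star homomorphism. -/
def evalStarHom (ξ : Plane) : (Plane →ᵇ ℂ) →⋆ₐ[ℂ] ℂ where
  toFun := fun m => m ξ
  map_one' := rfl
  map_mul' := fun _ _ => rfl
  map_zero' := rfl
  map_add' := fun _ _ => rfl
  commutes' := fun c => by simp [Algebra.algebraMap_eq_smul_one]
  map_star' := fun _ => rfl

theorem hilbertRpow_fourierMul {ν : Plane → ℝ} (hc : Continuous ν) {C : ℝ} (hb : ∀ ξ, |ν ξ| ≤ C)
    (h0 : ∀ ξ, 0 ≤ ν ξ) {s : ℝ} (hs : 0 ≤ s) {C' : ℝ} (hc' : Continuous fun ξ => ν ξ ^ s)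
    (hb' : ∀ ξ, |ν ξ ^ s| ≤ C') :
    hilbertRpow (fourierMul (realSymbol ν hc C hb)) s
      = fourierMul (realSymbol (fun ξ => ν ξ ^ s) hc' C' hb') :=
  cfc_rpow_map (A := Plane →ᵇ ℂ) (E := L2) fourierMul (isSelfAdjoint_realSymbol hc hb)
    (fourierMul_nonneg hc hb h0) hs evalStarHom (fun _ _ h => DFunLike.ext _ _ h) ν (fun _ => rfl)
    (fun _ => rfl)

end Multipliers

/-! ### Weak equations on the Fourier side. -/

section WeakFourier

open scoped SchwartzMap

variable {F : Plane → ℂ}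

theorem L2.integral_mul_schwartz (f : L2) (θ : 𝓢(Plane, ℂ)) :
    ∫ x, f x * θ x = ∫ ξ, (𝓕 f : L2) ξ * (𝓕⁻ θ) ξ := by
  have h := congrArg (fun T => T (𝓕⁻ θ)) (Lp.fourier_toTemperedDistribution_eq f)
  simp only [TemperedDistribution.fourier_apply, FourierTransform.fourier_fourierInv_eq,
    Lp.toTemperedDistribution_apply] at h
  simp only [smul_eq_mul] at h
  simp_rw [mul_comm _ (θ _), mul_comm _ ((𝓕⁻ θ) _)]
  exact h

theorem integral_mul_schwartz_of_integrable (hF : Integrable F) (θ : 𝓢(Plane, ℂ)) :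
    ∫ x, F x * θ x = ∫ ξ, 𝓕 F ξ * (𝓕⁻ θ) ξ := by
  rw [integral_fourier_mul_eq hF (𝓕⁻ θ).integrable]
  have : 𝓕 ((𝓕⁻ θ : 𝓢(Plane, ℂ)) : Plane → ℂ) = θ := by
    rw [← SchwartzMap.fourier_coe, FourierTransform.fourier_fourierInv_eq]
  rw [this]

theorem fourier_laplacian (θ : 𝓢(Plane, ℂ)) (ξ : Plane) :
    (𝓕 (Δ θ)) ξ = -(freqSq ξ : ℂ) * (𝓕 θ) ξ := by
  have hg : (fun x : Plane => ‖x‖ ^ 2).HasTemperateGrowth := by fun_prop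
  rw [SchwartzMap.laplacian_eq_fourierMultiplierCLM, FourierTransform.fourier_smul,
    SchwartzMap.fourierMultiplierCLM_apply, FourierTransform.fourier_fourierInv_eq,
    smul_apply, SchwartzMap.smulLeftCLM_apply_apply (by fun_prop), freqSq]
  simp only [Complex.real_smul]
  push_cast
  ring

theorem schwartz_fourierInv_eq (θ : 𝓢(Plane, ℂ)) (ξ : Plane) : (𝓕⁻ θ) ξ = (𝓕 θ) (-ξ) := by
  rw [SchwartzMap.fourierInv_coe, SchwartzMap.fourier_coe, Real.fourierInv_eq_fourier_neg]

theorem freqSq_neg (ξ : Plane) : freqSq (-ξ) = freqSq ξ := by simp [freqSq]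

theorem fourierInv_laplacian (θ : 𝓢(Plane, ℂ)) (ξ : Plane) :
    (𝓕⁻ (Δ θ)) ξ = -(freqSq ξ : ℂ) * (𝓕⁻ θ) ξ := by
  rw [schwartz_fourierInv_eq, schwartz_fourierInv_eq, fourier_laplacian, freqSq_neg]

theorem L2.integrable_mul_schwartz (f : L2) (θ : 𝓢(Plane, ℂ)) : Integrable fun x => f x * θ x :=
  (Lp.memLp f).integrable_mul (θ.memLp 2)

/-- The symbol side of the equation `(-Δ + μ) u = f - F`. -/
def weakDefect (μ : ℝ) (u f : L2) (F : Plane → ℂ) (ξ : Plane) : ℂ :=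
  (𝓕 f : L2) ξ - 𝓕 F ξ - ((freqSq ξ + μ : ℝ) : ℂ) * (𝓕 u : L2) ξ

theorem integrable_weakDefect_mul (μ : ℝ) (u f : L2) (hF : Integrable F) (θ : 𝓢(Plane, ℂ)) :
    Integrable fun ξ => weakDefect μ u f F ξ * (𝓕⁻ θ) ξ := by
  have h1 := L2.integrable_mul_schwartz (𝓕 f) (𝓕⁻ θ)
  have h2 := integrable_fourier_mul hF (𝓕⁻ θ).integrable
  have h3 := (L2.integrable_mul_schwartz (𝓕 u) (𝓕⁻ θ)).const_mul (μ : ℂ)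
  have h4 := L2.integrable_mul_schwartz (𝓕 u) (𝓕⁻ (Δ θ))
  refine (((h1.sub h2).sub h3).add h4).congr (Eventually.of_forall fun ξ => ?_)
  simp only [Pi.add_apply, Pi.sub_apply, fourierInv_laplacian, weakDefect]
  push_cast
  ring

theorem integral_weakDefect (μ : ℝ) (u f : L2) (hF : Integrable F) (θ : 𝓢(Plane, ℂ)) :
    ∫ ξ, weakDefect μ u f F ξ * (𝓕⁻ θ) ξ
      = (∫ x, (f x - (μ : ℂ) * u x - F x) * θ x) - ∫ x, u x * (-(Δ (θ : Plane → ℂ) x)) := by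
  have h1 := L2.integrable_mul_schwartz (𝓕 f) (𝓕⁻ θ)
  have h2 := integrable_fourier_mul hF (𝓕⁻ θ).integrable
  have h3 := (L2.integrable_mul_schwartz (𝓕 u) (𝓕⁻ θ)).const_mul (μ : ℂ)
  have h4 := L2.integrable_mul_schwartz (𝓕 u) (𝓕⁻ (Δ θ))
  have e1 : ∫ ξ, weakDefect μ u f F ξ * (𝓕⁻ θ) ξ
      = ∫ ξ, ((𝓕 f : L2) ξ * (𝓕⁻ θ) ξ - 𝓕 F ξ * (𝓕⁻ θ) ξ - (μ : ℂ) * ((𝓕 u : L2) ξ * (𝓕⁻ θ) ξ)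
        + (𝓕 u : L2) ξ * (𝓕⁻ (Δ θ)) ξ) := by
    refine integral_congr_ae (Eventually.of_forall fun ξ => ?_)
    simp only [fourierInv_laplacian, weakDefect]
    push_cast
    ring
  have h12 : Integrable fun ξ => (𝓕 f : L2) ξ * (𝓕⁻ θ) ξ - 𝓕 F ξ * (𝓕⁻ θ) ξ := h1.sub h2
  have h123 : Integrable fun ξ => (𝓕 f : L2) ξ * (𝓕⁻ θ) ξ - 𝓕 F ξ * (𝓕⁻ θ) ξ
      - (μ : ℂ) * ((𝓕 u : L2) ξ * (𝓕⁻ θ) ξ) := h12.sub h3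
  rw [e1, integral_add h123 h4, integral_sub h12 h3, integral_sub h1 h2, integral_const_mul,
    ← L2.integral_mul_schwartz, ← L2.integral_mul_schwartz, ← L2.integral_mul_schwartz,
    ← integral_mul_schwartz_of_integrable hF]
  have i1 := L2.integrable_mul_schwartz f θ
  have i2 := (L2.integrable_mul_schwartz u θ).const_mul (μ : ℂ)
  have i3 : Integrable fun x => F x * θ x :=
    hF.mul_bdd (c := SchwartzMap.seminorm ℝ 0 0 θ) θ.continuous.aestronglyMeasurable
      (Eventually.of_forall (SchwartzMap.norm_le_seminorm ℝ θ))
  have e2 : ∫ x, (f x - (μ : ℂ) * u x - F x) * θ x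
      = ∫ x, (f x * θ x - (μ : ℂ) * (u x * θ x) - F x * θ x) :=
    integral_congr_ae (Eventually.of_forall fun x => by ring)
  have i12 : Integrable fun x => f x * θ x - (μ : ℂ) * (u x * θ x) := i1.sub i2
  rw [e2, integral_sub i12 i3, integral_sub i1 i2, integral_const_mul]
  have e3 : ∫ x, u x * (-(Δ (θ : Plane → ℂ) x)) = -∫ x, u x * (Δ θ) x := by
    rw [← integral_neg]
    refine integral_congr_ae (Eventually.of_forall fun x => ?_)
    simp only [SchwartzMap.laplacian_apply, mul_neg]
  rw [e3]
  ring

theorem ae_eq_zero_of_fourier_eq_zero (hF : Integrable F) (h : ∀ x, 𝓕 F x = 0) :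
    ∀ᵐ x, F x = 0 := by
  refine ae_eq_zero_of_integral_contDiff_smul_eq_zero hF.locallyIntegrable fun g hg hc => ?_
  have hc' : HasCompactSupport fun x => (g x : ℂ) := hc.comp_left (g := Complex.ofReal) rfl
  have h1 := integral_mul_schwartz_of_integrable hF
    (hc'.toSchwartzMap (Complex.ofRealCLM.contDiff.comp hg))
  simp only [h, zero_mul, integral_zero] at h1
  rw [← h1]
  refine integral_congr_ae (Eventually.of_forall fun x => ?_)
  simp only [Complex.real_smul, mul_comm]
  rfl

/-- The Plancherel transform and the Fourier integral agree on `L¹ ∩ L²`, since they have the same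
pairings with Schwartz functions. -/
theorem fourier_toLp_ae_eq (hF : Integrable F) (hF2 : MemLp F 2 volume) :
    (𝓕 (hF2.toLp F) : L2) =ᵐ[volume] 𝓕 F := by
  refine ae_eq_of_integral_contDiff_smul_eq ((Lp.memLp _).locallyIntegrable one_le_two)
    (continuous_fourier_of_integrable hF).locallyIntegrable fun g hg hc => ?_
  have hc' : HasCompactSupport fun x => (g x : ℂ) := hc.comp_left (g := Complex.ofReal) rfl
  set θ := hc'.toSchwartzMap (Complex.ofRealCLM.contDiff.comp hg) with hθ
  have h1 := integral_mul_schwartz_of_integrable hF (𝓕 θ)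
  have h2 := L2.integral_mul_schwartz (hF2.toLp F) (𝓕 θ)
  rw [FourierTransform.fourierInv_fourier_eq] at h1 h2
  have h3 : ∫ x, hF2.toLp F x * (𝓕 θ) x = ∫ x, F x * (𝓕 θ) x := by
    refine integral_congr_ae ?_
    filter_upwards [hF2.coeFn_toLp] with x hx
    rw [hx]
  rw [h1, h2] at h3
  have e : ∀ G : Plane → ℂ, ∫ x, g x • G x = ∫ x, G x * θ x := fun G =>
    integral_congr_ae (Eventually.of_forall fun x => by
      simp only [Complex.real_smul, mul_comm]
      rfl)
  rw [e, e, h3]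

/-- Translating a test function multiplies its inverse transform by a character. So the hypothesis
for all translates says that the integrable function `D φ̌` has zero Fourier transform. -/
theorem ae_mul_fourierInv_eq_zero {D : Plane → ℂ}
    (hint : ∀ θ : 𝓢(Plane, ℂ), Integrable fun ξ => D ξ * (𝓕⁻ θ) ξ)
    (hD : ∀ (φ : Plane → ℂ) (hφ : ContDiff ℝ ∞ φ) (hc : HasCompactSupport φ),
      ∫ ξ, D ξ * (𝓕⁻ (hc.toSchwartzMap hφ)) ξ = 0)
    {φ : Plane → ℂ} (hφ : ContDiff ℝ ∞ φ) (hc : HasCompactSupport φ) :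
    ∀ᵐ ξ, D ξ * (𝓕⁻ (hc.toSchwartzMap hφ)) ξ = 0 := by
  refine ae_eq_zero_of_fourier_eq_zero (hint _) fun x => ?_
  have hc1 : HasCompactSupport fun y => φ (y + x) :=
    hc.comp_homeomorph (Homeomorph.addRight x)
  have hφ1 : ContDiff ℝ ∞ fun y => φ (y + x) := hφ.comp (contDiff_id.add contDiff_const)
  have h := hD _ hφ1 hc1
  rw [Real.fourier_eq, ← h]
  refine integral_congr_ae (Eventually.of_forall fun ξ => ?_)
  simp only
  rw [schwartz_fourierInv_eq, schwartz_fourierInv_eq, SchwartzMap.fourier_coe, SchwartzMap.fourier_coe]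
  have h2 := congrFun (VectorFourier.fourierIntegral_comp_add_right Real.fourierChar volume
    (innerₗ Plane) φ x) (-ξ)
  have h3 : 𝓕 (fun y => φ (y + x)) (-ξ) = Real.fourierChar (⟪x, -ξ⟫_ℝ) • 𝓕 φ (-ξ) := h2
  change _ = D ξ * 𝓕 (fun y => φ (y + x)) (-ξ)
  rw [h3, inner_neg_right, real_inner_comm, mul_smul_comm]
  rfl

/-- If the bump lives in radius `r` and `8 r |ξ| ≤ 1`, all phases are at most `π/4`, so the real
part of the transform is positive. Small bumps thus detect any bounded set of frequencies. -/
theorem exists_fourierInv_ne_zero {r : ℝ} (hr : 0 < r) :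
    ∃ (φ : Plane → ℂ) (hφ : ContDiff ℝ ∞ φ) (hc : HasCompactSupport φ),
      ∀ ξ : Plane, 8 * r * ‖ξ‖ ≤ 1 → (𝓕⁻ (hc.toSchwartzMap hφ)) ξ ≠ 0 := by
  obtain ⟨b, hbr⟩ : ∃ b : ContDiffBump (0 : Plane), b.rOut = r :=
    ⟨⟨r / 2, r, by positivity, by linarith⟩, rfl⟩
  have hφ : ContDiff ℝ ∞ fun x => (b x : ℂ) := Complex.ofRealCLM.contDiff.comp b.contDiff
  have hc : HasCompactSupport fun x => (b x : ℂ) :=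
    b.hasCompactSupport.comp_left (g := Complex.ofReal) rfl
  refine ⟨_, hφ, hc, fun ξ hξ h0 => ?_⟩
  rw [schwartz_fourierInv_eq, SchwartzMap.fourier_coe] at h0
  change 𝓕 (fun x => (b x : ℂ)) (-ξ) = 0 at h0
  rw [Real.fourier_eq'] at h0
  have hcont : Continuous fun v => b v * Real.cos (2 * Real.pi * ⟪v, ξ⟫_ℝ) := by
    have := b.continuous
    fun_prop
  have hcos : ∀ v, b v ≠ 0 → 0 < Real.cos (2 * Real.pi * ⟪v, ξ⟫_ℝ) := by
    intro v hv
    have hvr : ‖v‖ < r := by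
      have : v ∈ Function.support b := hv
      rw [b.support_eq, hbr] at this
      simpa using this
    have h1 : |⟪v, ξ⟫_ℝ| ≤ r * ‖ξ‖ :=
      (abs_real_inner_le_norm v ξ).trans (by gcongr)
    have hpi := Real.pi_pos
    have h2 := abs_le.1 h1
    refine Real.cos_pos_of_mem_Ioo ⟨?_, ?_⟩ <;> nlinarith
  have hpos : 0 < ∫ v, b v * Real.cos (2 * Real.pi * ⟪v, ξ⟫_ℝ) := by
    refine hcont.integral_pos_of_hasCompactSupport_nonneg_nonzero (x := 0)
      b.hasCompactSupport.mul_right (fun v => ?_) ?_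
    · rcases eq_or_ne (b v) 0 with h | h
      · simp [h]
      · exact mul_nonneg b.nonneg (hcos v h).le
    · have h1 : b 0 = 1 := b.one_of_mem_closedBall (Metric.mem_closedBall_self b.rIn_pos.le)
      simp [h1]
  have hi : Integrable fun v : Plane =>
      Complex.exp (((-2 * Real.pi * ⟪v, -ξ⟫_ℝ : ℝ) : ℂ) * Complex.I) • (b v : ℂ) := by
    have hb := b.continuous
    refine Continuous.integrable_of_hasCompactSupport (by fun_prop) (hc.mono fun v hv h => hv ?_)
    simp only [h, smul_zero]
  have hre := congrArg RCLike.re h0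
  rw [← integral_re hi] at hre
  refine hpos.ne' (Eq.trans (integral_congr_ae (Eventually.of_forall fun v => ?_)) (hre.trans (by simp)))
  simp only [smul_eq_mul, inner_neg_right]
  rw [mul_comm]
  change _ = (Complex.exp (((-2 * Real.pi * -⟪v, ξ⟫_ℝ : ℝ) : ℂ) * Complex.I) * (b v : ℂ)).re
  rw [Complex.re_mul_ofReal, Complex.exp_ofReal_mul_I_re]
  congr 2
  ring

/-- The weak equation `(-Δ + μ) u = f - F` in `L²` holds on the Fourier side. -/
theorem ae_weakDefect_eq_zero {μ : ℝ} {u f : L2} (hF : Integrable F)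
    (h : ∀ φ : Plane → ℂ, ContDiff ℝ ∞ φ → HasCompactSupport φ →
      ∫ x, u x * (-(Δ φ) x) = ∫ x, (f x - (μ : ℂ) * u x - F x) * φ x) :
    ∀ᵐ ξ, weakDefect μ u f F ξ = 0 := by
  have hint := integrable_weakDefect_mul μ u f hF
  have hn : ∀ n : ℕ, ∀ᵐ ξ, ‖ξ‖ ≤ n → weakDefect μ u f F ξ = 0 := by
    intro n
    obtain ⟨φ, hφ, hc, hne⟩ := exists_fourierInv_ne_zero (r := 1 / (8 * (n + 1))) (by positivity)
    have h1 := ae_mul_fourierInv_eq_zero hint (fun φ hφ hc => by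
      rw [integral_weakDefect μ u f hF, sub_eq_zero]
      exact (h φ hφ hc).symm) hφ hc
    filter_upwards [h1] with ξ hξ hξn
    refine (mul_eq_zero.1 hξ).resolve_right (hne ξ ?_)
    have : 8 * (1 / (8 * ((n : ℝ) + 1))) * ‖ξ‖ = ‖ξ‖ / (n + 1) := by field_simp
    rw [this, div_le_one (by positivity)]
    linarith
  filter_upwards [ae_all_iff.2 hn] with ξ hξ
  obtain ⟨n, hn⟩ := exists_nat_ge ‖ξ‖
  exact hξ n hn

theorem integral_mul_laplacian_eq {μ : ℝ} {u f : L2} (hF : Integrable F)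
    (h : ∀ᵐ ξ, weakDefect μ u f F ξ = 0) {φ : Plane → ℂ} (hφ : ContDiff ℝ ∞ φ)
    (hc : HasCompactSupport φ) :
    ∫ x, u x * (-(Δ φ) x) = ∫ x, (f x - (μ : ℂ) * u x - F x) * φ x := by
  have h1 := integral_weakDefect μ u f hF (hc.toSchwartzMap hφ)
  have h0 : ∫ ξ, weakDefect μ u f F ξ * (𝓕⁻ (hc.toSchwartzMap hφ)) ξ = 0 := by
    rw [integral_congr_ae (g := fun _ => 0), integral_zero]
    filter_upwards [h] with ξ hξ
    rw [hξ, zero_mul]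
  rw [h0] at h1
  exact (sub_eq_zero.1 h1.symm).symm

end WeakFourier

/-! ### The operator `(-Δ + μ)^{-1/2} v`. -/

section Birman

open scoped ComplexConjugate

variable {V : Plane → ℝ} {μ : ℝ}

theorem L2.inner_eq_integral (f g : L2) : ⟪f, g⟫_ℂ = ∫ x, conj (f x) * g x := by
  rw [L2.inner_def]
  refine integral_congr_ae (Eventually.of_forall fun ξ => ?_)
  simp only [RCLike.inner_apply]
  rw [mul_comm]

theorem inner_mulBdd_left {m : Plane → ℝ} (hm : MemLp (fun x => (m x : ℂ)) ⊤ volume) (f g : L2) :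
    ⟪mulBdd _ hm f, g⟫_ℂ = ⟪f, mulBdd _ hm g⟫_ℂ := by
  rw [L2.inner_eq_integral, L2.inner_eq_integral]
  refine integral_congr_ae ?_
  filter_upwards [coeFn_mulBdd hm f, coeFn_mulBdd hm g] with x h1 h2
  rw [h1, h2, map_mul, Complex.conj_ofReal]
  ring

theorem isSelfAdjoint_mulBdd {m : Plane → ℝ} (hm : MemLp (fun x => (m x : ℂ)) ⊤ volume) :
    IsSelfAdjoint (mulBdd _ hm) := by
  rw [ContinuousLinearMap.isSelfAdjoint_iff_isSymmetric]
  exact fun f g => inner_mulBdd_left hm f g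

/-- The product `v φ`, with `v = |V|^{1/2}`. -/
def rootMul (V : Plane → ℝ) (φ : L2) (x : Plane) : ℂ := (rootAbs V x : ℂ) * φ x

theorem integrable_rootMul (hV : Integrable V) (φ : L2) : Integrable (rootMul V φ) :=
  (memLp_rootAbs hV).integrable_mul (Lp.memLp φ)

theorem rootMul_add (V : Plane → ℝ) (φ ψ : L2) :
    rootMul V (φ + ψ) =ᵐ[volume] rootMul V φ + rootMul V ψ := by
  filter_upwards [Lp.coeFn_add φ ψ] with x hx
  simp only [rootMul, hx, Pi.add_apply, mul_add]

theorem rootMul_smul (V : Plane → ℝ) (c : ℂ) (φ : L2) :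
    rootMul V (c • φ) =ᵐ[volume] c • rootMul V φ := by
  filter_upwards [Lp.coeFn_smul c φ] with x hx
  simp only [rootMul, hx, Pi.smul_apply, smul_eq_mul]
  ring

theorem fourier_rootMul_add (hV : Integrable V) (φ ψ : L2) (ξ : Plane) :
    𝓕 (rootMul V (φ + ψ)) ξ = 𝓕 (rootMul V φ) ξ + 𝓕 (rootMul V ψ) ξ := by
  rw [Real.fourier_congr_ae (rootMul_add V φ ψ)]
  exact congrFun (VectorFourier.fourierIntegral_add Real.continuous_fourierChar continuous_inner_prod
    (integrable_rootMul hV φ) (integrable_rootMul hV ψ)) ξ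

theorem fourier_rootMul_smul (V : Plane → ℝ) (c : ℂ) (φ : L2) (ξ : Plane) :
    𝓕 (rootMul V (c • φ)) ξ = c * 𝓕 (rootMul V φ) ξ := by
  rw [Real.fourier_congr_ae (rootMul_smul V c φ)]
  exact congrFun (VectorFourier.fourierIntegral_const_smul _ _ _ _ _) ξ

theorem enorm_rootMul (V : Plane → ℝ) (φ : L2) (x : Plane) :
    ‖rootMul V φ x‖ₑ = ‖rootAbs V x‖ₑ * ‖φ x‖ₑ := enorm_ofReal_mul _ _

/-- The squared Hilbert–Schmidt norm of the kernel `v(x) K(x,y) v(y)`. -/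
def hsSq (V : Plane → ℝ) (K : Plane × Plane → ℝ≥0∞) : ℝ≥0∞ :=
  ∫⁻ p, ‖V p.1‖ₑ * ‖V p.2‖ₑ * K p ^ 2 ∂((volume : Measure Plane).prod volume)

/-- Cauchy–Schwarz on the product space, separating the weighted kernel from `ψ ⊗ φ`. -/
theorem lintegral_rootMul_mul_le (hV : AEMeasurable V) {K : Plane × Plane → ℝ≥0∞} (hK : Measurable K)
    (ψ φ : L2) :
    ∫⁻ p : Plane × Plane, ‖rootMul V ψ p.1‖ₑ * ‖rootMul V φ p.2‖ₑ * K p ∂(volume.prod volume)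
      ≤ hsSq V K ^ (1 / 2 : ℝ) * (‖ψ‖ₑ * ‖φ‖ₑ) := by
  have hr : AEMeasurable fun x => ‖rootAbs V x‖ₑ := (aemeasurable_rootAbs hV).enorm
  have hφ : ∀ φ : L2, AEMeasurable fun x => ‖φ x‖ₑ := fun φ => (Lp.aestronglyMeasurable φ).enorm
  have h1 : ∀ {a : Plane → ℝ≥0∞}, AEMeasurable a →
      AEMeasurable (fun p : Plane × Plane => a p.1) (volume.prod volume) := fun ha =>
    ha.comp_quasiMeasurePreserving Measure.quasiMeasurePreserving_fst
  have h2 : ∀ {a : Plane → ℝ≥0∞}, AEMeasurable a →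
      AEMeasurable (fun p : Plane × Plane => a p.2) (volume.prod volume) := fun ha =>
    ha.comp_quasiMeasurePreserving Measure.quasiMeasurePreserving_snd
  have hc := ENNReal.lintegral_mul_le_Lp_mul_Lq (volume.prod volume) Real.HolderConjugate.two_two
    (f := fun p : Plane × Plane => ‖rootAbs V p.1‖ₑ * ‖rootAbs V p.2‖ₑ * K p)
    (g := fun p : Plane × Plane => ‖ψ p.1‖ₑ * ‖φ p.2‖ₑ)
    (((h1 hr).mul (h2 hr)).mul hK.aemeasurable) ((h1 (hφ ψ)).mul (h2 (hφ φ)))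
  refine le_trans (le_of_eq (lintegral_congr fun p => ?_)) (hc.trans (le_of_eq ?_))
  · rw [Pi.mul_apply, enorm_rootMul, enorm_rootMul]; ring
  · congr 1
    · congr 1
      refine lintegral_congr fun p => ?_
      rw [ENNReal.rpow_two, mul_pow, mul_pow, enorm_rootAbs_sq, enorm_rootAbs_sq]
    · have e : ∀ p : Plane × Plane, (‖ψ p.1‖ₑ * ‖φ p.2‖ₑ) ^ (2 : ℝ) = ‖ψ p.1‖ₑ ^ 2 * ‖φ p.2‖ₑ ^ 2 :=
        fun p => by rw [ENNReal.rpow_two, mul_pow]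
      simp_rw [e]
      rw [lintegral_prod_mul ((hφ ψ).pow_const 2) ((hφ φ).pow_const 2), ← L2.enorm_sq_eq,
        ← L2.enorm_sq_eq, ← mul_pow, ← ENNReal.rpow_natCast, ← ENNReal.rpow_mul]
      norm_num

/-- The kernel `k_μ(x - y)` as an extended nonnegative function of two variables. -/
def resKernel₂ (μ : ℝ) (p : Plane × Plane) : ℝ≥0∞ := ENNReal.ofReal (resKernel μ (p.1 - p.2))

theorem measurable_resKernel₂ (μ : ℝ) : Measurable (resKernel₂ μ) :=
  ((measurable_resKernel μ).comp (measurable_fst.sub measurable_snd)).ennreal_ofReal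

/-- The symbol of `(-Δ + μ)^{-1/2}`. -/
def rootSymbol (μ : ℝ) (ξ : Plane) : ℝ := (Real.sqrt (freqSq ξ + μ))⁻¹

theorem rootSymbol_pos (hμ : 0 < μ) (ξ : Plane) : 0 < rootSymbol μ ξ :=
  inv_pos.2 (Real.sqrt_pos.2 (freqSq_add_pos hμ ξ))

theorem rootSymbol_sq (hμ : 0 < μ) (ξ : Plane) : rootSymbol μ ξ ^ 2 = (freqSq ξ + μ)⁻¹ := by
  rw [rootSymbol, inv_pow, Real.sq_sqrt (freqSq_add_pos hμ ξ).le]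

theorem continuous_rootSymbol (hμ : 0 < μ) : Continuous (rootSymbol μ) := by
  unfold rootSymbol
  refine Continuous.inv₀ (by fun_prop) fun ξ => (Real.sqrt_pos.2 (freqSq_add_pos hμ ξ)).ne'

theorem abs_rootSymbol_le (hμ : 0 < μ) (ξ : Plane) : |rootSymbol μ ξ| ≤ (Real.sqrt μ)⁻¹ := by
  rw [abs_of_pos (rootSymbol_pos hμ ξ), rootSymbol]
  have := freqSq_nonneg ξ
  gcongr
  linarith

/-- The operator `(-Δ + μ)^{-1/2}`. -/
def freeRoot (μ : ℝ) (hμ : 0 < μ) : L2 →L[ℂ] L2 :=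
  fourierMul (realSymbol (rootSymbol μ) (continuous_rootSymbol hμ) _ (abs_rootSymbol_le hμ))

theorem fourier_freeRoot (hμ : 0 < μ) (f : L2) :
    (𝓕 (freeRoot μ hμ f) : L2) =ᵐ[volume] fun ξ => (rootSymbol μ ξ : ℂ) * (𝓕 f : L2) ξ :=
  fourier_fourierMul _ f

theorem isSelfAdjoint_freeRoot (hμ : 0 < μ) : IsSelfAdjoint (freeRoot μ hμ) :=
  (isSelfAdjoint_realSymbol _ _).map fourierMul

/-- `B` is the operator `(-Δ + μ)^{-1/2} v`. -/
def IsBirman (V : Plane → ℝ) (μ : ℝ) (B : L2 →L[ℂ] L2) : Prop :=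
  ∀ φ : L2, (𝓕 (B φ) : L2) =ᵐ[volume] fun ξ => (rootSymbol μ ξ : ℂ) * 𝓕 (rootMul V φ) ξ

theorem enorm_rootSymbol_sq (hμ : 0 < μ) (ξ : Plane) :
    ‖rootSymbol μ ξ‖ₑ ^ 2 = ENNReal.ofReal (freqSq ξ + μ)⁻¹ := by
  rw [Real.enorm_eq_ofReal (rootSymbol_pos hμ ξ).le, ← ENNReal.ofReal_pow (rootSymbol_pos hμ ξ).le,
    rootSymbol_sq hμ]

theorem lintegral_rootSymbol_mul_sq_le (hV : Integrable V) (hμ : 0 < μ) (φ : L2) :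
    ∫⁻ ξ, ‖(rootSymbol μ ξ : ℂ) * 𝓕 (rootMul V φ) ξ‖ₑ ^ 2
      ≤ hsSq V (resKernel₂ μ) ^ (1 / 2 : ℝ) * ‖φ‖ₑ ^ 2 := by
  have h1 := (lintegral_fourier_sq_le (integrable_rootMul hV φ) hμ).trans
    (lintegral_rootMul_mul_le hV.1.aemeasurable (measurable_resKernel₂ μ) φ φ)
  rw [← sq] at h1
  refine le_trans (le_of_eq (lintegral_congr fun ξ => ?_)) h1
  rw [enorm_ofReal_mul, mul_pow, enorm_rootSymbol_sq hμ, mul_comm]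

theorem exists_isBirman (hV : Integrable V) (hμ : 0 < μ) (hhs : hsSq V (resKernel₂ μ) < ⊤) :
    ∃ B : L2 →L[ℂ] L2, IsBirman V μ B := by
  have hm : ∀ φ : L2, MemLp (fun ξ => (rootSymbol μ ξ : ℂ) * 𝓕 (rootMul V φ) ξ) 2 volume := by
    intro φ
    refine memLp_two_of_lintegral ?_ ((lintegral_rootSymbol_mul_sq_le hV hμ φ).trans_lt ?_)
    · exact ((Complex.continuous_ofReal.comp (continuous_rootSymbol hμ)).mul
        (continuous_fourier_of_integrable (integrable_rootMul hV φ))).aestronglyMeasurable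
    · exact ENNReal.mul_lt_top (ENNReal.rpow_lt_top_of_nonneg (by norm_num) hhs.ne) (by finiteness)
  let B₀ : L2 →ₗ[ℂ] L2 :=
    { toFun := fun φ => (hm φ).toLp
      map_add' := fun φ ψ => by
        rw [← MemLp.toLp_add]
        refine MemLp.toLp_congr _ _ (Eventually.of_forall fun ξ => ?_)
        simp only [Pi.add_apply, fourier_rootMul_add hV]
        ring
      map_smul' := fun c φ => by
        rw [RingHom.id_apply, ← MemLp.toLp_const_smul]
        refine MemLp.toLp_congr _ _ (Eventually.of_forall fun ξ => ?_)
        simp only [Pi.smul_apply, fourier_rootMul_smul, smul_eq_mul]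
        ring }
  -- `hsSq` is the square of the Hilbert–Schmidt norm of `B* B`, and `‖B‖²` is at most that norm;
  -- hence the exponent `1/4`.
  set H := hsSq V (resKernel₂ μ) ^ (1 / 4 : ℝ) with hH
  have hHf : H ≠ ⊤ := ENNReal.rpow_ne_top_of_nonneg (by norm_num) hhs.ne
  have hb : ∀ φ, ‖B₀ φ‖ ≤ H.toReal * ‖φ‖ := by
    intro φ
    have h1 : ‖B₀ φ‖ₑ ^ 2 ≤ (H * ‖φ‖ₑ) ^ 2 := by
      rw [L2.enorm_sq_eq, mul_pow]
      have e : H ^ 2 = hsSq V (resKernel₂ μ) ^ (1 / 2 : ℝ) := by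
        rw [hH, ← ENNReal.rpow_natCast, ← ENNReal.rpow_mul]; norm_num
      rw [e]
      refine le_trans (le_of_eq (lintegral_congr_ae ?_)) (lintegral_rootSymbol_mul_sq_le hV hμ φ)
      filter_upwards [(hm φ).coeFn_toLp] with ξ hξ
      change ‖(hm φ).toLp _ ξ‖ₑ ^ 2 = _
      rw [hξ]
    have h2 := (ENNReal.pow_le_pow_left_iff two_ne_zero).1 h1
    have h3 := ENNReal.toReal_mono (by finiteness) h2
    simpa [ENNReal.toReal_mul] using h3
  let B₁ : L2 →L[ℂ] L2 := B₀.mkContinuous H.toReal hb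
  refine ⟨((Lp.fourierTransformₗᵢ Plane ℂ).symm : L2 →L[ℂ] L2) ∘L B₁, fun φ => ?_⟩
  have h : (𝓕 ((((Lp.fourierTransformₗᵢ Plane ℂ).symm : L2 →L[ℂ] L2) ∘L B₁) φ) : L2) = (hm φ).toLp :=
    (Lp.fourierTransformₗᵢ Plane ℂ).apply_symm_apply _
  rw [h]
  exact (hm φ).coeFn_toLp

variable {B : L2 →L[ℂ] L2}

theorem IsBirman.inner_eq (hB : IsBirman V μ B) (hV : Integrable V) (hμ : 0 < μ)
    (hhs : hsSq V (resKernel₂ μ) < ⊤) (ψ φ : L2) :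
    ⟪B ψ, B φ⟫_ℂ = ∫ p : Plane × Plane, conj (rootMul V ψ p.1) * rootMul V φ p.2 *
      (resKernel μ (p.1 - p.2) : ℂ) ∂(volume.prod volume) := by
  have hfin : hsSq V (resKernel₂ μ) ^ (1 / 2 : ℝ) ≠ ⊤ :=
    ENNReal.rpow_ne_top_of_nonneg (by norm_num) hhs.ne
  rw [← integral_conj_fourier_mul_resolvent (integrable_rootMul hV ψ) (integrable_rootMul hV φ) hμ,
    L2.inner_eq_integral_fourier]
  · refine integral_congr_ae ?_
    filter_upwards [hB ψ, hB φ] with ξ h1 h2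
    rw [h1, h2, map_mul, Complex.conj_ofReal, ← rootSymbol_sq hμ]
    push_cast
    ring
  · exact (lintegral_rootMul_mul_le hV.1.aemeasurable (measurable_resKernel₂ μ) ψ φ).trans_lt
      (by finiteness)
  · have h := ((Lp.memLp (𝓕 (B ψ) : L2)).integrable_mul (Lp.memLp (𝓕 (B φ) : L2))).2
    refine lt_of_le_of_lt (le_of_eq (lintegral_congr_ae ?_)) h
    filter_upwards [hB ψ, hB φ] with ξ h1 h2
    rw [Pi.mul_apply, h1, h2, enorm_mul, enorm_ofReal_mul, enorm_ofReal_mul, ← enorm_rootSymbol_sq hμ]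
    ring

/-- The adjoint of `(-Δ + μ)^{-1/2} v` is `v (-Δ + μ)^{-1/2}`. -/
theorem IsBirman.adjoint_ae_eq (hB : IsBirman V μ B) (hV : Integrable V) (hμ : 0 < μ) (w : L2) :
    ContinuousLinearMap.adjoint B w =ᵐ[volume] rootMul V (freeRoot μ hμ w) := by
  -- Since `v` may be unbounded, `v (-Δ + μ)^{-1/2} w` is not known in advance to be in `L²`. Both
  -- sides are multiplied by `m = 1/(1+v)`: the products `m` and `n = v m` are bounded, the identity
  -- can be tested in `L²`, and `m` never vanishes.
  set m : Plane → ℝ := fun x => (1 + rootAbs V x)⁻¹ with hm_def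
  set n : Plane → ℝ := fun x => rootAbs V x * (1 + rootAbs V x)⁻¹ with hn_def
  have hrm := aemeasurable_rootAbs hV.1.aemeasurable
  have hmm : AEMeasurable m := (hrm.const_add 1).inv
  have hmL : MemLp (fun x => (m x : ℂ)) ⊤ volume := by
    refine memLp_top_of_bound (Complex.measurable_ofReal.comp_aemeasurable hmm).aestronglyMeasurable 1
      (Eventually.of_forall fun x => ?_)
    have h0 := rootAbs_nonneg V x
    rw [Complex.norm_real, Real.norm_of_nonneg (by positivity)]
    exact inv_le_one_of_one_le₀ (by linarith)
  have hnL : MemLp (fun x => (n x : ℂ)) ⊤ volume := by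
    refine memLp_top_of_bound (Complex.measurable_ofReal.comp_aemeasurable
      (hrm.mul hmm)).aestronglyMeasurable 1 (Eventually.of_forall fun x => ?_)
    have h0 := rootAbs_nonneg V x
    rw [Complex.norm_real, Real.norm_of_nonneg (by positivity)]
    change rootAbs V x * (1 + rootAbs V x)⁻¹ ≤ 1
    rw [← div_eq_mul_inv, div_le_one (by positivity)]
    linarith
  have key : mulBdd _ hmL (ContinuousLinearMap.adjoint B w) = mulBdd _ hnL (freeRoot μ hμ w) := by
    refine ext_inner_right ℂ fun θ => ?_
    rw [inner_mulBdd_left, inner_mulBdd_left, ContinuousLinearMap.adjoint_inner_left,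
      L2.inner_eq_integral_fourier, L2.inner_eq_integral_fourier]
    have e : rootMul V (mulBdd _ hmL θ) =ᵐ[volume] mulBdd _ hnL θ := by
      filter_upwards [coeFn_mulBdd hmL θ, coeFn_mulBdd hnL θ] with x h1 h2
      rw [rootMul, h1, h2]
      simp only [hm_def, hn_def]
      push_cast
      ring
    have hi := integrable_rootMul hV (mulBdd _ hmL θ)
    have hL2 : MemLp (rootMul V (mulBdd _ hmL θ)) 2 volume :=
      (memLp_congr_ae e).2 (Lp.memLp _)
    have hF := fourier_toLp_ae_eq hi hL2
    have hE : hL2.toLp = mulBdd _ hnL θ := Lp.ext (hL2.coeFn_toLp.trans e)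
    rw [hE] at hF
    refine integral_congr_ae ?_
    filter_upwards [hB (mulBdd _ hmL θ), hF, fourier_freeRoot hμ w] with ξ h1 h2 h3
    rw [h1, h2, h3, map_mul, Complex.conj_ofReal]
    ring
  have h1 := coeFn_mulBdd hmL (ContinuousLinearMap.adjoint B w)
  rw [key] at h1
  filter_upwards [h1, coeFn_mulBdd hnL (freeRoot μ hμ w)] with x hx hx'
  rw [hx'] at hx
  have h0 := rootAbs_nonneg V x
  have hne : ((1 + rootAbs V x : ℝ) : ℂ) ≠ 0 := by
    rw [Complex.ofReal_ne_zero]; positivity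
  rw [rootMul]
  simp only [hm_def, hn_def] at hx
  push_cast at hx hne
  field_simp at hx
  exact hx.symm

end Birman

/-! ### Hilbert–Schmidt norms and their limits in `μ`. -/

section HilbertSchmidt

open scoped ComplexConjugate

variable {V : Plane → ℝ} {μ : ℝ}

theorem ENNReal.add_sq_le (a b : ℝ≥0∞) : (a + b) ^ 2 ≤ 4 * (a ^ 2 + b ^ 2) := by
  have key : ∀ a b : ℝ≥0∞, a ≤ b → (a + b) ^ 2 ≤ 4 * (a ^ 2 + b ^ 2) := fun a b h => by
    calc (a + b) ^ 2 ≤ (b + b) ^ 2 := by gcongr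
      _ = 4 * b ^ 2 := by ring
      _ ≤ 4 * (a ^ 2 + b ^ 2) := mul_le_mul' le_rfl le_add_self
  rcases le_total a b with h | h
  · exact key a b h
  · rw [add_comm, add_comm (a ^ 2)]; exact key b a h

theorem aemeasurable_enorm_prod (hV : AEMeasurable V) :
    AEMeasurable (fun p : Plane × Plane => ‖V p.1‖ₑ * ‖V p.2‖ₑ) (volume.prod volume) :=
  (hV.enorm.comp_quasiMeasurePreserving Measure.quasiMeasurePreserving_fst).mul
    (hV.enorm.comp_quasiMeasurePreserving Measure.quasiMeasurePreserving_snd)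

theorem hsSq_mono {K K' : Plane × Plane → ℝ≥0∞} (h : ∀ᵐ p ∂(volume.prod volume), K p ≤ K' p) :
    hsSq V K ≤ hsSq V K' := by
  refine lintegral_mono_ae ?_
  filter_upwards [h] with p hp
  gcongr

theorem hsSq_add_le (hV : AEMeasurable V) {K K' : Plane × Plane → ℝ≥0∞} (hK : Measurable K) :
    hsSq V (K + K') ≤ 4 * (hsSq V K + hsSq V K') := by
  have hm : AEMeasurable (fun p : Plane × Plane => ‖V p.1‖ₑ * ‖V p.2‖ₑ * K p ^ 2)
    (volume.prod volume) := (aemeasurable_enorm_prod hV).mul (hK.pow_const 2).aemeasurable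
  rw [hsSq, hsSq, hsSq, ← lintegral_add_left' hm, ← lintegral_const_mul' _ _ (by norm_num)]
  refine lintegral_mono fun p => ?_
  calc _ ≤ ‖V p.1‖ₑ * ‖V p.2‖ₑ * (4 * (K p ^ 2 + K' p ^ 2)) :=
        mul_le_mul' le_rfl (ENNReal.add_sq_le _ _)
    _ = _ := by ring

theorem hsSq_const_mul (c : ℝ≥0∞) (hc : c ≠ ⊤) (K : Plane × Plane → ℝ≥0∞) :
    hsSq V (fun p => c * K p) = c ^ 2 * hsSq V K := by
  rw [hsSq, hsSq, ← lintegral_const_mul' _ _ (by finiteness)]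
  refine lintegral_congr fun p => ?_
  ring

theorem hsSq_const (hV : AEMeasurable V) (c : ℝ≥0∞) :
    hsSq V (fun _ => c) = (∫⁻ x, ‖V x‖ₑ) ^ 2 * c ^ 2 := by
  rw [hsSq, lintegral_mul_const'' _ (aemeasurable_enorm_prod hV),
    lintegral_prod_mul hV.enorm hV.enorm, ← sq]

theorem measurable_green : Measurable fun p : Plane × Plane => green p.1 p.2 := by
  unfold green; fun_prop

/-- The kernel `v(x) log|x - y| v(y)` is Hilbert–Schmidt. -/
theorem hsSq_green_lt_top (hV : Integrable V) (hV2 : ∫⁻ x, wt x ^ (2 : ℝ) * ‖V x‖ₑ < ⊤) {r : ℝ}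
    (hr : 1 < r) (hVr : ∫⁻ x, ‖V x‖ₑ ^ r < ⊤) : hsSq V (fun p => ‖green p.1 p.2‖ₑ) < ⊤ := by
  obtain ⟨A, hA, hAb⟩ := exists_lintegral_mul_negLog_le hr (a := 2) two_pos
  have hVm := hV.1.aemeasurable
  have hVe : AEMeasurable fun x => ‖V x‖ₑ := hVm.enorm
  have hVr' : (∫⁻ x, ‖V x‖ₑ ^ r) ^ (1 / r) ≠ ⊤ :=
    ENNReal.rpow_ne_top_of_nonneg (by positivity) hVr.ne
  have hw := measurable_wt
  have h1 : hsSq V (fun p => wt p.1 * wt p.2) < ⊤ := by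
    have hm : AEMeasurable fun x => wt x ^ (2 : ℝ) * ‖V x‖ₑ := by fun_prop
    have e : hsSq V (fun p => wt p.1 * wt p.2) = (∫⁻ x, wt x ^ (2 : ℝ) * ‖V x‖ₑ) ^ 2 := by
      rw [sq, ← lintegral_prod_mul hm hm]
      refine lintegral_congr fun p => ?_
      simp only [ENNReal.rpow_two]
      ring
    rw [e]
    finiteness
  have h2 : hsSq V (fun p => negLog (p.2 - p.1)) < ⊤ := by
    have hm : AEMeasurable (fun p : Plane × Plane => ‖V p.1‖ₑ * ‖V p.2‖ₑ * negLog (p.2 - p.1) ^ 2)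
        (volume.prod volume) :=
      (aemeasurable_enorm_prod hVm).mul (measurable_negLog_sub.pow_const 2).aemeasurable
    rw [hsSq, lintegral_prod _ hm]
    calc ∫⁻ x, ∫⁻ y, ‖V x‖ₑ * ‖V y‖ₑ * negLog (y - x) ^ 2
        ≤ ∫⁻ x, ‖V x‖ₑ * ((∫⁻ x, ‖V x‖ₑ ^ r) ^ (1 / r) * A) := by
          refine lintegral_mono fun x => ?_
          have := hAb _ hVe x
          simp only [ENNReal.rpow_two] at this
          simp_rw [mul_assoc]
          rw [lintegral_const_mul' _ _ enorm_ne_top]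
          exact mul_le_mul' le_rfl this
      _ = (∫⁻ x, ‖V x‖ₑ) * ((∫⁻ x, ‖V x‖ₑ ^ r) ^ (1 / r) * A) := lintegral_mul_const'' _ hVe
      _ < ⊤ := ENNReal.mul_lt_top hV.2 (by finiteness)
  have hmw : Measurable fun p : Plane × Plane => wt p.1 * wt p.2 := by fun_prop
  refine lt_of_le_of_lt (hsSq_mono (Eventually.of_forall fun p => ?_))
    (lt_of_le_of_lt (hsSq_add_le hVm (K' := fun p => negLog (p.2 - p.1)) hmw) (by finiteness))
  exact enorm_green_le p.1 p.2

/-- The kernel is a constant plus a term dominated by Green's function, and constants are harmless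
because `V` is integrable. -/
theorem hsSq_resKernel_lt_top (hV : Integrable V)
    (hG : hsSq V (fun p => ‖green p.1 p.2‖ₑ) < ⊤) (hμ : 0 < μ) : hsSq V (resKernel₂ μ) < ⊤ := by
  have hc : hsSq V (fun _ => ENNReal.ofReal (heatIntegral 1 μ)) < ⊤ := by
    rw [hsSq_const hV.1.aemeasurable]
    exact ENNReal.mul_lt_top (ENNReal.pow_lt_top hV.2) (by finiteness)
  refine lt_of_le_of_lt (hsSq_mono ?_) (lt_of_le_of_lt (hsSq_add_le hV.1.aemeasurable
    (K' := fun p => ‖green p.1 p.2‖ₑ) measurable_const) (by finiteness :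
      4 * (hsSq V (fun _ => ENNReal.ofReal (heatIntegral 1 μ)) + _) < ⊤))
  filter_upwards [ae_ne_prod] with p hp
  rw [resKernel₂, Pi.add_apply, Real.enorm_eq_ofReal_abs,
    ← ENNReal.ofReal_add heatIntegral_nonneg (abs_nonneg _)]
  refine ENNReal.ofReal_le_ofReal ?_
  linarith [(abs_le.1 (abs_resKernel_sub_le hμ hp)).2]

/-- Dominated convergence, the kernel being decreasing in `μ`. -/
theorem tendsto_hsSq_resKernel_atTop (hV : Integrable V)
    (hG : hsSq V (fun p => ‖green p.1 p.2‖ₑ) < ⊤) :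
    Tendsto (fun μ => hsSq V (resKernel₂ μ)) atTop (𝓝 0) := by
  have hz : (0 : ℝ≥0∞) = ∫⁻ _ : Plane × Plane, 0 ∂(volume.prod volume) := by simp
  rw [hz]
  refine tendsto_lintegral_filter_of_dominated_convergence'
    (fun p => ‖V p.1‖ₑ * ‖V p.2‖ₑ * resKernel₂ 1 p ^ 2) ?_ ?_
    (hsSq_resKernel_lt_top hV hG one_pos).ne ?_
  · exact Eventually.of_forall fun μ => (aemeasurable_enorm_prod hV.1.aemeasurable).mul
      ((measurable_resKernel₂ μ).pow_const 2).aemeasurable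
  · filter_upwards [eventually_ge_atTop 1] with μ hμ
    filter_upwards [ae_ne_prod] with p hp
    have h : 0 < ‖p.1 - p.2‖ ^ 2 := by have := norm_pos_iff.2 (sub_ne_zero.2 hp); positivity
    have := ENNReal.ofReal_le_ofReal (heatIntegral_anti h one_pos hμ)
    refine mul_le_mul' le_rfl ?_
    gcongr
    exact this
  · filter_upwards [ae_ne_prod] with p hp
    have h := ENNReal.tendsto_ofReal (tendsto_resKernel_atTop (sub_ne_zero.2 hp))
    rw [ENNReal.ofReal_zero] at h
    have h2 := ENNReal.Tendsto.const_mul (a := ‖V p.1‖ₑ * ‖V p.2‖ₑ)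
      (((ENNReal.continuous_pow 2).tendsto 0).comp h) (Or.inr (by finiteness))
    simpa [resKernel₂] using h2

/-- The error in the small energy expansion of the resolvent kernel. -/
def kernelError (μ : ℝ) (p : Plane × Plane) : ℝ :=
  resKernel μ (p.1 - p.2) - heatIntegral 1 μ - green p.1 p.2

theorem measurable_kernelError (μ : ℝ) : Measurable (kernelError μ) :=
  (((measurable_resKernel μ).comp (measurable_fst.sub measurable_snd)).sub_const _).sub
    measurable_green

/-- Off the diagonal the error tends to zero, and it is dominated by `2 |green|` uniformly in `μ`.
-/
theorem tendsto_hsSq_kernelError (hV : Integrable V)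
    (hG : hsSq V (fun p => ‖green p.1 p.2‖ₑ) < ⊤) :
    Tendsto (fun μ => hsSq V (fun p => ‖kernelError μ p‖ₑ)) (𝓝[>] 0) (𝓝 0) := by
  have hz : (0 : ℝ≥0∞) = ∫⁻ _ : Plane × Plane, 0 ∂(volume.prod volume) := by simp
  rw [hz]
  have hfin : hsSq V (fun p => 2 * ‖green p.1 p.2‖ₑ) ≠ ⊤ := by
    rw [hsSq_const_mul _ (by norm_num)]; finiteness
  refine tendsto_lintegral_filter_of_dominated_convergence'
    (fun p => ‖V p.1‖ₑ * ‖V p.2‖ₑ * (2 * ‖green p.1 p.2‖ₑ) ^ 2) ?_ ?_ hfin ?_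
  · exact Eventually.of_forall fun μ => (aemeasurable_enorm_prod hV.1.aemeasurable).mul
      ((measurable_kernelError μ).enorm.pow_const 2).aemeasurable
  · filter_upwards [self_mem_nhdsWithin] with μ hμ
    filter_upwards [ae_ne_prod] with p hp
    have h1 := abs_resKernel_sub_le (Set.mem_Ioi.1 hμ) hp
    have h2 : ‖kernelError μ p‖ₑ ≤ 2 * ‖green p.1 p.2‖ₑ := by
      rw [Real.enorm_eq_ofReal_abs, Real.enorm_eq_ofReal_abs,
        ← ENNReal.ofReal_ofNat, ← ENNReal.ofReal_mul (by norm_num)]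
      refine ENNReal.ofReal_le_ofReal ((abs_sub _ _).trans ?_)
      linarith
    gcongr
  · filter_upwards [ae_ne_prod] with p hp
    have h := ((tendsto_resKernel_sub hp).sub_const (green p.1 p.2)).enorm
    rw [sub_self, enorm_zero] at h
    have h2 := ENNReal.Tendsto.const_mul (a := ‖V p.1‖ₑ * ‖V p.2‖ₑ)
      (((ENNReal.continuous_pow 2).tendsto 0).comp h) (Or.inr (by finiteness))
    simpa [kernelError] using h2

/-- The sesquilinear form with kernel `v(x) K(x,y) v(y)`. -/
def rootForm (V : Plane → ℝ) (K : Plane × Plane → ℝ) (ψ φ : L2) : ℂ :=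
  ∫ p : Plane × Plane, conj (rootMul V ψ p.1) * rootMul V φ p.2 * (K p : ℂ) ∂(volume.prod volume)

variable {K K' : Plane × Plane → ℝ}

theorem integrable_rootForm (hV : Integrable V) (hK : Measurable K)
    (hf : hsSq V (fun p => ‖K p‖ₑ) < ⊤) (ψ φ : L2) :
    Integrable (fun p : Plane × Plane => conj (rootMul V ψ p.1) * rootMul V φ p.2 * (K p : ℂ))
      (volume.prod volume) := by
  refine ⟨(aestronglyMeasurable_conj_mul (integrable_rootMul hV ψ).1 (integrable_rootMul hV φ).1).mul
    (Complex.measurable_ofReal.comp hK).aestronglyMeasurable, ?_⟩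
  have hfin : hsSq V (fun p => ‖K p‖ₑ) ^ (1 / 2 : ℝ) ≠ ⊤ :=
    ENNReal.rpow_ne_top_of_nonneg (by norm_num) hf.ne
  refine lt_of_le_of_lt (le_of_eq (lintegral_congr fun p => ?_))
    ((lintegral_rootMul_mul_le hV.1.aemeasurable hK.enorm ψ φ).trans_lt (by finiteness))
  simp only
  rw [mul_comm, enorm_ofReal_mul, enorm_conj_mul, mul_comm]

theorem enorm_rootForm_le (hV : Integrable V) (hK : Measurable K) (ψ φ : L2) :
    ‖rootForm V K ψ φ‖ₑ ≤ hsSq V (fun p => ‖K p‖ₑ) ^ (1 / 2 : ℝ) * (‖ψ‖ₑ * ‖φ‖ₑ) := by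
  refine (enorm_integral_le_lintegral_enorm _).trans (le_trans (le_of_eq
    (lintegral_congr fun p => ?_)) (lintegral_rootMul_mul_le hV.1.aemeasurable hK.enorm ψ φ))
  rw [mul_comm, enorm_ofReal_mul, enorm_conj_mul, mul_comm]

theorem rootForm_sub (hV : Integrable V) (hK : Measurable K)
    (hf : hsSq V (fun p => ‖K p‖ₑ) < ⊤) (hK' : Measurable K')
    (hf' : hsSq V (fun p => ‖K' p‖ₑ) < ⊤) (ψ φ : L2) :
    rootForm V (fun p => K p - K' p) ψ φ = rootForm V K ψ φ - rootForm V K' ψ φ := by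
  rw [rootForm, rootForm, rootForm, ← integral_sub (integrable_rootForm hV hK hf ψ φ)
    (integrable_rootForm hV hK' hf' ψ φ)]
  refine integral_congr_ae (Eventually.of_forall fun p => ?_)
  simp only
  push_cast
  ring

/-- The Hilbert–Schmidt norm bounds the operator norm: take `ψ = S φ` in the form. -/
theorem norm_le_of_inner_eq_rootForm (hV : Integrable V) (hK : Measurable K) {S : L2 →L[ℂ] L2}
    (hS : ∀ ψ φ, ⟪ψ, S φ⟫_ℂ = rootForm V K ψ φ) {δ : ℝ} (hδ : 0 ≤ δ)
    (h : hsSq V (fun p => ‖K p‖ₑ) ^ (1 / 2 : ℝ) ≤ ENNReal.ofReal δ) : ‖S‖ ≤ δ := by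
  refine S.opNorm_le_bound hδ fun φ => ?_
  have h1 := (enorm_rootForm_le hV hK (S φ) φ).trans (mul_le_mul' h le_rfl)
  rw [← hS, inner_self_eq_norm_sq_to_K, ← ofReal_norm, ← ofReal_norm, ← ofReal_norm,
    ← ENNReal.ofReal_mul (norm_nonneg _), ← ENNReal.ofReal_mul hδ,
    ENNReal.ofReal_le_ofReal_iff (by positivity)] at h1
  simp only [norm_pow, RCLike.norm_ofReal, abs_norm] at h1
  rcases (norm_nonneg (S φ)).eq_or_lt with h0 | h0
  · rw [← h0]; positivity
  · nlinarith

end HilbertSchmidt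

/-! ### Lower bounds for the Birman–Schwinger operator. -/

section BirmanSchwinger

open scoped ComplexConjugate

variable {V : Plane → ℝ} {μ : ℝ} {B : L2 →L[ℂ] L2}

theorem memLp_sgnPot (hV : AEMeasurable V) : MemLp (fun x => (sgnPot V x : ℂ)) ⊤ volume := by
  refine memLp_top_of_bound (Complex.measurable_ofReal.comp_aemeasurable
    (aemeasurable_sgnPot hV)).aestronglyMeasurable 1 (Eventually.of_forall fun x => ?_)
  unfold sgnPot
  split_ifs <;> simp

/-- Multiplication by `U = sgn V`. -/
def sgnMul (V : Plane → ℝ) (hV : AEMeasurable V) : L2 →L[ℂ] L2 := mulBdd _ (memLp_sgnPot hV)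

theorem coeFn_sgnMul (hV : AEMeasurable V) (φ : L2) :
    sgnMul V hV φ =ᵐ[volume] fun x => (sgnPot V x : ℂ) * φ x := coeFn_mulBdd _ _

theorem isSelfAdjoint_sgnMul (hV : AEMeasurable V) : IsSelfAdjoint (sgnMul V hV) :=
  isSelfAdjoint_mulBdd (memLp_sgnPot hV)

theorem sgnMul_sgnMul (hV : AEMeasurable V) (φ : L2) : sgnMul V hV (sgnMul V hV φ) = φ := by
  refine Lp.ext ?_
  filter_upwards [coeFn_sgnMul hV φ, coeFn_sgnMul hV (sgnMul V hV φ)] with x h1 h2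
  rw [h2, h1, ← mul_assoc, ← Complex.ofReal_mul, sgnPot_mul_self, Complex.ofReal_one, one_mul]

theorem norm_sgnMul (hV : AEMeasurable V) (φ : L2) : ‖sgnMul V hV φ‖ = ‖φ‖ := by
  have h : ‖sgnMul V hV φ‖ₑ ^ 2 = ‖φ‖ₑ ^ 2 := by
    rw [L2.enorm_sq_eq, L2.enorm_sq_eq]
    refine lintegral_congr_ae ?_
    filter_upwards [coeFn_sgnMul hV φ] with x hx
    rw [hx, enorm_ofReal_mul, enorm_sgnPot, one_mul]
  have hn := (ENNReal.pow_right_strictMono two_ne_zero).injective h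
  rwa [← ofReal_norm, ← ofReal_norm, ENNReal.ofReal_eq_ofReal_iff (norm_nonneg _) (norm_nonneg _)]
    at hn

/-- The Birman–Schwinger operator `U + v (-Δ + μ)⁻¹ v`, for `B = (-Δ + μ)^{-1/2} v`. -/
def birmanSchwinger (V : Plane → ℝ) (hV : AEMeasurable V) (B : L2 →L[ℂ] L2) : L2 →L[ℂ] L2 :=
  sgnMul V hV + ContinuousLinearMap.adjoint B ∘L B

theorem isSelfAdjoint_birmanSchwinger (hV : AEMeasurable V) (B : L2 →L[ℂ] L2) :
    IsSelfAdjoint (birmanSchwinger V hV B) :=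
  (isSelfAdjoint_sgnMul hV).add (IsSelfAdjoint.star_mul_self B)

theorem IsBirman.inner_eq_rootForm (hB : IsBirman V μ B) (hV : Integrable V) (hμ : 0 < μ)
    (hhs : hsSq V (resKernel₂ μ) < ⊤) (ψ φ : L2) :
    ⟪ψ, ContinuousLinearMap.adjoint B (B φ)⟫_ℂ
      = rootForm V (fun p => resKernel μ (p.1 - p.2)) ψ φ := by
  rw [ContinuousLinearMap.adjoint_inner_right, hB.inner_eq hV hμ hhs, rootForm]

theorem enorm_resKernel_eq (μ : ℝ) :
    (fun p : Plane × Plane => ‖resKernel μ (p.1 - p.2)‖ₑ) = resKernel₂ μ := by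
  funext p
  rw [Real.enorm_of_nonneg (resKernel_nonneg _ _), resKernel₂]

theorem tendsto_rpow_half_zero {ι : Type*} {l : Filter ι} {a : ι → ℝ≥0∞} (h : Tendsto a l (𝓝 0)) :
    Tendsto (fun i => a i ^ (1 / 2 : ℝ)) l (𝓝 0) := by
  have := ((ENNReal.continuous_rpow_const (y := (1 / 2 : ℝ))).tendsto 0).comp h
  rw [ENNReal.zero_rpow_of_pos (by norm_num)] at this
  exact this

theorem eventually_le_ofReal {ι : Type*} {l : Filter ι} {a : ι → ℝ≥0∞} (h : Tendsto a l (𝓝 0))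
    {δ : ℝ} (hδ : 0 < δ) : ∀ᶠ i in l, a i ^ (1 / 2 : ℝ) ≤ ENNReal.ofReal δ :=
  (tendsto_rpow_half_zero h).eventually_le_const (ENNReal.ofReal_pos.2 hδ)

theorem eventually_norm_adjoint_mul_le (hV : Integrable V)
    (hG : hsSq V (fun p => ‖green p.1 p.2‖ₑ) < ⊤) {δ : ℝ} (hδ : 0 < δ) :
    ∀ᶠ μ in atTop, ∀ B, IsBirman V μ B → ‖ContinuousLinearMap.adjoint B ∘L B‖ ≤ δ := by
  filter_upwards [eventually_le_ofReal (tendsto_hsSq_resKernel_atTop hV hG) hδ,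
    eventually_gt_atTop 0] with μ h hμ B hB
  refine norm_le_of_inner_eq_rootForm hV
    ((measurable_resKernel μ).comp (measurable_fst.sub measurable_snd))
    (fun ψ φ => hB.inner_eq_rootForm hV hμ (hsSq_resKernel_lt_top hV hG hμ) ψ φ) hδ.le ?_
  simpa only [Function.comp_def, Pi.sub_apply, enorm_resKernel_eq] using h

theorem inner_thresholdOp {T : L2 →L[ℂ] L2} (hT : IsThresholdOp V T) (hV : Integrable V)
    (hG : hsSq V (fun p => ‖green p.1 p.2‖ₑ) < ⊤) (ψ φ : L2) :
    ⟪ψ, T φ⟫_ℂ = ⟪ψ, sgnMul V hV.1.aemeasurable φ⟫_ℂ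
      + rootForm V (fun p => green p.1 p.2) ψ φ := by
  have hi := integrable_rootForm hV measurable_green hG ψ φ
  have h1 : Integrable fun x => conj (ψ x) * sgnMul V hV.1.aemeasurable φ x :=
    (Lp.memLp ψ).star.integrable_mul (Lp.memLp _)
  have h2 := hi.integral_prod_left
  rw [L2.inner_eq_integral, L2.inner_eq_integral, rootForm, integral_prod _ hi, ← integral_add h1 h2]
  refine integral_congr_ae ?_
  filter_upwards [hT φ, coeFn_sgnMul hV.1.aemeasurable φ] with x hx hs
  rw [hx, hs, mul_add, ← mul_assoc (conj (ψ x)) (rootAbs V x : ℂ), ← integral_const_mul]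
  congr 1
  refine integral_congr_ae (Eventually.of_forall fun y => ?_)
  simp only [rootMul, map_mul, Complex.conj_ofReal]
  push_cast
  ring

/-- A constant kernel is rank one along `v`; this is the divergent part of the resolvent at small
energy. -/
theorem rootForm_const (hV : Integrable V) (c : ℝ) (ψ φ : L2) :
    rootForm V (fun _ => c) ψ φ = ⟪ψ, ((c : ℂ) * ⟪rootAbsL2 V, φ⟫_ℂ) • rootAbsL2 V⟫_ℂ := by
  rw [inner_smul_right, L2.inner_eq_integral, L2.inner_eq_integral, rootForm]
  have e1 : ∫ x, conj ((rootAbsL2 V : L2) x) * φ x = ∫ x, rootMul V φ x := by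
    refine integral_congr_ae ?_
    filter_upwards [coeFn_rootAbsL2 hV] with x hx
    rw [hx, Complex.conj_ofReal, rootMul]
  have e2 : ∫ x, conj (ψ x) * (rootAbsL2 V : L2) x = ∫ x, conj (rootMul V ψ x) := by
    refine integral_congr_ae ?_
    filter_upwards [coeFn_rootAbsL2 hV] with x hx
    rw [hx, rootMul, map_mul, Complex.conj_ofReal, mul_comm]
  rw [e1, e2, integral_mul_const,
    integral_prod_mul (fun x => conj (rootMul V ψ x)) (rootMul V φ)]
  ring

/-- If zero is a regular point, the Birman–Schwinger operators are uniformly bounded below at small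
energies. -/
theorem exists_birmanSchwinger_bounded_below (hV : Integrable V)
    (hG : hsSq V (fun p => ‖green p.1 p.2‖ₑ) < ⊤) (hreg : ZeroIsRegular V) :
    ∃ D : ℝ, 0 < D ∧ ∀ᶠ μ in 𝓝[>] 0, ∀ B, IsBirman V μ B →
      ∀ φ, ‖φ‖ ≤ D * ‖birmanSchwinger V hV.1.aemeasurable B φ‖ := by
  obtain ⟨T, hT, hunit⟩ := hreg
  obtain ⟨D, δ, c₀, hD, hδ, -, h⟩ := exists_uniform_bounded_below (v := rootAbsL2 V) rfl hunit
  refine ⟨D, hD, ?_⟩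
  filter_upwards [eventually_le_ofReal (tendsto_hsSq_kernelError hV hG) hδ,
    tendsto_heatIntegral_one_atTop.eventually_ge_atTop c₀, self_mem_nhdsWithin]
    with μ hμδ hc hμ B hB
  set c := heatIntegral 1 μ
  have hhs := hsSq_resKernel_lt_top hV hG hμ
  -- The expansion `M = T + c ⟪v, ·⟫ v + S`, where the kernel of `S` is `kernelError`. As `μ → 0`,
  -- `c → ∞` and `‖S‖ → 0`, which are the requirements of `exists_uniform_bounded_below`.
  set S : L2 →L[ℂ] L2 := birmanSchwinger V hV.1.aemeasurable B - T
    - (c : ℂ) • (innerSL ℂ (rootAbsL2 V)).smulRight (rootAbsL2 V) with hS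
  have hSφ : ∀ φ, S φ = birmanSchwinger V hV.1.aemeasurable B φ - T φ
      - ((c : ℂ) * ⟪rootAbsL2 V, φ⟫_ℂ) • rootAbsL2 V := by
    intro φ
    rw [hS, sub_apply, sub_apply, smul_apply, ContinuousLinearMap.smulRight_apply,
      innerSL_apply_apply, mul_smul]
  refine h _ S c hc (norm_le_of_inner_eq_rootForm hV (measurable_kernelError μ) ?_ hδ.le hμδ) ?_
  · intro ψ φ
    have m1 : Measurable fun p : Plane × Plane => resKernel μ (p.1 - p.2) :=
      (measurable_resKernel μ).comp (measurable_fst.sub measurable_snd)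
    have f1 : hsSq V (fun p => ‖resKernel μ (p.1 - p.2)‖ₑ) < ⊤ := by rwa [enorm_resKernel_eq]
    have fc : hsSq V (fun _ => ‖c‖ₑ) < ⊤ := by
      rw [hsSq_const hV.1.aemeasurable]
      exact ENNReal.mul_lt_top (ENNReal.pow_lt_top hV.2) (by finiteness)
    have f2 : hsSq V (fun p => ‖resKernel μ (p.1 - p.2) - c‖ₑ) < ⊤ := by
      refine lt_of_le_of_lt (hsSq_mono ?_) hG
      filter_upwards [ae_ne_prod] with p hp
      rw [Real.enorm_eq_ofReal_abs, Real.enorm_eq_ofReal_abs]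
      exact ENNReal.ofReal_le_ofReal (abs_resKernel_sub_le hμ hp)
    rw [hSφ, inner_sub_right, inner_sub_right, inner_thresholdOp hT hV hG, birmanSchwinger,
      add_apply, inner_add_right, ContinuousLinearMap.comp_apply,
      hB.inner_eq_rootForm hV hμ hhs, ← rootForm_const hV]
    have e := rootForm_sub hV (m1.sub_const c) f2 measurable_green hG ψ φ
    rw [rootForm_sub hV m1 f1 measurable_const fc] at e
    change _ = rootForm V (fun p => resKernel μ (p.1 - p.2) - c - green p.1 p.2) ψ φ
    rw [e]
    ring
  · intro φ
    rw [hSφ]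
    abel

/-- At large energies the Birman–Schwinger operators are bounded below. -/
theorem birmanSchwinger_bounded_below_of_norm_le (hV : AEMeasurable V)
    (h : ‖ContinuousLinearMap.adjoint B ∘L B‖ ≤ 1 / 2) (φ : L2) :
    ‖φ‖ ≤ 2 * ‖birmanSchwinger V hV B φ‖ := by
  have h1 : ‖(ContinuousLinearMap.adjoint B ∘L B) φ‖ ≤ 1 / 2 * ‖φ‖ :=
    (ContinuousLinearMap.le_opNorm _ _).trans (by gcongr)
  have h2 : ‖sgnMul V hV φ‖ ≤ ‖birmanSchwinger V hV B φ‖ + ‖(ContinuousLinearMap.adjoint B ∘L B) φ‖ := by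
    have := norm_sub_le (birmanSchwinger V hV B φ) ((ContinuousLinearMap.adjoint B ∘L B) φ)
    rwa [birmanSchwinger, add_apply, add_sub_cancel_right] at this
  rw [norm_sgnMul] at h2
  linarith

end BirmanSchwinger

/-! ### Construction of the resolvents of `H`. -/

section Resolvent

open scoped ComplexConjugate

variable {V : Plane → ℝ} {μ : ℝ} {B N : L2 →L[ℂ] L2}

theorem rootSymbol_mul_self_mul (hμ : 0 < μ) (ξ : Plane) :
    ((freqSq ξ + μ : ℝ) : ℂ) * ((rootSymbol μ ξ : ℂ) * (rootSymbol μ ξ : ℂ)) = 1 := by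
  rw [← Complex.ofReal_mul, ← Complex.ofReal_mul, ← sq, rootSymbol_sq hμ,
    mul_inv_cancel₀ (freqSq_add_pos hμ ξ).ne', Complex.ofReal_one]

theorem sobolevNorm_one_freeRoot_lt_top (hμ : 0 < μ) (w : L2) :
    sobolevNorm 1 (freeRoot μ hμ w) < ⊤ := by
  refine ENNReal.rpow_lt_top_of_nonneg (by norm_num) (ne_of_lt ?_)
  have hw : ∫⁻ ξ, ‖(𝓕 w : L2) ξ‖ₑ ^ 2 < ⊤ := by rw [← L2.enorm_sq_eq]; finiteness
  calc _ ≤ ∫⁻ ξ, ENNReal.ofReal (1 + μ⁻¹) * ‖(𝓕 w : L2) ξ‖ₑ ^ 2 := by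
        refine lintegral_mono_ae ?_
        filter_upwards [fourier_freeRoot hμ w] with ξ hξ
        change ENNReal.ofReal ((1 + freqSq ξ) ^ (1 : ℝ)) * _ ≤ _
        rw [hξ, enorm_ofReal_mul, mul_pow, enorm_rootSymbol_sq hμ, Real.rpow_one, ← mul_assoc, ← ENNReal.ofReal_mul (by linarith [freqSq_nonneg ξ])]
        refine mul_le_mul' (ENNReal.ofReal_le_ofReal ?_) le_rfl
        have h1 := freqSq_add_pos hμ ξ
        have h2 := freqSq_nonneg ξ
        rw [← div_eq_mul_inv, div_le_iff₀ h1]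
        have h3 : μ⁻¹ * μ = 1 := inv_mul_cancel₀ hμ.ne'
        have h4 : 0 < μ⁻¹ := inv_pos.2 hμ
        nlinarith
    _ < ⊤ := by
        rw [lintegral_const_mul' _ _ ENNReal.ofReal_ne_top]
        finiteness

/-- `H¹` is the range of `(-Δ + μ)^{-1/2}`, since the inverse symbol is bounded by a multiple of
`⟨ξ⟩`. This parametrizes the candidates for `D(H)`. -/
theorem exists_eq_freeRoot (hμ : 0 < μ) {u : L2} (hu : sobolevNorm 1 u < ⊤) :
    ∃ w, u = freeRoot μ hμ w := by
  have hu' : ∫⁻ ξ, ENNReal.ofReal (1 + freqSq ξ) * ‖(𝓕 u : L2) ξ‖ₑ ^ 2 < ⊤ := by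
    have := (ENNReal.rpow_lt_top_iff_of_pos (by norm_num)).1 hu
    simpa only [Real.rpow_one, freqSq] using this
  have hm : MemLp (fun ξ => ((rootSymbol μ ξ)⁻¹ : ℂ) * (𝓕 u : L2) ξ) 2 volume := by
    refine memLp_two_of_lintegral ?_ ?_
    · refine Continuous.aestronglyMeasurable ?_ |>.mul (Lp.aestronglyMeasurable _)
      exact Continuous.inv₀ (Complex.continuous_ofReal.comp (continuous_rootSymbol hμ))
        fun ξ => Complex.ofReal_ne_zero.2 (rootSymbol_pos hμ ξ).ne'
    · refine lt_of_le_of_lt (lintegral_mono fun ξ => ?_)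
        (by rw [lintegral_const_mul' _ _ ENNReal.ofReal_ne_top]; finiteness :
          ∫⁻ ξ, ENNReal.ofReal (1 + μ) * (ENNReal.ofReal (1 + freqSq ξ) * ‖(𝓕 u : L2) ξ‖ₑ ^ 2) < ⊤)
      have h2 := freqSq_nonneg ξ
      rw [← Complex.ofReal_inv, enorm_ofReal_mul, mul_pow, ← mul_assoc]
      refine mul_le_mul' ?_ le_rfl
      rw [rootSymbol, inv_inv, Real.enorm_of_nonneg (Real.sqrt_nonneg _),
        ← ENNReal.ofReal_pow (Real.sqrt_nonneg _), Real.sq_sqrt (freqSq_add_pos hμ ξ).le,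
        ← ENNReal.ofReal_mul (by linarith)]
      refine ENNReal.ofReal_le_ofReal ?_
      nlinarith
  refine ⟨(Lp.fourierTransformₗᵢ Plane ℂ).symm hm.toLp, L2.ext_fourier ?_⟩
  have h : (𝓕 ((Lp.fourierTransformₗᵢ Plane ℂ).symm hm.toLp) : L2) = hm.toLp :=
    (Lp.fourierTransformₗᵢ Plane ℂ).apply_symm_apply _
  have h2 := fourier_freeRoot hμ ((Lp.fourierTransformₗᵢ Plane ℂ).symm hm.toLp)
  rw [h] at h2
  filter_upwards [h2, hm.coeFn_toLp] with ξ h2 h3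
  rw [h2, h3, mul_inv_cancel_left₀ (Complex.ofReal_ne_zero.2 (ne_of_gt (rootSymbol_pos hμ ξ)))]

/-- The operator `(-Δ + μ)⁻¹ - (-Δ + μ)⁻¹ v N v (-Δ + μ)⁻¹`, where `B = (-Δ + μ)^{-1/2} v`. -/
def resolventOp (μ : ℝ) (hμ : 0 < μ) (B N : L2 →L[ℂ] L2) : L2 →L[ℂ] L2 :=
  freeRoot μ hμ * freeRoot μ hμ - (freeRoot μ hμ * B) * N * star (freeRoot μ hμ * B)

theorem star_freeRoot_mul_apply (hμ : 0 < μ) (B : L2 →L[ℂ] L2) (f : L2) :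
    star (freeRoot μ hμ * B) f = ContinuousLinearMap.adjoint B (freeRoot μ hμ f) := by
  rw [star_mul, (isSelfAdjoint_freeRoot hμ).star_eq]
  rfl

theorem resolventOp_apply (hμ : 0 < μ) (B N : L2 →L[ℂ] L2) (f : L2) :
    resolventOp μ hμ B N f = freeRoot μ hμ (freeRoot μ hμ f
      - B (N (ContinuousLinearMap.adjoint B (freeRoot μ hμ f)))) := by
  rw [resolventOp, sub_apply, map_sub, ← star_freeRoot_mul_apply]
  rfl

theorem fourier_sub_apply (f g : L2) :
    (𝓕 (f - g) : L2) =ᵐ[volume] fun ξ => (𝓕 f : L2) ξ - (𝓕 g : L2) ξ := by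
  have h : (𝓕 (f - g) : L2) = 𝓕 f - 𝓕 g := map_sub (Lp.fourierTransformₗᵢ Plane ℂ) f g
  rw [h]
  exact Lp.coeFn_sub _ _

theorem rootAbs_mul_sgnPot_mul (V : Plane → ℝ) (x : Plane) (z : ℂ) :
    (rootAbs V x : ℂ) * ((sgnPot V x : ℂ) * ((rootAbs V x : ℂ) * z)) = (V x : ℂ) * z := by
  have h := sgnPot_mul_abs V x
  rw [← rootAbs_mul_self] at h
  rw [← h]
  push_cast
  ring

/-- Solving `(-Δ + μ) u = f - V u` with `u = (-Δ + μ)^{-1/2} w` and `φ = U v u` amounts to `w = (-Δ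
+ μ)^{-1/2} f - B φ` and `M φ = B* (-Δ + μ)^{-1/2} f`. The second equation is solved by `N = M⁻¹`.
-/
theorem isResolvent_resolventOp (hV : Integrable V) (hμ : 0 < μ) (hB : IsBirman V μ B)
    (hMN : birmanSchwinger V hV.1.aemeasurable B * N = 1)
    (hNM : N * birmanSchwinger V hV.1.aemeasurable B = 1) (hN : IsSelfAdjoint N) :
    IsResolvent V μ (resolventOp μ hμ B N) := by
  set U := sgnMul V hV.1.aemeasurable with hU
  have hMa : ∀ φ, birmanSchwinger V hV.1.aemeasurable B φ
      = U φ + ContinuousLinearMap.adjoint B (B φ) := fun φ => rfl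
  refine ⟨?_, fun f => ?_, fun u g hug => ?_⟩
  · refine IsSelfAdjoint.sub ?_ (hN.conjugate _)
    have := IsSelfAdjoint.star_mul_self (freeRoot μ hμ)
    rwa [(isSelfAdjoint_freeRoot hμ).star_eq] at this
  · rw [resolventOp_apply]
    set φ := N (ContinuousLinearMap.adjoint B (freeRoot μ hμ f)) with hφ
    set w := freeRoot μ hμ f - B φ with hw
    set u := freeRoot μ hμ w with hu
    -- From `M φ = U φ + B* B φ`, only `U φ` remains. Since `B* w = v u`, this gives `φ = U v u`,
    -- that is `v φ = V u`.
    have h1 : ContinuousLinearMap.adjoint B w = U φ := by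
      have h := DFunLike.congr_fun hMN (ContinuousLinearMap.adjoint B (freeRoot μ hμ f))
      have h' : birmanSchwinger V hV.1.aemeasurable B φ
        = ContinuousLinearMap.adjoint B (freeRoot μ hμ f) := h
      rw [hw, map_sub, ← h', hMa, add_sub_cancel_right]
    have h2 : ∀ᵐ x, rootMul V φ x = (V x : ℂ) * u x := by
      have ha := hB.adjoint_ae_eq hV hμ w
      rw [h1] at ha
      have hc := coeFn_sgnMul hV.1.aemeasurable (U φ)
      rw [hU, sgnMul_sgnMul] at hc
      filter_upwards [ha, hc] with x hx hx'
      rw [rootMul, hx', hx, rootMul, rootAbs_mul_sgnPot_mul]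
    have hd : ∀ᵐ ξ, weakDefect μ u f (rootMul V φ) ξ = 0 := by
      filter_upwards [fourier_freeRoot hμ w, fourier_freeRoot hμ f, hB φ,
        fourier_sub_apply (freeRoot μ hμ f) (B φ)] with ξ e1 e2 e3 e4
      rw [weakDefect, e1, e4, e2, e3]
      linear_combination ((-(𝓕 f : L2) ξ + 𝓕 (rootMul V φ) ξ)) * rootSymbol_mul_self_mul hμ ξ
    have hint := integrable_rootMul hV φ
    have hg : (fun x => (f - (μ : ℂ) • u : L2) x - (V x : ℂ) * u x) =ᵐ[volume]
        fun x => f x - (μ : ℂ) * u x - rootMul V φ x := by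
      filter_upwards [h2, Lp.coeFn_sub f ((μ : ℂ) • u), Lp.coeFn_smul (μ : ℂ) u] with x e1 e2 e3
      rw [e2, Pi.sub_apply, e3, e1]
      rfl
    refine ⟨sobolevNorm_one_freeRoot_lt_top hμ w, (Lp.memLp u).locallyIntegrable one_le_two, ?_, ?_⟩
    · refine LocallyIntegrable.sub ((Lp.memLp _).locallyIntegrable one_le_two) ?_
      exact (hint.congr h2).locallyIntegrable
    · intro θ hθ hc
      rw [integral_mul_laplacian_eq hint hd hθ hc]
      refine integral_congr_ae ?_
      filter_upwards [hg] with x hx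
      rw [← hx]
  · obtain ⟨w, hw⟩ := exists_eq_freeRoot hμ hug.1
    -- Conversely, for `u` in the domain this `φ` is `U v u`; it solves the Birman–Schwinger
    -- equation, and `N M = 1` recovers it.
    set φ := U (ContinuousLinearMap.adjoint B w) with hφ
    set f := g + (μ : ℂ) • u with hf
    have h2 : ∀ᵐ x, rootMul V φ x = (V x : ℂ) * u x := by
      filter_upwards [hB.adjoint_ae_eq hV hμ w,
        coeFn_sgnMul hV.1.aemeasurable (ContinuousLinearMap.adjoint B w)] with x hx hx'
      rw [rootMul, hφ, hU, hx', hx, rootMul, rootAbs_mul_sgnPot_mul, hw]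
    have hd : ∀ᵐ ξ, weakDefect μ u f (rootMul V φ) ξ = 0 := by
      refine ae_weakDefect_eq_zero (integrable_rootMul hV φ) fun θ hθ hc => ?_
      rw [hug.2.2.2 θ hθ hc]
      refine integral_congr_ae ?_
      filter_upwards [h2, Lp.coeFn_add g ((μ : ℂ) • u), Lp.coeFn_smul (μ : ℂ) u] with x e1 e2 e3
      rw [hf, e2, Pi.add_apply, e3, e1, Pi.smul_apply, smul_eq_mul]
      ring
    have h3 : w = freeRoot μ hμ f - B φ := by
      refine L2.ext_fourier ?_
      have hw' := fourier_freeRoot hμ w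
      rw [← hw] at hw'
      filter_upwards [hd, hw', fourier_freeRoot hμ f, hB φ,
        fourier_sub_apply (freeRoot μ hμ f) (B φ)] with ξ e0 e1 e2 e3 e4
      rw [weakDefect, e1] at e0
      rw [e4, e2, e3]
      linear_combination (-(rootSymbol μ ξ : ℂ)) * e0 - (𝓕 w : L2) ξ * rootSymbol_mul_self_mul hμ ξ
    have h4 : birmanSchwinger V hV.1.aemeasurable B φ
        = ContinuousLinearMap.adjoint B (freeRoot μ hμ f) := by
      have h5 : B φ = freeRoot μ hμ f - w := by rw [h3]; abel
      rw [hMa, h5, hφ, hU, sgnMul_sgnMul, map_sub]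
      abel
    have h5 : N (ContinuousLinearMap.adjoint B (freeRoot μ hμ f)) = φ := by
      rw [← h4]
      exact DFunLike.congr_fun hNM φ
    rw [resolventOp_apply, h5, ← h3, hw]

theorem IsResolvent.sub_eq {m m' : ℝ} {R R' : L2 →L[ℂ] L2} (h : IsResolvent V m R)
    (h' : IsResolvent V m' R') : R' - R = (m - m') • (R * R') := by
  ext1 f
  have h1 := h.2.2 _ _ (h'.2.1 f)
  have e : f - (m' : ℂ) • R' f + (m : ℂ) • R' f = f + ((m - m' : ℝ) : ℂ) • R' f := by
    rw [Complex.ofReal_sub, sub_smul]; abel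
  rw [e, map_add, map_smul] at h1
  have h2 : ((m - m') • (R * R')) f = ((m - m' : ℝ) : ℂ) • R (R' f) := by
    rw [smul_apply, Complex.coe_smul]; rfl
  rw [sub_apply, h2, sub_eq_iff_eq_add', h1]

/-- If `R f = 0`, the weak equation for `u = 0` says that `f` vanishes as a distribution. -/
theorem IsResolvent.injective {m : ℝ} {R : L2 →L[ℂ] L2} (h : IsResolvent V m R) :
    Function.Injective R := by
  refine (injective_iff_map_eq_zero _).2 fun f hf => ?_
  have h1 := (h.2.1 f).2
  rw [hf, smul_zero, sub_zero] at h1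
  obtain ⟨-, h2, h3⟩ := h1
  have hz : (0 : L2) =ᵐ[volume] (0 : Plane → ℂ) := Lp.coeFn_zero ℂ 2 volume
  have h4 : (f : Plane → ℂ) =ᵐ[volume] fun x => f x - (V x : ℂ) * (0 : L2) x := by
    filter_upwards [hz] with x hx
    rw [hx, Pi.zero_apply, mul_zero, sub_zero]
  have h5 : ∀ᵐ x, f x = 0 := by
    refine ae_eq_zero_of_integral_contDiff_smul_eq_zero
      ((Lp.memLp f).locallyIntegrable one_le_two) fun g hg hc => ?_
    have hc' : HasCompactSupport fun x => (g x : ℂ) := hc.comp_left (g := Complex.ofReal) rfl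
    have := h3 _ (Complex.ofRealCLM.contDiff.comp hg) hc'
    have e1 : ∫ x, (0 : L2) x * (-(Δ (Complex.ofRealCLM ∘ g)) x) = 0 := by
      rw [integral_congr_ae (g := fun _ => 0), integral_zero]
      filter_upwards [hz] with x hx
      rw [hx, Pi.zero_apply, zero_mul]
    rw [e1] at this
    rw [this]
    refine integral_congr_ae ?_
    filter_upwards [h4] with x hx
    rw [← hx, Complex.real_smul, mul_comm]
    rfl
  refine Lp.ext ?_
  filter_upwards [h5, hz] with x hx hx'
  rw [hx, hx', Pi.zero_apply]

end Resolvent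

/-! ### Abstract calculus for powers, in the form used below. -/

section HilbertCalculus

variable {E : Type*} [NormedAddCommGroup E] [InnerProductSpace ℂ E] [CompleteSpace E]
  {R R' J N : E →L[ℂ] E} {m m' α s C K l : ℝ} {f g u : E}

theorem hilbertCfc_abs_pow_of_resolvent_identity (h0 : 0 ≤ α) (h1 : α < 1) (hR : IsSelfAdjoint R)
    (hR' : IsSelfAdjoint R') (h : R' - R = (m - m') • (R * R'))
    (hfg : hilbertCfc (fun r : ℝ => r * |r⁻¹ - m'| ^ α) R' f = R' g) :
    hilbertCfc (fun r : ℝ => r * |r⁻¹ - m| ^ α) R f = R g :=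
  cfc_abs_pow_eq_of_resolvent_identity h0 h1 hR hR' h hfg

theorem isSelfAdjoint_hilbertCfc (ψ : ℝ → ℝ) (R : E →L[ℂ] E) : IsSelfAdjoint (hilbertCfc ψ R) :=
  cfc_predicate ψ R

theorem hilbertCfc_apply_comm (ψ : ℝ → ℝ) (R : E →L[ℂ] E) (f : E) :
    hilbertCfc ψ R (R f) = R (hilbertCfc ψ R f) := by
  have h := ((Commute.refl R).cfc_real ψ).eq
  exact DFunLike.congr_fun h f

theorem hilbertCfc_abs_pow_zero (hR : IsSelfAdjoint R) (m : ℝ) :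
    hilbertCfc (fun r : ℝ => r * |r⁻¹ - m| ^ (0 : ℝ)) R = R := by
  simp only [Real.rpow_zero, mul_one]
  exact cfc_id' ℝ R

/-- Operators comparable with the resolvent control the powers of `|H|`, with constants uniform in
the exponent. -/
theorem exists_const_abs_pow_of_le (hR : 0 ≤ R) (hinj : Function.Injective R) (hJ : 0 ≤ J)
    (hC : 1 ≤ C) (hJR : J ≤ C • R) (m : ℝ) :
    ∃ K : ℝ, 0 ≤ K ∧ ∀ s ∈ Set.Icc (0 : ℝ) 1,
      (∀ h, ∃ g, hilbertCfc (fun r : ℝ => r * |r⁻¹ - m| ^ (s / 2)) R (hilbertRpow J (s / 2) h) = R g ∧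
        ‖g‖ ≤ K * ‖h‖) ∧
      ∀ f g, hilbertCfc (fun r : ℝ => r * |r⁻¹ - m| ^ (s / 2)) R f = R g →
        ‖hilbertRpow J (s / 2) g‖ ≤ K * ‖f‖ := by
  obtain ⟨K, hK1, hK⟩ := exists_abs_one_sub_mul_le R m
  exact ⟨C * K, by positivity, fun s hs =>
    ⟨fun h => exists_abs_pow_of_rpow_half hR hinj hJ hC hJR hK hK1 hs h,
      fun f g hfg => norm_rpow_half_le_of_abs_pow hR hinj hJ hC hJR hK hK1 hs hfg⟩⟩

/-- Resolvents at all points `-t` with `0 < t < l₀` exclude spectrum of `H` in `(-l₀, 0)`, the gap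
needed to compare `|H| + l` with `H + l`. -/
theorem exists_hilbertRpow_eq_of_abs_pow (hR : 0 ≤ R) (hinj : Function.Injective R) (hm : 0 < m)
    {l₀ : ℝ} (hl : 0 < l) (hl₀ : l ≤ l₀ / 2)
    (hres : ∀ t, 0 < t → t < l₀ → ∃ R' : E →L[ℂ] E, IsSelfAdjoint R' ∧
      R' - R = (m - t) • (R * R'))
    (hR' : IsSelfAdjoint R') (h : R' - R = (m - l) • (R * R')) (hN : 0 ≤ N)
    (hNinj : Function.Injective (hilbertRpow N (s / 2))) (hC : 1 ≤ C)
    (hRN : R' + (3 * m / l₀) • R ≤ C • N) (hs : s ∈ Set.Icc (0 : ℝ) 1)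
    (hug : hilbertCfc (fun r : ℝ => r * |r⁻¹ - m| ^ (s / 2)) R u = R g) :
    ∃ x, hilbertRpow N (s / 2) x = u ∧ ‖x‖ ≤ C * (‖g‖ + l ^ (s / 2) * ‖u‖) := by
  refine exists_rpow_half_eq_of_abs_pow hR hinj hl hN hNinj hC ?_ hs hug
  refine (cfc_regularized_le hR hm hl hl₀ fun t ht ht' r hr => ?_).trans ?_
  · obtain ⟨R'', h1, h2⟩ := hres t ht ht'
    exact one_sub_mul_ne_zero_of_resolvent_identity hR.isSelfAdjoint h1 h2 hr
  · rwa [← eq_cfc_of_resolvent_identity hR.isSelfAdjoint hR' h]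

theorem le_of_re_inner_le {A B : E →L[ℂ] E} (hA : IsSelfAdjoint A) (hB : IsSelfAdjoint B)
    (h : ∀ x, RCLike.re ⟪A x, x⟫_ℂ ≤ RCLike.re ⟪B x, x⟫_ℂ) : A ≤ B := by
  rw [ContinuousLinearMap.le_def, ContinuousLinearMap.isPositive_def]
  refine ⟨(hB.sub hA).isSymmetric, fun x => ?_⟩
  rw [ContinuousLinearMap.reApplyInnerSelf_apply, sub_apply, inner_sub_left, map_sub]
  linarith [h x]

end HilbertCalculus

/-! ### Powers of positive multipliers as weighted norms. -/

section MultiplierPowers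

variable {ν : Plane → ℝ} {hc : Continuous ν} {C : ℝ} {hb : ∀ ξ, |ν ξ| ≤ C}

theorem L2.enorm_sq_eq_fourier (f : L2) : ‖f‖ₑ ^ 2 = ∫⁻ ξ, ‖(𝓕 f : L2) ξ‖ₑ ^ 2 := by
  have h : ‖f‖ₑ = ‖(𝓕 f : L2)‖ₑ := by
    rw [← ofReal_norm, ← ofReal_norm, Lp.norm_fourier_eq]
  rw [h, L2.enorm_sq_eq]

theorem fourier_hilbertRpow (h0 : ∀ ξ, 0 < ν ξ) {t : ℝ} (ht : 0 ≤ t) (f : L2) :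
    (𝓕 (hilbertRpow (fourierMul (realSymbol ν hc C hb)) t f) : L2) =ᵐ[volume]
      fun ξ => ((ν ξ ^ t : ℝ) : ℂ) * (𝓕 f : L2) ξ := by
  have hb' : ∀ ξ, |ν ξ ^ t| ≤ C ^ t := fun ξ => by
    rw [abs_of_nonneg (Real.rpow_nonneg (h0 ξ).le t)]
    exact Real.rpow_le_rpow (h0 ξ).le ((le_abs_self _).trans (hb ξ)) ht
  rw [hilbertRpow_fourierMul hc hb (fun ξ => (h0 ξ).le) ht
    (hc.rpow_const fun ξ => Or.inl (h0 ξ).ne') hb']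
  exact fourier_fourierMul _ f

theorem enorm_rpow_half_sq {a : ℝ} (ha : 0 < a) (s : ℝ) :
    ‖a ^ (s / 2)‖ₑ ^ 2 = ENNReal.ofReal (a ^ s) := by
  rw [Real.enorm_of_nonneg (by positivity), ← ENNReal.ofReal_pow (by positivity),
    ← Real.rpow_natCast, ← Real.rpow_mul ha.le]
  congr 2
  push_cast
  ring

theorem enorm_hilbertRpow_sq (h0 : ∀ ξ, 0 < ν ξ) {s : ℝ} (hs : 0 ≤ s) (f : L2) :
    ‖hilbertRpow (fourierMul (realSymbol ν hc C hb)) (s / 2) f‖ₑ ^ 2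
      = ∫⁻ ξ, ENNReal.ofReal (ν ξ ^ s) * ‖(𝓕 f : L2) ξ‖ₑ ^ 2 := by
  rw [L2.enorm_sq_eq_fourier]
  refine lintegral_congr_ae ?_
  filter_upwards [fourier_hilbertRpow (hc := hc) (hb := hb) h0 (t := s / 2) (by linarith) f] with ξ hξ
  rw [hξ, enorm_ofReal_mul, mul_pow, enorm_rpow_half_sq (h0 ξ)]

theorem enorm_sq_eq_of_hilbertRpow_eq (h0 : ∀ ξ, 0 < ν ξ) {s : ℝ} (hs : 0 ≤ s) {x u : L2}
    (h : hilbertRpow (fourierMul (realSymbol ν hc C hb)) (s / 2) x = u) :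
    ‖x‖ₑ ^ 2 = ∫⁻ ξ, ENNReal.ofReal ((ν ξ)⁻¹ ^ s) * ‖(𝓕 u : L2) ξ‖ₑ ^ 2 := by
  rw [L2.enorm_sq_eq_fourier]
  refine lintegral_congr_ae ?_
  have h1 := fourier_hilbertRpow (hc := hc) (hb := hb) h0 (t := s / 2) (by linarith) x
  rw [h] at h1
  filter_upwards [h1] with ξ hξ
  have hp := Real.rpow_pos_of_pos (h0 ξ) s
  rw [hξ, enorm_ofReal_mul, mul_pow, enorm_rpow_half_sq (h0 ξ), ← mul_assoc,
    ← ENNReal.ofReal_mul (Real.rpow_nonneg (inv_nonneg.2 (h0 ξ).le) s),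
    Real.inv_rpow (h0 ξ).le, inv_mul_cancel₀ hp.ne', ENNReal.ofReal_one, one_mul]

theorem injective_hilbertRpow (h0 : ∀ ξ, 0 < ν ξ) {s : ℝ} (hs : 0 ≤ s) :
    Function.Injective (hilbertRpow (fourierMul (realSymbol ν hc C hb)) (s / 2)) := by
  refine (injective_iff_map_eq_zero _).2 fun x hx => ?_
  have h := enorm_sq_eq_of_hilbertRpow_eq h0 hs hx
  have h00 : (𝓕 (0 : L2) : L2) = 0 := map_zero (Lp.fourierTransformₗᵢ Plane ℂ)
  have h2 : ∫⁻ ξ, ENNReal.ofReal ((ν ξ)⁻¹ ^ s) * ‖(𝓕 (0 : L2) : L2) ξ‖ₑ ^ 2 = 0 := by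
    rw [h00, lintegral_congr_ae (g := fun _ => 0), lintegral_zero]
    filter_upwards [Lp.coeFn_zero ℂ 2 (volume : Measure Plane)] with ξ hξ
    rw [hξ]
    simp
  rw [h2] at h
  simpa using h

theorem exists_hilbertRpow_eq (h0 : ∀ ξ, 0 < ν ξ) {s : ℝ} (hs : 0 ≤ s) {u : L2}
    (h : ∫⁻ ξ, ENNReal.ofReal ((ν ξ)⁻¹ ^ s) * ‖(𝓕 u : L2) ξ‖ₑ ^ 2 < ⊤) :
    ∃ x, hilbertRpow (fourierMul (realSymbol ν hc C hb)) (s / 2) x = u := by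
  have hm : MemLp (fun ξ => (((ν ξ)⁻¹ ^ (s / 2) : ℝ) : ℂ) * (𝓕 u : L2) ξ) 2 volume := by
    refine memLp_two_of_lintegral ?_ (lt_of_eq_of_lt (lintegral_congr fun ξ => ?_) h)
    · refine Continuous.aestronglyMeasurable ?_ |>.mul (Lp.aestronglyMeasurable _)
      exact Complex.continuous_ofReal.comp ((hc.inv₀ fun ξ => (h0 ξ).ne').rpow_const
        fun ξ => Or.inl (inv_pos.2 (h0 ξ)).ne')
    · rw [enorm_ofReal_mul, mul_pow, enorm_rpow_half_sq (inv_pos.2 (h0 ξ))]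
  refine ⟨(Lp.fourierTransformₗᵢ Plane ℂ).symm hm.toLp, L2.ext_fourier ?_⟩
  have h1 : (𝓕 ((Lp.fourierTransformₗᵢ Plane ℂ).symm hm.toLp) : L2) = hm.toLp :=
    (Lp.fourierTransformₗᵢ Plane ℂ).apply_symm_apply _
  have h2 := fourier_hilbertRpow (hc := hc) (hb := hb) h0 (t := s / 2) (by linarith)
    ((Lp.fourierTransformₗᵢ Plane ℂ).symm hm.toLp)
  rw [h1] at h2
  filter_upwards [h2, hm.coeFn_toLp] with ξ h2 h3
  have hp := Real.rpow_pos_of_pos (h0 ξ) (s / 2)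
  rw [h2, h3, ← mul_assoc, ← Complex.ofReal_mul, Real.inv_rpow (h0 ξ).le, mul_inv_cancel₀ hp.ne',
    Complex.ofReal_one, one_mul]

end MultiplierPowers

/-! ### Independence of the chosen resolvent. -/

section AbsPow

variable {V : Plane → ℝ} {m α : ℝ} {R : L2 →L[ℂ] L2} {f g : L2}

theorem IsAbsPow.eq_of_isResolvent (h : IsAbsPow V α f g) (h0 : 0 ≤ α) (h1 : α < 1)
    (hR : IsResolvent V m R) : hilbertCfc (fun r : ℝ => r * |r⁻¹ - m| ^ α) R f = R g := by
  obtain ⟨m', R', hR', hfg⟩ := h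
  exact hilbertCfc_abs_pow_of_resolvent_identity h0 h1 hR.1 hR'.1 (hR.sub_eq hR') hfg

end AbsPow

theorem isSelfAdjoint_real_smul {E : Type*} [NormedAddCommGroup E] [InnerProductSpace ℂ E]
    [CompleteSpace E] {A : E →L[ℂ] E} (hA : IsSelfAdjoint A) (c : ℝ) : IsSelfAdjoint (c • A) :=
  (IsSelfAdjoint.all c).smul hA

/-! ### Large energies and the inhomogeneous Sobolev bounds. -/

section LargeEnergy

variable {V : Plane → ℝ} {μ : ℝ} {B N : L2 →L[ℂ] L2}

/-- The symbol of `(-Δ + μ)⁻¹`. -/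
def resSymbol (μ : ℝ) (ξ : Plane) : ℝ := (freqSq ξ + μ)⁻¹

theorem resSymbol_pos (hμ : 0 < μ) (ξ : Plane) : 0 < resSymbol μ ξ :=
  inv_pos.2 (freqSq_add_pos hμ ξ)

theorem continuous_resSymbol (hμ : 0 < μ) : Continuous (resSymbol μ) :=
  Continuous.inv₀ (continuous_freqSq.add continuous_const) fun ξ => (freqSq_add_pos hμ ξ).ne'

theorem abs_resSymbol_le (hμ : 0 < μ) (ξ : Plane) : |resSymbol μ ξ| ≤ μ⁻¹ := by
  rw [abs_of_pos (resSymbol_pos hμ ξ), resSymbol]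
  have := freqSq_nonneg ξ
  gcongr
  linarith

/-- The operator `(-Δ + μ)⁻¹`. -/
def freeRes (μ : ℝ) (hμ : 0 < μ) : L2 →L[ℂ] L2 :=
  fourierMul (realSymbol (resSymbol μ) (continuous_resSymbol hμ) _ (abs_resSymbol_le hμ))

theorem freeRoot_mul_freeRoot (hμ : 0 < μ) : freeRoot μ hμ * freeRoot μ hμ = freeRes μ hμ := by
  rw [freeRoot, freeRes, ← map_mul]
  congr 1
  ext ξ
  rw [BoundedContinuousFunction.mul_apply, realSymbol_apply, realSymbol_apply, ← Complex.ofReal_mul,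
    ← sq, rootSymbol_sq hμ, resSymbol]

theorem freeRes_nonneg (hμ : 0 < μ) : 0 ≤ freeRes μ hμ :=
  fourierMul_nonneg _ _ fun ξ => (resSymbol_pos hμ ξ).le

theorem isSelfAdjoint_freeRes (hμ : 0 < μ) : IsSelfAdjoint (freeRes μ hμ) :=
  (isSelfAdjoint_realSymbol _ _).map fourierMul

theorem re_inner_freeRes (hμ : 0 < μ) (f : L2) :
    RCLike.re ⟪freeRes μ hμ f, f⟫_ℂ = ‖freeRoot μ hμ f‖ ^ 2 := by
  rw [← freeRoot_mul_freeRoot]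
  change RCLike.re ⟪freeRoot μ hμ (freeRoot μ hμ f), f⟫_ℂ = _
  rw [inner_apply_left_of_isSelfAdjoint (isSelfAdjoint_freeRoot hμ), inner_self_eq_norm_sq]

/-- The perturbation has the form `A N A*` with `A* = B* (-Δ + μ)^{-1/2}`, so its quadratic form is
`⟪N w, w⟫` with `w = A* f`. -/
theorem abs_re_inner_resolventOp_sub_le (hμ : 0 < μ) (f : L2) :
    |RCLike.re ⟪resolventOp μ hμ B N f, f⟫_ℂ - ‖freeRoot μ hμ f‖ ^ 2|
      ≤ ‖N‖ * ‖ContinuousLinearMap.adjoint B (freeRoot μ hμ f)‖ ^ 2 := by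
  rw [resolventOp_apply, inner_apply_left_of_isSelfAdjoint (isSelfAdjoint_freeRoot hμ),
    inner_sub_left, map_sub, inner_self_eq_norm_sq, ← ContinuousLinearMap.adjoint_inner_right,
    sub_sub_cancel_left, abs_neg]
  set w := ContinuousLinearMap.adjoint B (freeRoot μ hμ f)
  calc _ ≤ ‖⟪N w, w⟫_ℂ‖ := RCLike.abs_re_le_norm _
    _ ≤ ‖N w‖ * ‖w‖ := norm_inner_le_norm _ _
    _ ≤ ‖N‖ * ‖w‖ * ‖w‖ := by gcongr; exact N.le_opNorm w
    _ = _ := by ring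

theorem re_inner_real_smul (c : ℝ) (A : L2 →L[ℂ] L2) (f : L2) :
    RCLike.re ⟪(c • A) f, f⟫_ℂ = c * RCLike.re ⟪A f, f⟫_ℂ := by
  have : (c • A) f = (c : ℂ) • A f := by
    rw [smul_apply, Complex.coe_smul]; rfl
  rw [this, inner_smul_left]
  simp

/-- At large energies the resolvents of `-Δ + V` and `-Δ` are comparable. -/
theorem exists_isResolvent_comparable (hV : Integrable V)
    (hG : hsSq V (fun p => ‖green p.1 p.2‖ₑ) < ⊤) :
    ∃ (m : ℝ) (hm : 0 < m) (R : L2 →L[ℂ] L2), IsResolvent V m R ∧ 0 ≤ R ∧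
      freeRes m hm ≤ (2 : ℝ) • R ∧ R ≤ (2 : ℝ) • freeRes m hm := by
  obtain ⟨m, hb, hm⟩ := ((eventually_norm_adjoint_mul_le hV hG (δ := 1 / 4) (by norm_num)).and
    (eventually_gt_atTop 0)).exists
  obtain ⟨B, hB⟩ := exists_isBirman hV hm (hsSq_resKernel_lt_top hV hG hm)
  have hBB := hb B hB
  obtain ⟨N, hMN, hNM, hNn, hN⟩ := exists_inverse_of_bounded_below
    (isSelfAdjoint_birmanSchwinger hV.1.aemeasurable B) (c := 1 / 2) (by norm_num) fun φ => by
      have := birmanSchwinger_bounded_below_of_norm_le hV.1.aemeasurable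
        (hBB.trans (by norm_num)) φ
      linarith
  have hBn : ‖ContinuousLinearMap.adjoint B‖ * ‖ContinuousLinearMap.adjoint B‖ ≤ 1 / 4 := by
    rwa [LinearIsometryEquiv.norm_map, ← ContinuousLinearMap.norm_adjoint_comp_self]
  -- With `‖B*‖² ≤ 1/4` and `‖N‖ ≤ 2` the deviation is at most half of the free form, so `R` lies
  -- between `1/2` and `3/2` of the free resolvent.
  have key : ∀ f, |RCLike.re ⟪resolventOp m hm B N f, f⟫_ℂ - ‖freeRoot m hm f‖ ^ 2|
      ≤ 1 / 2 * ‖freeRoot m hm f‖ ^ 2 := fun f => by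
    refine (abs_re_inner_resolventOp_sub_le hm f).trans ?_
    have h1 := (ContinuousLinearMap.adjoint B).le_opNorm (freeRoot m hm f)
    have h2 : ‖ContinuousLinearMap.adjoint B (freeRoot m hm f)‖ ^ 2
        ≤ 1 / 4 * ‖freeRoot m hm f‖ ^ 2 := by
      calc _ ≤ (‖ContinuousLinearMap.adjoint B‖ * ‖freeRoot m hm f‖) ^ 2 := by gcongr
        _ = (‖ContinuousLinearMap.adjoint B‖ * ‖ContinuousLinearMap.adjoint B‖)
            * ‖freeRoot m hm f‖ ^ 2 := by ring
        _ ≤ _ := by gcongr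
    calc _ ≤ 2 * (1 / 4 * ‖freeRoot m hm f‖ ^ 2) := by
          gcongr
          exact hNn.trans (by norm_num)
      _ = _ := by ring
  have hR := isResolvent_resolventOp hV hm hB hMN hNM hN
  refine ⟨m, hm, _, hR, ?_, ?_, ?_⟩
  · refine le_of_re_inner_le (IsSelfAdjoint.zero _) hR.1 fun f => ?_
    have := (abs_le.1 (key f)).1
    have h0 : RCLike.re ⟪(0 : L2 →L[ℂ] L2) f, f⟫_ℂ = 0 := by simp
    rw [h0]
    nlinarith [sq_nonneg ‖freeRoot m hm f‖]
  · refine le_of_re_inner_le (isSelfAdjoint_freeRes hm) (isSelfAdjoint_real_smul hR.1 2) fun f => ?_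
    have := (abs_le.1 (key f)).1
    rw [re_inner_freeRes, re_inner_real_smul]
    nlinarith [sq_nonneg ‖freeRoot m hm f‖]
  · refine le_of_re_inner_le hR.1 (isSelfAdjoint_real_smul (isSelfAdjoint_freeRes hm) 2) fun f => ?_
    have := (abs_le.1 (key f)).2
    rw [re_inner_real_smul, re_inner_freeRes]
    nlinarith [sq_nonneg ‖freeRoot m hm f‖]

theorem sobolevNorm_sq (σ : ℝ) (f : L2) :
    sobolevNorm σ f ^ 2 = ∫⁻ ξ, ENNReal.ofReal ((1 + freqSq ξ) ^ σ) * ‖(𝓕 f : L2) ξ‖ₑ ^ 2 := by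
  rw [sobolevNorm, ← ENNReal.rpow_natCast, ← ENNReal.rpow_mul]
  norm_num
  rfl

theorem rpow_le_one_add_mul_rpow {a b K s : ℝ} (ha : 0 ≤ a) (hb : 0 ≤ b) (hK : 1 ≤ K)
    (h : a ≤ K * b) (hs : s ∈ Set.Icc (0 : ℝ) 1) : a ^ s ≤ K * b ^ s := by
  calc a ^ s ≤ (K * b) ^ s := Real.rpow_le_rpow ha h hs.1
    _ = K ^ s * b ^ s := Real.mul_rpow (by linarith) hb
    _ ≤ K ^ (1 : ℝ) * b ^ s := by
        refine mul_le_mul_of_nonneg_right ?_ (Real.rpow_nonneg hb s)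
        exact Real.rpow_le_rpow_of_exponent_le hK hs.2
    _ = K * b ^ s := by rw [Real.rpow_one]

/-- For `J = (-Δ + m)⁻¹`, the norms of `J^{∓s/2}` are the `H^{±s}` norms up to a factor `1 + m`
uniform in `s`, and `J ≤ 2 R` transfers them to `|H|^{s/2}`. -/
theorem exists_absPow_sobolev_bound (hV : Integrable V)
    (hG : hsSq V (fun p => ‖green p.1 p.2‖ₑ) < ⊤) :
    ∃ C : ℝ≥0, ∀ s ∈ Set.Icc (0 : ℝ) 1,
      (∀ f : L2, sobolevNorm s f < ⊤ →
        ∃ g : L2, IsAbsPow V (s / 2) f g ∧ ‖g‖ₑ ≤ C * sobolevNorm s f) ∧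
      (∀ f g : L2, IsAbsPow V (s / 2) f g → sobolevNorm (-s) g ≤ C * ‖f‖ₑ) := by
  obtain ⟨m, hm, R, hR, hR0, hJR, -⟩ := exists_isResolvent_comparable hV hG
  obtain ⟨K, hK, hKs⟩ := exists_const_abs_pow_of_le hR0 hR.injective (freeRes_nonneg hm)
    (by norm_num) hJR m
  have hm1 : 1 ≤ 1 + m := by linarith
  set C : ℝ≥0 := ⟨K * (1 + m), by positivity⟩ with hC
  have hCe : (C : ℝ≥0∞) = ENNReal.ofReal K * ENNReal.ofReal (1 + m) := by
    rw [← ENNReal.ofReal_mul hK, ← ENNReal.ofReal_coe_nnreal]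
    rfl
  have hsq : ENNReal.ofReal (1 + m) ≤ ENNReal.ofReal (1 + m) ^ 2 := by
    rw [← ENNReal.ofReal_pow (by linarith)]
    exact ENNReal.ofReal_le_ofReal (by nlinarith)
  have hsymb : ∀ ξ, (resSymbol m ξ)⁻¹ ≤ (1 + m) * (1 + freqSq ξ) := fun ξ => by
    rw [resSymbol, inv_inv]
    nlinarith [freqSq_nonneg ξ]
  refine ⟨C, fun s hs => ⟨fun f hf => ?_, fun f g hfg => ?_⟩⟩
  · have h1 : ∫⁻ ξ, ENNReal.ofReal ((resSymbol m ξ)⁻¹ ^ s) * ‖(𝓕 f : L2) ξ‖ₑ ^ 2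
        ≤ ENNReal.ofReal (1 + m) * sobolevNorm s f ^ 2 := by
      rw [sobolevNorm_sq, ← lintegral_const_mul' _ _ ENNReal.ofReal_ne_top]
      refine lintegral_mono fun ξ => ?_
      rw [← mul_assoc, ← ENNReal.ofReal_mul (by linarith)]
      refine mul_le_mul' (ENNReal.ofReal_le_ofReal ?_) le_rfl
      exact rpow_le_one_add_mul_rpow (inv_nonneg.2 (resSymbol_pos hm ξ).le)
        (by linarith [freqSq_nonneg ξ]) hm1 (hsymb ξ) hs
    obtain ⟨h, hh⟩ := exists_hilbertRpow_eq (hc := continuous_resSymbol hm)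
      (hb := abs_resSymbol_le hm) (resSymbol_pos hm) hs.1
      (h1.trans_lt (ENNReal.mul_lt_top ENNReal.ofReal_lt_top (ENNReal.pow_lt_top hf)))
    have hn := enorm_sq_eq_of_hilbertRpow_eq (resSymbol_pos hm) hs.1 hh
    obtain ⟨g, hg, hgn⟩ := (hKs s hs).1 h
    have hhn : ‖h‖ₑ ≤ ENNReal.ofReal (1 + m) * sobolevNorm s f := by
      rw [← ENNReal.pow_le_pow_left_iff two_ne_zero, hn, mul_pow]
      exact h1.trans (mul_le_mul' hsq le_rfl)
    refine ⟨g, ⟨m, R, hR, ?_⟩, ?_⟩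
    · rw [← hg, ← hh]
      rfl
    · rw [hCe, mul_assoc]
      refine le_trans ?_ (mul_le_mul' le_rfl hhn)
      rw [← ofReal_norm, ← ofReal_norm, ← ENNReal.ofReal_mul hK]
      exact ENNReal.ofReal_le_ofReal hgn
  · have h1 := (hKs s hs).2 f g (hfg.eq_of_isResolvent (by linarith [hs.1]) (by linarith [hs.2]) hR)
    have h2 := enorm_hilbertRpow_sq (hc := continuous_resSymbol hm)
      (hb := abs_resSymbol_le hm) (resSymbol_pos hm) hs.1 g
    have h3 : sobolevNorm (-s) g ^ 2
        ≤ ENNReal.ofReal (1 + m) * ‖hilbertRpow (freeRes m hm) (s / 2) g‖ₑ ^ 2 := by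
      rw [freeRes, h2, sobolevNorm_sq, ← lintegral_const_mul' _ _ ENNReal.ofReal_ne_top]
      refine lintegral_mono fun ξ => ?_
      rw [← mul_assoc, ← ENNReal.ofReal_mul (by linarith)]
      refine mul_le_mul' (ENNReal.ofReal_le_ofReal ?_) le_rfl
      have hp : 0 < 1 + freqSq ξ := by linarith [freqSq_nonneg ξ]
      rw [Real.rpow_neg hp.le, ← Real.inv_rpow hp.le]
      refine rpow_le_one_add_mul_rpow (inv_nonneg.2 hp.le) (resSymbol_pos hm ξ).le hm1 ?_ hs
      have h4 := hsymb ξ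
      rw [inv_le_iff_one_le_mul₀ (resSymbol_pos hm ξ)] at h4
      rw [inv_le_iff_one_le_mul₀ hp]
      nlinarith
    have h5 : ‖hilbertRpow (freeRes m hm) (s / 2) g‖ₑ ≤ ENNReal.ofReal K * ‖f‖ₑ := by
      rw [← ofReal_norm, ← ofReal_norm, ← ENNReal.ofReal_mul hK]
      exact ENNReal.ofReal_le_ofReal h1
    rw [← ENNReal.pow_le_pow_left_iff two_ne_zero, hCe]
    calc _ ≤ _ := h3
      _ ≤ ENNReal.ofReal (1 + m) ^ 2 * (ENNReal.ofReal K * ‖f‖ₑ) ^ 2 := by gcongr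
      _ = _ := by ring

end LargeEnergy

/-! ### The frequency barrier. -/

section Barrier

variable {ε x y : ℝ}

/-- A regularization of `x` at zero: of size `x ^ (1 + ε)` for small `x` and of size `x` for
large `x`. -/
def barrier (ε x : ℝ) : ℝ := (x / (1 + x)) ^ ε * x

theorem barrier_pos (hx : 0 < x) : 0 < barrier ε x := by unfold barrier; positivity

theorem barrier_nonneg (hx : 0 ≤ x) : 0 ≤ barrier ε x := by unfold barrier; positivity

theorem barrier_mono (hε : 0 ≤ ε) (hx : 0 ≤ x) (hxy : x ≤ y) : barrier ε x ≤ barrier ε y := by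
  have hy : 0 ≤ y := hx.trans hxy
  have h : x / (1 + x) ≤ y / (1 + y) := by
    rw [div_le_div_iff₀ (by positivity) (by positivity)]
    nlinarith
  unfold barrier
  gcongr

theorem barrier_le_self (hε : 0 ≤ ε) (hx : 0 ≤ x) : barrier ε x ≤ x := by
  have h : (x / (1 + x)) ^ ε ≤ 1 :=
    Real.rpow_le_one (by positivity) (by rw [div_le_one (by positivity)]; linarith) hε
  calc _ ≤ 1 * x := by unfold barrier; gcongr
    _ = x := one_mul x

theorem barrier_div_sq_le_inv (hε : 0 ≤ ε) (hx : 0 < x) : barrier ε x / x ^ 2 ≤ x⁻¹ := by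
  rw [div_le_iff₀ (by positivity)]
  calc _ ≤ x := barrier_le_self hε hx.le
    _ = _ := by field_simp

/-- With `x` comparable to `|ξ|²` the right side is `|ξ|^{2ε-2}`, locally integrable in the plane
exactly for `ε > 0`; without the barrier there would be a logarithmic divergence. -/
theorem barrier_div_sq_le_rpow (hε : 0 ≤ ε) (hx : 0 < x) : barrier ε x / x ^ 2 ≤ x ^ (ε - 1) := by
  rw [div_le_iff₀ (by positivity)]
  have h : (x / (1 + x)) ^ ε ≤ x ^ ε := by
    refine Real.rpow_le_rpow (by positivity) ?_ hε
    exact div_le_self hx.le (by linarith)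
  calc _ ≤ x ^ ε * x := by unfold barrier; gcongr
    _ = x ^ (ε - 1) * x ^ 2 := by
        rw [Real.rpow_sub_one hx.ne']
        field_simp

theorem continuous_barrier_add (hε : 0 ≤ ε) {l : ℝ} (hl : 0 < l) :
    Continuous fun ξ => barrier ε (freqSq ξ + l) := by
  have h : ∀ ξ, 1 + (freqSq ξ + l) ≠ 0 := fun ξ => by linarith [freqSq_add_pos hl ξ]
  have hc := continuous_freqSq
  unfold barrier
  exact (Continuous.rpow_const (Continuous.div (by fun_prop) (by fun_prop) h)
    fun _ => Or.inr hε).mul (by fun_prop)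

/-- The reciprocal of the barrier, as a Fourier symbol. -/
def barrierSymbol (ε l : ℝ) (ξ : Plane) : ℝ := (barrier ε (freqSq ξ + l))⁻¹

variable {l : ℝ}

theorem barrierSymbol_pos (hl : 0 < l) (ξ : Plane) : 0 < barrierSymbol ε l ξ :=
  inv_pos.2 (barrier_pos (freqSq_add_pos hl ξ))

theorem continuous_barrierSymbol (hε : 0 ≤ ε) (hl : 0 < l) : Continuous (barrierSymbol ε l) :=
  (continuous_barrier_add hε hl).inv₀ fun ξ => (barrier_pos (freqSq_add_pos hl ξ)).ne'

theorem abs_barrierSymbol_le (hε : 0 ≤ ε) (hl : 0 < l) (ξ : Plane) :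
    |barrierSymbol ε l ξ| ≤ (barrier ε l)⁻¹ := by
  rw [abs_of_pos (barrierSymbol_pos hl ξ)]
  exact inv_anti₀ (barrier_pos hl) (barrier_mono hε hl.le (by linarith [freqSq_nonneg ξ]))

/-- The Fourier multiplier with symbol `barrierSymbol ε l`. -/
def barrierMul (ε l : ℝ) (hε : 0 ≤ ε) (hl : 0 < l) : L2 →L[ℂ] L2 :=
  fourierMul (realSymbol (barrierSymbol ε l) (continuous_barrierSymbol hε hl) _
    (abs_barrierSymbol_le hε hl))

theorem ofReal_re_inner_fourierMul {ν : Plane → ℝ} (hc : Continuous ν) {C : ℝ}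
    (hb : ∀ ξ, |ν ξ| ≤ C) (h0 : ∀ ξ, 0 ≤ ν ξ) (f : L2) :
    ENNReal.ofReal (RCLike.re ⟪fourierMul (realSymbol ν hc C hb) f, f⟫_ℂ)
      = ∫⁻ ξ, ENNReal.ofReal (ν ξ) * ‖(𝓕 f : L2) ξ‖ₑ ^ 2 := by
  have hi : Integrable fun ξ => ν ξ * ‖(𝓕 f : L2) ξ‖ ^ 2 :=
    ((Lp.memLp (𝓕 f : L2)).integrable_norm_pow two_ne_zero).bdd_mul hc.aestronglyMeasurable
      (Eventually.of_forall hb)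
  rw [inner_fourierMul_realSymbol]
  change ENNReal.ofReal (∫ ξ, ν ξ * ‖(𝓕 f : L2) ξ‖ ^ 2) = _
  rw [ofReal_integral_eq_lintegral_ofReal hi
    (Eventually.of_forall fun ξ => mul_nonneg (h0 ξ) (by positivity))]
  refine lintegral_congr fun ξ => ?_
  rw [ENNReal.ofReal_mul (h0 ξ), ENNReal.ofReal_pow (norm_nonneg _), ofReal_norm]

end Barrier

/-! ### Uniform estimates for `v (-Δ + l)⁻¹` at small energy. -/

section SmallEnergy

variable {V : Plane → ℝ} {ε l : ℝ} {B : L2 →L[ℂ] L2}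

theorem lintegral_rootMul_sq_le (hV : Integrable V) (ψ : L2) :
    (∫⁻ x, ‖rootMul V ψ x‖ₑ) ^ 2 ≤ (∫⁻ x, ‖V x‖ₑ) * ‖ψ‖ₑ ^ 2 := by
  have hr : AEMeasurable fun x => ‖rootAbs V x‖ₑ := (aemeasurable_rootAbs hV.1.aemeasurable).enorm
  have hψ : AEMeasurable fun x => ‖ψ x‖ₑ := (Lp.aestronglyMeasurable ψ).enorm
  have hc := ENNReal.lintegral_mul_le_Lp_mul_Lq volume Real.HolderConjugate.two_two hr hψ
  have e : ∫⁻ x, ‖rootMul V ψ x‖ₑ = ∫⁻ x, ((fun x => ‖rootAbs V x‖ₑ) * fun x => ‖ψ x‖ₑ) x :=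
    lintegral_congr fun x => by rw [enorm_rootMul, Pi.mul_apply]
  rw [e]
  calc _ ≤ _ := pow_le_pow_left' hc 2
    _ = _ := by
      simp only [ENNReal.rpow_two, enorm_rootAbs_sq]
      rw [mul_pow, ← L2.enorm_sq_eq, ← ENNReal.rpow_natCast, ← ENNReal.rpow_natCast,
        ← ENNReal.rpow_mul, ← ENNReal.rpow_mul]
      norm_num

theorem lintegral_ball_freqSq_rpow_lt_top (hε : 0 < ε) :
    ∫⁻ ξ in Metric.ball (0 : Plane) 1, ENNReal.ofReal (freqSq ξ ^ (ε - 1)) < ⊤ := by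
  have h := (integrableOn_ball_norm_rpow (a := 2 * (ε - 1)) (by linarith)).const_mul
    ((2 * Real.pi) ^ (2 * (ε - 1)))
  refine lt_of_le_of_lt (lintegral_mono fun ξ => ?_) h.2
  change _ ≤ ‖(2 * Real.pi) ^ (2 * (ε - 1)) * ‖ξ‖ ^ (2 * (ε - 1))‖ₑ
  rw [← Real.mul_rpow (by positivity) (norm_nonneg ξ), Real.enorm_of_nonneg (by positivity), freqSq,
    ← Real.rpow_natCast (2 * Real.pi * ‖ξ‖) 2, ← Real.rpow_mul (by positivity)]
  norm_num

theorem ofReal_barrier_div_sq_le (hε : 0 ≤ ε) (hε1 : ε ≤ 1) (hl : 0 < l) {ξ : Plane} (hξ : ξ ≠ 0) :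
    ENNReal.ofReal (barrier ε (freqSq ξ + l) / (freqSq ξ + l) ^ 2)
      ≤ (Metric.ball (0 : Plane) 1).indicator (fun ξ => ENNReal.ofReal (freqSq ξ ^ (ε - 1))) ξ
        + 2 * ‖rootSymbol 1 ξ‖ₑ ^ 2 := by
  have hx := freqSq_add_pos hl ξ
  have hn : 0 < ‖ξ‖ := norm_pos_iff.2 hξ
  by_cases hb : ‖ξ‖ < 1
  · rw [Set.indicator_of_mem (by simpa using hb)]
    refine le_trans (ENNReal.ofReal_le_ofReal ?_) le_self_add
    refine (barrier_div_sq_le_rpow hε hx).trans ?_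
    have : 0 < freqSq ξ := by unfold freqSq; positivity
    exact Real.rpow_le_rpow_of_nonpos this (by linarith) (by linarith)
  · refine le_trans ?_ le_add_self
    rw [enorm_rootSymbol_sq one_pos, ← ENNReal.ofReal_ofNat, ← ENNReal.ofReal_mul (by norm_num)]
    refine ENNReal.ofReal_le_ofReal ((barrier_div_sq_le_inv hε hx).trans ?_)
    have h1 : 1 ≤ freqSq ξ := by
      unfold freqSq
      have : 1 ≤ 2 * Real.pi * ‖ξ‖ := by nlinarith [Real.pi_gt_three, not_lt.1 hb]
      nlinarith
    rw [← div_eq_mul_inv, inv_eq_one_div, div_le_div_iff₀ hx (by linarith)]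
    linarith

/-- Uniform in `l`: at low frequencies the transform of `v ψ` is bounded and the weight is
integrable; at high frequencies the weight is at most `2 / (|ξ|² + 1)`, and the bound for `B` at `μ
= 1` applies. -/
theorem exists_lintegral_barrier_mul_fourier_le (hV : Integrable V)
    (hG : hsSq V (fun p => ‖green p.1 p.2‖ₑ) < ⊤) (hε : 0 < ε) (hε1 : ε ≤ 1) :
    ∃ A : ℝ≥0, ∀ l, 0 < l → ∀ ψ : L2,
      ∫⁻ ξ, ENNReal.ofReal (barrier ε (freqSq ξ + l) / (freqSq ξ + l) ^ 2)
        * ‖𝓕 (rootMul V ψ) ξ‖ₑ ^ 2 ≤ A * ‖ψ‖ₑ ^ 2 := by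
  set A₁ := ∫⁻ ξ in Metric.ball (0 : Plane) 1, ENNReal.ofReal (freqSq ξ ^ (ε - 1)) with hA₁
  have hA₁t : A₁ < ⊤ := lintegral_ball_freqSq_rpow_lt_top hε
  set A₂ := hsSq V (resKernel₂ 1) ^ (1 / 2 : ℝ) with hA₂
  have hA₂t : A₂ < ⊤ := ENNReal.rpow_lt_top_of_nonneg (by norm_num)
    (hsSq_resKernel_lt_top hV hG one_pos).ne
  have hVt : ∫⁻ x, ‖V x‖ₑ < ⊤ := hV.2
  set A := A₁ * (∫⁻ x, ‖V x‖ₑ) + 2 * A₂ with hA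
  have hAt : A ≠ ⊤ := by finiteness
  refine ⟨A.toNNReal, fun l hl ψ => ?_⟩
  rw [ENNReal.coe_toNNReal hAt]
  have hm : Measurable fun ξ : Plane => ENNReal.ofReal (freqSq ξ ^ (ε - 1)) :=
    (continuous_freqSq.measurable.pow_const _).ennreal_ofReal
  have hF : AEMeasurable fun ξ => ‖𝓕 (rootMul V ψ) ξ‖ₑ ^ 2 :=
    ((continuous_fourier_of_integrable (integrable_rootMul hV ψ)).measurable.enorm.pow_const
      2).aemeasurable
  have hne : ∀ᵐ ξ : Plane, ξ ≠ 0 := by simp [ae_iff]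
  have h1 : ∀ ξ, ‖𝓕 (rootMul V ψ) ξ‖ₑ ^ 2 ≤ (∫⁻ x, ‖V x‖ₑ) * ‖ψ‖ₑ ^ 2 := fun ξ =>
    (pow_le_pow_left' (enorm_fourier_le_lintegral _ ξ) 2).trans (lintegral_rootMul_sq_le hV ψ)
  calc _ ≤ ∫⁻ ξ, ((Metric.ball (0 : Plane) 1).indicator
        (fun ξ => ENNReal.ofReal (freqSq ξ ^ (ε - 1))) ξ * ((∫⁻ x, ‖V x‖ₑ) * ‖ψ‖ₑ ^ 2)
        + 2 * ‖(rootSymbol 1 ξ : ℂ) * 𝓕 (rootMul V ψ) ξ‖ₑ ^ 2) := by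
        refine lintegral_mono_ae ?_
        filter_upwards [hne] with ξ hξ
        refine (mul_le_mul' (ofReal_barrier_div_sq_le hε.le hε1 hl hξ) le_rfl).trans ?_
        rw [add_mul, enorm_ofReal_mul, mul_pow, mul_assoc 2]
        exact add_le_add (mul_le_mul' le_rfl (h1 ξ)) le_rfl
    _ = A₁ * ((∫⁻ x, ‖V x‖ₑ) * ‖ψ‖ₑ ^ 2)
        + 2 * ∫⁻ ξ, ‖(rootSymbol 1 ξ : ℂ) * 𝓕 (rootMul V ψ) ξ‖ₑ ^ 2 := by
        rw [lintegral_add_left ((hm.indicator measurableSet_ball).mul_const _),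
          lintegral_mul_const _ (hm.indicator measurableSet_ball),
          lintegral_indicator measurableSet_ball, lintegral_const_mul' _ _ (by norm_num)]
    _ ≤ A₁ * ((∫⁻ x, ‖V x‖ₑ) * ‖ψ‖ₑ ^ 2) + 2 * (A₂ * ‖ψ‖ₑ ^ 2) := by
        gcongr
        exact lintegral_rootSymbol_mul_sq_le hV one_pos ψ
    _ = A * ‖ψ‖ₑ ^ 2 := by rw [hA]; ring

theorem ENNReal.le_of_sq_le_mul {a b : ℝ≥0∞} (ha : a ≠ ⊤) (h : a ^ 2 ≤ b * a) : a ≤ b := by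
  rcases eq_or_ne a 0 with rfl | h0
  · exact zero_le
  · rw [sq] at h
    exact (ENNReal.mul_le_mul_iff_left h0 ha).1 h

/-- The operator on the left is `v (-Δ + l)⁻¹`, and `hA` bounds the adjoint of its composition with
the square root of the barrier. The lemma is the dual statement. -/
theorem IsBirman.norm_adjoint_freeRoot_sq_le (hB : IsBirman V l B) (hε : 0 ≤ ε) (hl : 0 < l)
    {A : ℝ≥0} (hA : ∀ ψ : L2, ∫⁻ ξ, ENNReal.ofReal (barrier ε (freqSq ξ + l) / (freqSq ξ + l) ^ 2)
        * ‖𝓕 (rootMul V ψ) ξ‖ₑ ^ 2 ≤ A * ‖ψ‖ₑ ^ 2) (h : L2) :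
    ‖ContinuousLinearMap.adjoint B (freeRoot l hl h)‖ ^ 2
      ≤ A * RCLike.re ⟪barrierMul ε l hε hl h, h⟫_ℂ := by
  set ψ := ContinuousLinearMap.adjoint B (freeRoot l hl h) with hψ
  set X := ∫⁻ ξ, ENNReal.ofReal (barrierSymbol ε l ξ) * ‖(𝓕 h : L2) ξ‖ₑ ^ 2 with hX
  have hsp := fun ξ => barrierSymbol_pos (ε := ε) hl ξ
  have hbp := fun ξ => barrier_pos (ε := ε) (freqSq_add_pos hl ξ)
  have hXr : ENNReal.ofReal (RCLike.re ⟪barrierMul ε l hε hl h, h⟫_ℂ) = X :=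
    ofReal_re_inner_fourierMul _ _ (fun ξ => (hsp ξ).le) h
  have m1 : AEMeasurable fun ξ => ‖(Real.sqrt (barrierSymbol ε l ξ) : ℂ) * (𝓕 h : L2) ξ‖ₑ :=
    ((Complex.continuous_ofReal.comp
      (continuous_barrierSymbol hε hl).sqrt).aestronglyMeasurable.mul
      (Lp.aestronglyMeasurable _)).enorm
  have m2 : AEMeasurable fun ξ =>
      ‖(Real.sqrt (barrier ε (freqSq ξ + l)) * rootSymbol l ξ : ℂ) * (𝓕 (B ψ) : L2) ξ‖ₑ :=
    (((Complex.continuous_ofReal.comp (continuous_barrier_add hε hl).sqrt).mul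
      (Complex.continuous_ofReal.comp (continuous_rootSymbol hl))).aestronglyMeasurable.mul
      (Lp.aestronglyMeasurable _)).enorm
  have hcs := ENNReal.lintegral_mul_le_Lp_mul_Lq volume Real.HolderConjugate.two_two m1 m2
  -- `‖ψ‖² = ⟪(-Δ + l)^{-1/2} h, B ψ⟫`; the product of the square roots of the barrier and its
  -- inverse is inserted before Cauchy–Schwarz.
  have h1 : ‖ψ‖ₑ ^ 2 ≤ ∫⁻ ξ, ((fun ξ => ‖(Real.sqrt (barrierSymbol ε l ξ) : ℂ) * (𝓕 h : L2) ξ‖ₑ) *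
      fun ξ => ‖(Real.sqrt (barrier ε (freqSq ξ + l)) * rootSymbol l ξ : ℂ) * (𝓕 (B ψ) : L2) ξ‖ₑ) ξ := by
    have e : ‖ψ‖ₑ ^ 2 = ‖⟪freeRoot l hl h, B ψ⟫_ℂ‖ₑ := by
      have e' : ‖((‖ψ‖ : ℝ) : ℂ)‖ₑ = ‖ψ‖ₑ := by
        rw [← ofReal_norm, Complex.norm_real, norm_norm, ofReal_norm]
      rw [← ContinuousLinearMap.adjoint_inner_left, ← hψ, inner_self_eq_norm_sq_to_K, enorm_pow]
      exact congrArg (· ^ 2) e'.symm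
    rw [e, L2.inner_eq_integral_fourier]
    refine (enorm_integral_le_lintegral_enorm _).trans (lintegral_mono_ae ?_)
    filter_upwards [fourier_freeRoot hl h] with ξ hξ
    rw [enorm_conj_mul, hξ, Pi.mul_apply, enorm_ofReal_mul, enorm_ofReal_mul, ← Complex.ofReal_mul,
      enorm_ofReal_mul, enorm_mul]
    have e2 : ‖Real.sqrt (barrierSymbol ε l ξ)‖ₑ * ‖Real.sqrt (barrier ε (freqSq ξ + l))‖ₑ = 1 := by
      rw [← enorm_mul, barrierSymbol, Real.sqrt_inv,
        inv_mul_cancel₀ (Real.sqrt_pos.2 (hbp ξ)).ne', enorm_one]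
    calc ‖rootSymbol l ξ‖ₑ * ‖(𝓕 h : L2) ξ‖ₑ * ‖(𝓕 (B ψ) : L2) ξ‖ₑ
        = (‖Real.sqrt (barrierSymbol ε l ξ)‖ₑ * ‖Real.sqrt (barrier ε (freqSq ξ + l))‖ₑ) *
          (‖rootSymbol l ξ‖ₑ * ‖(𝓕 h : L2) ξ‖ₑ * ‖(𝓕 (B ψ) : L2) ξ‖ₑ) := by rw [e2, one_mul]
      _ ≤ _ := le_of_eq (by ring)
  have h2 : ∫⁻ ξ, ‖(Real.sqrt (barrierSymbol ε l ξ) : ℂ) * (𝓕 h : L2) ξ‖ₑ ^ (2 : ℝ) = X := by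
    refine lintegral_congr fun ξ => ?_
    rw [ENNReal.rpow_two, enorm_ofReal_mul, mul_pow, Real.enorm_of_nonneg (Real.sqrt_nonneg _),
      ← ENNReal.ofReal_pow (Real.sqrt_nonneg _), Real.sq_sqrt (hsp ξ).le]
  have h3 : ∫⁻ ξ, ‖(Real.sqrt (barrier ε (freqSq ξ + l)) * rootSymbol l ξ : ℂ)
      * (𝓕 (B ψ) : L2) ξ‖ₑ ^ (2 : ℝ) ≤ A * ‖ψ‖ₑ ^ 2 := by
    refine le_trans (le_of_eq (lintegral_congr_ae ?_)) (hA ψ)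
    filter_upwards [hB ψ] with ξ hξ
    rw [hξ, ENNReal.rpow_two, ← mul_assoc, ← Complex.ofReal_mul, ← Complex.ofReal_mul,
      enorm_ofReal_mul, mul_pow]
    congr 1
    have hp := rootSymbol_pos hl ξ
    rw [Real.enorm_of_nonneg (by positivity), ← ENNReal.ofReal_pow (by positivity), mul_assoc, mul_pow,
      ← sq, rootSymbol_sq hl, Real.sq_sqrt (hbp ξ).le, inv_pow, div_eq_mul_inv]
  have h4 : (‖ψ‖ₑ ^ 2) ^ 2 ≤ A * X * ‖ψ‖ₑ ^ 2 := by
    calc (‖ψ‖ₑ ^ 2) ^ 2 ≤ (X ^ (1 / 2 : ℝ) * (A * ‖ψ‖ₑ ^ 2) ^ (1 / 2 : ℝ)) ^ 2 := by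
          refine pow_le_pow_left' ((h1.trans hcs).trans ?_) 2
          rw [h2]
          gcongr
      _ = X * (A * ‖ψ‖ₑ ^ 2) := by
          rw [mul_pow, ← ENNReal.rpow_natCast, ← ENNReal.rpow_natCast, ← ENNReal.rpow_mul,
            ← ENNReal.rpow_mul]
          norm_num
      _ = _ := by ring
  have h5 := ENNReal.le_of_sq_le_mul (by finiteness) h4
  rw [← hXr, ← ofReal_norm, ← ENNReal.ofReal_pow (norm_nonneg _), ← ENNReal.ofReal_coe_nnreal,
    ← ENNReal.ofReal_mul (NNReal.coe_nonneg A)] at h5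
  refine (ENNReal.ofReal_le_ofReal_iff (mul_nonneg (NNReal.coe_nonneg A) ?_)).1 h5
  have := fourierMul_nonneg (continuous_barrierSymbol hε hl) (abs_barrierSymbol_le hε hl)
    fun ξ => (hsp ξ).le
  rw [ContinuousLinearMap.nonneg_iff_isPositive] at this
  exact this.re_inner_nonneg_left h

end SmallEnergy

/-! ### Frequency bounds for the domain of `|H|^{s/2}`. -/

section BarrierBound

variable {V : Plane → ℝ} {ε l : ℝ}

/-- The constant `D` bounds `M⁻¹` for all small `l`; resolvents at every `-l` also yield the
spectral gap. -/
theorem exists_isResolvent_small (hV : Integrable V)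
    (hG : hsSq V (fun p => ‖green p.1 p.2‖ₑ) < ⊤) (hreg : ZeroIsRegular V) :
    ∃ D l₀ : ℝ, 0 < D ∧ 0 < l₀ ∧ ∀ l (hl : 0 < l), l < l₀ → ∃ B R : L2 →L[ℂ] L2,
      IsBirman V l B ∧ IsResolvent V l R ∧ ∀ f, RCLike.re ⟪R f, f⟫_ℂ ≤
        ‖freeRoot l hl f‖ ^ 2 + D * ‖ContinuousLinearMap.adjoint B (freeRoot l hl f)‖ ^ 2 := by
  obtain ⟨D, hD, h⟩ := exists_birmanSchwinger_bounded_below hV hG hreg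
  obtain ⟨l₀, hl₀, h⟩ := (mem_nhdsGT_iff_exists_Ioo_subset).1 h
  refine ⟨D, l₀, hD, hl₀, fun l hl hll => ?_⟩
  obtain ⟨B, hB⟩ := exists_isBirman hV hl (hsSq_resKernel_lt_top hV hG hl)
  have hb := h ⟨hl, hll⟩ B hB
  obtain ⟨N, hMN, hNM, hNn, hN⟩ := exists_inverse_of_bounded_below
    (isSelfAdjoint_birmanSchwinger hV.1.aemeasurable B) (c := D⁻¹) (inv_pos.2 hD) fun φ => by
      rw [inv_mul_le_iff₀ hD]
      exact hb φ
  rw [inv_inv] at hNn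
  refine ⟨B, _, hB, isResolvent_resolventOp hV hl hB hMN hNM hN, fun f => ?_⟩
  have h1 := (abs_le.1 (abs_re_inner_resolventOp_sub_le (B := B) (N := N) hl f)).2
  have h2 : ‖N‖ * ‖ContinuousLinearMap.adjoint B (freeRoot l hl f)‖ ^ 2
      ≤ D * ‖ContinuousLinearMap.adjoint B (freeRoot l hl f)‖ ^ 2 := by gcongr
  linarith

theorem barrierMul_nonneg (hε : 0 ≤ ε) (hl : 0 < l) : 0 ≤ barrierMul ε l hε hl :=
  fourierMul_nonneg _ _ fun ξ => (barrierSymbol_pos hl ξ).le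

theorem re_inner_barrierMul_nonneg (hε : 0 ≤ ε) (hl : 0 < l) (f : L2) :
    0 ≤ RCLike.re ⟪barrierMul ε l hε hl f, f⟫_ℂ := by
  have := barrierMul_nonneg (ε := ε) hε hl
  rw [ContinuousLinearMap.nonneg_iff_isPositive] at this
  exact this.re_inner_nonneg_left f

theorem re_inner_freeRes_le_barrierMul (hε : 0 ≤ ε) (hl : 0 < l) {m : ℝ} (hlm : l ≤ m) (f : L2) :
    RCLike.re ⟪freeRes m (hl.trans_le hlm) f, f⟫_ℂ ≤ RCLike.re ⟪barrierMul ε l hε hl f, f⟫_ℂ := by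
  have hm := hl.trans_le hlm
  refine (ENNReal.ofReal_le_ofReal_iff (re_inner_barrierMul_nonneg hε hl f)).1 ?_
  rw [freeRes, barrierMul, ofReal_re_inner_fourierMul _ _ fun ξ => (resSymbol_pos hm ξ).le,
    ofReal_re_inner_fourierMul _ _ fun ξ => (barrierSymbol_pos hl ξ).le]
  refine lintegral_mono fun ξ => mul_le_mul' (ENNReal.ofReal_le_ofReal ?_) le_rfl
  have hx := freqSq_add_pos hl ξ
  exact inv_anti₀ (barrier_pos hx) ((barrier_le_self hε hx.le).trans (by linarith))

theorem exists_lintegral_barrier_rpow_le (hV : Integrable V)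
    (hG : hsSq V (fun p => ‖green p.1 p.2‖ₑ) < ⊤) (hreg : ZeroIsRegular V)
    (hε : 0 < ε) (hε1 : ε ≤ 1) :
    ∃ C : ℝ, 1 ≤ C ∧ ∀ s ∈ Set.Icc (0 : ℝ) 1, ∀ u g : L2, IsAbsPow V (s / 2) u g →
      ∫⁻ ξ, ENNReal.ofReal (barrier ε (freqSq ξ) ^ s) * ‖(𝓕 u : L2) ξ‖ₑ ^ 2
        ≤ ENNReal.ofReal (C * ‖g‖) ^ 2 := by
  obtain ⟨m, hm, R, hR, hR0, -, hRJ⟩ := exists_isResolvent_comparable hV hG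
  obtain ⟨D, l₀, hD, hl₀, hsmall⟩ := exists_isResolvent_small hV hG hreg
  obtain ⟨A, hA⟩ := exists_lintegral_barrier_mul_fourier_le hV hG hε hε1
  -- `1 + D A` comes from `(H + l)⁻¹`, and `3 m / l₀ · 2` from the correction for the negative
  -- spectrum, using `R ≤ 2 (-Δ + m)⁻¹`.
  set C : ℝ := 1 + D * A + 3 * m / l₀ * 2 with hC
  have hC1 : 1 ≤ C := by
    have : 0 ≤ D * A := by positivity
    have : 0 ≤ 3 * m / l₀ * 2 := by positivity
    linarith
  refine ⟨C, hC1, fun s hs u g hug => ?_⟩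
  have hug' := hug.eq_of_isResolvent (by linarith [hs.1]) (by linarith [hs.2]) hR
  -- The case `s = 0` is separate: the error `l^{s/2} ‖u‖` below does not tend to zero then, but the
  -- claim is trivial.
  rcases hs.1.eq_or_lt with rfl | hs0
  · rw [zero_div, hilbertCfc_abs_pow_zero hR.1] at hug'
    have hu : u = g := hR.injective hug'
    simp only [Real.rpow_zero, ENNReal.ofReal_one, one_mul]
    rw [← L2.enorm_sq_eq_fourier, hu, ← ofReal_norm]
    refine pow_le_pow_left' (ENNReal.ofReal_le_ofReal ?_) 2
    nlinarith [norm_nonneg g]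
  have key : ∀ l, 0 < l → l ≤ l₀ / 2 → l ≤ m →
      ∫⁻ ξ, ENNReal.ofReal (barrier ε (freqSq ξ) ^ s) * ‖(𝓕 u : L2) ξ‖ₑ ^ 2
        ≤ ENNReal.ofReal (C * (‖g‖ + l ^ (s / 2) * ‖u‖)) ^ 2 := by
    intro l hl hl2 hlm
    obtain ⟨B, R', hB, hR', hRl⟩ := hsmall l hl (by linarith)
    have hle : R' + (3 * m / l₀) • R ≤ C • barrierMul ε l hε.le hl := by
      refine le_of_re_inner_le (hR'.1.add (isSelfAdjoint_real_smul hR.1 _))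
        (isSelfAdjoint_real_smul ((isSelfAdjoint_realSymbol _ _).map fourierMul) _) fun f => ?_
      rw [add_apply, inner_add_left, map_add, re_inner_real_smul, re_inner_real_smul]
      have h1 := hRl f
      have h2 := hB.norm_adjoint_freeRoot_sq_le hε.le hl (hA l hl) f
      have h3 := re_inner_freeRes_le_barrierMul hε.le hl le_rfl f
      have h4 := re_inner_freeRes_le_barrierMul hε.le hl hlm f
      have h5 : RCLike.re ⟪R f, f⟫_ℂ ≤ 2 * RCLike.re ⟪freeRes m hm f, f⟫_ℂ := by
        have := ((ContinuousLinearMap.le_def _ _).1 hRJ).re_inner_nonneg_left f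
        rw [sub_apply, inner_sub_left, map_sub, re_inner_real_smul] at this
        linarith
      rw [re_inner_freeRes] at h3
      have h6 : 0 ≤ 3 * m / l₀ := by positivity
      have h7 := mul_le_mul_of_nonneg_left h2 hD.le
      have h8 := mul_le_mul_of_nonneg_left (h5.trans (mul_le_mul_of_nonneg_left h4 two_pos.le)) h6
      rw [hC]
      linarith
    obtain ⟨x, hx, hxn⟩ := exists_hilbertRpow_eq_of_abs_pow hR0 hR.injective hm hl hl2
      (fun t ht ht' => by
        obtain ⟨-, R'', -, hR'', -⟩ := hsmall t ht ht'
        exact ⟨R'', hR''.1, hR.sub_eq hR''⟩) hR'.1 (hR.sub_eq hR') (barrierMul_nonneg hε.le hl)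
      (injective_hilbertRpow (barrierSymbol_pos hl) hs.1) hC1 hle hs hug'
    have h1 := enorm_sq_eq_of_hilbertRpow_eq (barrierSymbol_pos hl) hs.1 hx
    calc _ ≤ ‖x‖ₑ ^ 2 := by
          rw [h1]
          refine lintegral_mono fun ξ => mul_le_mul' (ENNReal.ofReal_le_ofReal ?_) le_rfl
          rw [barrierSymbol, inv_inv]
          have h0 := freqSq_nonneg ξ
          exact Real.rpow_le_rpow (barrier_nonneg h0) (barrier_mono hε.le h0 (by linarith)) hs.1
      _ ≤ _ := by
          rw [← ofReal_norm]
          exact pow_le_pow_left' (ENNReal.ofReal_le_ofReal hxn) 2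
  -- The left side of `key` is free of `l`, because the barrier is monotone; only the right side
  -- passes to the limit.
  have hlim : Tendsto (fun l : ℝ => ENNReal.ofReal (C * (‖g‖ + l ^ (s / 2) * ‖u‖)) ^ 2) (𝓝[>] 0)
      (𝓝 (ENNReal.ofReal (C * ‖g‖) ^ 2)) := by
    have h1 : Continuous fun l : ℝ => ENNReal.ofReal (C * (‖g‖ + l ^ (s / 2) * ‖u‖)) ^ 2 := by
      have : Continuous fun l : ℝ => l ^ (s / 2) := Real.continuous_rpow_const (by linarith)
      exact (ENNReal.continuous_pow 2).comp (ENNReal.continuous_ofReal.comp (by fun_prop))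
    have h2 := (h1.tendsto 0).mono_left (nhdsWithin_le_nhds (s := Set.Ioi 0))
    rwa [Real.zero_rpow (by linarith), zero_mul, add_zero] at h2
  refine ge_of_tendsto hlim ?_
  have hmin : 0 < min (l₀ / 2) m := by positivity
  filter_upwards [Ioo_mem_nhdsGT hmin] with l hl
  exact key l hl.1 (hl.2.le.trans (min_le_left _ _)) (hl.2.le.trans (min_le_right _ _))

end BarrierBound

/-! ### Homogeneous Sobolev norms and negative powers. -/

section Homogeneous

variable {V : Plane → ℝ} {ε ε' s w : ℝ}

theorem half_le_half_rpow (h1 : ε ≤ 1) : (1 / 2 : ℝ) ≤ (1 / 2) ^ ε := by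
  have := Real.rpow_le_rpow_of_exponent_ge (x := 1 / 2) (by norm_num) (by norm_num) h1
  rwa [Real.rpow_one] at this

/-- For `w ≤ 1` the barrier at `w²` is at least half of `w^{2+2ε'}`. Taking the power `s` loses `2 s
ε' ≤ 2 ε` in the exponent, which is harmless below one. -/
theorem rpow_le_two_mul_barrier_rpow_of_le_one (hε : 0 < ε') (hε1 : ε' ≤ 1) (hεε : ε' ≤ ε)
    (hs : s ∈ Set.Icc (0 : ℝ) 1) (hw : 0 ≤ w) (hw1 : w ≤ 1) :
    w ^ (2 * (s + ε)) ≤ 2 * barrier ε' (w ^ 2) ^ s := by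
  rcases hw.eq_or_lt with rfl | hw0
  · rw [Real.zero_rpow (by linarith [hs.1])]
    have := barrier_nonneg (ε := ε') (sq_nonneg (0 : ℝ))
    positivity
  have h1 : w ^ (2 + 2 * ε') ≤ 2 * barrier ε' (w ^ 2) := by
    have e : w ^ (2 + 2 * ε') = (w ^ 2) ^ ε' * w ^ 2 := by
      rw [Real.rpow_add hw0, Real.rpow_mul hw, mul_comm]
      norm_num
    have h2 : (1 / 2 * w ^ 2) ^ ε' ≤ (w ^ 2 / (1 + w ^ 2)) ^ ε' := by
      refine Real.rpow_le_rpow (by positivity) ?_ hε.le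
      rw [le_div_iff₀ (by positivity)]
      nlinarith [sq_nonneg w, mul_nonneg (sq_nonneg w) (by nlinarith : (0 : ℝ) ≤ 1 - w ^ 2)]
    rw [Real.mul_rpow (by norm_num) (sq_nonneg w)] at h2
    have h3 := half_le_half_rpow hε1
    have h4 : 0 ≤ (w ^ 2) ^ ε' := by positivity
    have h5 : (w ^ 2) ^ ε' ≤ 2 * (w ^ 2 / (1 + w ^ 2)) ^ ε' := by nlinarith
    rw [e, barrier, ← mul_assoc]
    gcongr
  have h2 := rpow_le_one_add_mul_rpow (by positivity) (barrier_nonneg (sq_nonneg w))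
    one_le_two h1 hs
  refine le_trans ?_ h2
  rw [← Real.rpow_mul hw]
  refine Real.rpow_le_rpow_of_exponent_ge hw0 hw1 ?_
  nlinarith [hs.1, hs.2]

theorem rpow_le_two_mul_barrier_rpow_of_one_le (hε : 0 < ε') (hε1 : ε' ≤ 1) (hε0 : 0 ≤ ε)
    (hs : s ∈ Set.Icc (0 : ℝ) 1) (hw : 1 ≤ w) :
    w ^ (2 * (s - ε)) ≤ 2 * barrier ε' (w ^ 2) ^ s := by
  have hw0 : 0 < w := by linarith
  have h1 : w ^ (2 : ℝ) ≤ 2 * barrier ε' (w ^ 2) := by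
    have h2 : (1 / 2 : ℝ) ^ ε' ≤ (w ^ 2 / (1 + w ^ 2)) ^ ε' := by
      refine Real.rpow_le_rpow (by norm_num) ?_ hε.le
      rw [le_div_iff₀ (by positivity)]
      nlinarith
    have h3 := half_le_half_rpow hε1
    rw [Real.rpow_two, barrier]
    nlinarith [sq_nonneg w]
  have h2 := rpow_le_one_add_mul_rpow (by positivity) (barrier_nonneg (sq_nonneg w))
    one_le_two h1 hs
  refine le_trans ?_ h2
  rw [← Real.rpow_mul hw0.le]
  exact Real.rpow_le_rpow_of_exponent_le hw (by linarith)

theorem homSobolevNorm_sq (σ : ℝ) (f : L2) : homSobolevNorm σ f ^ 2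
    = ∫⁻ ξ, ENNReal.ofReal ((2 * Real.pi * ‖ξ‖) ^ (2 * σ)) * ‖(𝓕 f : L2) ξ‖ₑ ^ 2 := by
  rw [homSobolevNorm, ← ENNReal.rpow_natCast, ← ENNReal.rpow_mul]
  norm_num

theorem measurable_barrier_freqSq (ε s : ℝ) : Measurable fun ξ => barrier ε (freqSq ξ) ^ s := by
  have := continuous_freqSq.measurable
  unfold barrier
  fun_prop

/-- The projections of a square-integrable function to low and high frequencies. -/
theorem exists_frequency_splitting (f : L2) : ∃ f₁ f₂ : L2, f = f₁ + f₂ ∧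
    (∀ᵐ ξ, ‖(𝓕 f₁ : L2) ξ‖ₑ ≤ ‖(𝓕 f : L2) ξ‖ₑ ∧ (1 < 2 * Real.pi * ‖ξ‖ → (𝓕 f₁ : L2) ξ = 0)) ∧
    ∀ᵐ ξ, ‖(𝓕 f₂ : L2) ξ‖ₑ ≤ ‖(𝓕 f : L2) ξ‖ₑ ∧ (2 * Real.pi * ‖ξ‖ ≤ 1 → (𝓕 f₂ : L2) ξ = 0) := by
  set S : Set Plane := {ξ | 2 * Real.pi * ‖ξ‖ ≤ 1} with hS
  have hSm : MeasurableSet S := measurableSet_le (by fun_prop) measurable_const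
  have hm : MemLp (S.indicator (𝓕 f : L2)) 2 volume := (Lp.memLp (𝓕 f : L2)).indicator hSm
  set f₁ : L2 := (Lp.fourierTransformₗᵢ Plane ℂ).symm hm.toLp with hf₁
  have h1 : (𝓕 f₁ : L2) = hm.toLp := (Lp.fourierTransformₗᵢ Plane ℂ).apply_symm_apply _
  have h2 : (𝓕 f₁ : L2) =ᵐ[volume] S.indicator (𝓕 f : L2) := h1 ▸ hm.coeFn_toLp
  refine ⟨f₁, f - f₁, by abel, ?_, ?_⟩
  · filter_upwards [h2] with ξ hξ
    by_cases h : ξ ∈ S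
    · rw [hξ, Set.indicator_of_mem h]
      exact ⟨le_rfl, fun h' => absurd h (not_le.2 h')⟩
    · rw [hξ, Set.indicator_of_notMem h]
      simp
  · filter_upwards [h2, fourier_sub_apply f f₁] with ξ hξ hξ'
    by_cases h : ξ ∈ S
    · rw [hξ', hξ, Set.indicator_of_mem h, sub_self]
      simp
    · rw [hξ', hξ, Set.indicator_of_notMem h, sub_zero]
      exact ⟨le_rfl, fun h' => absurd h' h⟩

theorem enorm_inner_le_of_weight {b : Plane → ℝ} (hb : Measurable b) (h0 : ∀ᵐ ξ, 0 < b ξ)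
    (f u : L2) : ‖⟪f, u⟫_ℂ‖ₑ ^ 2 ≤ (∫⁻ ξ, ENNReal.ofReal (b ξ)⁻¹ * ‖(𝓕 f : L2) ξ‖ₑ ^ 2)
      * ∫⁻ ξ, ENNReal.ofReal (b ξ) * ‖(𝓕 u : L2) ξ‖ₑ ^ 2 := by
  have m1 : AEMeasurable fun ξ => ENNReal.ofReal (Real.sqrt (b ξ)⁻¹) * ‖(𝓕 f : L2) ξ‖ₑ :=
    hb.inv.sqrt.ennreal_ofReal.aemeasurable.mul (Lp.aestronglyMeasurable _).enorm
  have m2 : AEMeasurable fun ξ => ENNReal.ofReal (Real.sqrt (b ξ)) * ‖(𝓕 u : L2) ξ‖ₑ :=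
    hb.sqrt.ennreal_ofReal.aemeasurable.mul (Lp.aestronglyMeasurable _).enorm
  have hcs := ENNReal.lintegral_mul_le_Lp_mul_Lq volume Real.HolderConjugate.two_two m1 m2
  have h1 : ‖⟪f, u⟫_ℂ‖ₑ ≤ ∫⁻ ξ, ((fun ξ => ENNReal.ofReal (Real.sqrt (b ξ)⁻¹) * ‖(𝓕 f : L2) ξ‖ₑ) *
      fun ξ => ENNReal.ofReal (Real.sqrt (b ξ)) * ‖(𝓕 u : L2) ξ‖ₑ) ξ := by
    rw [L2.inner_eq_integral_fourier]
    refine (enorm_integral_le_lintegral_enorm _).trans (lintegral_mono_ae ?_)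
    filter_upwards [h0] with ξ hξ
    have e : ENNReal.ofReal (Real.sqrt (b ξ)⁻¹) * ENNReal.ofReal (Real.sqrt (b ξ)) = 1 := by
      rw [← ENNReal.ofReal_mul (Real.sqrt_nonneg _), Real.sqrt_inv,
        inv_mul_cancel₀ (Real.sqrt_pos.2 hξ).ne', ENNReal.ofReal_one]
    rw [enorm_conj_mul, Pi.mul_apply, mul_mul_mul_comm, e, one_mul]
  have h2 : ∀ a : ℝ, 0 < a → ∀ z : ℝ≥0∞,
      (ENNReal.ofReal (Real.sqrt a) * z) ^ (2 : ℝ) = ENNReal.ofReal a * z ^ 2 := fun a ha z => by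
    rw [ENNReal.rpow_two, mul_pow, ← ENNReal.ofReal_pow (Real.sqrt_nonneg _), Real.sq_sqrt ha.le]
  calc _ ≤ _ := pow_le_pow_left' (h1.trans hcs) 2
    _ = _ := by
      rw [mul_pow, ← ENNReal.rpow_natCast, ← ENNReal.rpow_natCast, ← ENNReal.rpow_mul,
        ← ENNReal.rpow_mul]
      norm_num
      congr 1
      · refine lintegral_congr_ae ?_
        filter_upwards [h0] with ξ hξ
        have := h2 _ (inv_pos.2 hξ) ‖(𝓕 f : L2) ξ‖ₑ
        rw [ENNReal.rpow_two, Real.sqrt_inv] at this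
        exact this
      · refine lintegral_congr_ae ?_
        filter_upwards [h0] with ξ hξ
        have := h2 _ hξ ‖(𝓕 u : L2) ξ‖ₑ
        rwa [ENNReal.rpow_two] at this

theorem ae_barrier_freqSq_pos (ε s : ℝ) : ∀ᵐ ξ : Plane, 0 < barrier ε (freqSq ξ) ^ s := by
  have hne : ∀ᵐ ξ : Plane, ξ ≠ 0 := by simp [ae_iff]
  filter_upwards [hne] with ξ hξ
  have hn : 0 < ‖ξ‖ := norm_pos_iff.2 hξ
  exact Real.rpow_pos_of_pos (barrier_pos (by unfold freqSq; positivity)) s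

/-- The inverse barrier is bounded by the weight of order `-s - ε` at low frequencies and by that of
order `-s + ε` at high ones. -/
theorem lintegral_inv_barrier_le (hε : 0 < ε') (hε1 : ε' ≤ 1) (hεε : ε' ≤ ε)
    (hs : s ∈ Set.Icc (0 : ℝ) 1) (f : L2) :
    ∫⁻ ξ, ENNReal.ofReal (barrier ε' (freqSq ξ) ^ s)⁻¹ * ‖(𝓕 f : L2) ξ‖ₑ ^ 2
      ≤ (2 * (homSobolevNorm (-s - ε) f + homSobolevNorm (-s + ε) f)) ^ 2 := by
  have hne : ∀ᵐ ξ : Plane, ξ ≠ 0 := by simp [ae_iff]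
  have hm1 : AEMeasurable fun ξ => ENNReal.ofReal ((2 * Real.pi * ‖ξ‖) ^ (2 * (-s - ε)))
      * ‖(𝓕 f : L2) ξ‖ₑ ^ 2 :=
    (by fun_prop : Measurable fun ξ : Plane => ENNReal.ofReal ((2 * Real.pi * ‖ξ‖)
      ^ (2 * (-s - ε)))).aemeasurable.mul ((Lp.aestronglyMeasurable _).enorm.pow_const 2)
  calc _ ≤ ∫⁻ ξ, 2 * (ENNReal.ofReal ((2 * Real.pi * ‖ξ‖) ^ (2 * (-s - ε))) * ‖(𝓕 f : L2) ξ‖ₑ ^ 2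
        + ENNReal.ofReal ((2 * Real.pi * ‖ξ‖) ^ (2 * (-s + ε))) * ‖(𝓕 f : L2) ξ‖ₑ ^ 2) := by
        refine lintegral_mono_ae ?_
        filter_upwards [hne, ae_barrier_freqSq_pos ε' s] with ξ hξ hp
        have hn : 0 < ‖ξ‖ := norm_pos_iff.2 hξ
        set w := 2 * Real.pi * ‖ξ‖ with hw
        have hw0 : 0 < w := by positivity
        have hf : freqSq ξ = w ^ 2 := rfl
        rw [hf] at hp ⊢
        rw [← add_mul, ← mul_assoc]
        refine mul_le_mul' ?_ le_rfl
        have conv : ∀ a : ℝ, w ^ (2 * a) ≤ 2 * barrier ε' (w ^ 2) ^ s →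
            ENNReal.ofReal (barrier ε' (w ^ 2) ^ s)⁻¹ ≤ 2 * ENNReal.ofReal (w ^ (2 * -a)) := by
          intro a ha
          rw [← ENNReal.ofReal_ofNat, ← ENNReal.ofReal_mul (by norm_num)]
          refine ENNReal.ofReal_le_ofReal ?_
          have hwa : 0 < w ^ (2 * a) := Real.rpow_pos_of_pos hw0 _
          rw [mul_neg, Real.rpow_neg hw0.le, ← div_eq_mul_inv, inv_eq_one_div,
            div_le_div_iff₀ hp hwa]
          linarith
        rcases le_total w 1 with h | h
        · have := conv _ (rpow_le_two_mul_barrier_rpow_of_le_one hε hε1 hεε hs hw0.le h)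
          rw [neg_add, ← sub_eq_add_neg] at this
          exact this.trans (mul_le_mul' le_rfl le_self_add)
        · have := conv _ (rpow_le_two_mul_barrier_rpow_of_one_le hε hε1 (hε.le.trans hεε) hs h)
          rw [neg_sub, sub_eq_neg_add] at this
          exact this.trans (mul_le_mul' le_rfl le_add_self)
    _ = 2 * (homSobolevNorm (-s - ε) f ^ 2 + homSobolevNorm (-s + ε) f ^ 2) := by
        rw [lintegral_const_mul' _ _ (by norm_num), lintegral_add_left' hm1, homSobolevNorm_sq,
          homSobolevNorm_sq]
    _ ≤ _ := by
        set a := homSobolevNorm (-s - ε) f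
        set b := homSobolevNorm (-s + ε) f
        calc 2 * (a ^ 2 + b ^ 2) ≤ 4 * (a ^ 2 + b ^ 2) + 8 * a * b :=
              le_add_right (mul_le_mul' (by norm_num) le_rfl)
          _ = _ := by ring

theorem homSobolevNorm_le_of_barrier {σ : ℝ} {f f₁ : L2} {X : ℝ≥0∞}
    (h : ∀ᵐ ξ, ENNReal.ofReal ((2 * Real.pi * ‖ξ‖) ^ (2 * σ)) * ‖(𝓕 f₁ : L2) ξ‖ₑ ^ 2
      ≤ 2 * (ENNReal.ofReal (barrier ε (freqSq ξ) ^ s) * ‖(𝓕 f : L2) ξ‖ₑ ^ 2))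
    (hX : ∫⁻ ξ, ENNReal.ofReal (barrier ε (freqSq ξ) ^ s) * ‖(𝓕 f : L2) ξ‖ₑ ^ 2 ≤ X ^ 2) :
    homSobolevNorm σ f₁ ≤ 2 * X := by
  rw [← ENNReal.pow_le_pow_left_iff two_ne_zero, homSobolevNorm_sq]
  refine (lintegral_mono_ae h).trans ?_
  rw [lintegral_const_mul' _ _ (by norm_num), mul_pow]
  exact mul_le_mul' (by norm_num) hX

/-- The weighted bound for `|H|^{s/2}` yields the splitting `f = f₁ + f₂` at frequency one. Its dual
says that `f` with finite dual norm lies in the range of `|H|^{s/2}`. -/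
theorem exists_homSobolev_bound (hV : Integrable V)
    (hG : hsSq V (fun p => ‖green p.1 p.2‖ₑ) < ⊤) (hreg : ZeroIsRegular V) (hε : 0 < ε) :
    ∃ C : ℝ≥0, ∀ s ∈ Set.Icc (0 : ℝ) 1,
      (∀ f : L2, homSobolevNorm (-s - ε) f + homSobolevNorm (-s + ε) f < ⊤ →
        ∃ g : L2, IsAbsPowInv V (s / 2) f g ∧
          ‖g‖ₑ ≤ C * (homSobolevNorm (-s - ε) f + homSobolevNorm (-s + ε) f)) ∧
      (∀ f g : L2, IsAbsPow V (s / 2) f g → ∃ f₁ f₂ : L2, f = f₁ + f₂ ∧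
        homSobolevNorm (s + ε) f₁ + homSobolevNorm (s - ε) f₂ ≤ C * ‖g‖ₑ) := by
  -- The barrier estimates need an exponent at most one, and a smaller loss is stronger.
  set ε' := min ε 1 with hε'
  have h0 : 0 < ε' := lt_min hε one_pos
  have h1 : ε' ≤ 1 := min_le_right _ _
  have h2 : ε' ≤ ε := min_le_left _ _
  obtain ⟨m, hm, R, hR, -⟩ := exists_isResolvent_comparable hV hG
  obtain ⟨C, hC1, hC⟩ := exists_lintegral_barrier_rpow_le hV hG hreg h0 h1
  have hC0 : 0 ≤ C := by linarith
  have hCe : ((4 * C).toNNReal : ℝ≥0∞) = 4 * ENNReal.ofReal C := by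
    change ENNReal.ofReal (4 * C) = _
    rw [ENNReal.ofReal_mul (by norm_num), ENNReal.ofReal_ofNat]
  refine ⟨(4 * C).toNNReal, fun s hs => ⟨fun f hf => ?_, fun f g hfg => ?_⟩⟩
  · have hs0 : 0 ≤ s / 2 := by linarith [hs.1]
    have hs1 : s / 2 < 1 := by linarith [hs.2]
    set Y := homSobolevNorm (-s - ε) f + homSobolevNorm (-s + ε) f with hY
    set Ψ := hilbertCfc (fun r : ℝ => r * |r⁻¹ - m| ^ (s / 2)) R with hΨ
    have hΨs : IsSelfAdjoint Ψ := isSelfAdjoint_hilbertCfc _ R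
    have habs : ∀ y : L2, IsAbsPow V (s / 2) (R y) (Ψ y) := fun y =>
      ⟨m, R, hR, hilbertCfc_apply_comm _ R y⟩
    -- A vector with `|H|^{s/2} y = 0` has zero barrier norm, hence vanishes; this also makes the
    -- preimage unique.
    have hinj : Function.Injective Ψ := by
      refine (injective_iff_map_eq_zero _).2 fun y hy => ?_
      have hy' : IsAbsPow V (s / 2) y 0 := ⟨m, R, hR, by rw [map_zero]; exact hy⟩
      have hi := hC s hs y 0 hy'
      have hm : AEMeasurable fun ξ =>
          ENNReal.ofReal (barrier ε' (freqSq ξ) ^ s) * ‖(𝓕 y : L2) ξ‖ₑ ^ 2 :=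
        (measurable_barrier_freqSq ε' s).ennreal_ofReal.aemeasurable.mul
          ((Lp.aestronglyMeasurable _).enorm.pow_const 2)
      have hz : ∫⁻ ξ, ENNReal.ofReal (barrier ε' (freqSq ξ) ^ s) * ‖(𝓕 y : L2) ξ‖ₑ ^ 2 = 0 := by
        simpa using hi
      rw [lintegral_eq_zero_iff' hm] at hz
      have hz2 : ‖y‖ₑ ^ 2 = 0 := by
        rw [L2.enorm_sq_eq_fourier, lintegral_congr_ae (g := fun _ => 0), lintegral_zero]
        filter_upwards [hz, ae_barrier_freqSq_pos ε' s] with ξ h3 h4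
        exact (mul_eq_zero.1 h3).resolve_left (ENNReal.ofReal_pos.2 h4).ne'
      simpa using hz2
    -- Pair `f` with `R y`. Since `|H|^{s/2} (R y) = Ψ y`, the barrier norm of `R y` is at most `C
    -- ‖Ψ y‖`, so `R f` lies in the range of `Ψ`.
    have hbound : ∀ y : L2, ‖⟪R f, y⟫_ℂ‖ ≤ (2 * Y.toReal * C) * ‖Ψ y‖ := by
      intro y
      rw [inner_apply_left_of_isSelfAdjoint hR.1]
      have h3 := enorm_inner_le_of_weight (measurable_barrier_freqSq ε' s)
        (ae_barrier_freqSq_pos ε' s) f (R y)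
      have h4 := h3.trans (mul_le_mul' (lintegral_inv_barrier_le h0 h1 h2 hs f)
        (hC s hs _ _ (habs y)))
      rw [← mul_pow] at h4
      have h5 := ENNReal.toReal_mono (ENNReal.mul_ne_top
        (ENNReal.mul_ne_top (by norm_num) hf.ne) ENNReal.ofReal_ne_top) ((ENNReal.pow_le_pow_left_iff two_ne_zero).1 h4)
      rw [ENNReal.toReal_mul, ENNReal.toReal_mul, ENNReal.toReal_ofReal (by positivity),
        toReal_enorm] at h5
      calc _ ≤ _ := h5
        _ = _ := by rw [ENNReal.toReal_ofNat]; ring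
    obtain ⟨g, hg, hgn⟩ := exists_apply_eq_of_inner_le hΨs hinj
      (by positivity : 0 ≤ 2 * Y.toReal * C) hbound
    refine ⟨g, ⟨⟨m, R, hR, hg⟩, fun g' hg' => ?_⟩, ?_⟩
    · exact hinj ((hg'.eq_of_isResolvent hs0 hs1 hR).trans hg.symm)
    · rw [hCe, ← ofReal_norm]
      refine (ENNReal.ofReal_le_ofReal hgn).trans ?_
      rw [ENNReal.ofReal_mul (by positivity), ENNReal.ofReal_mul (by norm_num),
        ENNReal.ofReal_toReal hf.ne, ENNReal.ofReal_ofNat]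
      calc 2 * Y * ENNReal.ofReal C = 2 * (ENNReal.ofReal C * Y) := by ring
        _ ≤ 4 * (ENNReal.ofReal C * Y) := mul_le_mul' (by norm_num) le_rfl
        _ = _ := by ring
  · obtain ⟨f₁, f₂, hf, hf₁, hf₂⟩ := exists_frequency_splitting f
    have hi := hC s hs f g hfg
    have hpt : ∀ (σ : ℝ) (ξ : Plane) (z : ℝ≥0∞), z ≤ ‖(𝓕 f : L2) ξ‖ₑ →
        (2 * Real.pi * ‖ξ‖) ^ (2 * σ) ≤ 2 * barrier ε' (freqSq ξ) ^ s →
        ENNReal.ofReal ((2 * Real.pi * ‖ξ‖) ^ (2 * σ)) * z ^ 2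
          ≤ 2 * (ENNReal.ofReal (barrier ε' (freqSq ξ) ^ s) * ‖(𝓕 f : L2) ξ‖ₑ ^ 2) := by
      intro σ ξ z hz hle
      rw [← mul_assoc]
      refine mul_le_mul' ?_ (pow_le_pow_left' hz 2)
      refine (ENNReal.ofReal_le_ofReal hle).trans (le_of_eq ?_)
      rw [ENNReal.ofReal_mul (by norm_num), ENNReal.ofReal_ofNat]
    have hb1 : homSobolevNorm (s + ε) f₁ ≤ 2 * ENNReal.ofReal (C * ‖g‖) := by
      refine homSobolevNorm_le_of_barrier ?_ hi
      filter_upwards [hf₁] with ξ hξ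
      rcases le_or_gt (2 * Real.pi * ‖ξ‖) 1 with h | h
      · exact hpt _ ξ _ hξ.1 (rpow_le_two_mul_barrier_rpow_of_le_one h0 h1 h2 hs (by positivity) h)
      · rw [hξ.2 h]
        simp
    have hb2 : homSobolevNorm (s - ε) f₂ ≤ 2 * ENNReal.ofReal (C * ‖g‖) := by
      refine homSobolevNorm_le_of_barrier ?_ hi
      filter_upwards [hf₂] with ξ hξ
      rcases le_or_gt (2 * Real.pi * ‖ξ‖) 1 with h | h
      · rw [hξ.2 h]
        simp
      · exact hpt _ ξ _ hξ.1 (rpow_le_two_mul_barrier_rpow_of_one_le h0 h1 hε.le hs h.le)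
    refine ⟨f₁, f₂, hf, (add_le_add hb1 hb2).trans (le_of_eq ?_)⟩
    rw [hCe, ENNReal.ofReal_mul hC0, ofReal_norm]
    ring

end Homogeneous

end Wave2D

end

theorem lemma3p4 (V : Wave2D.Plane → ℝ) (k : ℝ) (hk : 1 ≤ k)
    (hV : Integrable (fun x => Wave2D.logWeight x ^ (2 * k) * V x))
    (q : ℝ≥0∞) (hq : 1 < q)
    (hloc : ∀ K : Set Wave2D.Plane, IsCompact K → MemLp V q (volume.restrict K))
    (htail : Tendsto (fun R : ℝ => ENNReal.ofReal (R ^ (1 - (q⁻¹).toReal)) *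
      eLpNorm V q (volume.restrict {x | R ≤ ‖x‖ ∧ ‖x‖ ≤ 2 * R})) atTop (𝓝 0))
    (hreg : Wave2D.ZeroIsRegular V) :
    (∃ C : ℝ≥0, ∀ (p : ℝ≥0∞) (f g : Wave2D.Plane → ℂ), 1 ≤ p → p ≠ ⊤ → MemLp f p volume →
      Wave2D.IsWeakNegLaplacian f g →
        Wave2D.weightedL1Norm k (fun x => g x + (V x : ℂ) * f x)
            ≤ C * Wave2D.weightedL1Norm k g ∧
        Wave2D.weightedL1Norm k g
            ≤ C * Wave2D.weightedL1Norm k (fun x => g x + (V x : ℂ) * f x)) ∧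
    ∀ p : ℝ≥0∞, 1 < p → MemLp V p volume →
      (∃ C : ℝ≥0, ∀ s ∈ Set.Icc (0 : ℝ) 1,
        (∀ f : Wave2D.L2, Wave2D.sobolevNorm s f < ⊤ →
          ∃ g : Wave2D.L2, Wave2D.IsAbsPow V (s / 2) f g ∧
            ‖g‖ₑ ≤ C * Wave2D.sobolevNorm s f) ∧
        (∀ f g : Wave2D.L2, Wave2D.IsAbsPow V (s / 2) f g →
          Wave2D.sobolevNorm (-s) g ≤ C * ‖f‖ₑ)) ∧
      (∀ ε : ℝ, 0 < ε → ∃ C : ℝ≥0, ∀ s ∈ Set.Icc (0 : ℝ) 1,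
        (∀ f : Wave2D.L2,
          Wave2D.homSobolevNorm (-s - ε) f + Wave2D.homSobolevNorm (-s + ε) f < ⊤ →
          ∃ g : Wave2D.L2, Wave2D.IsAbsPowInv V (s / 2) f g ∧
            ‖g‖ₑ ≤ C * (Wave2D.homSobolevNorm (-s - ε) f + Wave2D.homSobolevNorm (-s + ε) f)) ∧
        (∀ f g : Wave2D.L2, Wave2D.IsAbsPow V (s / 2) f g →
          ∃ f₁ f₂ : Wave2D.L2, f = f₁ + f₂ ∧
            Wave2D.homSobolevNorm (s + ε) f₁ + Wave2D.homSobolevNorm (s - ε) f₂ ≤ C * ‖g‖ₑ)) := by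
  have hVi : Integrable V := Wave2D.integrable_of_weighted (by linarith) hV
  -- From here on the local and annular hypotheses enter only through `V ∈ L^r`, and the weight with
  -- exponent `2 ≤ 2k` suffices for the Hilbert–Schmidt bound.
  obtain ⟨r, hr, hVr⟩ := Wave2D.exists_lintegral_rpow_lt_top hVi hq hloc htail
  have hV2 := Wave2D.lintegral_wt_rpow_mul_lt_top_of_le
    (Wave2D.lintegral_wt_rpow_mul_lt_top hV) (a := 2) (by linarith)
  have hG := Wave2D.hsSq_green_lt_top hVi hV2 hr hVr
  exact ⟨Wave2D.exists_weightedL1Norm_equiv hk hV hr hVr hreg, fun _ _ _ =>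
    ⟨Wave2D.exists_absPow_sobolev_bound hVi hG,
      fun _ hε => Wave2D.exists_homSobolev_bound hVi hG hreg hε⟩⟩
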